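/- Let $M_1, M_2$ be closed smooth 4-manifolds (in particular, closed non-orientable ones) with $Pin^+$-structures $\phi_1,\phi_2$. A $Pin^+$-structure on an $n$-manifold $M$ is a principal $Pin^+(n)$-bundle $P\to M$ with an isomorphism $P\times_{Pin^+(n)}\mathbb{R}^n\cong TM$, where $Pin^+(n)$ is generated by the unit vectors of $\mathbb{R}^n$ in the Clifford algebra with $v^2=+|v|^2$; two such structures are equivalent if some isomorphism of the principal bundles induces an automorphism of $TM$ homotopic to the identity through automorphisms. Write $-\phi$ for $\phi$ tensored with the orientation character $w_1$. (a) Circle sums. Let $D^3\tilde{\times}S^1$ be the non-trivial $D^3$-bundle over $S^1$ with a $Pin^+$-structure $\psi$, and let $i_1, i_2$ be smooth embeddings of it in $M_1, M_2$ (given on an open tube $\mathbb{R}^3\tilde{\times}S^1$ around it; their cores are automatically orientation-reversing loops) such that $i_1$ preserves the $Pin^+$-structure, $i_1^*\phi_1\simeq\psi$, and $i_2$ reverses it, $i_2^*\phi_2\simeq-\psi$. Let $$M_1\#_{S^1}M_2=(M_1\setminus i_1(\mathrm{int}\,D^3\tilde{\times}S^1))\cup(M_2\setminus i_2(\mathrm{int}\,D^3\tilde{\times}S^1)),$$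 glued by $i_2\circ i_1^{-1}$ along the boundaries. Then $M_1\#_{S^1}M_2$ carries a $Pin^+$-structure which restricts (up to equivalence) to $\phi_1$ and $\phi_2$ on the two pieces, and with which it is $Pin^+$-bordant to the disjoint union $(M_1,\phi_1)\sqcup(M_2,\phi_2)$. (b) Connected sums. For all smooth embeddings $i_1, i_2$ of a 4-disc in $M_1, M_2$ (given on an open tube $\mathbb{R}^4$ around it), the connected sum $M_1\# M_2$ formed along them carries a $Pin^+$-structure which restricts (up to equivalence) to $\phi_1$ and $\phi_2$ on the complements of the discs, and with which it is $Pin^+$-bordant to $(M_1,\phi_1)\sqcup(M_2,\phi_2)$. Here $(N,\phi)$ and $(N',\phi')$ are $Pin^+$-bordant if there is a compact smooth $Pin^+$-manifold $W$ with $\partial W=N\sqcup N'$ whose $Pin^+$-structure induces $\phi$ on $N$ by means of an outward normal field and $\phi'$ on $N'$ by means of an inward normal field, i.e. $\partial W=(N,\phi)\sqcup-(N',\phi')$. -/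

import Mathlib

open Set Filter Topology Manifold ContDiff TopologicalSpace

universe u v

/-! ### Quotient manifolds -/

/-- An equivalence relation on a manifold `Y` along which `Y` may be glued: any two equivalent
points are matched by a smooth local map that respects the relation, and nearby points are never
identified. Then `Quotient s` is a manifold with `Y → Quotient s` a local diffeomorphism. -/
structure SmoothGluing {E H : Type*} [NormedAddCommGroup E] [NormedSpace ℝ E] [TopologicalSpace H]
    (I : ModelWithCorners ℝ E H) {Y : Type*} [TopologicalSpace Y] [ChartedSpace H Y]
    (s : Setoid Y) : Prop where
  transport : ∀ y y', s y y' → ∃ τ : Y → Y, τ y = y' ∧ ContMDiffAt I I ∞ τ y ∧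
    ∀ᶠ z in 𝓝 y, s z (τ z)
  locally_injective : ∀ y, ∃ U ∈ 𝓝 y, ∀ z ∈ U, ∀ z' ∈ U, s z z' → z = z'

namespace SmoothGluing

variable {E H : Type*} [NormedAddCommGroup E] [NormedSpace ℝ E] [TopologicalSpace H]
    {I : ModelWithCorners ℝ E H} {Y : Type*} [TopologicalSpace Y] [ChartedSpace H Y]
    {s : Setoid Y}

theorem isOpenMap_mk (h : SmoothGluing I s) : IsOpenMap (Quotient.mk s) := by
  intro V hV
  rw [← isQuotientMap_quotient_mk'.isOpen_preimage, isOpen_iff_mem_nhds]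
  rintro z ⟨v, hv, hvz⟩
  obtain ⟨τ, rfl, hτ, hs⟩ := h.transport z v (Setoid.symm (Quotient.exact hvz))
  filter_upwards [hτ.continuousAt (hV.mem_nhds hv), hs] with w hw hsw
  exact ⟨τ w, hw, Quotient.sound (Setoid.symm hsw)⟩

theorem isLocalHomeomorph_mk (h : SmoothGluing I s) : IsLocalHomeomorph (Quotient.mk s) := by
  rw [isLocalHomeomorph_iff_isOpenEmbedding_restrict]
  intro y
  obtain ⟨U, hU, hinj⟩ := h.locally_injective y
  refine ⟨interior U, isOpen_interior.mem_nhds (mem_interior_iff_mem_nhds.2 hU), ?_⟩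
  refine .of_continuous_injective_isOpenMap ?_ ?_ ?_
  · exact continuous_quotient_mk'.comp continuous_subtype_val
  · rintro ⟨a, ha⟩ ⟨b, hb⟩ hab
    exact Subtype.ext (hinj a (interior_subset ha) b (interior_subset hb) (Quotient.exact hab))
  · exact h.isOpenMap_mk.domRestrict isOpen_interior

/-- The manifold structure on the quotient, with charts pushed forward from `Y`. -/
@[reducible] noncomputable def chartedSpace (h : SmoothGluing I s) : ChartedSpace H (Quotient s) :=
  h.isLocalHomeomorph_mk.chartedSpace Quotient.mk_surjective

theorem contMDiffAt_localInverse_comp (h : SmoothGluing I s) (y₀ y : Y)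
    (hy : Quotient.mk s y ∈ (h.isLocalHomeomorph_mk.localInverseAt y₀).source) :
    ContMDiffAt I I ∞ (fun z => h.isLocalHomeomorph_mk.localInverseAt y₀ (Quotient.mk s z)) y := by
  set e := h.isLocalHomeomorph_mk.localInverseAt y₀ with he
  have hes : ∀ x, e.symm x = Quotient.mk s x := fun x => by
    rw [he, IsLocalHomeomorph.localInverseAt_symm]
  have hq : s y (e (Quotient.mk s y)) := by
    apply Quotient.exact
    rw [← hes, ← hes, e.left_inv (by rwa [hes])]
  obtain ⟨τ, hτy, hτ, hs⟩ := h.transport _ _ hq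
  refine hτ.congr_of_eventuallyEq ?_
  have h1 : ∀ᶠ z in 𝓝 y, τ z ∈ e.target := by
    apply hτ.continuousAt
    rw [hτy]
    exact e.open_target.mem_nhds (e.map_source hy)
  filter_upwards [h1, hs] with z hz hsz
  rw [Quotient.sound hsz, ← hes, e.right_inv hz]

theorem isManifold (h : SmoothGluing I s) [IsManifold I ∞ Y] :
    letI := h.chartedSpace
    IsManifold I ∞ (Quotient s) := by
  let := h.chartedSpace
  apply isManifold_of_contDiffOn
  rintro _ _ ⟨q, rfl⟩ ⟨q', rfl⟩
  set y := (Quotient.mk_surjective (s := s)).hasRightInverse.choose q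
  set y' := (Quotient.mk_surjective (s := s)).hasRightInverse.choose q'
  set e := h.isLocalHomeomorph_mk.localInverseAt y with he
  set e' := h.isLocalHomeomorph_mk.localInverseAt y' with he'
  have hes : ∀ x, e.symm x = Quotient.mk s x := fun x => by
    rw [he, IsLocalHomeomorph.localInverseAt_symm]
  set T := (e.trans (chartAt H y)).symm.trans (e'.trans (chartAt H y')) with hT
  have key : ContMDiffOn I I ∞ T T.source := by
    intro x hx
    have hx' : x ∈ (chartAt H y).target ∧ (chartAt H y).symm x ∈ e.target ∧
        Quotient.mk s ((chartAt H y).symm x) ∈ e'.source ∧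
        e' (Quotient.mk s ((chartAt H y).symm x)) ∈ (chartAt H y').source := by
      simpa [hT, hes, and_assoc] using hx
    obtain ⟨h1, h2, h3, h4⟩ := hx'
    have c1 : ContMDiffAt I I ∞ (chartAt H y).symm x :=
      (contMDiffOn_chart_symm (I := I) (n := ∞) (x := y)).contMDiffAt
        ((chartAt H y).open_target.mem_nhds h1)
    have c2 := h.contMDiffAt_localInverse_comp y' _ h3
    have c3 : ContMDiffAt I I ∞ (chartAt H y') (e' (Quotient.mk s ((chartAt H y).symm x))) :=
      (contMDiffOn_chart (I := I) (n := ∞) (x := y')).contMDiffAt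
        ((chartAt H y').open_source.mem_nhds h4)
    have c := c3.comp x (c2.comp x c1)
    have : (T : H → H) = (chartAt H y') ∘ (fun z => e' (Quotient.mk s z)) ∘ (chartAt H y).symm := by
      ext z
      simp [hT, hes]
    rw [this]
    exact c.contMDiffWithinAt
  rcases isEmpty_or_nonempty H with hH | ⟨⟨x₀⟩⟩
  · intro z hz; exact (hH.false (I.symm z)).elim
  have := (contMDiffOn_iff.1 key).2 x₀ x₀
  refine this.mono ?_ |>.congr ?_
  · intro z hz
    simpa [chartAt_self_eq, and_comm] using hz
  · intro z hz
    simp [chartAt_self_eq]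

theorem contMDiff_mk (h : SmoothGluing I s) [IsManifold I ∞ Y] :
    letI := h.chartedSpace
    ContMDiff I I ∞ (Quotient.mk s) := by
  let := h.chartedSpace
  intro y
  rw [contMDiffAt_iff_target]
  refine ⟨continuous_quotient_mk'.continuousAt, ?_⟩
  set y' := (Quotient.mk_surjective (s := s)).hasRightInverse.choose (Quotient.mk s y)
  have hy' : Quotient.mk s y' = Quotient.mk s y :=
    (Quotient.mk_surjective (s := s)).hasRightInverse.choose_spec _
  set e' := h.isLocalHomeomorph_mk.localInverseAt y' with he'
  have hmem : Quotient.mk s y ∈ e'.source := by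
    rw [← hy']; simp [he']
  have hval : e' (Quotient.mk s y) = y' := by
    rw [← hy']; simp [he']
  have c2 := h.contMDiffAt_localInverse_comp y' y hmem
  have c3 : ContMDiffAt I 𝓘(ℝ, E) ∞ (extChartAt I y') (e' (Quotient.mk s y)) := by
    rw [hval]
    exact contMDiffAt_extChartAt
  exact ContMDiffAt.comp (f := fun z => e' (Quotient.mk s z)) y c3 c2

theorem contMDiffAt_of_comp_mk (h : SmoothGluing I s) [IsManifold I ∞ Y]
    {E' H' Z : Type*} [NormedAddCommGroup E'] [NormedSpace ℝ E'] [TopologicalSpace H']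
    {I' : ModelWithCorners ℝ E' H'} [TopologicalSpace Z] [ChartedSpace H' Z]
    {f : Quotient s → Z} {q : Quotient s} :
    letI := h.chartedSpace
    (∀ y, Quotient.mk s y = q → ContMDiffAt I I' ∞ (fun z => f (Quotient.mk s z)) y) →
    ContMDiffAt I I' ∞ f q := by
  let := h.chartedSpace
  have := h.isManifold
  intro hf
  set y' := (Quotient.mk_surjective (s := s)).hasRightInverse.choose q with hy
  have hy' : Quotient.mk s y' = q :=
    (Quotient.mk_surjective (s := s)).hasRightInverse.choose_spec _
  set e' := h.isLocalHomeomorph_mk.localInverseAt y' with he'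
  have hes : ∀ x, e'.symm x = Quotient.mk s x := fun x => by
    rw [he', IsLocalHomeomorph.localInverseAt_symm]
  have hq : q ∈ e'.source := by rw [← hy']; simp [he']
  have hval : e' q = y' := by rw [← hy']; simp [he']
  have c : ContMDiffAt I I ∞ e' q := by
    rw [contMDiffAt_iff_target]
    refine ⟨e'.continuousAt hq, ?_⟩
    have : ContMDiffAt I 𝓘(ℝ, E) ∞ (extChartAt I q) q := contMDiffAt_extChartAt
    rw [hval]
    exact this
  have c2 := hf y' hy'
  rw [← hval] at c2
  refine (c2.comp q c).congr_of_eventuallyEq ?_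
  filter_upwards [e'.open_source.mem_nhds hq] with z hz
  simp only [Function.comp]
  rw [← hes, e'.left_inv hz]

end SmoothGluing

/-! ### Gluing two manifolds along tubes -/

/-- A smooth open embedding `E ↪ M` between `n`-manifolds. -/
structure OpenTube (n : ℕ) (E M : Type*)
    [TopologicalSpace E] [ChartedSpace (EuclideanSpace ℝ (Fin n)) E]
    [TopologicalSpace M] [ChartedSpace (EuclideanSpace ℝ (Fin n)) M] where
  toFun : E → M
  isLocalDiffeomorph : IsLocalDiffeomorph (𝓡 n) (𝓡 n) ∞ toFun
  injective : Function.Injective toFun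

/-- A model tube `E` with a compact core and a smooth involution `inv` of `E ∖ core`. In both cases
used below `E` is a bundle of copies of `ℝᵐ`, `core` is its zero section, and `inv` is the fibrewise
inversion `x ↦ x / ‖x‖²`, which fixes the unit sphere bundle and exchanges its two sides. -/
structure CollarModel (n : ℕ) (E : Type*)
    [TopologicalSpace E] [ChartedSpace (EuclideanSpace ℝ (Fin n)) E] where
  core : Set E
  isCompact_core : IsCompact core
  inv : E → E
  inv_notMem : ∀ z ∉ core, inv z ∉ core
  inv_inv : ∀ z ∉ core, inv (inv z) = z
  contMDiffAt_inv : ∀ z ∉ core, ContMDiffAt (𝓡 n) (𝓡 n) ∞ inv z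

namespace CollarModel

variable {n : ℕ} {E : Type*} [TopologicalSpace E] [ChartedSpace (EuclideanSpace ℝ (Fin n)) E]
  {M M₁ M₂ : Type*} [TopologicalSpace M] [ChartedSpace (EuclideanSpace ℝ (Fin n)) M] [T2Space M]
  [TopologicalSpace M₁] [ChartedSpace (EuclideanSpace ℝ (Fin n)) M₁] [T2Space M₁]
  [TopologicalSpace M₂] [ChartedSpace (EuclideanSpace ℝ (Fin n)) M₂] [T2Space M₂]

/-- The open complement `M ∖ i(core)`. -/
def compl (K : CollarModel n E) (i : OpenTube n E M) : Opens M :=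
  ⟨(i.toFun '' K.core)ᶜ, (K.isCompact_core.image
    i.isLocalDiffeomorph.contMDiff.continuous).isClosed.isOpen_compl⟩

theorem mem_compl_iff (K : CollarModel n E) (i : OpenTube n E M) (z : E) :
    i.toFun z ∈ K.compl i ↔ z ∉ K.core := by
  change i.toFun z ∉ i.toFun '' K.core ↔ _
  rw [i.injective.mem_set_image]

theorem exists_transport (K : CollarModel n E) (i₁ : OpenTube n E M₁) (i₂ : OpenTube n E M₂)
    (a : K.compl i₁) (b : K.compl i₂) (z : E) (hz : z ∉ K.core) (ha : (a : M₁) = i₁.toFun z)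
    (hb : (b : M₂) = i₂.toFun (K.inv z)) :
    ∃ f : K.compl i₁ → K.compl i₂, f a = b ∧ ContMDiffAt (𝓡 n) (𝓡 n) ∞ f a ∧
      ∀ᶠ x : K.compl i₁ in 𝓝 a, ∃ w ∉ K.core, (x : M₁) = i₁.toFun w ∧ (f x : M₂) = i₂.toFun (K.inv w) := by
  classical
  have hl := i₁.isLocalDiffeomorph z
  let L : M₁ → E := hl.localInverse
  let g : M₁ → M₂ := fun x => i₂.toFun (K.inv (L x))
  have hLa : L (a : M₁) = z := by
    rw [ha]; exact hl.localInverse_left_inv hl.localInverse_mem_target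
  have hLs : ContMDiffAt (𝓡 n) (𝓡 n) ∞ L (a : M₁) := by
    rw [ha]; exact hl.localInverse_contMDiffAt
  have hgs : ContMDiffAt (𝓡 n) (𝓡 n) ∞ g (a : M₁) := by
    have h1 : ContMDiffAt (𝓡 n) (𝓡 n) ∞ K.inv (L (a : M₁)) := by
      rw [hLa]; exact K.contMDiffAt_inv z hz
    exact ((i₂.isLocalDiffeomorph.contMDiff (K.inv (L a))).comp (L (a : M₁)) h1).comp (a : M₁) hLs
  have hev : ∀ᶠ x in 𝓝 (a : M₁), i₁.toFun (L x) = x := by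
    rw [ha]
    exact hl.localInverse_eventuallyEq_right
  have hev' : ∀ᶠ x : K.compl i₁ in 𝓝 a, i₁.toFun (L x) = x :=
    continuous_subtype_val.continuousAt.eventually hev
  have hval : Tendsto (Subtype.val : K.compl i₁ → M₁) (𝓝 a) (𝓝 (a : M₁)) :=
    continuous_subtype_val.continuousAt
  have hgmem : ∀ᶠ x : K.compl i₁ in 𝓝 a, g x ∈ K.compl i₂ := by
    filter_upwards [hev'] with x hx
    have : L x ∉ K.core := by
      rw [← K.mem_compl_iff i₁, hx]; exact x.2
    exact (K.mem_compl_iff i₂ _).2 (K.inv_notMem _ this)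
  have hga : g a = b := by simp only [g, hLa, hb]
  refine ⟨fun x => if h : g x ∈ K.compl i₂ then ⟨g x, h⟩ else b, ?_, ?_, ?_⟩
  · have : g a ∈ K.compl i₂ := by rw [hga]; exact b.2
    simp only [this, dite_true]
    exact Subtype.ext hga
  · rw [← ContMDiffAt.subtypeVal_comp_iff]
    have : ContMDiffAt (𝓡 n) (𝓡 n) ∞ (fun x : K.compl i₁ => g x) a :=
      contMDiffAt_subtype_iff.2 hgs
    refine this.congr_of_eventuallyEq ?_
    filter_upwards [hgmem] with x hx
    simp [hx]
  · filter_upwards [hev', hgmem] with x hx hx'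
    refine ⟨L x, ?_, hx.symm, ?_⟩
    · rw [← K.mem_compl_iff i₁, hx]; exact x.2
    · simp [hx', g]

/-- The relation identifying `i₁(z)` with `i₂(inv z)` for every `z ∉ core`. -/
def glueRel (K : CollarModel n E) (i₁ : OpenTube n E M₁) (i₂ : OpenTube n E M₂) :
    K.compl i₁ ⊕ K.compl i₂ → K.compl i₁ ⊕ K.compl i₂ → Prop
  | .inl a, .inl a' => a = a'
  | .inl a, .inr b => ∃ z ∉ K.core, (a : M₁) = i₁.toFun z ∧ (b : M₂) = i₂.toFun (K.inv z)
  | .inr b, .inl a => ∃ z ∉ K.core, (a : M₁) = i₁.toFun z ∧ (b : M₂) = i₂.toFun (K.inv z)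
  | .inr b, .inr b' => b = b'

/-- The relation `glueRel` as an equivalence relation. -/
def glueSetoid (K : CollarModel n E) (i₁ : OpenTube n E M₁) (i₂ : OpenTube n E M₂) :
    Setoid (K.compl i₁ ⊕ K.compl i₂) where
  r := K.glueRel i₁ i₂
  iseqv := by
    have hinj : ∀ z ∉ K.core, ∀ z' ∉ K.core, i₂.toFun (K.inv z) = i₂.toFun (K.inv z') → z = z' := by
      intro z hz z' hz' h
      rw [← K.inv_inv z hz, i₂.injective h, K.inv_inv z' hz']
    refine ⟨?_, ?_, ?_⟩
    · rintro (a | b) <;> rfl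
    · rintro (a | b) (a' | b') h
      · exact Eq.symm h
      · exact h
      · exact h
      · exact Eq.symm h
    · rintro (a | b) (a' | b') (a'' | b'') h h'
      · exact Eq.trans h h'
      · obtain rfl : a = a' := h
        exact h'
      · obtain ⟨z, hz, h1, h2⟩ := h
        obtain ⟨w, hw, h3, h4⟩ := h'
        obtain rfl := hinj z hz w hw (h2.symm.trans h4)
        exact Subtype.ext (h1.trans h3.symm)
      · obtain rfl : b' = b'' := h'
        exact h
      · obtain rfl : a' = a'' := h'
        exact h
      · obtain ⟨z, hz, h1, h2⟩ := h
        obtain ⟨w, hw, h3, h4⟩ := h'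
        obtain rfl := i₁.injective (h1.symm.trans h3)
        exact Subtype.ext (h2.trans h4.symm)
      · obtain rfl : b = b' := h
        exact h'
      · exact Eq.trans h h'

theorem smoothGluing_glueSetoid (K : CollarModel n E) (i₁ : OpenTube n E M₁)
    (i₂ : OpenTube n E M₂) [IsManifold (𝓡 n) ∞ M₁] [IsManifold (𝓡 n) ∞ M₂] :
    SmoothGluing (𝓡 n) (K.glueSetoid i₁ i₂) where
  transport := by
    rintro (a | b) (a' | b') h
    · obtain rfl : a = a' := h
      exact ⟨id, rfl, contMDiffAt_id, .of_forall (K.glueSetoid i₁ i₂).refl'⟩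
    · obtain ⟨z, hz, h1, h2⟩ := h
      obtain ⟨f, hf, hfs, hev⟩ := K.exists_transport i₁ i₂ a b' z hz h1 h2
      let π : K.compl i₁ ⊕ K.compl i₂ → K.compl i₁ := Sum.elim id (fun _ => a)
      have hπ : ContMDiff (𝓡 n) (𝓡 n) ∞ π := contMDiff_id.sumElim contMDiff_const
      refine ⟨fun y => .inr (f (π y)), congrArg _ hf, ?_, ?_⟩
      · have : ContMDiffAt (𝓡 n) (𝓡 n) ∞ f (π (.inl a)) := hfs
        exact ContMDiffAt.comp (f := fun y => f (π y)) (Sum.inl a)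
          (ContMDiff.inr (f (π (.inl a)))) (this.comp _ (hπ _))
      · rw [nhds_inl]
        exact hev
    · obtain ⟨z, hz, h1, h2⟩ := h
      obtain ⟨f, hf, hfs, hev⟩ := K.exists_transport i₂ i₁ b a' (K.inv z) (K.inv_notMem z hz) h2
        (by rw [h1, K.inv_inv z hz])
      let π : K.compl i₁ ⊕ K.compl i₂ → K.compl i₂ := Sum.elim (fun _ => b) id
      have hπ : ContMDiff (𝓡 n) (𝓡 n) ∞ π := contMDiff_const.sumElim contMDiff_id
      refine ⟨fun y => .inl (f (π y)), congrArg _ hf, ?_, ?_⟩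
      · have : ContMDiffAt (𝓡 n) (𝓡 n) ∞ f (π (.inr b)) := hfs
        exact ContMDiffAt.comp (f := fun y => f (π y)) (Sum.inr b)
          (ContMDiff.inl (f (π (.inr b)))) (this.comp _ (hπ _))
      · rw [nhds_inr]
        change ∀ᶠ x in 𝓝 b, K.glueRel i₁ i₂ (.inr x) (.inl (f x))
        filter_upwards [hev] with x hx
        obtain ⟨w, hw, h3, h4⟩ := hx
        exact ⟨K.inv w, K.inv_notMem w hw, h4, by rw [h3, K.inv_inv w hw]⟩
    · obtain rfl : b = b' := h
      exact ⟨id, rfl, contMDiffAt_id, .of_forall (K.glueSetoid i₁ i₂).refl'⟩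
  locally_injective := by
    rintro (a | b)
    · refine ⟨range .inl, isOpen_range_inl.mem_nhds ⟨a, rfl⟩, ?_⟩
      rintro _ ⟨x, rfl⟩ _ ⟨x', rfl⟩ h
      exact congrArg _ h
    · refine ⟨range .inr, isOpen_range_inr.mem_nhds ⟨b, rfl⟩, ?_⟩
      rintro _ ⟨x, rfl⟩ _ ⟨x', rfl⟩ h
      exact congrArg _ h

end CollarModel

open CollarModel

section
variable {n : ℕ} {E : Type*} [TopologicalSpace E] [ChartedSpace (EuclideanSpace ℝ (Fin n)) E]
  {M₁ M₂ : Type*}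
  [TopologicalSpace M₁] [ChartedSpace (EuclideanSpace ℝ (Fin n)) M₁] [T2Space M₁]
  [TopologicalSpace M₂] [ChartedSpace (EuclideanSpace ℝ (Fin n)) M₂] [T2Space M₂]

/-- The manifold obtained from `M₁ ∖ i₁(core)` and `M₂ ∖ i₂(core)` by identifying `i₁(z)` with
`i₂(inv z)` for `z ∉ core`. If `E` is a bundle of copies of `ℝᵐ` with unit disc bundle `D` and `inv`
is the fibrewise inversion, this is `(M₁ ∖ i₁(int D)) ∪ (M₂ ∖ i₂(int D))`, glued along the identity
of `∂D`, with the smooth structure given by the radial collars. -/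
def TubeSum (K : CollarModel n E) (i₁ : OpenTube n E M₁) (i₂ : OpenTube n E M₂) : Type _ :=
  Quotient (K.glueSetoid i₁ i₂)

namespace TubeSum
variable {K : CollarModel n E} {i₁ : OpenTube n E M₁} {i₂ : OpenTube n E M₂}

instance : TopologicalSpace (TubeSum K i₁ i₂) :=
  inferInstanceAs (TopologicalSpace (Quotient (K.glueSetoid i₁ i₂)))

/-- The inclusion of `M₁ ∖ i₁(core)`. -/
def inl (a : K.compl i₁) : TubeSum K i₁ i₂ := Quotient.mk (K.glueSetoid i₁ i₂) (.inl a)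
/-- The inclusion of `M₂ ∖ i₂(core)`. -/
def inr (b : K.compl i₂) : TubeSum K i₁ i₂ := Quotient.mk (K.glueSetoid i₁ i₂) (.inr b)

variable [IsManifold (𝓡 n) ∞ M₁] [IsManifold (𝓡 n) ∞ M₂]

noncomputable instance : ChartedSpace (EuclideanSpace ℝ (Fin n)) (TubeSum K i₁ i₂) :=
  (K.smoothGluing_glueSetoid i₁ i₂).chartedSpace

instance : IsManifold (𝓡 n) ∞ (TubeSum K i₁ i₂) :=
  (K.smoothGluing_glueSetoid i₁ i₂).isManifold

end TubeSum
end

noncomputable section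

/-! ### The models for connected sums and circle sums -/

section Models

/-- The tube `ℝⁿ` with core the origin and the inversion `x ↦ x / ‖x‖²`. -/
def discCollarModel (n : ℕ) : CollarModel n (EuclideanSpace ℝ (Fin n)) where
  core := {0}
  isCompact_core := isCompact_singleton
  inv x := (‖x‖ ^ 2)⁻¹ • x
  inv_notMem x hx := by
    have : ‖x‖ ≠ 0 := norm_ne_zero_iff.2 hx
    simp only [mem_singleton_iff, smul_eq_zero, not_or]
    exact ⟨by positivity, hx⟩
  inv_inv x hx := by
    have : ‖x‖ ≠ 0 := norm_ne_zero_iff.2 hx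
    rw [smul_smul, norm_smul, norm_inv, norm_pow, norm_norm]
    have : ((‖x‖ ^ 2)⁻¹ * ‖x‖) ^ 2 = (‖x‖ ^ 2)⁻¹ := by field_simp
    rw [this, _root_.inv_inv, mul_inv_cancel₀ (by positivity), one_smul]
  contMDiffAt_inv x hx := by
    have : ‖x‖ ≠ 0 := norm_ne_zero_iff.2 hx
    exact ((((contDiff_norm_sq ℝ).contDiffAt).inv (by positivity)).smul contDiffAt_id).contMDiffAt

/-- The action of `k : ℤ` on `ℝ³ × ℝ` generated by `(x₀, x₁, x₂, t) ↦ (-x₀, x₁, x₂, t + 1)`. -/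
def twistShift (k : ℤ) (x : EuclideanSpace ℝ (Fin 4)) : EuclideanSpace ℝ (Fin 4) :=
  !₂[(-1 : ℝ) ^ k * x 0, x 1, x 2, x 3 + k]

theorem twistShift_zero (x : EuclideanSpace ℝ (Fin 4)) : twistShift 0 x = x := by
  ext i; fin_cases i <;> simp [twistShift]

theorem twistShift_twistShift (k l : ℤ) (x : EuclideanSpace ℝ (Fin 4)) :
    twistShift k (twistShift l x) = twistShift (k + l) x := by
  ext i; fin_cases i <;> simp [twistShift, zpow_add₀, mul_assoc, add_assoc, add_comm]

theorem contDiff_twistShift (k : ℤ) : ContDiff ℝ ∞ (twistShift k) := by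
  rw [contDiff_euclidean]
  intro i; fin_cases i <;> simp [twistShift] <;> fun_prop

/-- The orbit relation of this action. -/
def twistSetoid : Setoid (EuclideanSpace ℝ (Fin 4)) where
  r x y := ∃ k : ℤ, y = twistShift k x
  iseqv := by
    refine ⟨fun x => ⟨0, (twistShift_zero x).symm⟩, ?_, ?_⟩
    · rintro x _ ⟨k, rfl⟩
      exact ⟨-k, by rw [twistShift_twistShift, neg_add_cancel, twistShift_zero]⟩
    · rintro x _ _ ⟨k, rfl⟩ ⟨l, rfl⟩
      exact ⟨l + k, twistShift_twistShift _ _ _⟩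

theorem smoothGluing_twistSetoid : SmoothGluing (𝓡 4) twistSetoid where
  transport := by
    rintro x _ ⟨k, rfl⟩
    exact ⟨twistShift k, rfl, (contDiff_twistShift k).contMDiff.contMDiffAt,
      .of_forall fun z => ⟨k, rfl⟩⟩
  locally_injective x := by
    have hc : Continuous fun z : EuclideanSpace ℝ (Fin 4) => z 3 := by fun_prop
    refine ⟨(fun z => z 3) ⁻¹' Ioo (x 3 - 1 / 2) (x 3 + 1 / 2),
      (isOpen_Ioo.preimage hc).mem_nhds (by simp), ?_⟩
    rintro z ⟨h1, h2⟩ _ h3 ⟨k, rfl⟩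
    have h3' : x 3 - 1 / 2 < z 3 + k ∧ z 3 + k < x 3 + 1 / 2 := by
      simpa [twistShift] using h3
    have hk1 : (k : ℝ) < 1 := by linarith [h3'.2]
    have hk2 : (-1 : ℝ) < k := by linarith [h3'.1]
    have : k = 0 := by
      have a : k < 1 := by exact_mod_cast hk1
      have b : -1 < k := by exact_mod_cast hk2
      omega
    rw [this, twistShift_zero]

/-- The non-trivial (non-orientable) bundle `ℝ³ ×~ S¹` over the circle, as the mapping torus of a
reflection of `ℝ³`; its unit disc bundle is `D³ ×~ S¹`. -/
def TwistedTube : Type := Quotient twistSetoid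

namespace TwistedTube

/-- The quotient map `ℝ³ × ℝ → ℝ³ ×~ S¹`. -/
def mk (x : EuclideanSpace ℝ (Fin 4)) : TwistedTube := Quotient.mk twistSetoid x

instance : TopologicalSpace TwistedTube :=
  inferInstanceAs (TopologicalSpace (Quotient twistSetoid))

instance : ChartedSpace (EuclideanSpace ℝ (Fin 4)) TwistedTube :=
  smoothGluing_twistSetoid.chartedSpace

instance : IsManifold (𝓡 4) ∞ TwistedTube := smoothGluing_twistSetoid.isManifold

theorem contMDiff_mk : ContMDiff (𝓡 4) (𝓡 4) ∞ mk := smoothGluing_twistSetoid.contMDiff_mk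

/-- The squared norm in the fibre. -/
def radSq (x : EuclideanSpace ℝ (Fin 4)) : ℝ := x 0 ^ 2 + x 1 ^ 2 + x 2 ^ 2

theorem radSq_twistShift (k : ℤ) (x : EuclideanSpace ℝ (Fin 4)) :
    radSq (twistShift k x) = radSq x := by
  have : ((-1 : ℝ) ^ k) ^ 2 = 1 := by
    rcases Int.even_or_odd k with h | h
    · simp [h.neg_one_zpow]
    · simp [h.neg_one_zpow]
  simp [radSq, twistShift, mul_pow, this]

/-- The inversion in the fibre. -/
def radInv (x : EuclideanSpace ℝ (Fin 4)) : EuclideanSpace ℝ (Fin 4) :=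
  !₂[(radSq x)⁻¹ * x 0, (radSq x)⁻¹ * x 1, (radSq x)⁻¹ * x 2, x 3]

theorem radSq_radInv (x : EuclideanSpace ℝ (Fin 4)) : radSq (radInv x) = (radSq x)⁻¹ := by
  have h1 : radSq (radInv x) = ((radSq x)⁻¹ * x 0) ^ 2 + ((radSq x)⁻¹ * x 1) ^ 2 +
      ((radSq x)⁻¹ * x 2) ^ 2 := rfl
  have h2 : radSq (radInv x) = (radSq x)⁻¹ ^ 2 * radSq x := by
    rw [h1, mul_pow, mul_pow, mul_pow, ← mul_add, ← mul_add]; rfl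
  rw [h2]
  by_cases h : radSq x = 0
  · simp [h]
  · field_simp

theorem radInv_radInv (x : EuclideanSpace ℝ (Fin 4)) (h : radSq x ≠ 0) :
    radInv (radInv x) = x := by
  have h' := radSq_radInv x
  ext i
  fin_cases i <;> simp [radInv.eq_1 (radInv x), h'] <;> simp [radInv, h]

theorem radInv_twistShift (k : ℤ) (x : EuclideanSpace ℝ (Fin 4)) :
    radInv (twistShift k x) = twistShift k (radInv x) := by
  ext i
  fin_cases i <;> simp [radInv, radSq_twistShift] <;> simp [twistShift]
  ring

theorem contDiffAt_radInv (x : EuclideanSpace ℝ (Fin 4)) (h : radSq x ≠ 0) :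
    ContDiffAt ℝ ∞ radInv x := by
  have h1 : ContDiffAt ℝ ∞ radSq x := by unfold radSq; fun_prop
  have h2 := h1.inv h
  rw [contDiffAt_euclidean]
  intro i
  fin_cases i <;> simp [radInv] <;> fun_prop

/-- The zero section of `ℝ³ ×~ S¹`. -/
def core : Set TwistedTube := mk '' {x | radSq x = 0}

theorem mk_mem_core (x : EuclideanSpace ℝ (Fin 4)) : mk x ∈ core ↔ radSq x = 0 := by
  constructor
  · rintro ⟨y, hy, hyx⟩
    obtain ⟨k, rfl⟩ : ∃ k : ℤ, x = twistShift k y := Quotient.exact hyx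
    rw [radSq_twistShift]; exact hy
  · intro h
    exact ⟨x, h, rfl⟩

/-- The fibrewise inversion of `ℝ³ ×~ S¹` off the zero section. -/
def inv : TwistedTube → TwistedTube :=
  Quotient.map radInv (by
    rintro x _ ⟨k, rfl⟩
    exact ⟨k, radInv_twistShift k x⟩)

theorem isCompact_core : IsCompact core := by
  have : core = (fun t : ℝ => mk !₂[0, 0, 0, t]) '' Icc 0 1 := by
    ext z
    constructor
    · rintro ⟨x, hx, rfl⟩
      have hx' : x 0 ^ 2 + x 1 ^ 2 + x 2 ^ 2 = 0 := hx
      have h0 : x 0 = 0 := by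
        nlinarith [sq_nonneg (x 0), sq_nonneg (x 1), sq_nonneg (x 2), hx']
      have h1 : x 1 = 0 := by
        nlinarith [sq_nonneg (x 0), sq_nonneg (x 1), sq_nonneg (x 2), hx']
      have h2 : x 2 = 0 := by
        nlinarith [sq_nonneg (x 0), sq_nonneg (x 1), sq_nonneg (x 2), hx']
      refine ⟨Int.fract (x 3), ⟨Int.fract_nonneg _, (Int.fract_lt_one _).le⟩, ?_⟩
      refine Quotient.sound ⟨⌊x 3⌋, ?_⟩
      ext i
      fin_cases i <;> simp [twistShift, h0, h1, h2]
    · rintro ⟨t, -, rfl⟩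
      exact ⟨_, by simp [radSq], rfl⟩
  rw [this]
  refine isCompact_Icc.image (contMDiff_mk.continuous.comp ?_)
  refine (PiLp.continuous_toLp 2 _).comp (continuous_pi fun i => ?_)
  fin_cases i <;> simp <;> fun_prop

end TwistedTube

/-- The tube `ℝ³ ×~ S¹` with core its zero section and the fibrewise inversion. -/
def circleCollarModel : CollarModel 4 TwistedTube where
  core := TwistedTube.core
  isCompact_core := TwistedTube.isCompact_core
  inv := TwistedTube.inv
  inv_notMem := by
    rintro ⟨x⟩ hx
    change TwistedTube.mk x ∉ _ at hx
    change TwistedTube.mk (TwistedTube.radInv x) ∉ _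
    rw [TwistedTube.mk_mem_core] at hx ⊢
    rw [TwistedTube.radSq_radInv]
    exact inv_ne_zero hx
  inv_inv := by
    rintro ⟨x⟩ hx
    change TwistedTube.mk x ∉ _ at hx
    rw [TwistedTube.mk_mem_core] at hx
    exact congrArg TwistedTube.mk (TwistedTube.radInv_radInv x hx)
  contMDiffAt_inv := by
    intro z hz
    refine smoothGluing_twistSetoid.contMDiffAt_of_comp_mk ?_
    rintro x rfl
    change TwistedTube.mk x ∉ _ at hz
    rw [TwistedTube.mk_mem_core] at hz
    exact (TwistedTube.contMDiff_mk _).comp x (TwistedTube.contDiffAt_radInv x hz).contMDiffAt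

section Sums

variable {M₁ M₂ : Type*}
  [TopologicalSpace M₁] [ChartedSpace (EuclideanSpace ℝ (Fin 4)) M₁] [T2Space M₁]
  [TopologicalSpace M₂] [ChartedSpace (EuclideanSpace ℝ (Fin 4)) M₂] [T2Space M₂]

/-- The connected sum `M₁ # M₂` of two 4-manifolds along two embedded discs. -/
abbrev ConnectedSum (i₁ : OpenTube 4 (EuclideanSpace ℝ (Fin 4)) M₁)
    (i₂ : OpenTube 4 (EuclideanSpace ℝ (Fin 4)) M₂) : Type _ :=
  TubeSum (discCollarModel 4) i₁ i₂

/-- The circle sum `M₁ #_{S¹} M₂` of two 4-manifolds along embedded copies of `D³ ×~ S¹`. As the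
tube is non-orientable, the cores of `i₁` and `i₂` are orientation reversing loops. -/
abbrev CircleSum (i₁ : OpenTube 4 TwistedTube M₁) (i₂ : OpenTube 4 TwistedTube M₂) : Type _ :=
  TubeSum circleCollarModel i₁ i₂

end Sums

end Models

/-! ### The group `Pin⁺(n)` -/


/-- The quadratic form `v ↦ ‖v‖²` on `ℝⁿ`. -/
abbrev euclForm (n : ℕ) : QuadraticForm ℝ (EuclideanSpace ℝ (Fin n)) :=
  LinearMap.BilinMap.toQuadraticMap (innerₗ (EuclideanSpace ℝ (Fin n)))

/-- The Clifford algebra of `ℝⁿ` in which unit vectors square to `+1`. -/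
abbrev Cliff (n : ℕ) : Type := CliffordAlgebra (euclForm n)

/-- `Pin⁺(n)` (for `n ≥ 1`): the group generated by the unit vectors of `ℝⁿ` in the Clifford algebra
with `v² = +‖v‖²`. -/
def pinPlus (n : ℕ) : Subgroup (Cliff n)ˣ :=
  Subgroup.closure {u | ∃ v : EuclideanSpace ℝ (Fin n), ‖v‖ = 1 ∧
    (u : Cliff n) = CliffordAlgebra.ι (euclForm n) v}

/-- `Pin⁺(n)` as a type. -/
abbrev PinPlus (n : ℕ) : Type := ↥(pinPlus n)

/-- The topology induced from the finite-dimensional real vector space `Cliff n`. -/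
instance (n : ℕ) : TopologicalSpace (PinPlus n) :=
  TopologicalSpace.induced (fun g => ((g : (Cliff n)ˣ) : Cliff n)) (moduleTopology ℝ (Cliff n))

/-- The projection of the Clifford algebra onto `ℝⁿ`. -/
def vecPart (n : ℕ) : Cliff n →ₗ[ℝ] EuclideanSpace ℝ (Fin n) :=
  ExteriorAlgebra.ιInv ∘ₗ (CliffordAlgebra.equivExterior (euclForm n)).toLinearMap

theorem vecPart_ι (n : ℕ) (v : EuclideanSpace ℝ (Fin n)) :
    vecPart n (CliffordAlgebra.ι (euclForm n) v) = v := by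
  have : CliffordAlgebra.equivExterior (euclForm n) (CliffordAlgebra.ι (euclForm n) v) =
      ExteriorAlgebra.ι ℝ v := 
    CliffordAlgebra.changeForm_ι CliffordAlgebra.changeForm.associated_neg_proof v
  simp only [vecPart, LinearMap.comp_apply, LinearEquiv.coe_coe, this]
  exact ExteriorAlgebra.ι_leftInverse v

/-- The double covering `ρ : Pin⁺(n) → O(n)`, `ρ(g) v = α(g) v g⁻¹` with `α` the grading involution
(see `ι_pinRho`). A unit vector `u` acts as the reflection in the hyperplane orthogonal to `u`. -/
def pinRho {n : ℕ} (g : PinPlus n) :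
    EuclideanSpace ℝ (Fin n) →ₗ[ℝ] EuclideanSpace ℝ (Fin n) :=
  vecPart n ∘ₗ
    LinearMap.mulLeft ℝ (CliffordAlgebra.involute ((g : (Cliff n)ˣ) : Cliff n)) ∘ₗ
    LinearMap.mulRight ℝ (((g : (Cliff n)ˣ)⁻¹ : (Cliff n)ˣ) : Cliff n) ∘ₗ
    CliffordAlgebra.ι (euclForm n)

theorem ι_pinRho {n : ℕ} (g : PinPlus n) (v : EuclideanSpace ℝ (Fin n)) :
    CliffordAlgebra.ι (euclForm n) (pinRho g v) =
      CliffordAlgebra.involute ((g : (Cliff n)ˣ) : Cliff n) * CliffordAlgebra.ι (euclForm n) v *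
        (((g : (Cliff n)ˣ)⁻¹ : (Cliff n)ˣ) : Cliff n) := by
  have hg : (g : (Cliff n)ˣ) ∈ lipschitzGroup (euclForm n) := by
    refine Subgroup.closure_mono ?_ g.2
    rintro u ⟨v, -, hv⟩
    exact ⟨v, hv.symm⟩
  obtain ⟨w, hw⟩ := lipschitzGroup.involute_act_ι_mem_range_ι hg v
  have : pinRho g v = w := by
    simp only [pinRho, LinearMap.comp_apply, LinearMap.mulLeft_apply, LinearMap.mulRight_apply]
    rw [← mul_assoc, ← hw, vecPart_ι]
  rw [this, hw]

/-- The homomorphism `Pin⁺(m) → Pin⁺(n)` induced by an algebra map that sends unit vectors to unit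
vectors. -/
def pinMap {m n : ℕ} (f : Cliff m →ₐ[ℝ] Cliff n)
    (hf : ∀ v : EuclideanSpace ℝ (Fin m), ‖v‖ = 1 → ∃ w : EuclideanSpace ℝ (Fin n), ‖w‖ = 1 ∧
      f (CliffordAlgebra.ι (euclForm m) v) = CliffordAlgebra.ι (euclForm n) w) :
    PinPlus m →* PinPlus n :=
  ((Units.map (f : Cliff m →* Cliff n)).comp (pinPlus m).subtype).codRestrict (pinPlus n) (by
    rintro ⟨g, hg⟩
    have : pinPlus m ≤ (pinPlus n).comap (Units.map (f : Cliff m →* Cliff n)) := by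
      refine (Subgroup.closure_le _).2 ?_
      rintro u ⟨v, hv, huv⟩
      obtain ⟨w, hw, hfw⟩ := hf v hv
      refine Subgroup.subset_closure ⟨w, hw, ?_⟩
      simp [huv, hfw]
    exact this hg)

/-- The grading involution `α(g) = det(ρ(g)) · g` of `Pin⁺(n)`, which satisfies `ρ ∘ α = ρ`. -/
def pinGrading (n : ℕ) : PinPlus n →* PinPlus n :=
  pinMap CliffordAlgebra.involute fun v hv => ⟨-v, by simpa using hv, by simp⟩

/-- The inclusion `ℝⁿ → ℝⁿ⁺¹`, `v ↦ (v, 0)`. -/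
def euclIncl (n : ℕ) : EuclideanSpace ℝ (Fin n) →ₗ[ℝ] EuclideanSpace ℝ (Fin (n + 1)) where
  toFun v := WithLp.toLp 2 (Fin.snoc (α := fun _ => ℝ) v.ofLp 0)
  map_add' v w := by
    ext i; refine Fin.lastCases ?_ (fun i => ?_) i <;> simp
  map_smul' c v := by
    ext i; refine Fin.lastCases ?_ (fun i => ?_) i <;> simp

theorem norm_euclIncl {n : ℕ} (v : EuclideanSpace ℝ (Fin n)) : ‖euclIncl n v‖ = ‖v‖ := by
  simp [EuclideanSpace.norm_eq, euclIncl, Fin.sum_univ_castSucc]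

/-- The inclusion `Pin⁺(n) → Pin⁺(n + 1)`. -/
def pinIncl (n : ℕ) : PinPlus n →* PinPlus (n + 1) :=
  pinMap (CliffordAlgebra.map
    { euclIncl n with
      map_app' := fun v => by
        have := norm_euclIncl v
        simp only [LinearMap.BilinMap.toQuadraticMap_apply, innerₗ_apply_apply,
          real_inner_self_eq_norm_sq]
        exact congrArg (· ^ 2) this })
    fun v hv => ⟨euclIncl n v, (norm_euclIncl v).trans hv, by
      rw [CliffordAlgebra.map_apply_ι]; rfl⟩

/-! ### Pin⁺ structures -/

section Frames

variable {n : ℕ} {H : Type*} [TopologicalSpace H]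
  (I : ModelWithCorners ℝ (EuclideanSpace ℝ (Fin n)) H)
  (M : Type*) [TopologicalSpace M] [ChartedSpace H M]

/-- A linear frame `ℝⁿ ≃ T_x M` at a point `x` of `M`. -/
structure TangentFrame where
  base : M
  iso : EuclideanSpace ℝ (Fin n) ≃L[ℝ] TangentSpace I base

variable {I M}

/-- The tangent vector with coordinates `v` in the frame `b`. -/
def TangentFrame.vec (b : TangentFrame I M) (v : EuclideanSpace ℝ (Fin n)) : TangentBundle I M :=
  ⟨b.base, b.iso v⟩

/-- The image of a frame under the differential of a local diffeomorphism. -/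
def TangentFrame.map {H' N : Type*} [TopologicalSpace H'] [TopologicalSpace N] [ChartedSpace H' N]
    {J : ModelWithCorners ℝ (EuclideanSpace ℝ (Fin n)) H'} {f : M → N}
    (hf : IsLocalDiffeomorph I J ∞ f) (b : TangentFrame I M) : TangentFrame J N :=
  ⟨f b.base, b.iso.trans (hf.mfderivToContinuousLinearEquiv (by simp) b.base)⟩

theorem TangentFrame.vec_map {H' N : Type*} [TopologicalSpace H'] [TopologicalSpace N]
    [ChartedSpace H' N] {J : ModelWithCorners ℝ (EuclideanSpace ℝ (Fin n)) H'} {f : M → N}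
    (hf : IsLocalDiffeomorph I J ∞ f) (b : TangentFrame I M) (v : EuclideanSpace ℝ (Fin n)) :
    (b.map hf).vec v = tangentMap I J f (b.vec v) := rfl

end Frames

/-- A Pin⁺ structure on an `n`-manifold `M` (possibly with boundary): a principal `Pin⁺(n)`-bundle
`P → M` with an isomorphism `P ×_{Pin⁺(n)} ℝⁿ ≅ TM`. The isomorphism is given by the frames
`v ↦ [p, v]` that it attaches to the points `p` of `P`; they satisfy
`frame (p g) = frame p ∘ ρ(g)`, and the bundle projection sends `p` to the base of `frame p`. -/
structure PinStructure {n : ℕ} {H : Type*} [TopologicalSpace H]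
    (I : ModelWithCorners ℝ (EuclideanSpace ℝ (Fin n)) H)
    (M : Type v) [TopologicalSpace M] [ChartedSpace H M] [IsManifold I ∞ M] where
  P : Type u
  [topP : TopologicalSpace P]
  act : P → PinPlus n → P
  act_one : ∀ p, act p 1 = p
  act_mul : ∀ p g h, act p (g * h) = act (act p g) h
  continuous_act : Continuous fun x : P × PinPlus n => act x.1 x.2
  frame : P → TangentFrame I M
  continuous_frame : Continuous fun x : P × EuclideanSpace ℝ (Fin n) => (frame x.1).vec x.2
  frame_act : ∀ p g v, (frame (act p g)).vec v = (frame p).vec (pinRho g v)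
  locally_trivial : ∀ x : M, ∃ e : Bundle.Trivialization (PinPlus n) fun p => (frame p).base,
    x ∈ e.baseSet ∧ ∀ p ∈ e.source, ∀ g, (e (act p g)).2 = (e p).2 * g

namespace PinStructure

attribute [instance] PinStructure.topP

variable {m n : ℕ} {H H' : Type*} [TopologicalSpace H] [TopologicalSpace H']
  {I : ModelWithCorners ℝ (EuclideanSpace ℝ (Fin m)) H}
  {J : ModelWithCorners ℝ (EuclideanSpace ℝ (Fin n)) H'}
  {M N : Type*} [TopologicalSpace M] [ChartedSpace H M] [IsManifold I ∞ M]
  [TopologicalSpace N] [ChartedSpace H' N] [IsManifold J ∞ N]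

/-- Given `φ` on `M`, `ψ` on `N`, a homomorphism `θ` and a family `T` of frames of `N` indexed by
the principal bundle of `φ`: there is a `θ`-equivariant bundle map `h : φ.P → ψ.P` whose frames
`ψ.frame ∘ h` are homotopic to `T` through equivariant families of frames over the same points. -/
def LiftsAlong (φ : PinStructure I M) (ψ : PinStructure J N) (θ : PinPlus m →* PinPlus n)
    (T : φ.P → EuclideanSpace ℝ (Fin n) → TangentBundle J N) : Prop :=
  ∃ (h : φ.P → ψ.P) (F : unitInterval → φ.P → TangentFrame J N),
    Continuous h ∧ (∀ p g, h (φ.act p g) = ψ.act (h p) (θ g)) ∧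
    Continuous (fun x : unitInterval × φ.P × EuclideanSpace ℝ (Fin n) =>
      (F x.1 x.2.1).vec x.2.2) ∧
    (∀ t p, (F t p).base = (ψ.frame (h p)).base) ∧
    (∀ t p g v, (F t (φ.act p g)).vec v = (F t p).vec (pinRho (θ g) v)) ∧
    (∀ p v, (F 0 p).vec v = (ψ.frame (h p)).vec v) ∧
    (∀ p v, (F 1 p).vec v = T p v)


/-- The local diffeomorphism `f` preserves the Pin⁺ structures: `φ` is equivalent to `f^* ψ`. -/
def Preserves {H' N : Type*} [TopologicalSpace H'] [TopologicalSpace N] [ChartedSpace H' N]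
    {J : ModelWithCorners ℝ (EuclideanSpace ℝ (Fin m)) H'} [IsManifold J ∞ N]
    (φ : PinStructure I M) (ψ : PinStructure J N) (f : M → N) : Prop :=
  φ.LiftsAlong ψ (MonoidHom.id _) fun p v => tangentMap I J f ((φ.frame p).vec v)

/-- The local diffeomorphism `f` reverses the Pin⁺ structures: `-φ` is equivalent to `f^* ψ`, where
`-φ` is `φ` with the action of `Pin⁺` twisted by the grading involution, that is, `φ` tensored with
the orientation character `w₁`. -/
def Reverses {H' N : Type*} [TopologicalSpace H'] [TopologicalSpace N] [ChartedSpace H' N]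
    {J : ModelWithCorners ℝ (EuclideanSpace ℝ (Fin m)) H'} [IsManifold J ∞ N]
    (φ : PinStructure I M) (ψ : PinStructure J N) (f : M → N) : Prop :=
  φ.LiftsAlong ψ (pinGrading m) fun p v => tangentMap I J f ((φ.frame p).vec v)

theorem exists_trivialization_push {F P Q M N : Type*} [TopologicalSpace F] [Nonempty F]
    [TopologicalSpace P] [TopologicalSpace Q] [TopologicalSpace M] [TopologicalSpace N]
    {π : P → M} {π' : Q → N} {a : M → N} {b : P → Q} (ha : IsOpenEmbedding a)
    (hb : IsOpenEmbedding b) (hab : ∀ p, π' (b p) = a (π p))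
    (hpre : ∀ q, π' q ∈ range a → q ∈ range b) (e : Bundle.Trivialization F π) (x : M)
    (hx : x ∈ e.baseSet) :
    ∃ e' : Bundle.Trivialization F π', a x ∈ e'.baseSet ∧ e'.source = b '' e.source ∧
      ∀ p, (e' (b p)).2 = (e p).2 := by
  have hM : Nonempty M := ⟨x⟩
  have hP : Nonempty P := ⟨e.toOpenPartialHomeomorph.symm (x, Classical.arbitrary F)⟩
  have hid : IsOpenEmbedding (id : F → F) := .id
  let c : M × F → N × F := Prod.map a id
  have hc : IsOpenEmbedding c := ha.prodMap hid
  have hsrc : ((hb.toOpenPartialHomeomorph b).symm.trans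
      (e.toOpenPartialHomeomorph.trans (hc.toOpenPartialHomeomorph c))).source =
      b '' e.source := by
    ext q
    simp only [OpenPartialHomeomorph.trans_source, OpenPartialHomeomorph.symm_source,
      IsOpenEmbedding.toOpenPartialHomeomorph_target,
      IsOpenEmbedding.toOpenPartialHomeomorph_source, preimage_univ, inter_univ, mem_inter_iff,
      mem_preimage, mem_image]
    constructor
    · rintro ⟨⟨p, rfl⟩, h⟩
      rw [hb.toOpenPartialHomeomorph_left_inv] at h
      exact ⟨p, h, rfl⟩
    · rintro ⟨p, h, rfl⟩
      exact ⟨⟨p, rfl⟩, by rwa [hb.toOpenPartialHomeomorph_left_inv]⟩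
  refine ⟨{
    toOpenPartialHomeomorph := (hb.toOpenPartialHomeomorph b).symm.trans
      (e.toOpenPartialHomeomorph.trans (hc.toOpenPartialHomeomorph c))
    baseSet := a '' e.baseSet
    open_baseSet := ha.isOpenMap _ e.open_baseSet
    source_eq := ?_
    target_eq := ?_
    proj_toFun := ?_ }, ⟨x, hx, rfl⟩, hsrc, ?_⟩
  · rw [hsrc, e.source_eq]
    ext q
    constructor
    · rintro ⟨p, hp, rfl⟩
      exact ⟨π p, hp, (hab p).symm⟩
    · rintro ⟨y, hy, hyq⟩
      obtain ⟨p, rfl⟩ := hpre q ⟨y, hyq⟩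
      rw [hab] at hyq
      exact ⟨p, by rw [mem_preimage, ← ha.injective hyq]; exact hy, rfl⟩
  · ext ⟨y, g⟩
    simp only [OpenPartialHomeomorph.trans_target, OpenPartialHomeomorph.symm_target,
      IsOpenEmbedding.toOpenPartialHomeomorph_target,
      IsOpenEmbedding.toOpenPartialHomeomorph_source, preimage_univ, inter_univ, mem_inter_iff,
      mem_preimage, e.target_eq]
    constructor
    · rintro ⟨⟨⟨y', g'⟩, h'⟩, h⟩
      rw [← h', hc.toOpenPartialHomeomorph_left_inv] at h
      exact ⟨⟨y', h.1, congrArg Prod.fst h'⟩, trivial⟩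
    · rintro ⟨⟨y', hy', rfl⟩, -⟩
      have : ((a y', g) : N × F) = c (y', g) := rfl
      rw [this, hc.toOpenPartialHomeomorph_left_inv]
      exact ⟨⟨_, rfl⟩, hy', trivial⟩
  · intro q hq
    rw [hsrc] at hq
    obtain ⟨p, hp, rfl⟩ := hq
    simp only [OpenPartialHomeomorph.coe_trans, Function.comp,
      hb.toOpenPartialHomeomorph_left_inv, IsOpenEmbedding.toOpenPartialHomeomorph_apply, c,
      Prod.map, hab]
    exact congrArg a (e.proj_toFun p hp)
  · intro p
    change ((hc.toOpenPartialHomeomorph c) (e ((hb.toOpenPartialHomeomorph b).symm (b p)))).2 = _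
    rw [hb.toOpenPartialHomeomorph_left_inv]
    rfl

section sum

variable {n : ℕ} {H : Type*} [TopologicalSpace H]
  {I : ModelWithCorners ℝ (EuclideanSpace ℝ (Fin n)) H}
  {M M' : Type v} [TopologicalSpace M] [ChartedSpace H M]
  [TopologicalSpace M'] [ChartedSpace H M']

theorem isLocalDiffeomorph_inl :
    IsLocalDiffeomorph I I ∞ (Sum.inl : M → M ⊕ M') := fun x =>
  ⟨{ toFun := Sum.inl
     invFun := Sum.elim id fun _ => x
     source := univ
     target := range Sum.inl
     map_source' := fun y _ => ⟨y, rfl⟩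
     map_target' := fun _ _ => trivial
     left_inv' := fun _ _ => rfl
     right_inv' := by rintro _ ⟨y, rfl⟩; rfl
     open_source := isOpen_univ
     open_target := isOpen_range_inl
     contMDiffOn_toFun := ContMDiff.inl.contMDiffOn
     contMDiffOn_invFun := (contMDiff_id.sumElim contMDiff_const).contMDiffOn },
   trivial, fun _ _ => rfl⟩

theorem isLocalDiffeomorph_inr :
    IsLocalDiffeomorph I I ∞ (Sum.inr : M' → M ⊕ M') := fun x =>
  ⟨{ toFun := Sum.inr
     invFun := Sum.elim (fun _ => x) id
     source := univ
     target := range Sum.inr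
     map_source' := fun y _ => ⟨y, rfl⟩
     map_target' := fun _ _ => trivial
     left_inv' := fun _ _ => rfl
     right_inv' := by rintro _ ⟨y, rfl⟩; rfl
     open_source := isOpen_univ
     open_target := isOpen_range_inr
     contMDiffOn_toFun := ContMDiff.inr.contMDiffOn
     contMDiffOn_invFun := (contMDiff_const.sumElim contMDiff_id).contMDiffOn },
   trivial, fun _ _ => rfl⟩

variable [IsManifold I ∞ M] [IsManifold I ∞ M']

/-- The Pin⁺ structure `φ ⊔ φ'` on the disjoint union `M ⊔ M'`. -/
def sum (φ : PinStructure.{u} I M) (φ' : PinStructure.{u} I M') :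
    PinStructure.{u} I (M ⊕ M') where
  P := φ.P ⊕ φ'.P
  act p g := Sum.map (φ.act · g) (φ'.act · g) p
  act_one := by rintro (p | p) <;> simp [φ.act_one, φ'.act_one]
  act_mul := by rintro (p | p) <;> simp [φ.act_mul, φ'.act_mul]
  continuous_act := by
    have h : Continuous ((fun x : (φ.P × PinPlus n) ⊕ (φ'.P × PinPlus n) =>
        Sum.map (fun y : φ.P × PinPlus n => φ.act y.1 y.2)
          (fun y : φ'.P × PinPlus n => φ'.act y.1 y.2) x) ∘
        (Homeomorph.sumProdDistrib (X := φ.P) (Y := φ'.P) (Z := PinPlus n))) :=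
      (φ.continuous_act.sumMap φ'.continuous_act).comp (Homeomorph.continuous _)
    refine h.congr ?_
    rintro ⟨p | p, g⟩ <;> rfl
  frame := Sum.elim (fun p => (φ.frame p).map isLocalDiffeomorph_inl)
    (fun p => (φ'.frame p).map isLocalDiffeomorph_inr)
  continuous_frame := by
    have h : Continuous ((Sum.elim
        (fun y : φ.P × EuclideanSpace ℝ (Fin n) =>
          tangentMap I I (Sum.inl : M → M ⊕ M') ((φ.frame y.1).vec y.2))
        (fun y : φ'.P × EuclideanSpace ℝ (Fin n) =>
          tangentMap I I (Sum.inr : M' → M ⊕ M') ((φ'.frame y.1).vec y.2))) ∘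
        (Homeomorph.sumProdDistrib (X := φ.P) (Y := φ'.P) (Z := EuclideanSpace ℝ (Fin n)))) := by
      refine Continuous.comp (Continuous.sumElim ?_ ?_) (Homeomorph.continuous _)
      · exact ((ContMDiff.inl (n := ∞)).continuous_tangentMap (by simp)).comp φ.continuous_frame
      · exact ((ContMDiff.inr (n := ∞)).continuous_tangentMap (by simp)).comp φ'.continuous_frame
    refine h.congr ?_
    rintro ⟨p | p, g⟩ <;> rfl
  frame_act := by
    rintro (p | p) g v
    · exact congrArg (tangentMap I I (Sum.inl : M → M ⊕ M')) (φ.frame_act p g v)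
    · exact congrArg (tangentMap I I (Sum.inr : M' → M ⊕ M')) (φ'.frame_act p g v)
  locally_trivial := by
    rintro (x | x)
    · obtain ⟨e, hx, he⟩ := φ.locally_trivial x
      obtain ⟨e', hx', hs, he'⟩ := exists_trivialization_push
        (π' := fun p : φ.P ⊕ φ'.P => (Sum.elim
          (fun p => (φ.frame p).map isLocalDiffeomorph_inl)
          (fun p => (φ'.frame p).map isLocalDiffeomorph_inr) p :
            TangentFrame I (M ⊕ M')).base)
        IsOpenEmbedding.inl (IsOpenEmbedding.inl (X := φ.P) (Y := φ'.P)) (fun p => rfl)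
        (by
          rintro (p | p) ⟨y, hy⟩
          · exact ⟨p, rfl⟩
          · exact absurd hy Sum.inl_ne_inr) e x hx
      refine ⟨e', hx', ?_⟩
      intro p hp g
      rw [hs] at hp
      obtain ⟨p, hp, rfl⟩ := hp
      rw [he', ← he p hp g]
      exact he' _
    · obtain ⟨e, hx, he⟩ := φ'.locally_trivial x
      obtain ⟨e', hx', hs, he'⟩ := exists_trivialization_push
        (π' := fun p : φ.P ⊕ φ'.P => (Sum.elim
          (fun p => (φ.frame p).map isLocalDiffeomorph_inl)
          (fun p => (φ'.frame p).map isLocalDiffeomorph_inr) p :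
            TangentFrame I (M ⊕ M')).base)
        IsOpenEmbedding.inr (IsOpenEmbedding.inr (X := φ.P) (Y := φ'.P)) (fun p => rfl)
        (by
          rintro (p | p) ⟨y, hy⟩
          · exact absurd hy Sum.inr_ne_inl
          · exact ⟨p, rfl⟩) e x hx
      refine ⟨e', hx', ?_⟩
      intro p hp g
      rw [hs] at hp
      obtain ⟨p, hp, rfl⟩ := hp
      rw [he', ← he p hp g]
      exact he' _

end sum

end PinStructure

/-! ### Pin⁺ bordism -/

/-- The tangent vector `v` at the boundary point `y` of `W` points out of `W`: its first coordinate
is negative in a chart to the half space `x₀ ≥ 0`. -/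
def PointsOutward {n : ℕ} {W : Type*} [TopologicalSpace W]
    [ChartedSpace (EuclideanHalfSpace (n + 1)) W] {y : W}
    (v : TangentSpace (𝓡∂ (n + 1)) y) : Prop :=
  let w : EuclideanSpace ℝ (Fin (n + 1)) :=
    mfderiv (𝓡∂ (n + 1)) 𝓘(ℝ, EuclideanSpace ℝ (Fin (n + 1))) (extChartAt (𝓡∂ (n + 1)) y) y v
  w 0 < 0

/-- `φ` is the Pin⁺ structure induced by `Ψ` on the boundary part `j : N → W`, where `TW` is
identified with `TN ⊕ ℝ` along `N` by means of the vector field `ν` along `j`. -/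
def PinStructure.IsBoundaryOf {n : ℕ} {N W : Type*}
    [TopologicalSpace N] [ChartedSpace (EuclideanSpace ℝ (Fin n)) N] [IsManifold (𝓡 n) ∞ N]
    [TopologicalSpace W] [ChartedSpace (EuclideanHalfSpace (n + 1)) W]
    [IsManifold (𝓡∂ (n + 1)) ∞ W]
    (φ : PinStructure (𝓡 n) N) (Ψ : PinStructure (𝓡∂ (n + 1)) W) (j : N → W)
    (ν : ∀ x : N, TangentSpace (𝓡∂ (n + 1)) (j x)) : Prop :=
  φ.LiftsAlong Ψ (pinIncl n) fun p w =>
    ⟨j (φ.frame p).base,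
      mfderiv (𝓡 n) (𝓡∂ (n + 1)) j (φ.frame p).base
        ((φ.frame p).iso (WithLp.toLp 2 (Fin.init (α := fun _ => ℝ) w.ofLp))) +
      w (Fin.last n) • ν (φ.frame p).base⟩

/-- A Pin⁺ bordism from `(N, φ)` to `(N', φ')`: a compact Pin⁺ manifold `W` of dimension `n + 1` whose
boundary is `N ⊔ N'`, inducing `φ` on `N` by means of an outward normal and `φ'` on `N'` by means of
an inward normal, so that `∂W = (N, φ) ⊔ -(N', φ')`. -/
structure PinBordism {n : ℕ} {N N' : Type u}
    [TopologicalSpace N] [ChartedSpace (EuclideanSpace ℝ (Fin n)) N] [IsManifold (𝓡 n) ∞ N]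
    [TopologicalSpace N'] [ChartedSpace (EuclideanSpace ℝ (Fin n)) N'] [IsManifold (𝓡 n) ∞ N']
    (φ : PinStructure.{u} (𝓡 n) N) (φ' : PinStructure.{u} (𝓡 n) N') where
  W : Type u
  [topW : TopologicalSpace W]
  [chartedW : ChartedSpace (EuclideanHalfSpace (n + 1)) W]
  [manifoldW : IsManifold (𝓡∂ (n + 1)) ∞ W]
  [compactW : CompactSpace W]
  [t2W : T2Space W]
  pin : PinStructure.{u} (𝓡∂ (n + 1)) W
  incl : N → W
  incl' : N' → W
  isSmoothEmbedding : IsSmoothEmbedding (𝓡 n) (𝓡∂ (n + 1)) ∞ incl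
  isSmoothEmbedding' : IsSmoothEmbedding (𝓡 n) (𝓡∂ (n + 1)) ∞ incl'
  disjoint : Disjoint (range incl) (range incl')
  boundary_eq : range incl ∪ range incl' = (𝓡∂ (n + 1)).boundary W
  normal : ∀ x, TangentSpace (𝓡∂ (n + 1)) (incl x)
  normal' : ∀ x, TangentSpace (𝓡∂ (n + 1)) (incl' x)
  continuous_normal :
    Continuous fun x => (⟨incl x, normal x⟩ : TangentBundle (𝓡∂ (n + 1)) W)
  continuous_normal' :
    Continuous fun x => (⟨incl' x, normal' x⟩ : TangentBundle (𝓡∂ (n + 1)) W)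
  outward : ∀ x, PointsOutward (normal x)
  inward : ∀ x, PointsOutward (-normal' x)
  isBoundary : φ.IsBoundaryOf pin incl normal
  isBoundary' : φ'.IsBoundaryOf pin incl' normal'

/-- `(N, φ)` and `(N', φ')` are Pin⁺-bordant. -/
def PinBordant {n : ℕ} {N N' : Type u}
    [TopologicalSpace N] [ChartedSpace (EuclideanSpace ℝ (Fin n)) N] [IsManifold (𝓡 n) ∞ N]
    [TopologicalSpace N'] [ChartedSpace (EuclideanSpace ℝ (Fin n)) N'] [IsManifold (𝓡 n) ∞ N']
    (φ : PinStructure.{u} (𝓡 n) N) (φ' : PinStructure.{u} (𝓡 n) N') : Prop :=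
  Nonempty (PinBordism φ φ')

/-- The Pin⁺ structure `Φ` on the sum of `M₁` and `M₂` along tubes agrees with `φ₁` on
`M₁ ∖ i₁(core)` and with `φ₂` on `M₂ ∖ i₂(core)`; here `θ₁`, `θ₂` are the restrictions of `φ₁`, `φ₂`
to these open submanifolds. -/
def PinStructure.IsGluedFrom {n : ℕ} {E : Type*} [TopologicalSpace E]
    [ChartedSpace (EuclideanSpace ℝ (Fin n)) E] {M₁ M₂ : Type u}
    [TopologicalSpace M₁] [ChartedSpace (EuclideanSpace ℝ (Fin n)) M₁] [T2Space M₁]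
    [IsManifold (𝓡 n) ∞ M₁]
    [TopologicalSpace M₂] [ChartedSpace (EuclideanSpace ℝ (Fin n)) M₂] [T2Space M₂]
    [IsManifold (𝓡 n) ∞ M₂]
    {K : CollarModel n E} {i₁ : OpenTube n E M₁} {i₂ : OpenTube n E M₂}
    (Φ : PinStructure.{u} (𝓡 n) (TubeSum K i₁ i₂))
    (φ₁ : PinStructure.{u} (𝓡 n) M₁) (φ₂ : PinStructure.{u} (𝓡 n) M₂) : Prop :=
  (∃ θ₁ : PinStructure.{u} (𝓡 n) (K.compl i₁),
    θ₁.Preserves φ₁ (Subtype.val : K.compl i₁ → M₁) ∧ θ₁.Preserves Φ TubeSum.inl) ∧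
  (∃ θ₂ : PinStructure.{u} (𝓡 n) (K.compl i₂),
    θ₂.Preserves φ₂ (Subtype.val : K.compl i₂ → M₂) ∧ θ₂.Preserves Φ TubeSum.inr)

end

/-!
Both sums are formed along a tube `E` with flat coordinates `ℝⁿ → E`: the identity for a disc, the
universal covering for `ℝ³ ×~ S¹`, whose deck transformations are affine with orthogonal linear
part. The inversion of the tube is `x ↦ x / ‖X‖²` in the radial coordinates `X` of `x` only, and
`E` minus its core is the quotient of `{X ≠ 0}` by the deck transformations.

*Flat sections.* Over `ℝⁿ` a Pin⁺ structure has a section whose frames have triangular matrices with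
positive diagonal (`PinStructure.exists_triSection`). By Gram–Schmidt and the surjectivity of
`ρ : Pin⁺(n) → O(n)`, the points of the principal bundle with such frames form a covering of `ℝⁿ`
with group `ker ρ = {1, -1}`, and `ℝⁿ` is simply connected. Triangular matrices form a convex set,
so they are homotopic to the identity, and uniqueness of lifts shows that a deck transformation
changes the section by a fixed element `c` of the Pin group (`exists_act_twistShift`). If `i₁`
preserves and `i₂` reverses the structure of the tube, the images of this section in `M₁` and `M₂`
are sections `σ₁`, `σ₂` that change by `c` and by `α(c)`, where `α` is the grading involution
(`PinStructure.LiftsAlong.exists_flatSection`). The result is a `FlatTube`. For the disc there are no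
deck transformations, and nothing has to be assumed about the two structures.

*The sign.* The differential of the inversion at `x` is the reflection in the hyperplane orthogonal
to `X`, followed by a positive radial stretching (`RadProj.fderiv_inversion`). The reflection is
`ρ(u)` for the unit vector `u(X) = X / ‖X‖` of the Pin group, called `pinDir X`. Identify the point
`σ₁(x)` of the first bundle with `σ₂(x / ‖X‖²) u(X)` in the second. Since
`u(ρ(c) X) = α(c) u(X) c⁻¹` (`pinDir_pinRho`), a deck transformation multiplies both of
these by the same element exactly because the second section changes by `α(c)`. This is where the
reversing hypothesis on `i₂` enters. The frames of the identified points differ by matrices with a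
canonical homotopy to the identity, `gluingMatrix`. Running it up to a cutoff time that depends on
`‖X‖²` produces a Pin⁺ structure on the sum, equivalent to the given ones on the two pieces
(`PinGluing.glued`, `FlatTube.isGluedFrom`).

*The bordism.* Take the cylinders `Mᵢ × [0, 2]`, write `y` for the height and `r² = ‖X‖² + y²`, and
remove from each the set `2 r² ≤ y`, a closed ball (or bundle of balls) resting on the core at height
`0`. Identify the parts `y < 2`, `y < 2 r²` of the remaining tubes by the inversion
`(x, y) ↦ (x, y) / r²`. It exchanges the bounding spheres `y = 2 r²` with the planes `y = 2`, so the
result `FlatTube.W` is Hausdorff, and it is compact because the parts `r ≥ 1` of the two pieces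
cover it. At `y = 0` the identification is the one that defines the sum, while the top level `y = 2`
is untouched; hence the boundary of `W` is the sum at the bottom and `M₁ ⊔ M₂` at the top. The
identification is again an inversion, with `y` as one more radial coordinate, so the same gluing of
Pin⁺ structures applies to the cylinders. At `y = 0` its matrices are those of the sum extended by a
positive factor in the direction of `y` (`FlatTube.Λ_bottom`), so the two structures agree on the
boundary (`FlatTube.pinBordant`).
-/

noncomputable section

set_option linter.unusedSectionVars false

/-! ### The topological group `Pin⁺(n)` and its action on `ℝⁿ` -/

section PinGroup

variable {n : ℕ}

instance finite_cliff (n : ℕ) : Module.Finite ℝ (Cliff n) :=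
  have : Module.Finite ℝ (ExteriorAlgebra ℝ (EuclideanSpace ℝ (Fin n))) :=
    Module.Finite.of_basis (Module.finBasis ℝ (EuclideanSpace ℝ (Fin n))).ExteriorAlgebra
  Module.Finite.equiv (CliffordAlgebra.equivExterior (euclForm n)).symm

instance nontrivial_cliff (n : ℕ) : Nontrivial (Cliff n) :=
  (CliffordAlgebra.equivExterior (euclForm n)).toEquiv.nontrivial

/-- The canonical topology of the finite-dimensional vector space `Cliff n`. -/
@[reducible] def cliffTopology (n : ℕ) : TopologicalSpace (Cliff n) := moduleTopology ℝ (Cliff n)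

section cliffTop
attribute [local instance] cliffTopology

theorem isModuleTopology_cliff (n : ℕ) : IsModuleTopology ℝ (Cliff n) := ⟨rfl⟩
attribute [local instance] isModuleTopology_cliff

theorem isTopologicalAddGroup_cliff (n : ℕ) : IsTopologicalAddGroup (Cliff n) :=
  IsModuleTopology.topologicalAddGroup ℝ (Cliff n)
attribute [local instance] isTopologicalAddGroup_cliff

theorem continuousSMul_cliff (n : ℕ) : ContinuousSMul ℝ (Cliff n) :=
  IsModuleTopology.toContinuousSMul ℝ (Cliff n)
attribute [local instance] continuousSMul_cliff

theorem t2Space_cliff (n : ℕ) : T2Space (Cliff n) := by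
  let b := Module.finBasis ℝ (Cliff n)
  have h : Continuous b.equivFun := IsModuleTopology.continuous_of_linearMap b.equivFun.toLinearMap
  exact T2Space.of_injective_continuous b.equivFun.injective h
attribute [local instance] t2Space_cliff

theorem continuous_linearMap_cliff {F : Type*} [AddCommGroup F] [Module ℝ F] [TopologicalSpace F]
    [ContinuousAdd F] [ContinuousSMul ℝ F] (f : Cliff n →ₗ[ℝ] F) : Continuous f :=
  IsModuleTopology.continuous_of_linearMap f

theorem isInducing_pin_coe :
    IsInducing fun g : PinPlus n => ((g : (Cliff n)ˣ) : Cliff n) := ⟨rfl⟩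

theorem injective_pin_coe :
    Function.Injective fun g : PinPlus n => ((g : (Cliff n)ˣ) : Cliff n) :=
  fun _ _ h => Subtype.ext (Units.ext h)

theorem inner_eq_euclForm (v : EuclideanSpace ℝ (Fin n)) : euclForm n v = ‖v‖ ^ 2 := by
  simp [LinearMap.BilinMap.toQuadraticMap_apply, innerₗ_apply_apply]

theorem pin_ι_mul_ι (v w : EuclideanSpace ℝ (Fin n)) :
    CliffordAlgebra.ι (euclForm n) v * CliffordAlgebra.ι (euclForm n) w +
      CliffordAlgebra.ι (euclForm n) w * CliffordAlgebra.ι (euclForm n) v =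
    algebraMap ℝ (Cliff n) (2 * inner ℝ v w) := by
  rw [CliffordAlgebra.ι_mul_ι_add_swap]
  congr 1
  simp only [QuadraticMap.polar, inner_eq_euclForm]
  rw [norm_add_sq_real]; ring

theorem pin_ι_sq {v : EuclideanSpace ℝ (Fin n)} (hv : ‖v‖ = 1) :
    CliffordAlgebra.ι (euclForm n) v * CliffordAlgebra.ι (euclForm n) v = 1 := by
  rw [CliffordAlgebra.ι_sq_scalar, inner_eq_euclForm, hv]; simp

/-- The element of `Pin⁺(n)` given by a unit vector. -/
def pinVec (v : EuclideanSpace ℝ (Fin n)) (hv : ‖v‖ = 1) : PinPlus n :=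
  ⟨⟨CliffordAlgebra.ι (euclForm n) v, CliffordAlgebra.ι (euclForm n) v, pin_ι_sq hv, pin_ι_sq hv⟩,
    Subgroup.subset_closure ⟨v, hv, rfl⟩⟩

theorem pin_induction {C : PinPlus n → Prop} (h1 : C 1) (hv : ∀ v hv, C (pinVec v hv))
    (hmul : ∀ g h, C g → C h → C (g * h)) (hinv : ∀ g, C g → C g⁻¹) (g : PinPlus n) : C g := by
  obtain ⟨g, hg⟩ := g
  induction hg using Subgroup.closure_induction with
  | mem x hx =>
    obtain ⟨v, hv', h⟩ := hx
    have : (⟨x, Subgroup.subset_closure ⟨v, hv', h⟩⟩ : PinPlus n) = pinVec v hv' :=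
      injective_pin_coe h
    rw [this]; exact hv v hv'
  | one => exact h1
  | mul x y hx hy hx' hy' => exact hmul _ _ hx' hy'
  | inv x hx hx' => exact hinv _ hx'

theorem reverse_pin (g : PinPlus n) :
    CliffordAlgebra.reverse ((g : (Cliff n)ˣ) : Cliff n) = ((g⁻¹ : PinPlus n) : (Cliff n)ˣ) := by
  induction g using pin_induction with
  | h1 => simp
  | hv v hv => exact CliffordAlgebra.reverse_ι v
  | hmul g h hg hh => simp [CliffordAlgebra.reverse.map_mul, hg, hh]
  | hinv g hg => rw [_root_.inv_inv, ← hg, CliffordAlgebra.reverse_reverse]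

instance isTopologicalGroup_pinPlus : IsTopologicalGroup (PinPlus n) where
  continuous_mul := by
    rw [isInducing_pin_coe.continuous_iff]
    have h := IsModuleTopology.continuous_mul_of_finite ℝ (Cliff n)
    exact h.comp ((isInducing_pin_coe.continuous.comp continuous_fst).prodMk
      (isInducing_pin_coe.continuous.comp continuous_snd))
  continuous_inv := by
    rw [isInducing_pin_coe.continuous_iff]
    refine ((continuous_linearMap_cliff (CliffordAlgebra.reverse (Q := euclForm n))).comp
      isInducing_pin_coe.continuous).congr fun g => reverse_pin g

theorem ι_injective_euclForm : Function.Injective (CliffordAlgebra.ι (euclForm n)) :=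
  fun v w h => by rw [← vecPart_ι n v, h, vecPart_ι]

theorem pinRho_mul (g h : PinPlus n) (v : EuclideanSpace ℝ (Fin n)) :
    pinRho (g * h) v = pinRho g (pinRho h v) := by
  apply ι_injective_euclForm
  simp only [ι_pinRho, Subgroup.coe_mul, Units.val_mul, map_mul, mul_inv_rev, mul_assoc]

@[simp] theorem pinRho_one (v : EuclideanSpace ℝ (Fin n)) : pinRho (1 : PinPlus n) v = v := by
  apply ι_injective_euclForm
  simp [ι_pinRho]

@[simp] theorem pinRho_inv_pinRho (g : PinPlus n) (v : EuclideanSpace ℝ (Fin n)) :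
    pinRho g⁻¹ (pinRho g v) = v := by
  rw [← pinRho_mul, inv_mul_cancel, pinRho_one]

@[simp] theorem pinRho_pinRho_inv (g : PinPlus n) (v : EuclideanSpace ℝ (Fin n)) :
    pinRho g (pinRho g⁻¹ v) = v := by
  rw [← pinRho_mul, mul_inv_cancel, pinRho_one]

theorem pinRho_pinVec (v : EuclideanSpace ℝ (Fin n)) (hv : ‖v‖ = 1)
    (w : EuclideanSpace ℝ (Fin n)) : pinRho (pinVec v hv) w = w - (2 * inner ℝ v w) • v := by
  apply ι_injective_euclForm
  rw [ι_pinRho]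
  have h : ((pinVec v hv : (Cliff n)ˣ) : Cliff n) = CliffordAlgebra.ι (euclForm n) v := rfl
  have h' : (((pinVec v hv : (Cliff n)ˣ)⁻¹ : (Cliff n)ˣ) : Cliff n) =
      CliffordAlgebra.ι (euclForm n) v := rfl
  rw [h, h', CliffordAlgebra.involute_ι, neg_mul, eq_sub_of_add_eq (pin_ι_mul_ι v w),
    neg_mul, sub_mul, mul_assoc, pin_ι_sq hv, mul_one, neg_sub, map_sub, map_smul,
    Algebra.smul_def]

theorem inner_pinRho (g : PinPlus n) (v w : EuclideanSpace ℝ (Fin n)) :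
    inner ℝ (pinRho g v) (pinRho g w) = inner ℝ v w := by
  induction g using pin_induction generalizing v w with
  | h1 => simp
  | hv u hu =>
    simp only [pinRho_pinVec, inner_sub_left, inner_sub_right, inner_smul_left, inner_smul_right,
      real_inner_self_eq_norm_sq, hu, real_inner_comm u v]
    simp; ring
  | hmul g h hg hh => rw [pinRho_mul, pinRho_mul, hg, hh]
  | hinv g hg => rw [← hg, pinRho_pinRho_inv, pinRho_pinRho_inv]

theorem norm_pinRho (g : PinPlus n) (v : EuclideanSpace ℝ (Fin n)) : ‖pinRho g v‖ = ‖v‖ := by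
  rw [← sq_eq_sq₀ (norm_nonneg _) (norm_nonneg _), ← real_inner_self_eq_norm_sq, inner_pinRho,
    real_inner_self_eq_norm_sq]

theorem pinRho_injective (g : PinPlus n) : Function.Injective (pinRho g) :=
  fun v w h => by rw [← pinRho_inv_pinRho g v, h, pinRho_inv_pinRho]

theorem continuous_pinRho :
    Continuous fun x : PinPlus n × EuclideanSpace ℝ (Fin n) => pinRho x.1 x.2 := by
  have hm := IsModuleTopology.continuous_mul_of_finite ℝ (Cliff n)
  have hg : Continuous fun x : PinPlus n × EuclideanSpace ℝ (Fin n) =>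
      ((x.1 : (Cliff n)ˣ) : Cliff n) := isInducing_pin_coe.continuous.comp continuous_fst
  have hg' : Continuous fun x : PinPlus n × EuclideanSpace ℝ (Fin n) =>
      (((x.1⁻¹ : PinPlus n) : (Cliff n)ˣ) : Cliff n) :=
    isInducing_pin_coe.continuous.comp (continuous_inv.comp continuous_fst)
  have hι : Continuous (CliffordAlgebra.ι (euclForm n)) :=
    LinearMap.continuous_of_finiteDimensional _
  have hi : Continuous (CliffordAlgebra.involute (Q := euclForm n)) :=
    continuous_linearMap_cliff (CliffordAlgebra.involute (Q := euclForm n)).toLinearMap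
  exact (continuous_linearMap_cliff (vecPart n)).comp
    (hm.comp ((hi.comp hg).prodMk (hm.comp ((hι.comp continuous_snd).prodMk hg'))))

theorem continuous_pinMap {m : ℕ} (f : Cliff m →ₐ[ℝ] Cliff n) (hf) : Continuous (pinMap f hf) := by
  rw [isInducing_pin_coe.continuous_iff]
  exact (continuous_linearMap_cliff f.toLinearMap).comp isInducing_pin_coe.continuous

theorem continuous_pinIncl : Continuous (pinIncl n) := continuous_pinMap _ _

theorem pinVec_pinRho (g : PinPlus n) (v : EuclideanSpace ℝ (Fin n)) (hv : ‖v‖ = 1) :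
    pinVec (pinRho g v) ((norm_pinRho g v).trans hv) = pinGrading n g * pinVec v hv * g⁻¹ :=
  injective_pin_coe (ι_pinRho g v)

/-- The grading involution changes elements of `Pin⁺` by a sign. -/
theorem coe_pinGrading_eq_or (g : PinPlus n) :
    ((pinGrading n g : (Cliff n)ˣ) : Cliff n) = ((g : (Cliff n)ˣ) : Cliff n) ∨
    ((pinGrading n g : (Cliff n)ˣ) : Cliff n) = -((g : (Cliff n)ˣ) : Cliff n) := by
  induction g using pin_induction with
  | h1 => simp
  | hv v hv => right; exact CliffordAlgebra.involute_ι v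
  | hmul g h hg hh => rcases hg with hg | hg <;> rcases hh with hh | hh <;> simp [hg, hh]
  | hinv g hg =>
    have key : pinGrading n g⁻¹ = (pinGrading n g)⁻¹ := map_inv _ _
    rcases hg with hg | hg
    · have : pinGrading n g = g := injective_pin_coe hg
      rw [key, this]; simp
    · right
      have : ((pinGrading n g : PinPlus n) : (Cliff n)ˣ) = -(g : (Cliff n)ˣ) := Units.ext hg
      rw [key, Subgroup.coe_inv, this, inv_neg]; simp

@[simp] theorem pinRho_pinGrading (g : PinPlus n) (v : EuclideanSpace ℝ (Fin n)) :
    pinRho (pinGrading n g) v = pinRho g v := by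
  apply ι_injective_euclForm
  rw [ι_pinRho, ι_pinRho]
  rcases coe_pinGrading_eq_or g with h | h
  · rw [show pinGrading n g = g from injective_pin_coe h]
  · have : ((pinGrading n g : PinPlus n) : (Cliff n)ˣ) = -(g : (Cliff n)ˣ) := Units.ext h
    rw [this, inv_neg]; simp

/-- The element of `Pin⁺(n)` given by the direction of `w` (and `1` for `w = 0`). -/
def pinDir (w : EuclideanSpace ℝ (Fin n)) : PinPlus n :=
  if h : w = 0 then 1 else pinVec (‖w‖⁻¹ • w) (norm_smul_inv_norm h)

theorem pinDir_of_ne {w : EuclideanSpace ℝ (Fin n)} (h : w ≠ 0) :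
    pinDir w = pinVec (‖w‖⁻¹ • w) (norm_smul_inv_norm h) := dif_neg h

theorem pinDir_mul_self (w : EuclideanSpace ℝ (Fin n)) : pinDir w * pinDir w = 1 := by
  by_cases h : w = 0
  · simp [pinDir, h]
  · rw [pinDir_of_ne h]; exact injective_pin_coe (pin_ι_sq (norm_smul_inv_norm h))

/-- How the Pin group moves the element attached to a direction. The grading involution on the left
is the reason why one of the two tubes has to reverse the Pin⁺ structure. -/
theorem pinDir_pinRho (g : PinPlus n) {w : EuclideanSpace ℝ (Fin n)} (h : w ≠ 0) :
    pinDir (pinRho g w) = pinGrading n g * pinDir w * g⁻¹ := by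
  have h' : pinRho g w ≠ 0 := fun h0 => h (pinRho_injective g (h0.trans (map_zero _).symm))
  rw [pinDir_of_ne h, pinDir_of_ne h', ← pinVec_pinRho]
  apply injective_pin_coe
  change CliffordAlgebra.ι (euclForm n) _ = CliffordAlgebra.ι (euclForm n) _
  rw [norm_pinRho, map_smul (pinRho g)]

theorem pinRho_pinDir {w : EuclideanSpace ℝ (Fin n)} (h : w ≠ 0) (v : EuclideanSpace ℝ (Fin n)) :
    pinRho (pinDir w) v = v - (2 * inner ℝ w v / ‖w‖ ^ 2) • w := by
  rw [pinDir_of_ne h, pinRho_pinVec, inner_smul_left, smul_smul]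
  congr 2
  have : ‖w‖ ≠ 0 := norm_ne_zero_iff.2 h
  simp; field_simp

theorem continuousOn_pinDir : ContinuousOn (pinDir (n := n)) {0}ᶜ := by
  rw [isInducing_pin_coe.continuousOn_iff]
  have h : ContinuousOn (fun w : EuclideanSpace ℝ (Fin n) =>
      CliffordAlgebra.ι (euclForm n) (‖w‖⁻¹ • w)) {0}ᶜ := by
    refine (LinearMap.continuous_of_finiteDimensional
      (CliffordAlgebra.ι (euclForm n))).comp_continuousOn ?_
    exact (continuous_norm.continuousOn.inv₀ fun w hw => norm_ne_zero_iff.2 hw).smul continuousOn_id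
  refine h.congr fun w hw => ?_
  simp only [Function.comp, pinDir_of_ne (show w ≠ 0 from hw)]
  rfl

theorem pinIncl_pinVec (v : EuclideanSpace ℝ (Fin n)) (hv : ‖v‖ = 1) :
    pinIncl n (pinVec v hv) = pinVec (euclIncl n v) ((norm_euclIncl v).trans hv) := by
  apply injective_pin_coe
  exact CliffordAlgebra.map_apply_ι _ _

theorem pinIncl_pinDir (w : EuclideanSpace ℝ (Fin n)) :
    pinIncl n (pinDir w) = pinDir (euclIncl n w) := by
  by_cases h : w = 0
  · simp [pinDir, h]
  · have h' : euclIncl n w ≠ 0 := by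
      rw [← norm_ne_zero_iff, norm_euclIncl]; exact norm_ne_zero_iff.2 h
    rw [pinDir_of_ne h, pinDir_of_ne h', pinIncl_pinVec]
    congr 1
    rw [norm_euclIncl, map_smul]

theorem pinIncl_pinGrading (g : PinPlus n) :
    pinIncl n (pinGrading n g) = pinGrading (n + 1) (pinIncl n g) := by
  induction g using pin_induction with
  | h1 => simp
  | hv v hv =>
    apply injective_pin_coe
    change CliffordAlgebra.map _ (CliffordAlgebra.involute (CliffordAlgebra.ι (euclForm n) v)) =
      CliffordAlgebra.involute (CliffordAlgebra.map _ (CliffordAlgebra.ι (euclForm n) v))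
    simp
  | hmul g h hg hh => simp [hg, hh]
  | hinv g hg => simp [hg]

/-- The vector `(v, c)` of `ℝⁿ⁺¹`. -/
def euclSnoc (v : EuclideanSpace ℝ (Fin n)) (c : ℝ) : EuclideanSpace ℝ (Fin (n + 1)) :=
  WithLp.toLp 2 (Fin.snoc (α := fun _ => ℝ) v.ofLp c)

/-- The first `n` coordinates of a vector of `ℝⁿ⁺¹`. -/
def euclInit (w : EuclideanSpace ℝ (Fin (n + 1))) : EuclideanSpace ℝ (Fin n) :=
  WithLp.toLp 2 (Fin.init (α := fun _ => ℝ) w.ofLp)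

@[simp] theorem euclInit_euclSnoc (v : EuclideanSpace ℝ (Fin n)) (c : ℝ) :
    euclInit (euclSnoc v c) = v := by simp [euclInit, euclSnoc]

@[simp] theorem euclSnoc_last (v : EuclideanSpace ℝ (Fin n)) (c : ℝ) :
    euclSnoc v c (Fin.last n) = c := by simp [euclSnoc]

@[simp] theorem euclSnoc_castSucc (v : EuclideanSpace ℝ (Fin n)) (c : ℝ) (i : Fin n) :
    euclSnoc v c i.castSucc = v i := by simp [euclSnoc]

@[simp] theorem euclSnoc_euclInit (w : EuclideanSpace ℝ (Fin (n + 1))) :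
    euclSnoc (euclInit w) (w (Fin.last n)) = w := by simp [euclInit, euclSnoc]

theorem euclIncl_eq (v : EuclideanSpace ℝ (Fin n)) : euclIncl n v = euclSnoc v 0 := rfl

theorem euclSnoc_ext {w w' : EuclideanSpace ℝ (Fin (n + 1))} (h : euclInit w = euclInit w')
    (h' : w (Fin.last n) = w' (Fin.last n)) : w = w' := by
  rw [← euclSnoc_euclInit w, h, h', euclSnoc_euclInit]

theorem inner_euclSnoc (v v' : EuclideanSpace ℝ (Fin n)) (c c' : ℝ) :
    inner ℝ (euclSnoc v c) (euclSnoc v' c') = inner ℝ v v' + c * c' := by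
  simp [PiLp.inner_apply, Fin.sum_univ_castSucc, mul_comm]

/-- `Pin⁺(n) → Pin⁺(n + 1)` covers the block inclusion `O(n) → O(n + 1)`. -/
theorem pinRho_pinIncl (g : PinPlus n) (v : EuclideanSpace ℝ (Fin n)) (c : ℝ) :
    pinRho (pinIncl n g) (euclSnoc v c) = euclSnoc (pinRho g v) c := by
  induction g using pin_induction generalizing v with
  | h1 => simp
  | hv u hu =>
    rw [pinIncl_pinVec, pinRho_pinVec, pinRho_pinVec, euclIncl_eq, inner_euclSnoc]
    ext i
    refine Fin.lastCases ?_ (fun i => ?_) i <;> simp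
  | hmul g h hg hh => rw [map_mul, pinRho_mul, pinRho_mul, hh, hg]
  | hinv g hg =>
    apply pinRho_injective (pinIncl n g)
    rw [map_inv, pinRho_pinRho_inv, hg, pinRho_pinRho_inv]

end cliffTop
end PinGroup

/-! ### The kernel and the image of `ρ` -/

section PinKernel

variable {n : ℕ}

section exterior

open CliffordAlgebra

variable {E : Type*} [AddCommGroup E] [Module ℝ E]

/-- The projection of the exterior algebra onto the part without the factor `e`, for a dual pair
`d`, `e`. -/
def dropFactor (d : Module.Dual ℝ E) (e : E) (x : CliffordAlgebra (0 : QuadraticForm ℝ E)) :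
    CliffordAlgebra (0 : QuadraticForm ℝ E) :=
  x - ι 0 e * contractLeft d x

theorem dropFactor_add (d : Module.Dual ℝ E) (e : E) (x y) :
    dropFactor d e (x + y) = dropFactor d e x + dropFactor d e y := by
  simp only [dropFactor, map_add, mul_add]; abel

theorem dropFactor_smul (d : Module.Dual ℝ E) (e : E) (c : ℝ) (x) :
    dropFactor d e (c • x) = c • dropFactor d e x := by
  simp only [dropFactor, map_smul, mul_smul_comm, smul_sub]

theorem dropFactor_ι_mul_self {d : Module.Dual ℝ E} {e : E} (h : d e = 1) (x) :
    dropFactor d e (ι 0 e * x) = 0 := by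
  simp only [dropFactor, contractLeft_ι_mul, h, one_smul, mul_sub, ← mul_assoc, ι_sq_scalar]
  simp

theorem dropFactor_ι_mul {d : Module.Dual ℝ E} {e f : E} (h : d f = 0) (x) :
    dropFactor d e (ι 0 f * x) = ι 0 f * dropFactor d e x := by
  have h' : ι (0 : QuadraticForm ℝ E) e * ι 0 f = -(ι 0 f * ι 0 e) := by
    rw [eq_neg_iff_add_eq_zero, ι_mul_ι_add_swap]; simp [QuadraticMap.polar]
  simp only [dropFactor, contractLeft_ι_mul, h, zero_smul, zero_sub, mul_sub, mul_neg, ← mul_assoc,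
    h', neg_mul, neg_neg]

/-- An element of the exterior algebra that is killed by all contractions is a scalar. -/
theorem eq_algebraMap_of_contractLeft_eq_zero {ι' : Type*} [Fintype ι'] (b : Module.Basis ι' ℝ E)
    (x : CliffordAlgebra (0 : QuadraticForm ℝ E)) (hx : ∀ d : Module.Dual ℝ E, contractLeft d x =
      0) :
    ∃ c : ℝ, x = algebraMap ℝ _ c := by
  classical
  -- `Q l` drops the basis factors of `l` one after the other
  let Q : List ι' → CliffordAlgebra (0 : QuadraticForm ℝ E) → CliffordAlgebra
    (0 : QuadraticForm ℝ E) :=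
    fun l y => l.foldr (fun i z => dropFactor (b.coord i) (b i) z) y
  have hadd : ∀ l y z, Q l (y + z) = Q l y + Q l z := by
    intro l y z
    induction l with
    | nil => rfl
    | cons i l ih =>
      change dropFactor _ _ (Q l (y + z)) = _
      rw [ih, dropFactor_add]; rfl
  have hsmul : ∀ l (c : ℝ) y, Q l (c • y) = c • Q l y := by
    intro l c y
    induction l with
    | nil => rfl
    | cons i l ih =>
      change dropFactor _ _ (Q l (c • y)) = _
      rw [ih, dropFactor_smul]; rfl
  have hzero : ∀ (l : List ι') j y, j ∈ l → Q l (ι 0 (b j) * y) = 0 := by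
    have hmove : ∀ (l : List ι') j y, j ∉ l → Q l (ι 0 (b j) * y) = ι 0 (b j) * Q l y := by
      intro l j y hj
      induction l with
      | nil => rfl
      | cons i l ih =>
        rw [List.mem_cons, not_or] at hj
        change dropFactor _ _ (Q l _) = _
        rw [ih hj.2, dropFactor_ι_mul]
        · rfl
        · simp [hj.1]
    intro l j y hj
    induction l with
    | nil => simp at hj
    | cons i l ih =>
      change dropFactor _ _ (Q l _) = _
      by_cases hjl : j ∈ l
      · rw [ih hjl]; simp [dropFactor]
      · obtain rfl : j = i := by simpa [hjl] using hj
        rw [hmove l j y hjl, dropFactor_ι_mul_self]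
        simp
  have hfix : ∀ l, Q l x = x := by
    intro l
    induction l with
    | nil => rfl
    | cons i l ih =>
      change dropFactor _ _ (Q l _) = _
      rw [ih, dropFactor, hx, mul_zero, sub_zero]
  have hscal : ∀ l (c : ℝ), Q l (algebraMap ℝ _ c) = algebraMap ℝ _ c := by
    intro l c
    induction l with
    | nil => rfl
    | cons i l ih =>
      change dropFactor _ _ (Q l _) = _
      rw [ih, dropFactor, contractLeft_algebraMap, mul_zero, sub_zero]
  rw [← hfix Finset.univ.toList]
  generalize x = z
  induction z using CliffordAlgebra.left_induction with
  | algebraMap c => exact ⟨c, hscal _ _⟩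
  | add y z hy hz =>
    obtain ⟨c, hc⟩ := hy
    obtain ⟨c', hc'⟩ := hz
    exact ⟨c + c', by rw [hadd, hc, hc', map_add]⟩
  | ι_mul y v hy =>
    refine ⟨0, ?_⟩
    have hfin : ∀ s : Finset ι', Q Finset.univ.toList (∑ i ∈ s, b.repr v i • (ι 0 (b i) * y)) =
      0 := by
      intro s
      induction s using Finset.induction_on with
      | empty => simpa using hsmul Finset.univ.toList 0 0
      | insert i s hi ih =>
        rw [Finset.sum_insert hi, hadd, ih, hsmul, hzero _ i _ (by simp)]; simp
    have hv : ι (0 : QuadraticForm ℝ E) v * y = ∑ i, b.repr v i • (ι 0 (b i) * y) := by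
      have := congrArg (fun w => ι (0 : QuadraticForm ℝ E) w * y) (b.sum_repr v).symm
      simpa only [map_sum, map_smul, Finset.sum_mul, smul_mul_assoc] using this
    rw [hv, hfin, map_zero]

end exterior

open CliffordAlgebra in
/-- The twisted commutator of `x` with a vector `v` is twice the contraction of `x` with `v`. -/
theorem ι_mul_eq_involute_mul_ι_add (v : EuclideanSpace ℝ (Fin n)) (x : Cliff n) :
    ι (euclForm n) v * x = involute x * ι (euclForm n) v +
      contractLeft (Q := euclForm n) ((2 : ℝ) • (innerₗ (EuclideanSpace ℝ (Fin n)) v)) x := by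
  induction x using CliffordAlgebra.left_induction with
  | algebraMap c =>
    rw [contractLeft_algebraMap, add_zero, AlgHom.commutes, Algebra.commutes]
  | add x y hx hy => simp only [mul_add, map_add, add_mul, hx, hy]; abel
  | ι_mul x a hx =>
    rw [← mul_assoc, eq_sub_of_add_eq (pin_ι_mul_ι v a), sub_mul, mul_assoc, hx, map_mul
      (involute (Q := euclForm n)),
      involute_ι, contractLeft_ι_mul, mul_add, neg_mul, neg_mul, Algebra.algebraMap_eq_smul_one,
      smul_mul_assoc, one_mul, mul_assoc]
    simp only [LinearMap.smul_apply, innerₗ_apply_apply, smul_eq_mul]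
    abel

/-- The kernel of `ρ` is `{1, -1}`. -/
theorem coe_eq_or_of_pinRho_eq (g : PinPlus n) (h : ∀ v, pinRho g v = v) :
    ((g : (Cliff n)ˣ) : Cliff n) = 1 ∨ ((g : (Cliff n)ˣ) : Cliff n) = -1 := by
  set x : Cliff n := ((g : (Cliff n)ˣ) : Cliff n) with hx
  have h1 : ∀ v, CliffordAlgebra.contractLeft (Q := euclForm n)
      ((2 : ℝ) • (innerₗ (EuclideanSpace ℝ (Fin n)) v)) x = 0 := by
    intro v
    have h2 := ι_pinRho g v
    rw [h v, ← hx] at h2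
    have h3 : CliffordAlgebra.ι (euclForm n) v * x =
        CliffordAlgebra.involute x * CliffordAlgebra.ι (euclForm n) v := by
      conv_lhs => rw [h2]
      rw [mul_assoc, hx, Units.inv_mul, mul_one]
    have h4 := ι_mul_eq_involute_mul_ι_add v x
    rw [h3] at h4
    simpa using h4
  have h2 : ∀ d : Module.Dual ℝ (EuclideanSpace ℝ (Fin n)),
      CliffordAlgebra.contractLeft (Q := euclForm n) d x = 0 := by
    intro d
    have : d = (2 : ℝ) • (innerₗ (EuclideanSpace ℝ (Fin n))
        ((2 : ℝ)⁻¹ • (InnerProductSpace.toDual ℝ (EuclideanSpace ℝ (Fin n))).symm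
          (LinearMap.toContinuousLinearMap d))) := by
      ext v
      simp
    rw [this]; exact h1 _
  have h3 : ∃ c : ℝ, x = algebraMap ℝ _ c := by
    obtain ⟨c, hc⟩ := eq_algebraMap_of_contractLeft_eq_zero
      (Module.finBasis ℝ (EuclideanSpace ℝ (Fin n)))
      (CliffordAlgebra.equivExterior (euclForm n) x) (by
        intro d
        have := CliffordAlgebra.changeForm_contractLeft
          (h := CliffordAlgebra.changeForm.associated_neg_proof (Q := euclForm n)) d x
        rw [h2, map_zero] at this
        exact this.symm)
    refine ⟨c, (CliffordAlgebra.equivExterior (euclForm n)).injective (hc.trans ?_)⟩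
    exact (CliffordAlgebra.changeForm_algebraMap
      (h := CliffordAlgebra.changeForm.associated_neg_proof (Q := euclForm n)) c).symm
  obtain ⟨c, hc⟩ := h3
  have h4 := reverse_pin g
  have h5 : x * CliffordAlgebra.reverse x = 1 := by
    rw [hx, h4, Subgroup.coe_inv, Units.mul_inv]
  rw [hc, CliffordAlgebra.reverse.commutes, ← map_mul] at h5
  have h6 : c * c = 1 := by
    have := (algebraMap ℝ (Cliff n)).injective (h5.trans (map_one (algebraMap ℝ (Cliff n))).symm)
    exact this
  rcases mul_self_eq_one_iff.1 h6 with rfl | rfl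
  · left; rw [hc, map_one]
  · right; rw [hc, map_neg, map_one]

/-- The kernel of `ρ` is discrete. -/
theorem eventually_pinRho_ne (n : ℕ) :
    ∀ᶠ g in 𝓝 (1 : PinPlus n), (∀ v, pinRho g v = v) → g = 1 := by
  let := cliffTopology n
  have := t2Space_cliff n
  have hne : (1 : Cliff n) ≠ -1 := by
    intro h
    have h2 : (2 : ℝ) • (1 : Cliff n) = 0 := by
      rw [two_smul]; nth_rewrite 2 [h]; rw [add_neg_cancel]
    rcases smul_eq_zero.1 h2 with h3 | h3
    · norm_num at h3
    · exact one_ne_zero h3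
  have hc : Tendsto (fun g : PinPlus n => ((g : (Cliff n)ˣ) : Cliff n)) (𝓝 1) (𝓝 1) :=
    isInducing_pin_coe.continuous.continuousAt (x := (1 : PinPlus n))
  filter_upwards [hc.eventually_ne hne] with g hg h
  rcases coe_eq_or_of_pinRho_eq g h with h' | h'
  · exact injective_pin_coe h'
  · exact absurd h' hg

/-- The standard orthonormal basis of `ℝⁿ`. -/
abbrev euclBasis (n : ℕ) : OrthonormalBasis (Fin n) ℝ (EuclideanSpace ℝ (Fin n)) :=
  EuclideanSpace.basisFun (Fin n) ℝ

theorem exists_pinRho_eq_isometry (φ : EuclideanSpace ℝ (Fin n) ≃ₗᵢ[ℝ] EuclideanSpace ℝ (Fin n)) :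
    ∃ g : PinPlus n, ∀ v, φ v = pinRho g v := by
  obtain ⟨l, -, rfl⟩ := φ.reflections_generate_dim
  induction l with
  | nil => exact ⟨1, fun v => by simp⟩
  | cons w l ih =>
    obtain ⟨g, hg⟩ := ih
    refine ⟨pinDir w * g, fun v => ?_⟩
    rw [pinRho_mul, ← hg, List.map_cons, List.prod_cons, LinearIsometryEquiv.coe_mul, Function.comp]
    generalize hv' : (List.map (fun v => (ℝ ∙ v)ᗮ.reflection) l).prod v = v'
    by_cases hw : w = 0
    · subst hw
      have : Submodule.reflection (ℝ ∙ (0 : EuclideanSpace ℝ (Fin n)))ᗮ v' = v' := by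
        rw [Submodule.reflection_eq_self_iff]; simp
      rw [this]; simp [pinDir]
    · rw [Submodule.reflection_orthogonal_apply, pinRho_pinDir hw,
        Submodule.reflection_singleton_apply]
      simp only [two_smul, RCLike.ofReal_real_eq_id, id]
      rw [neg_sub, ← add_smul]; congr 2; ring

/-- `Pin⁺(n)` acts transitively on orthonormal bases. -/
theorem exists_pinRho_eq {o : Fin n → EuclideanSpace ℝ (Fin n)} (ho : Orthonormal ℝ o) :
    ∃ g : PinPlus n, ∀ i, pinRho g (euclBasis n i) = o i := by
  have hs : ⊤ ≤ Submodule.span ℝ (range o) := by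
    rw [ho.linearIndependent.span_eq_top_of_card_eq_finrank' (by simp)]
  obtain ⟨g, hg⟩ := exists_pinRho_eq_isometry ((euclBasis n).equiv (OrthonormalBasis.mk ho hs)
    (.refl _))
  refine ⟨g, fun i => ?_⟩
  rw [← hg, OrthonormalBasis.equiv_apply_basis]; simp

theorem orthonormal_iff_mem_orthogonalGroup (o : Fin n → EuclideanSpace ℝ (Fin n)) :
    Orthonormal ℝ o ↔ (Matrix.of fun i j => o j i) ∈ Matrix.orthogonalGroup (Fin n) ℝ := by
  rw [orthonormal_iff_ite, Matrix.mem_orthogonalGroup_iff', ← Matrix.ext_iff]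
  refine forall₂_congr fun i j => ?_
  simp [Matrix.mul_apply, Matrix.one_apply, PiLp.inner_apply, mul_comm]

theorem orthonormal_pinRho (g : PinPlus n) : Orthonormal ℝ fun i => pinRho g (euclBasis n i) := by
  rw [orthonormal_iff_ite]
  intro i j
  rw [inner_pinRho, (euclBasis n).inner_eq_ite]

theorem euclBasis_sum (v : EuclideanSpace ℝ (Fin n)) : ∑ i, v i • euclBasis n i = v := by
  simpa using (euclBasis n).sum_repr v

theorem continuous_euclCoord (i : Fin n) : Continuous fun v : EuclideanSpace ℝ (Fin n) => v i := by
  fun_prop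

/-- `ρ` as a homomorphism to the orthogonal group. -/
def pinOrth (n : ℕ) : PinPlus n →* Matrix.orthogonalGroup (Fin n) ℝ where
  toFun g := ⟨Matrix.of fun i j => pinRho g (euclBasis n j) i,
    (orthonormal_iff_mem_orthogonalGroup _).1 (orthonormal_pinRho g)⟩
  map_one' := by
    apply Subtype.ext
    ext i j
    simp [Matrix.one_apply]
  map_mul' g h := by
    apply Subtype.ext
    ext i j
    simp only [Matrix.of_apply, Submonoid.coe_mul, Matrix.mul_apply, pinRho_mul]
    conv_lhs => rw [← euclBasis_sum (pinRho h (euclBasis n j))]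
    simp [mul_comm]

theorem pinOrth_apply (g : PinPlus n) (i j : Fin n) :
    (pinOrth n g : Matrix (Fin n) (Fin n) ℝ) i j = pinRho g (euclBasis n j) i := rfl

theorem continuous_pinRho_left (v : EuclideanSpace ℝ (Fin n)) :
    Continuous fun g : PinPlus n => pinRho g v := by
  have h := continuous_pinRho.comp (Continuous.prodMk_left (X := PinPlus n) v)
  exact h

theorem continuous_pinOrth : Continuous (pinOrth n) := by
  refine continuous_induced_rng.2 (continuous_matrix fun i j => ?_)
  have h := (continuous_euclCoord i).comp (continuous_pinRho_left (euclBasis n j))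
  exact h

theorem pinOrth_surjective : Function.Surjective (pinOrth n) := by
  rintro ⟨U, hU⟩
  obtain ⟨g, hg⟩ := exists_pinRho_eq
    ((orthonormal_iff_mem_orthogonalGroup fun j => WithLp.toLp 2 fun i => U i j).2 hU)
  refine ⟨g, Subtype.ext (Matrix.ext fun i j => ?_)⟩
  rw [pinOrth_apply, hg]

/-- The group is the union over `k` of the compact sets of products of at most `k` unit vectors.
This makes the open mapping theorem available for `ρ : Pin⁺(n) → O(n)`. -/
instance sigmaCompactSpace_pinPlus : SigmaCompactSpace (PinPlus n) := by
  let S : Set (PinPlus n) := insert 1 (pinDir '' Metric.sphere 0 1)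
  have hS : IsCompact S := by
    refine IsCompact.insert (IsCompact.image_of_continuousOn (isCompact_sphere _ _) ?_) 1
    exact continuousOn_pinDir.mono fun w hw => by
      have : ‖w‖ = 1 := by simpa using hw
      intro h
      rw [mem_singleton_iff] at h
      simp [h] at this
  have hpow : ∀ k : ℕ, ∃ K : Set (PinPlus n), IsCompact K ∧
      ∀ l : List (PinPlus n), l.length = k → (∀ g ∈ l, g ∈ S) → l.prod ∈ K := by
    intro k
    induction k with
    | zero => exact ⟨{1}, isCompact_singleton, fun l hl _ => by simp [List.length_eq_zero_iff.1 hl]⟩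
    | succ k ih =>
      obtain ⟨K, hK, hl⟩ := ih
      refine ⟨(fun x : PinPlus n × PinPlus n => x.1 * x.2) '' (S ×ˢ K),
        (hS.prod hK).image continuous_mul, ?_⟩
      rintro (_ | ⟨a, l⟩) h1 h2
      · simp at h1
      · refine ⟨(a, l.prod), ⟨h2 a (by simp), hl l (by simpa using h1) fun g hg => h2 g
          (by simp [hg])⟩, ?_⟩
        simp
  choose K hK hKl using hpow
  have hlist : ∀ g : PinPlus n, ∃ l : List (PinPlus n), (∀ h ∈ l, h ∈ S ∧ h⁻¹ ∈ S) ∧ l.prod =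
    g := by
    intro g
    induction g using pin_induction with
    | h1 => exact ⟨[], by simp, rfl⟩
    | hv v hv =>
      have hv0 : v ≠ 0 := fun h => by simp [h] at hv
      have h1 : pinVec v hv = pinDir v := by
        rw [pinDir_of_ne hv0]; congr 1; rw [hv]; simp
      have h2 : pinDir v ∈ S := Or.inr ⟨v, by simpa using hv, rfl⟩
      refine ⟨[pinDir v], ?_, by simp [h1]⟩
      intro h hh
      obtain rfl : h = pinDir v := by simpa using hh
      exact ⟨h2, by rwa [inv_eq_of_mul_eq_one_right (pinDir_mul_self v)]⟩
    | hmul g h hg hh =>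
      obtain ⟨l, hl, rfl⟩ := hg
      obtain ⟨l', hl', rfl⟩ := hh
      refine ⟨l ++ l', ?_, by simp⟩
      intro a ha
      rcases List.mem_append.1 ha with ha | ha
      · exact hl a ha
      · exact hl' a ha
    | hinv g hg =>
      obtain ⟨l, hl, rfl⟩ := hg
      refine ⟨(l.map (·⁻¹)).reverse, ?_, (List.prod_inv_reverse l).symm⟩
      intro a ha
      simp only [List.mem_reverse, List.mem_map] at ha
      obtain ⟨b, hb, rfl⟩ := ha
      exact ⟨(hl b hb).2, by rw [_root_.inv_inv]; exact (hl b hb).1⟩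
  refine SigmaCompactSpace.of_countable (range K) (countable_range K) ?_ ?_
  · rintro _ ⟨k, rfl⟩; exact hK k
  · rw [eq_univ_iff_forall]
    intro g
    obtain ⟨l, hl, rfl⟩ := hlist g
    exact ⟨_, ⟨l.length, rfl⟩, hKl _ l rfl fun h hh => (hl h hh).1⟩

/-- `ρ` is open as a map to the orthogonal group, by the open mapping theorem. -/
theorem isOpenMap_pinOrth : IsOpenMap (pinOrth n) := by
  have : LocallyCompactSpace (Matrix (Fin n) (Fin n) ℝ) :=
    inferInstanceAs (LocallyCompactSpace (Fin n → Fin n → ℝ))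
  have : LocallyCompactSpace (Matrix.orthogonalGroup (Fin n) ℝ) := by
    have h : IsClosed ((unitary (Matrix (Fin n) (Fin n) ℝ) : Set (Matrix (Fin n) (Fin n) ℝ))) :=
      isClosed_unitary
    exact h.isClosedEmbedding_subtypeVal.locallyCompactSpace
  exact MonoidHom.isOpenMap_of_sigmaCompact _ pinOrth_surjective continuous_pinOrth

/-- Orthonormal bases close to the standard basis are images of it under elements of `Pin⁺(n)` close
to `1`. -/
theorem eventually_exists_pinRho_eq {N : Set (PinPlus n)} (hN : N ∈ 𝓝 1) :
    ∀ᶠ o in 𝓝 (fun i => euclBasis n i), Orthonormal ℝ o →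
      ∃ g ∈ N, ∀ i, pinRho g (euclBasis n i) = o i := by
  have h1 : pinOrth n '' N ∈ 𝓝 (1 : Matrix.orthogonalGroup (Fin n) ℝ) := by
    rw [← map_one (pinOrth n)]; exact isOpenMap_pinOrth.image_mem_nhds hN
  rw [nhds_induced, mem_comap] at h1
  obtain ⟨V, hV, hVN⟩ := h1
  have hc : Continuous fun o : Fin n → EuclideanSpace ℝ (Fin n) =>
      (Matrix.of fun i j => o j i : Matrix (Fin n) (Fin n) ℝ) :=
    continuous_matrix fun i j => (continuous_euclCoord i).comp (continuous_apply j)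
  have h2 : (Matrix.of fun i j => euclBasis n j i : Matrix (Fin n) (Fin n) ℝ) = 1 := by
    ext i j; simp [Matrix.one_apply]
  have hVe := hc.continuousAt.preimage_mem_nhds (t := V) (x := fun i => euclBasis n i)
    (by rw [h2]; exact hV)
  filter_upwards [hVe] with o ho hon
  obtain ⟨g, hg, hgo⟩ := hVN (show (⟨_, (orthonormal_iff_mem_orthogonalGroup o).1 hon⟩ :
    Matrix.orthogonalGroup (Fin n) ℝ) ∈ _ from ho)
  refine ⟨g, hg, fun j => ?_⟩
  ext i
  rw [← pinOrth_apply, hgo]; rfl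

end PinKernel

/-! ### Frames of `ℝⁿ` and the Gram–Schmidt process -/

section GramSchmidt

variable {n : ℕ}

theorem continuousAt_gramSchmidt {f : Fin n → EuclideanSpace ℝ (Fin n)}
    (hf : LinearIndependent ℝ f) (i : Fin n) :
    ContinuousAt (fun f : Fin n → EuclideanSpace ℝ (Fin n) =>
      InnerProductSpace.gramSchmidt ℝ f i) f := by
  induction i using Fin.strong_induction_on with
  | _ i ih =>
    have h : (fun f : Fin n → EuclideanSpace ℝ (Fin n) => InnerProductSpace.gramSchmidt ℝ f i) =
        fun f => f i - ∑ k ∈ Finset.Iio i, (Inner.inner ℝ (InnerProductSpace.gramSchmidt ℝ f k)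
          (f i) /
          (‖InnerProductSpace.gramSchmidt ℝ f k‖ ^ 2)) • InnerProductSpace.gramSchmidt ℝ f k := by
      funext f
      rw [InnerProductSpace.gramSchmidt_def]
      congr 1
      refine Finset.sum_congr rfl fun k _ => ?_
      rw [Submodule.starProjection_singleton]; simp
    rw [h]
    refine (continuous_apply i).continuousAt.sub (tendsto_finsetSum _ fun k hk => ?_)
    have hk' := ih k (Finset.mem_Iio.1 hk)
    refine Tendsto.smul (Tendsto.div (Tendsto.inner hk' (continuous_apply i).continuousAt)
      (hk'.norm.pow 2) ?_) hk'
    have := InnerProductSpace.gramSchmidt_ne_zero k hf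
    simpa using this

theorem continuousAt_gramSchmidtNormed {f : Fin n → EuclideanSpace ℝ (Fin n)}
    (hf : LinearIndependent ℝ f) :
    ContinuousAt (fun f : Fin n → EuclideanSpace ℝ (Fin n) =>
      InnerProductSpace.gramSchmidtNormed ℝ f) f := by
  refine continuousAt_pi.2 fun i => ?_
  have h := continuousAt_gramSchmidt hf i
  refine ContinuousAt.smul (f := fun f : Fin n → EuclideanSpace ℝ (Fin n) =>
    (((‖InnerProductSpace.gramSchmidt ℝ f i‖ : ℝ))⁻¹ : ℝ)) (h.norm.inv₀ ?_) h
  exact norm_ne_zero_iff.2 (InnerProductSpace.gramSchmidt_ne_zero i hf)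

theorem inner_gramSchmidtNormed_pos {f : Fin n → EuclideanSpace ℝ (Fin n)}
    (hf : LinearIndependent ℝ f) (i : Fin n) :
    0 < inner ℝ (f i) (InnerProductSpace.gramSchmidtNormed ℝ f i) := by
  have h0 := norm_pos_iff.2 (InnerProductSpace.gramSchmidt_ne_zero (𝕜 := ℝ) i hf)
  have h : inner ℝ (f i) (InnerProductSpace.gramSchmidt ℝ f i) =
      ‖InnerProductSpace.gramSchmidt ℝ f i‖ ^ 2 := by
    conv_lhs => rw [InnerProductSpace.gramSchmidt_def' ℝ f i]
    rw [inner_add_left, real_inner_self_eq_norm_sq, sum_inner, Finset.sum_eq_zero, add_zero]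
    intro k hk
    rw [Submodule.starProjection_singleton, inner_smul_left,
      InnerProductSpace.gramSchmidt_orthogonal ℝ f (Finset.mem_Iio.1 hk).ne, mul_zero]
  unfold InnerProductSpace.gramSchmidtNormed
  rw [inner_smul_right, h]
  simp only [RCLike.ofReal_real_eq_id, id]
  positivity

/-- Lower triangular with positive diagonal. -/
def IsTri (A : EuclideanSpace ℝ (Fin n) →L[ℝ] EuclideanSpace ℝ (Fin n)) : Prop :=
  ∀ i, 0 < A (euclBasis n i) i ∧ ∀ j, i < j → A (euclBasis n j) i = 0

/-- The triangular matrices with positive diagonal are a convex set. -/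
theorem IsTri.lineMap {A : EuclideanSpace ℝ (Fin n) →L[ℝ] EuclideanSpace ℝ (Fin n)} (hA : IsTri A)
    (t : unitInterval) :
    IsTri ((1 - (t : ℝ)) • A + (t : ℝ) • ContinuousLinearMap.id ℝ _) := by
  intro i
  constructor
  · have h1 := (hA i).1
    have h2 := t.2.1
    have h3 := t.2.2
    have : ((((1 - (t : ℝ)) • A + (t : ℝ) • ContinuousLinearMap.id ℝ _ :
        EuclideanSpace ℝ (Fin n) →L[ℝ] EuclideanSpace ℝ (Fin n)) (euclBasis n i)) i) =
        (1 - (t : ℝ)) * A (euclBasis n i) i + t := by simp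
    rw [this]
    rcases eq_or_lt_of_le h2 with h | h
    · rw [← h]; simpa using h1
    · have : 0 ≤ (1 - (t : ℝ)) * A (euclBasis n i) i := mul_nonneg (by linarith) h1.le
      linarith
  · intro j hij
    have := (hA i).2 j hij
    simp only [EuclideanSpace.basisFun_apply] at this
    simp [this, hij.ne]

theorem IsTri.injective {A : EuclideanSpace ℝ (Fin n) →L[ℝ] EuclideanSpace ℝ (Fin n)}
    (hA : IsTri A) : Function.Injective A := by
  rw [injective_iff_map_eq_zero]
  intro v hv
  have key : ∀ i, v i = 0 := by
    intro i
    induction i using Fin.strong_induction_on with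
    | _ i ih =>
      have h : ∑ j, v j * A (euclBasis n j) i = 0 := by
        have h1 : A v = ∑ j, v j • A (euclBasis n j) := by
          conv_lhs => rw [← euclBasis_sum v]
          simp only [map_sum, map_smul]
        have h2 := congrArg (fun w : EuclideanSpace ℝ (Fin n) => w i) (h1.symm.trans hv)
        simpa using h2
      rw [Finset.sum_eq_single i] at h
      · exact (mul_eq_zero.1 h).resolve_right (hA i).1.ne'
      · intro j _ hj
        rcases lt_or_gt_of_ne hj with hj | hj
        · rw [ih j hj, zero_mul]
        · rw [(hA i).2 j hj, mul_zero]
      · simp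
  ext i; exact key i

/-- An injective endomorphism of `ℝⁿ` as an equivalence. -/
def equivOfInjective (A : EuclideanSpace ℝ (Fin n) →L[ℝ] EuclideanSpace ℝ (Fin n))
    (hA : Function.Injective A) : EuclideanSpace ℝ (Fin n) ≃L[ℝ] EuclideanSpace ℝ (Fin n) :=
  (LinearEquiv.ofInjectiveEndo A.toLinearMap hA).toContinuousLinearEquiv

@[simp] theorem equivOfInjective_apply
    (A : EuclideanSpace ℝ (Fin n) →L[ℝ] EuclideanSpace ℝ (Fin n)) (hA : Function.Injective A) (v) :
    equivOfInjective A hA v = A v := rfl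

/-- The rows of the matrix of `A`. -/
def rowsOf (A : EuclideanSpace ℝ (Fin n) ≃L[ℝ] EuclideanSpace ℝ (Fin n)) (i : Fin n) :
    EuclideanSpace ℝ (Fin n) := WithLp.toLp 2 fun j => A (euclBasis n j) i

theorem inner_rowsOf (A : EuclideanSpace ℝ (Fin n) ≃L[ℝ] EuclideanSpace ℝ (Fin n)) (i : Fin n)
    (v : EuclideanSpace ℝ (Fin n)) : inner ℝ (rowsOf A i) v = A v i := by
  conv_rhs => rw [← euclBasis_sum v]
  simp [PiLp.inner_apply, rowsOf]

theorem linearIndependent_rowsOf (A : EuclideanSpace ℝ (Fin n) ≃L[ℝ] EuclideanSpace ℝ (Fin n)) :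
    LinearIndependent ℝ (rowsOf A) := by
  rw [Fintype.linearIndependent_iff]
  intro c hc
  have h : ∑ i, c i * c i = 0 := by
    have := congrArg (fun w => inner ℝ w (A.symm (WithLp.toLp 2 c))) hc
    simpa [sum_inner, inner_smul_left, inner_rowsOf] using this
  intro i
  have := (Finset.sum_eq_zero_iff_of_nonneg fun i _ => mul_self_nonneg (c i)).1 h i
    (Finset.mem_univ _)
  exact mul_self_eq_zero.1 this

/-- The orthonormal family obtained from the rows of `A`. -/
def gramRows (A : EuclideanSpace ℝ (Fin n) ≃L[ℝ] EuclideanSpace ℝ (Fin n)) :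
    Fin n → EuclideanSpace ℝ (Fin n) :=
  InnerProductSpace.gramSchmidtNormed ℝ (rowsOf A)

theorem orthonormal_gramRows (A : EuclideanSpace ℝ (Fin n) ≃L[ℝ] EuclideanSpace ℝ (Fin n)) :
    Orthonormal ℝ (gramRows A) :=
  InnerProductSpace.gramSchmidtNormed_orthonormal (linearIndependent_rowsOf A)

/-- The frame `A`, made triangular by an element of `Pin⁺(n)`. -/
theorem isTri_of_pinRho_eq_gramRows
    (A : EuclideanSpace ℝ (Fin n) ≃L[ℝ] EuclideanSpace ℝ (Fin n)) (g : PinPlus n)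
    (hg : ∀ i, pinRho g (euclBasis n i) = gramRows A i) :
    IsTri ((A : EuclideanSpace ℝ (Fin n) →L[ℝ] EuclideanSpace ℝ (Fin n)).comp
      (pinRho g).toContinuousLinearMap) := by
  intro i
  refine ⟨?_, fun j hij => ?_⟩
  · change (0 : ℝ) < A (pinRho g _) i
    rw [hg, ← inner_rowsOf]
    exact inner_gramSchmidtNormed_pos (linearIndependent_rowsOf A) i
  · change A (pinRho g _) i = (0 : ℝ)
    rw [hg, ← inner_rowsOf, gramRows]
    unfold InnerProductSpace.gramSchmidtNormed
    rw [inner_smul_right, real_inner_comm, InnerProductSpace.gramSchmidt_inv_triangular ℝ _ hij,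
      mul_zero]

/-- The triangular form of a frame is unique. -/
theorem pinRho_eq_of_isTri (A : EuclideanSpace ℝ (Fin n) ≃L[ℝ] EuclideanSpace ℝ (Fin n))
    (hA : IsTri (A : EuclideanSpace ℝ (Fin n) →L[ℝ] EuclideanSpace ℝ (Fin n))) (g : PinPlus n)
    (hg : IsTri ((A : EuclideanSpace ℝ (Fin n) →L[ℝ] EuclideanSpace ℝ (Fin n)).comp
      (pinRho g).toContinuousLinearMap)) (v : EuclideanSpace ℝ (Fin n)) :
    pinRho g v = v := by
  have key : ∀ i, pinRho g⁻¹ (euclBasis n i) = euclBasis n i := by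
    intro i
    induction i using Fin.strong_induction_on with
    | _ i ih =>
      have hr : ∀ j, A (pinRho g (euclBasis n j)) i =
          ∑ k, A (euclBasis n k) i * inner ℝ (pinRho g⁻¹ (euclBasis n k)) (euclBasis n j) := by
        intro j
        rw [← inner_rowsOf, ← inner_pinRho g⁻¹, pinRho_inv_pinRho, ← euclBasis_sum (rowsOf A i)]
        simp only [map_sum, sum_inner, map_smul, inner_smul_left]
        rfl
      have hr' : ∀ j, A (pinRho g (euclBasis n j)) i =
          A (euclBasis n i) i * inner ℝ (pinRho g⁻¹ (euclBasis n i)) (euclBasis n j) +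
          if j < i then A (euclBasis n j) i else 0 := by
        intro j
        rw [hr j, Finset.sum_eq_add_sum_sdiff_singleton_of_mem (Finset.mem_univ i)]
        congr 1
        have : ∀ k ∈ Finset.univ \ {i}, A (euclBasis n k) i *
            inner ℝ (pinRho g⁻¹ (euclBasis n k)) (euclBasis n j) =
            if k = j then (if j < i then A (euclBasis n j) i else 0) else 0 := by
          intro k hk
          have hki : k ≠ i := by simpa using hk
          rcases lt_or_gt_of_ne hki with h | h
          · rw [ih k h, (euclBasis n).inner_eq_ite]
            by_cases hkj : k = j
            · subst hkj; simp [h]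
            · simp [hkj]
          · have h0 : A (euclBasis n k) i = 0 := (hA i).2 k h
            rw [h0, zero_mul]
            by_cases hkj : k = j
            · subst hkj; simp [h.not_gt]
            · simp [hkj]
        rw [Finset.sum_congr rfl this, Finset.sum_ite_eq']
        by_cases hji : j < i
        · simp [hji, hji.ne]
        · simp [hji]
      have hdiag : (0 : ℝ) < A (euclBasis n i) i := (hA i).1
      set w := pinRho g⁻¹ (euclBasis n i) with hw
      have hoff : ∀ j, j ≠ i → inner ℝ w (euclBasis n j) = 0 := by
        intro j hj
        rcases lt_or_gt_of_ne hj with h | h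
        · rw [← ih j h, hw, inner_pinRho, (euclBasis n).inner_eq_ite, if_neg hj.symm]
        · have h1 : A (pinRho g (euclBasis n j)) i = 0 := (hg i).2 j h
          rw [hr' j, if_neg h.not_gt, add_zero] at h1
          exact (mul_eq_zero.1 h1).resolve_left hdiag.ne'
      have hpos : 0 < inner ℝ w (euclBasis n i) := by
        have h1 : (0 : ℝ) < A (pinRho g (euclBasis n i)) i := (hg i).1
        rw [hr' i, if_neg (lt_irrefl i), add_zero] at h1
        exact (pos_iff_pos_of_mul_pos h1).1 hdiag
      have hwc : w = inner ℝ w (euclBasis n i) • euclBasis n i := by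
        conv_lhs => rw [← (euclBasis n).sum_repr' w]
        rw [Finset.sum_eq_single i]
        · rw [real_inner_comm]
        · intro j _ hj
          rw [real_inner_comm, hoff j hj, zero_smul]
        · simp
      have hn : ‖w‖ = 1 := by rw [hw, norm_pinRho]; simp
      rw [hwc, norm_smul, Real.norm_of_nonneg hpos.le, (euclBasis n).norm_eq_one, mul_one] at hn
      rw [hwc, hn, one_smul]
  apply pinRho_injective g⁻¹
  rw [pinRho_inv_pinRho]
  conv_lhs => rw [← euclBasis_sum v]
  conv_rhs => rw [← euclBasis_sum v]
  simp only [map_sum, map_smul, key]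

theorem continuous_gramRows {X : Type*} [TopologicalSpace X]
    {A : X → EuclideanSpace ℝ (Fin n) ≃L[ℝ] EuclideanSpace ℝ (Fin n)}
    (hA : Continuous fun x : X × EuclideanSpace ℝ (Fin n) => A x.1 x.2) :
    Continuous fun x => gramRows (A x) := by
  rw [continuous_iff_continuousAt]
  intro x
  refine (continuousAt_gramSchmidtNormed (linearIndependent_rowsOf (A x))).comp
    (f := fun x => rowsOf (A x)) ?_
  refine Continuous.continuousAt (continuous_pi fun i => ?_)
  refine (PiLp.continuous_toLp 2 _).comp (continuous_pi fun j => ?_)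
  exact (continuous_euclCoord i).comp (hA.comp (Continuous.prodMk_left _))

theorem gramRows_of_isTri (A : EuclideanSpace ℝ (Fin n) ≃L[ℝ] EuclideanSpace ℝ (Fin n))
    (hA : IsTri (A : EuclideanSpace ℝ (Fin n) →L[ℝ] EuclideanSpace ℝ (Fin n))) :
    gramRows A = fun i => euclBasis n i := by
  obtain ⟨g, hg⟩ := exists_pinRho_eq (orthonormal_gramRows A)
  funext i
  rw [← hg i]
  exact pinRho_eq_of_isTri A hA g (isTri_of_pinRho_eq_gramRows A g hg) _

theorem continuous_symm_apply {X : Type*} [TopologicalSpace X]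
    {A : X → EuclideanSpace ℝ (Fin n) ≃L[ℝ] EuclideanSpace ℝ (Fin n)}
    (hA : Continuous fun x : X × EuclideanSpace ℝ (Fin n) => A x.1 x.2) :
    Continuous fun x : X × EuclideanSpace ℝ (Fin n) => (A x.1).symm x.2 := by
  have h1 : Continuous fun x => (A x : EuclideanSpace ℝ (Fin n) →L[ℝ] EuclideanSpace ℝ (Fin n)) :=
    continuous_clm_apply.2 fun v => hA.comp (Continuous.prodMk_left v)
  have h2 : Continuous fun x =>
      ((A x).symm : EuclideanSpace ℝ (Fin n) →L[ℝ] EuclideanSpace ℝ (Fin n)) := by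
    rw [continuous_iff_continuousAt]
    intro x
    have h3 := (contDiffAt_map_inverse (𝕜 := ℝ) (n := 0) (A x)).continuousAt
    refine (ContinuousAt.comp (f := fun x =>
      (A x : EuclideanSpace ℝ (Fin n) →L[ℝ] EuclideanSpace ℝ (Fin n))) h3 h1.continuousAt).congr ?_
    exact .of_forall fun y => ContinuousLinearMap.inverse_equiv (A y)
  exact (h2.comp continuous_fst).clm_apply continuous_snd

end GramSchmidt

/-! ### Principal bundles -/

namespace PinStructure

variable {n : ℕ} {H : Type*} [TopologicalSpace H]
  {I : ModelWithCorners ℝ (EuclideanSpace ℝ (Fin n)) H}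
  {M : Type*} [TopologicalSpace M] [ChartedSpace H M] [IsManifold I ∞ M]

/-- The bundle projection. -/
def proj (φ : PinStructure I M) (p : φ.P) : M := (φ.frame p).base

theorem continuous_proj (φ : PinStructure I M) : Continuous φ.proj := by
  have h := (FiberBundle.continuous_proj (EuclideanSpace ℝ (Fin n))
    (TangentSpace I : M → Type _)).comp
    (φ.continuous_frame.comp (Continuous.prodMk_left (0 : EuclideanSpace ℝ (Fin n))))
  exact h

@[simp] theorem proj_act (φ : PinStructure I M) (p : φ.P) (g : PinPlus n) :
    φ.proj (φ.act p g) = φ.proj p :=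
  congrArg Bundle.TotalSpace.proj (φ.frame_act p g 0)

theorem act_inv_act (φ : PinStructure I M) (p : φ.P) (g : PinPlus n) :
    φ.act (φ.act p g) g⁻¹ = p := by rw [← φ.act_mul, mul_inv_cancel, φ.act_one]

theorem continuous_act' (φ : PinStructure I M) {X : Type*} [TopologicalSpace X] {p : X → φ.P}
    {g : X → PinPlus n} (hp : Continuous p) (hg : Continuous g) :
    Continuous fun x => φ.act (p x) (g x) :=
  φ.continuous_act.comp (hp.prodMk hg)

/-- A trivialization over a neighbourhood of `x`. -/
theorem exists_triv (φ : PinStructure I M) (x : M) :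
    ∃ e : Bundle.Trivialization (PinPlus n) φ.proj, x ∈ e.baseSet ∧
      ∀ p ∈ e.source, ∀ g, (e (φ.act p g)).2 = (e p).2 * g := φ.locally_trivial x

theorem mem_source_act (φ : PinStructure I M) (e : Bundle.Trivialization (PinPlus n) φ.proj)
    {p : φ.P} (hp : p ∈ e.source) (g : PinPlus n) : φ.act p g ∈ e.source := by
  rw [e.mem_source] at hp ⊢; rwa [proj_act]

theorem eq_of_triv (φ : PinStructure I M) (e : Bundle.Trivialization (PinPlus n) φ.proj)
    {p q : φ.P} (hp : p ∈ e.source) (h : φ.proj p = φ.proj q) (h2 : (e p).2 = (e q).2) : p = q := by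
  have hq : q ∈ e.source := e.mem_source.2 (h ▸ e.mem_source.1 hp)
  exact e.injOn hp hq (Prod.ext ((e.coe_fst hp).trans (h.trans (e.coe_fst hq).symm)) h2)

theorem act_injective (φ : PinStructure I M) (p : φ.P) : Function.Injective (φ.act p) := by
  intro g g' h
  obtain ⟨e, hx, he⟩ := φ.exists_triv (φ.proj p)
  have hp : p ∈ e.source := e.mem_source.2 hx
  have h1 := he p hp g
  rw [h, he p hp g'] at h1
  exact (mul_left_cancel h1).symm

theorem exists_act_eq (φ : PinStructure I M) {p q : φ.P} (h : φ.proj p = φ.proj q) :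
    ∃ g, φ.act p g = q := by
  obtain ⟨e, hx, he⟩ := φ.exists_triv (φ.proj p)
  have hp : p ∈ e.source := e.mem_source.2 hx
  refine ⟨(e p).2⁻¹ * (e q).2, ?_⟩
  refine φ.eq_of_triv e (φ.mem_source_act e hp _) (by rw [proj_act, h]) ?_
  rw [he p hp]; simp

/-- The element `g` with `p g = q`, for `p` and `q` in the same fibre. -/
def div (φ : PinStructure I M) (p q : φ.P) : PinPlus n :=
  open Classical in if h : φ.proj p = φ.proj q then (φ.exists_act_eq h).choose else 1

theorem act_div (φ : PinStructure I M) {p q : φ.P} (h : φ.proj p = φ.proj q) :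
    φ.act p (φ.div p q) = q := by
  rw [div, dif_pos h]; exact (φ.exists_act_eq h).choose_spec

/-- There is a local section through every point. -/
theorem exists_localSection (φ : PinStructure I M) (p : φ.P) :
    ∃ (U : Set M) (s : M → φ.P), IsOpen U ∧ φ.proj p ∈ U ∧ ContinuousOn s U ∧
      (∀ x ∈ U, φ.proj (s x) = x) ∧ s (φ.proj p) = p := by
  obtain ⟨e, hx, he⟩ := φ.exists_triv (φ.proj p)
  have hp : p ∈ e.source := e.mem_source.2 hx
  refine ⟨e.baseSet, fun x => e.toOpenPartialHomeomorph.symm (x, (e p).2), e.open_baseSet, hx, ?_,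
    ?_, ?_⟩
  · refine e.toOpenPartialHomeomorph.continuousOn_symm.comp
      (f := fun x => (x, (e p).2)) (by fun_prop) ?_
    intro x hx
    rw [e.target_eq]; exact ⟨hx, trivial⟩
  · intro x hx
    exact e.proj_symm_apply' hx
  · exact e.symm_apply_mk_proj hp

/-- An equivariant map to a principal bundle is open if it is so on the base. -/
theorem isOpenMap_of_equivariant (φ : PinStructure I M) {X : Type*} [TopologicalSpace X]
    (r : X → PinPlus n → X) (hr : Continuous fun x : X × PinPlus n => r x.1 x.2)
    (hr1 : ∀ x, r x 1 = x)
    (f : X → φ.P) (hf : Continuous f) (hfr : ∀ x g, f (r x g) = φ.act (f x) g)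
    (hb : IsOpenMap fun x => φ.proj (f x)) : IsOpenMap f := by
  rw [isOpenMap_iff_nhds_le]
  intro x S hS
  have hS' : f ⁻¹' S ∈ 𝓝 x := hS
  -- `x' ↦ f x'` hits every `q` near `f x` up to the action of an element close to `1`
  have h1 : Tendsto (fun y : X × PinPlus n => r y.1 y.2) (𝓝 (x, 1)) (𝓝 x) := by
    have := hr.tendsto (x, 1)
    rwa [hr1] at this
  obtain ⟨A, hA, B, hB, hAB⟩ := mem_nhds_prod_iff.1 (h1 hS')
  obtain ⟨e, hx, he⟩ := φ.exists_triv (φ.proj (f x))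
  have hxs : f x ∈ e.source := e.mem_source.2 hx
  have h2 : Tendsto (fun z : φ.P × φ.P => (e z.1).2⁻¹ * (e z.2).2) (𝓝 (f x, f x)) (𝓝 1) := by
    have : ContinuousAt (fun z : φ.P × φ.P => (e z.1).2⁻¹ * (e z.2).2) (f x, f x) := by
      refine ContinuousAt.mul (ContinuousAt.inv ?_) ?_
      · exact continuousAt_snd.comp (ContinuousAt.comp (x := (f x, f x)) (f := Prod.fst)
          (e.continuousAt hxs) continuousAt_fst)
      · exact continuousAt_snd.comp (ContinuousAt.comp (x := (f x, f x)) (f := Prod.snd)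
          (e.continuousAt hxs) continuousAt_snd)
    have h3 := this.tendsto
    simpa using h3
  obtain ⟨C, hC, D, hD, hCD⟩ := mem_nhds_prod_iff.1 (h2 hB)
  have hA' : A ∩ f ⁻¹' (C ∩ e.source) ∈ 𝓝 x :=
    inter_mem hA (hf.continuousAt (inter_mem hC (e.open_source.mem_nhds hxs)))
  have h4 := hb.image_mem_nhds hA'
  filter_upwards [hD, e.open_source.mem_nhds hxs, φ.continuous_proj.continuousAt h4] with q hqD hqs
    hq
  obtain ⟨y, ⟨hyA, hyC, hys⟩, hyq⟩ := hq
  have hyq' : φ.proj (f y) = φ.proj q := hyq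
  have h5 : (e (f y)).2⁻¹ * (e q).2 ∈ B := hCD (mk_mem_prod hyC hqD)
  have h6 : φ.act (f y) ((e (f y)).2⁻¹ * (e q).2) = q := by
    refine φ.eq_of_triv e (φ.mem_source_act e hys _) (by rw [proj_act, hyq']) ?_
    rw [he _ hys]; simp
  rw [← h6, ← hfr]
  exact hAB (mk_mem_prod hyA h5)

end PinStructure

/-- A trivialization of a principal bundle from a local section `s` and the division by `s`. -/
def trivializationOfSection {G P M : Type*} [Group G] [TopologicalSpace G] [TopologicalSpace P]
    [TopologicalSpace M] (π : P → M) (act : P → G → P)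
    (hact : Continuous fun x : P × G => act x.1 x.2) (hπ : Continuous π)
    (hπa : ∀ p g, π (act p g) = π p)
    (U : Set M) (hU : IsOpen U) (s : M → P) (hs : ContinuousOn s U) (hsU : ∀ x ∈ U, π (s x) = x)
    (d : P → G) (hd : ContinuousOn d (π ⁻¹' U)) (hsd : ∀ p, π p ∈ U → act (s (π p)) (d p) = p)
    (hds : ∀ x ∈ U, ∀ g, d (act (s x) g) = g) :
    Bundle.Trivialization G π where
  toFun p := (π p, d p)
  invFun y := act (s y.1) y.2
  source := π ⁻¹' U
  target := U ×ˢ univ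
  map_source' p hp := ⟨hp, trivial⟩
  map_target' y hy := by
    change π _ ∈ U
    rw [hπa, hsU _ hy.1]; exact hy.1
  left_inv' p hp := hsd p hp
  right_inv' y hy := by
    refine Prod.ext ?_ (hds _ hy.1 _)
    change π (act _ _) = _
    rw [hπa, hsU _ hy.1]
  open_source := hU.preimage hπ
  open_target := hU.prod isOpen_univ
  continuousOn_toFun := hπ.continuousOn.prodMk hd
  continuousOn_invFun := hact.comp_continuousOn
    ((hs.comp continuousOn_fst fun y hy => hy.1).prodMk continuousOn_snd)
  baseSet := U
  open_baseSet := hU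
  source_eq := rfl
  target_eq := rfl
  proj_toFun _ _ := rfl

/-! ### Frames and local diffeomorphisms -/

section comap

variable {n : ℕ} {H H' : Type*} [TopologicalSpace H] [TopologicalSpace H']
  {I : ModelWithCorners ℝ (EuclideanSpace ℝ (Fin n)) H}
  {J : ModelWithCorners ℝ (EuclideanSpace ℝ (Fin n)) H'}
  {M N : Type*} [TopologicalSpace M] [ChartedSpace H M]
  [TopologicalSpace N] [ChartedSpace H' N]

/-- The frame at `x` that the local diffeomorphism `f` sends to the frame `b` at `f x`. Meaningful
only if `b` is a frame at `f x`. -/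
def TangentFrame.comap {f : M → N} (hf : IsLocalDiffeomorph I J ∞ f) (b : TangentFrame J N) (x : M)
    :
    TangentFrame I M :=
  ⟨x, b.iso.trans (show TangentSpace J b.base ≃L[ℝ] TangentSpace I x from
    (hf.mfderivToContinuousLinearEquiv (by simp) x).symm)⟩

theorem TangentFrame.tangentMap_vec_comap {f : M → N} (hf : IsLocalDiffeomorph I J ∞ f)
    (b : TangentFrame J N) (x : M) (h : b.base = f x) (v : EuclideanSpace ℝ (Fin n)) :
    tangentMap I J f ((b.comap hf x).vec v) = b.vec v := by
  obtain ⟨y, e⟩ := b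
  obtain rfl : y = f x := h
  exact congrArg (Bundle.TotalSpace.mk (f x))
    ((hf.mfderivToContinuousLinearEquiv (by simp) x).apply_symm_apply (e v))

theorem tangentMap_injOn_fiber {f : M → N} (hf : IsLocalDiffeomorph I J ∞ f)
    {V W : TangentBundle I M} (h : V.proj = W.proj) (hVW : tangentMap I J f V = tangentMap I J f W)
      :
    V = W := by
  obtain ⟨x, v⟩ := V
  obtain ⟨y, w⟩ := W
  obtain rfl : x = y := h
  refine congrArg (Bundle.TotalSpace.mk x)
    ((hf.mfderivToContinuousLinearEquiv (by simp) x).injective ?_)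
  have : mfderiv I J f x v = mfderiv I J f x w := by simpa [tangentMap] using hVW
  exact this

variable [IsManifold I ∞ M] [IsManifold J ∞ N]

/-- Continuity of a family of tangent vectors can be tested after a local diffeomorphism. -/
theorem continuous_of_tangentMap {f : M → N} (hf : IsLocalDiffeomorph I J ∞ f) {X : Type*}
    [TopologicalSpace X] {V : X → TangentBundle I M} (hp : Continuous fun x => (V x).proj)
    (hV : Continuous fun x => tangentMap I J f (V x)) : Continuous V := by
  rw [continuous_iff_continuousAt]
  intro x₀
  have hl := hf (V x₀).proj
  set L := hl.localInverse with hL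
  have h1 : ContinuousOn (tangentMapWithin J I L L.source) (Bundle.TotalSpace.proj ⁻¹' L.source) :=
    (L.contMDiffOn).continuousOn_tangentMapWithin (by simp) L.open_source.uniqueMDiffOn
  have hmem : tangentMap I J f (V x₀) ∈ (Bundle.TotalSpace.proj ⁻¹' L.source :
      Set (TangentBundle J N)) := hl.localInverse_mem_source
  have hopen : IsOpen (Bundle.TotalSpace.proj ⁻¹' L.source : Set (TangentBundle J N)) :=
    L.open_source.preimage
      (FiberBundle.continuous_proj (EuclideanSpace ℝ (Fin n)) (TangentSpace J : N → Type _))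
  have h2 := (h1.continuousAt (hopen.mem_nhds hmem)).comp
    (f := fun x => tangentMap I J f (V x)) hV.continuousAt
  refine h2.congr ?_
  filter_upwards [hp.continuousAt (L.open_target.mem_nhds hl.localInverse_mem_target)] with x hx
  revert hx
  change (V x).proj ∈ L.target → _
  simp only [Function.comp]
  rcases V x with ⟨y, v⟩
  intro hx'
  change y ∈ L.target at hx'
  have hfy : f y ∈ L.source := by
    have := hl.localInverse_left_inv hx'
    have h3 : L.toPartialEquiv.symm y ∈ L.source := L.toPartialEquiv.map_target hx'
    have h4 : f y = L.toPartialEquiv.symm y := by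
      have h5 := hl.localInverse_right_inv h3
      have h6 : L.toPartialEquiv (L.toPartialEquiv.symm y) = y := L.toPartialEquiv.right_inv hx'
      have h7 : (hl.localInverse : N → M) (L.toPartialEquiv.symm y) = y := h6
      rw [h7] at h5
      exact h5
    rw [h4]; exact h3
  have hinv : L (f y) = y := hl.localInverse_left_inv hx'
  have hmd : MDifferentiableAt J I L (f y) :=
    (L.contMDiffOn.contMDiffAt (L.open_source.mem_nhds hfy)).mdifferentiableAt (by simp)
  have hfd : MDifferentiableAt I J f y := hf.contMDiff.mdifferentiable (by simp) y
  have hcomp : mfderiv J I L (f y) (mfderiv I J f y v) = v := by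
    have h8 : mfderiv I I (L ∘ f) y = (mfderiv J I L (f y)).comp (mfderiv I J f y) :=
      mfderiv_comp y hmd hfd
    have h9 : mfderiv I I (L ∘ f) y = mfderiv I I id y := by
      refine Filter.EventuallyEq.mfderiv_eq ?_
      filter_upwards [L.open_target.mem_nhds hx'] with z hz
      exact hl.localInverse_left_inv hz
    rw [mfderiv_id] at h9
    exact congrArg (fun T : EuclideanSpace ℝ (Fin n) →L[ℝ] EuclideanSpace ℝ (Fin n) => T v)
      (h8.symm.trans h9)
  change tangentMapWithin J I L L.source ⟨f y, mfderiv I J f y v⟩ = _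
  rw [tangentMapWithin_eq_tangentMap (L.open_source.uniqueMDiffOn _ hfy) hmd]
  change (⟨L (f y), mfderiv J I L (f y) (mfderiv I J f y v)⟩ : TangentBundle I M) = _
  rw [hcomp]
  exact congrArg (fun z => (⟨z, (v : EuclideanSpace ℝ (Fin n))⟩ : TangentBundle I M)) hinv

end comap

/-! ### Sections with triangular frames over `ℝⁿ` -/

section flat

variable {n : ℕ}

theorem pinOrth_eq_one_iff (g : PinPlus n) : pinOrth n g = 1 ↔ ∀ v, pinRho g v = v := by
  constructor
  · intro h v
    have h2 : ∀ i, pinRho g (euclBasis n i) = euclBasis n i := by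
      intro i; ext l
      have := congrArg (fun U : Matrix.orthogonalGroup (Fin n) ℝ =>
        (U : Matrix (Fin n) (Fin n) ℝ) l i) (h.trans (map_one (pinOrth n)).symm)
      simpa [pinOrth_apply, Matrix.one_apply] using this
    rw [← euclBasis_sum v]
    simp only [map_sum, map_smul, h2]
  · intro h
    rw [← map_one (pinOrth n)]
    apply Subtype.ext; ext l i
    rw [pinOrth_apply, pinOrth_apply, h, pinRho_one]

/-- Tangent vectors of `ℝⁿ` as pairs. -/
def flatVec (x v : EuclideanSpace ℝ (Fin n)) : TangentBundle (𝓡 n) (EuclideanSpace ℝ (Fin n)) :=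
  ⟨x, v⟩

theorem continuous_flatVec : Continuous fun z : EuclideanSpace ℝ (Fin n) × EuclideanSpace ℝ
    (Fin n) =>
    flatVec z.1 z.2 :=
  (tangentBundleModelSpaceHomeomorph (𝓡 n)).symm.continuous

theorem continuous_snd_of_flat {X : Type*} [TopologicalSpace X]
    {V : X → TangentBundle (𝓡 n) (EuclideanSpace ℝ (Fin n))} (hV : Continuous V) :
    Continuous fun x => ((V x).2 : EuclideanSpace ℝ (Fin n)) :=
  continuous_snd.comp ((tangentBundleModelSpaceHomeomorph (𝓡 n)).continuous.comp hV)

variable {M : Type*} [TopologicalSpace M] [ChartedSpace (EuclideanSpace ℝ (Fin n)) M]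
  [IsManifold (𝓡 n) ∞ M]
  {j : EuclideanSpace ℝ (Fin n) → M}

/-- The matrix of the frame `b` at `j x` with respect to the frame given by the differential of
`j`. -/
def flatFrame (hj : IsLocalDiffeomorph (𝓡 n) (𝓡 n) ∞ j) (b : TangentFrame (𝓡 n) M)
    (x : EuclideanSpace ℝ (Fin n)) : EuclideanSpace ℝ (Fin n) ≃L[ℝ] EuclideanSpace ℝ (Fin n) :=
  (b.comap hj x).iso

theorem tangentMap_flatFrame (hj : IsLocalDiffeomorph (𝓡 n) (𝓡 n) ∞ j) (b : TangentFrame (𝓡 n) M)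
    (x : EuclideanSpace ℝ (Fin n)) (h : b.base = j x) (v : EuclideanSpace ℝ (Fin n)) :
    tangentMap (𝓡 n) (𝓡 n) j (flatVec x (flatFrame hj b x v)) = b.vec v :=
  TangentFrame.tangentMap_vec_comap hj b x h v

theorem flatFrame_eq (hj : IsLocalDiffeomorph (𝓡 n) (𝓡 n) ∞ j) (b : TangentFrame (𝓡 n) M)
    (x : EuclideanSpace ℝ (Fin n)) (h : b.base = j x) {v w : EuclideanSpace ℝ (Fin n)}
    (hw : tangentMap (𝓡 n) (𝓡 n) j (flatVec x w) = b.vec v) : flatFrame hj b x v = w := by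
  rw [← tangentMap_flatFrame hj b x h v] at hw
  have h2 := tangentMap_injOn_fiber hj (V := flatVec x w) (W := flatVec x (flatFrame hj b x v)) rfl
    hw
  exact (congrArg (fun V => (tangentBundleModelSpaceHomeomorph (𝓡 n) V).2) h2).symm

theorem continuous_flatFrame (hj : IsLocalDiffeomorph (𝓡 n) (𝓡 n) ∞ j) {X : Type*}
    [TopologicalSpace X] {b : X → TangentFrame (𝓡 n) M} {x : X → EuclideanSpace ℝ (Fin n)}
    (hx : Continuous x) (hb : ∀ z, (b z).base = j (x z))
    (hbc : Continuous fun z : X × EuclideanSpace ℝ (Fin n) => (b z.1).vec z.2) :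
    Continuous fun z : X × EuclideanSpace ℝ (Fin n) => flatFrame hj (b z.1) (x z.1) z.2 := by
  have h : Continuous fun z : X × EuclideanSpace ℝ (Fin n) =>
      flatVec (x z.1) (flatFrame hj (b z.1) (x z.1) z.2) := by
    refine continuous_of_tangentMap hj (hx.comp continuous_fst) ?_
    refine hbc.congr fun z => ?_
    exact (tangentMap_flatFrame hj (b z.1) (x z.1) (hb z.1) z.2).symm
  exact continuous_snd_of_flat h

namespace PinStructure

variable (φ : PinStructure (𝓡 n) M) (hj : IsLocalDiffeomorph (𝓡 n) (𝓡 n) ∞ j)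

/-- The points of the principal bundle over `j` whose frames are triangular. -/
def TriBundle : Type _ := {z : EuclideanSpace ℝ (Fin n) × φ.P // φ.proj z.2 = j z.1 ∧
  IsTri (flatFrame hj (φ.frame z.2) z.1 : EuclideanSpace ℝ (Fin n) →L[ℝ] EuclideanSpace ℝ (Fin n))}

instance : TopologicalSpace (TriBundle φ hj) := inferInstanceAs (TopologicalSpace (Subtype _))

theorem flatFrame_act (p : φ.P) (x : EuclideanSpace ℝ (Fin n)) (h : φ.proj p = j x) (g : PinPlus n)
    (v : EuclideanSpace ℝ (Fin n)) :
    flatFrame hj (φ.frame (φ.act p g)) x v = flatFrame hj (φ.frame p) x (pinRho g v) := by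
  refine flatFrame_eq hj _ x ((φ.proj_act p g).trans h) ?_
  rw [tangentMap_flatFrame hj _ x h, φ.frame_act]

theorem isTri_act_iff (p : φ.P) (x : EuclideanSpace ℝ (Fin n)) (h : φ.proj p = j x) (g : PinPlus n)
    :
    IsTri (flatFrame hj (φ.frame (φ.act p g)) x :
      EuclideanSpace ℝ (Fin n) →L[ℝ] EuclideanSpace ℝ (Fin n)) ↔
    IsTri ((flatFrame hj (φ.frame p) x :
      EuclideanSpace ℝ (Fin n) →L[ℝ] EuclideanSpace ℝ (Fin n)).comp
      (pinRho g).toContinuousLinearMap) := by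
  have : (flatFrame hj (φ.frame (φ.act p g)) x :
      EuclideanSpace ℝ (Fin n) →L[ℝ] EuclideanSpace ℝ (Fin n)) = (flatFrame hj (φ.frame p) x :
      EuclideanSpace ℝ (Fin n) →L[ℝ] EuclideanSpace ℝ (Fin n)).comp
      (pinRho g).toContinuousLinearMap := by
    ext v : 1
    exact φ.flatFrame_act hj p x h g v
  rw [this]

/-- The kernel of `ρ` does not change frames, so it acts on the points with triangular frames. The
right action of the Pin group is turned into a left action by inversion. -/
instance : MulAction (pinOrth n).ker (TriBundle φ hj) where
  smul k z := ⟨(z.1.1, φ.act z.1.2 (k⁻¹ : (pinOrth n).ker)), (φ.proj_act _ _).trans z.2.1, by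
    rw [φ.isTri_act_iff hj _ _ z.2.1]
    have hk : ∀ v, pinRho ((k⁻¹ : (pinOrth n).ker) : PinPlus n) v = v :=
      (pinOrth_eq_one_iff _).1 (k⁻¹ : (pinOrth n).ker).2
    have : (flatFrame hj (φ.frame z.1.2) z.1.1 :
      EuclideanSpace ℝ (Fin n) →L[ℝ] EuclideanSpace ℝ (Fin n)).comp
      (pinRho ((k⁻¹ : (pinOrth n).ker) : PinPlus n)).toContinuousLinearMap =
      (flatFrame hj (φ.frame z.1.2) z.1.1 :
      EuclideanSpace ℝ (Fin n) →L[ℝ] EuclideanSpace ℝ (Fin n)) := by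
      ext v : 1
      exact congrArg (flatFrame hj (φ.frame z.1.2) z.1.1) (hk v)
    rw [this]; exact z.2.2⟩
  one_smul z := by
    apply Subtype.ext
    refine Prod.ext rfl ?_
    change φ.act _ _ = _
    simp [φ.act_one]
  mul_smul k l z := by
    apply Subtype.ext
    refine Prod.ext rfl ?_
    change φ.act _ _ = φ.act (φ.act _ _) _
    rw [← φ.act_mul]; simp

/-- Every frame can be made triangular by the Gram–Schmidt process, whose orthogonal matrix lifts to
the Pin group. -/
theorem triBundle_surjective : Function.Surjective fun z : TriBundle φ hj => z.1.1 := by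
  intro x
  obtain ⟨e, hx, he⟩ := φ.exists_triv (j x)
  let p := e.toOpenPartialHomeomorph.symm (j x, 1)
  have hp : φ.proj p = j x := e.proj_symm_apply' hx
  obtain ⟨g, hg⟩ := exists_pinRho_eq (orthonormal_gramRows (flatFrame hj (φ.frame p) x))
  exact ⟨⟨(x, φ.act p g), (φ.proj_act p g).trans hp,
    (φ.isTri_act_iff hj p x hp g).2 (isTri_of_pinRho_eq_gramRows _ g hg)⟩, rfl⟩

/-- Near a point of the bundle, a local section through it is corrected by the orthogonal matrix of
the Gram–Schmidt process. That matrix is close to the identity, so it lifts to an element of the Pin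
group close to `1`. -/
theorem isOpenMap_triBundle : IsOpenMap fun z : TriBundle φ hj => z.1.1 := by
  rw [isOpenMap_iff_nhds_le]
  rintro ⟨⟨x, p⟩, hp, htri⟩ S hS
  change _ ∈ 𝓝 x
  have hp' : φ.proj p = j x := hp
  obtain ⟨W, hW, hWS⟩ := (mem_nhds_subtype _ _ _).1 hS
  change W ∈ 𝓝 (x, p) at hW
  obtain ⟨U, s, hU, hpU, hsc, hsU, hsp⟩ := φ.exists_localSection p
  rw [hp'] at hpU hsp
  have hj' : Continuous j := hj.contMDiff.continuous
  have hsj : ContinuousAt (fun y => s (j y)) x :=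
    (hsc.continuousAt (hU.mem_nhds hpU)).comp hj'.continuousAt
  have h1 : Tendsto (fun y : EuclideanSpace ℝ (Fin n) × PinPlus n => (y.1, φ.act (s (j y.1)) y.2))
      (𝓝 (x, 1)) (𝓝 (x, p)) := by
    have hc : ContinuousAt (fun y : EuclideanSpace ℝ (Fin n) × PinPlus n =>
        (y.1, φ.act (s (j y.1)) y.2)) (x, 1) := by
      refine continuousAt_fst.prodMk ?_
      refine ContinuousAt.comp (g := fun z : φ.P × PinPlus n => φ.act z.1 z.2)
        (f := fun y : EuclideanSpace ℝ (Fin n) × PinPlus n => (s (j y.1), y.2))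
        φ.continuous_act.continuousAt ?_
      exact (ContinuousAt.comp (x := (x, (1 : PinPlus n))) (f := Prod.fst) hsj
        continuousAt_fst).prodMk
        continuousAt_snd
    have := hc.tendsto
    simpa [hsp, φ.act_one] using this
  obtain ⟨A, hA, N, hN, hAN⟩ := mem_nhds_prod_iff.1 (h1 hW)
  have hV : IsOpen (j ⁻¹' U) := hU.preimage hj'
  have h2 : ContinuousOn (fun y => gramRows (flatFrame hj (φ.frame (s (j y))) y)) (j ⁻¹' U) := by
    rw [continuousOn_iff_continuous_domRestrict]
    refine continuous_gramRows (A := fun y : j ⁻¹' U => flatFrame hj (φ.frame (s (j y))) y) ?_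
    refine continuous_flatFrame hj (b := fun y : j ⁻¹' U => φ.frame (s (j y)))
      (x := fun y : j ⁻¹' U => (y : EuclideanSpace ℝ (Fin n))) continuous_subtype_val
      (fun y => hsU _ y.2) ?_
    have hs : Continuous fun y : j ⁻¹' U => s (j y) :=
      hsc.comp_continuous (hj'.comp continuous_subtype_val) fun y => y.2
    exact φ.continuous_frame.comp ((hs.comp continuous_fst).prodMk continuous_snd)
  have h3 := h2.continuousAt (hV.mem_nhds hpU)
  have h4 : gramRows (flatFrame hj (φ.frame (s (j x))) x) = fun i => euclBasis n i := by
    rw [hsp]; exact gramRows_of_isTri _ htri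
  have h5 := h3.tendsto
  rw [h4] at h5
  filter_upwards [hA, hV.mem_nhds hpU, h5.eventually (eventually_exists_pinRho_eq hN)] with y hyA
    hyU hy
  obtain ⟨g, hg, hgo⟩ := hy (orthonormal_gramRows _)
  have hyb : φ.proj (s (j y)) = j y := hsU _ hyU
  exact hWS (a := ⟨(y, φ.act (s (j y)) g), (φ.proj_act _ g).trans hyb,
    (φ.isTri_act_iff hj _ y hyb g).2 (isTri_of_pinRho_eq_gramRows _ g hgo)⟩)
      (hAN (mk_mem_prod hyA hg))

/-- Two points of the bundle over the same point of `ℝⁿ` differ by an orthogonal matrix that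
preserves triangularity and the signs of the diagonal, hence by the kernel of `ρ`. -/
theorem isQuotientCoveringMap_triBundle :
    IsQuotientCoveringMap (fun z : TriBundle φ hj => z.1.1) (pinOrth n).ker := by
  have hcont : Continuous fun z : TriBundle φ hj => z.1.1 := continuous_fst.comp
    continuous_subtype_val
  refine { (φ.isOpenMap_triBundle hj).isQuotientMap hcont (φ.triBundle_surjective hj) with
    continuous_const_smul := ?_
    apply_eq_iff_mem_orbit := ?_
    disjoint := ?_ }
  · intro k
    refine Continuous.subtype_mk ?_ _
    exact hcont.prodMk (φ.continuous_act' (continuous_snd.comp continuous_subtype_val)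
      continuous_const)
  · rintro ⟨⟨x, p⟩, hp, ht⟩ ⟨⟨x', p'⟩, hp', ht'⟩
    constructor
    · intro h
      obtain rfl : x = x' := h
      obtain ⟨g, rfl⟩ := φ.exists_act_eq ((show φ.proj p' = j x from hp').trans
        (show φ.proj p = j x from hp).symm)
      have hk : pinOrth n g = 1 := by
        rw [pinOrth_eq_one_iff]
        exact pinRho_eq_of_isTri _ ht' g ((φ.isTri_act_iff hj p' x hp' g).1 ht)
      refine ⟨⟨g⁻¹, (Subgroup.inv_mem_iff _).2 hk⟩, ?_⟩
      apply Subtype.ext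
      refine Prod.ext rfl ?_
      change φ.act p' (g⁻¹)⁻¹ = _
      rw [_root_.inv_inv]
    · rintro ⟨k, hk⟩
      rw [← hk]; rfl
  · rintro ⟨⟨x, p⟩, hp, ht⟩
    obtain ⟨e, hx, he⟩ := φ.exists_triv (φ.proj p)
    have hps : p ∈ e.source := e.mem_source.2 hx
    have h1 : Tendsto (fun z : φ.P × φ.P => (e z.1).2⁻¹ * (e z.2).2) (𝓝 (p, p)) (𝓝 1) := by
      have : ContinuousAt (fun z : φ.P × φ.P => (e z.1).2⁻¹ * (e z.2).2) (p, p) := by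
        refine ContinuousAt.mul (ContinuousAt.inv ?_) ?_
        · exact continuousAt_snd.comp (ContinuousAt.comp (x := (p, p)) (f := Prod.fst)
            (e.continuousAt hps) continuousAt_fst)
        · exact continuousAt_snd.comp (ContinuousAt.comp (x := (p, p)) (f := Prod.snd)
            (e.continuousAt hps) continuousAt_snd)
      simpa using this.tendsto
    obtain ⟨C, hC, D, hD, hCD⟩ := mem_nhds_prod_iff.1 (h1 (eventually_pinRho_ne n))
    have hcs : Continuous fun z : TriBundle φ hj => z.1.2 := continuous_snd.comp
      continuous_subtype_val
    refine ⟨(fun z : TriBundle φ hj => z.1.2) ⁻¹' (C ∩ D ∩ e.source),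
      hcs.continuousAt (inter_mem (inter_mem hC hD) (e.open_source.mem_nhds hps)), ?_⟩
    rintro k ⟨_, ⟨z, ⟨⟨hzC, -⟩, hzs⟩, rfl⟩, ⟨⟨-, hzD⟩, -⟩⟩
    have h2 := hCD (mk_mem_prod hzC hzD)
    have h3 : (e (k • z).1.2).2 = (e z.1.2).2 * (k⁻¹ : (pinOrth n).ker) := he _ hzs _
    have h4 : ((k⁻¹ : (pinOrth n).ker) : PinPlus n) = 1 := by
      have h5 : (∀ v, pinRho ((e z.1.2).2⁻¹ * (e (k • z).1.2).2) v = v) →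
        (e z.1.2).2⁻¹ * (e (k • z).1.2).2 = 1 := h2
      rw [h3, inv_mul_cancel_left] at h5
      exact h5 ((pinOrth_eq_one_iff _).1 (k⁻¹ : (pinOrth n).ker).2)
    simpa using h4

/-- Over `ℝⁿ` a Pin⁺ structure has a global section with triangular frames. -/
theorem exists_triSection : ∃ σ : EuclideanSpace ℝ (Fin n) → φ.P, Continuous σ ∧
    (∀ x, φ.proj (σ x) = j x) ∧
    ∀ x, IsTri (flatFrame hj (φ.frame (σ x)) x :
      EuclideanSpace ℝ (Fin n) →L[ℝ] EuclideanSpace ℝ (Fin n)) := by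
  obtain ⟨z₀, hz₀⟩ := φ.triBundle_surjective hj 0
  obtain ⟨F, ⟨-, hF⟩, -⟩ := (φ.isQuotientCoveringMap_triBundle
    hj).isCoveringMap.existsUnique_continuousMap_lifts
    (ContinuousMap.id _) 0 z₀ hz₀
  have hF' : ∀ x, (F x).1.1 = x := fun x => congrFun hF x
  refine ⟨fun x => (F x).1.2, continuous_snd.comp (continuous_subtype_val.comp F.continuous), ?_,
    ?_⟩
  · intro x
    have := (F x).2.1
    rwa [hF'] at this
  · intro x
    have := (F x).2.2
    rwa [hF'] at this

/-- Sections with triangular frames are determined by one value. -/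
theorem triSection_unique {σ σ' : EuclideanSpace ℝ (Fin n) → φ.P} (hσ : Continuous σ)
    (hσ' : Continuous σ') (hb : ∀ x, φ.proj (σ x) = j x) (hb' : ∀ x, φ.proj (σ' x) = j x)
    (ht : ∀ x, IsTri (flatFrame hj (φ.frame (σ x)) x :
      EuclideanSpace ℝ (Fin n) →L[ℝ] EuclideanSpace ℝ (Fin n)))
    (ht' : ∀ x, IsTri (flatFrame hj (φ.frame (σ' x)) x :
      EuclideanSpace ℝ (Fin n) →L[ℝ] EuclideanSpace ℝ (Fin n)))
    (x₀ : EuclideanSpace ℝ (Fin n)) (h : σ x₀ = σ' x₀) : σ = σ' := by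
  let F : EuclideanSpace ℝ (Fin n) → TriBundle φ hj := fun x => ⟨(x, σ x), hb x, ht x⟩
  let F' : EuclideanSpace ℝ (Fin n) → TriBundle φ hj := fun x => ⟨(x, σ' x), hb' x, ht' x⟩
  have hFF' : F = F' := (φ.isQuotientCoveringMap_triBundle hj).isCoveringMap.eq_of_comp_eq
    ((continuous_id.prodMk hσ).subtype_mk _) ((continuous_id.prodMk hσ').subtype_mk _) rfl x₀
    (Subtype.ext (Prod.ext rfl h))
  funext x
  exact congrArg (fun z : TriBundle φ hj => z.1.2) (congrFun hFF' x)

end PinStructure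

end flat

/-! ### Gluing Pin⁺ structures -/

section gluing

variable {n : ℕ} {H : Type*} [TopologicalSpace H]
  {I : ModelWithCorners ℝ (EuclideanSpace ℝ (Fin n)) H}

theorem TangentFrame.ext_vec {M : Type*} [TopologicalSpace M] [ChartedSpace H M]
    {b b' : TangentFrame I M} (h : ∀ v, b.vec v = b'.vec v) : b = b' := by
  obtain ⟨x, e⟩ := b
  obtain ⟨x', e'⟩ := b'
  obtain rfl : x = x' := congrArg Bundle.TotalSpace.proj (h 0)
  congr 1
  refine ContinuousLinearEquiv.ext (funext fun v => ?_)
  exact eq_of_heq (Bundle.TotalSpace.mk.inj (h v)).2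

/-- Continuity can be tested after composition with an open map. -/
theorem continuousAt_of_comp_isOpenMap {X Y Z : Type*} [TopologicalSpace X] [TopologicalSpace Y]
    [TopologicalSpace Z] {f : X → Y} {g : Y → Z} (hf : IsOpenMap f) (hg : Continuous (g ∘ f))
      (x : X) :
    ContinuousAt g (f x) := by
  intro V hV
  have h1 : (g ∘ f) ⁻¹' V ∈ 𝓝 x := hg.continuousAt hV
  refine mem_map.2 (mem_of_superset (hf.image_mem_nhds h1) ?_)
  rintro _ ⟨y, hy, rfl⟩
  exact hy

variable {A B Q : Type*} [TopologicalSpace A] [ChartedSpace H A] [IsManifold I ∞ A]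
  [TopologicalSpace B] [ChartedSpace H B] [IsManifold I ∞ B]
  [TopologicalSpace Q] [ChartedSpace H Q] [IsManifold I ∞ Q]

/-- Data for gluing Pin⁺ structures on two open pieces `a : A → Q`, `b : B → Q` of a manifold `Q`:
an identification of the principal bundles over the overlap, parametrized by a space `X`, and a
homotopy `G` between the two families of frames there. The function `χ` is the time at which the
homotopy is stopped. -/
structure PinGluing (φA : PinStructure.{u} I A) (φB : PinStructure.{u} I B) (a : A → Q) (b : B → Q)
    (X : Type*) [TopologicalSpace X] where
  isLocalDiffeomorph_left : IsLocalDiffeomorph I I ∞ a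
  isLocalDiffeomorph_right : IsLocalDiffeomorph I I ∞ b
  injective_left : Function.Injective a
  injective_right : Function.Injective b
  cover : ∀ q, q ∈ range a ∨ q ∈ range b
  r : X → PinPlus n → X
  α : X → φA.P
  β : X → φB.P
  continuous_α : Continuous α
  continuous_β : Continuous β
  isOpenMap_α : IsOpenMap α
  isOpenMap_β : IsOpenMap β
  α_r : ∀ x g, α (r x g) = φA.act (α x) g
  β_r : ∀ x g, β (r x g) = φB.act (β x) g
  base_eq : ∀ x, a (φA.proj (α x)) = b (φB.proj (β x))
  α_eq_iff : ∀ x x', α x = α x' ↔ β x = β x'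
  mem_range_α : ∀ p, a (φA.proj p) ∈ range b → p ∈ range α
  mem_range_β : ∀ p, b (φB.proj p) ∈ range a → p ∈ range β
  G : unitInterval → X → TangentFrame I Q
  continuous_G : Continuous fun z : (unitInterval × X) × EuclideanSpace ℝ (Fin n) =>
    (G z.1.1 z.1.2).vec z.2
  base_G : ∀ t x, (G t x).base = a (φA.proj (α x))
  G_r : ∀ t x g v, (G t (r x g)).vec v = (G t x).vec (pinRho g v)
  G_eq : ∀ t x x', α x = α x' → G t x = G t x'
  G_zero : ∀ x v, (G 0 x).vec v = tangentMap I I a ((φA.frame (α x)).vec v)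
  G_one : ∀ x v, (G 1 x).vec v = tangentMap I I b ((φB.frame (β x)).vec v)
  χ : Q → unitInterval
  continuous_χ : Continuous χ
  χ_zero : ∀ q ∉ range b, ∀ᶠ q' in 𝓝 q, χ q' = 0
  χ_one : ∀ q ∉ range a, ∀ᶠ q' in 𝓝 q, χ q' = 1

namespace PinGluing

variable {φA : PinStructure.{u} I A} {φB : PinStructure.{u} I B} {a : A → Q} {b : B → Q}
  {X : Type*} [TopologicalSpace X] (D : PinGluing φA φB a b X)

/-- The same data with the two pieces exchanged. -/
def swap : PinGluing φB φA b a X where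
  isLocalDiffeomorph_left := D.isLocalDiffeomorph_right
  isLocalDiffeomorph_right := D.isLocalDiffeomorph_left
  injective_left := D.injective_right
  injective_right := D.injective_left
  cover q := (D.cover q).symm
  r := D.r
  α := D.β
  β := D.α
  continuous_α := D.continuous_β
  continuous_β := D.continuous_α
  isOpenMap_α := D.isOpenMap_β
  isOpenMap_β := D.isOpenMap_α
  α_r := D.β_r
  β_r := D.α_r
  base_eq x := (D.base_eq x).symm
  α_eq_iff x x' := (D.α_eq_iff x x').symm
  mem_range_α := D.mem_range_β
  mem_range_β := D.mem_range_α
  G t := D.G (unitInterval.symm t)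
  continuous_G := D.continuous_G.comp
    (((unitInterval.continuous_symm.comp (continuous_fst.comp continuous_fst)).prodMk
      (continuous_snd.comp continuous_fst)).prodMk continuous_snd)
  base_G t x := (D.base_G _ x).trans (D.base_eq x)
  G_r t := D.G_r _
  G_eq t x x' h := D.G_eq _ x x' ((D.α_eq_iff x x').2 h)
  G_zero x v := by rw [unitInterval.symm_zero]; exact D.G_one x v
  G_one x v := by rw [unitInterval.symm_one]; exact D.G_zero x v
  χ q := unitInterval.symm (D.χ q)
  continuous_χ := unitInterval.continuous_symm.comp D.continuous_χ
  χ_zero q hq := (D.χ_one q hq).mono fun q' h => by rw [h, unitInterval.symm_one]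
  χ_one q hq := (D.χ_zero q hq).mono fun q' h => by rw [h, unitInterval.symm_zero]

open Classical in
/-- The frames on the first piece, with the homotopy run up to the time `s * χ`. -/
def cutFrame (s : unitInterval) (p : φA.P) : TangentFrame I Q :=
  if h : ∃ x, D.α x = p then D.G (s * D.χ (a (φA.proj p))) h.choose
  else (φA.frame p).map D.isLocalDiffeomorph_left

theorem cutFrame_α (s : unitInterval) (x : X) :
    D.cutFrame s (D.α x) = D.G (s * D.χ (a (φA.proj (D.α x)))) x := by
  have h : ∃ x', D.α x' = D.α x := ⟨x, rfl⟩
  rw [cutFrame, dif_pos h]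
  exact D.G_eq _ _ _ h.choose_spec

theorem cutFrame_of_notMem (s : unitInterval) {p : φA.P} (h : p ∉ range D.α) :
    D.cutFrame s p = (φA.frame p).map D.isLocalDiffeomorph_left := dif_neg h

theorem cutFrame_of_χ_eq_zero (s : unitInterval) {p : φA.P} (h : s * D.χ (a (φA.proj p)) = 0) :
    D.cutFrame s p = (φA.frame p).map D.isLocalDiffeomorph_left := by
  by_cases hp : p ∈ range D.α
  · obtain ⟨x, rfl⟩ := hp
    rw [cutFrame_α, h]
    exact TangentFrame.ext_vec (D.G_zero x)
  · exact D.cutFrame_of_notMem s hp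

theorem base_cutFrame (s : unitInterval) (p : φA.P) :
    (D.cutFrame s p).base = a (φA.proj p) := by
  by_cases hp : p ∈ range D.α
  · obtain ⟨x, rfl⟩ := hp
    rw [cutFrame_α]; exact D.base_G _ x
  · rw [D.cutFrame_of_notMem s hp]; rfl

theorem cutFrame_act (s : unitInterval) (p : φA.P) (g : PinPlus n) (v : EuclideanSpace ℝ (Fin n)) :
    (D.cutFrame s (φA.act p g)).vec v = (D.cutFrame s p).vec (pinRho g v) := by
  by_cases hp : p ∈ range D.α
  · obtain ⟨x, rfl⟩ := hp
    rw [← D.α_r, cutFrame_α, cutFrame_α, D.G_r, D.α_r, φA.proj_act]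
  · have hp' : φA.act p g ∉ range D.α := by
      rintro ⟨x, hx⟩
      exact hp ⟨D.r x g⁻¹, by rw [D.α_r, hx, φA.act_inv_act]⟩
    rw [D.cutFrame_of_notMem s hp, D.cutFrame_of_notMem s hp', TangentFrame.vec_map,
      TangentFrame.vec_map, φA.frame_act]

/-- Over the overlap continuity is tested after composition with the open map `α`. Near the other
points the cutoff vanishes, and the frames are those of `φA`. -/
theorem continuous_cutFrame :
    Continuous fun z : (unitInterval × φA.P) × EuclideanSpace ℝ (Fin n) =>
      (D.cutFrame z.1.1 z.1.2).vec z.2 := by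
  have hca : Continuous a := D.isLocalDiffeomorph_left.contMDiff.continuous
  have hq : Continuous fun p => a (φA.proj p) := hca.comp φA.continuous_proj
  rw [continuous_iff_continuousAt]
  rintro ⟨⟨s, p⟩, v⟩
  by_cases hp : p ∈ range D.α
  · obtain ⟨x, rfl⟩ := hp
    let f : (unitInterval × X) × EuclideanSpace ℝ (Fin n) →
        (unitInterval × φA.P) × EuclideanSpace ℝ (Fin n) :=
      Prod.map (Prod.map id D.α) id
    have hf : IsOpenMap f := (IsOpenMap.id.prodMap D.isOpenMap_α).prodMap IsOpenMap.id
    refine continuousAt_of_comp_isOpenMap hf ?_ ((s, x), v)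
    have h : Continuous fun z : (unitInterval × X) × EuclideanSpace ℝ (Fin n) =>
        (D.G (z.1.1 * D.χ (a (φA.proj (D.α z.1.2)))) z.1.2).vec z.2 := by
      refine D.continuous_G.comp ((Continuous.prodMk ?_ (continuous_snd.comp continuous_fst)).prodMk
        continuous_snd)
      exact (continuous_fst.comp continuous_fst).mul (D.continuous_χ.comp (hq.comp
        (D.continuous_α.comp (continuous_snd.comp continuous_fst))))
    refine h.congr fun z => ?_
    exact congrArg (fun b : TangentFrame I Q => b.vec z.2) (D.cutFrame_α z.1.1 z.1.2).symm
  · have h0 : a (φA.proj p) ∉ range b := fun h => hp (D.mem_range_α p h)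
    have h1 : Continuous fun z : (unitInterval × φA.P) × EuclideanSpace ℝ (Fin n) =>
        tangentMap I I a ((φA.frame z.1.2).vec z.2) :=
      (D.isLocalDiffeomorph_left.contMDiff.continuous_tangentMap (by simp)).comp
        (φA.continuous_frame.comp ((continuous_snd.comp continuous_fst).prodMk continuous_snd))
    refine h1.continuousAt.congr ?_
    have h2 : Tendsto (fun z : (unitInterval × φA.P) × EuclideanSpace ℝ (Fin n) =>
        a (φA.proj z.1.2)) (𝓝 ((s, p), v)) (𝓝 (a (φA.proj p))) :=
      (hq.comp (continuous_snd.comp continuous_fst)).continuousAt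
    filter_upwards [h2.eventually (D.χ_zero _ h0)] with z hz
    rw [D.cutFrame_of_χ_eq_zero z.1.1 (by rw [hz, mul_zero])]
    rfl

/-- The relation that identifies `α x` with `β x`. -/
def rel : φA.P ⊕ φB.P → φA.P ⊕ φB.P → Prop
  | .inl p, .inl p' => p = p'
  | .inl p, .inr q => ∃ x, D.α x = p ∧ D.β x = q
  | .inr q, .inl p => ∃ x, D.α x = p ∧ D.β x = q
  | .inr q, .inr q' => q = q'

/-- The equivalence relation whose quotient is the glued principal bundle. -/
def setoid : Setoid (φA.P ⊕ φB.P) where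
  r := D.rel
  iseqv := by
    refine ⟨?_, ?_, ?_⟩
    · rintro (p | p) <;> rfl
    · rintro (p | p) (q | q) h
      · exact Eq.symm h
      · exact h
      · exact h
      · exact Eq.symm h
    · rintro (p | p) (q | q) (q' | q') h h'
      · exact Eq.trans h h'
      · obtain rfl : p = q := h
        exact h'
      · obtain ⟨x, rfl, rfl⟩ := h
        obtain ⟨y, rfl, hy⟩ := h'
        exact ((D.α_eq_iff x y).2 hy.symm)
      · obtain rfl : q = q' := h'
        exact h
      · obtain rfl : q = q' := h'
        exact h
      · obtain ⟨x, rfl, rfl⟩ := h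
        obtain ⟨y, hy, rfl⟩ := h'
        exact ((D.α_eq_iff x y).1 hy.symm)
      · obtain rfl : p = q := h
        exact h'
      · exact Eq.trans h h'

/-- The glued principal bundle. -/
def Total : Type u := Quotient D.setoid

instance : TopologicalSpace D.Total := inferInstanceAs (TopologicalSpace (Quotient D.setoid))

/-- The inclusion of the first bundle. -/
def inl (p : φA.P) : D.Total := Quotient.mk D.setoid (.inl p)

/-- The inclusion of the second bundle. -/
def inr (q : φB.P) : D.Total := Quotient.mk D.setoid (.inr q)

theorem inl_α (x : X) : D.inl (D.α x) = D.inr (D.β x) :=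
  Quotient.sound (s := D.setoid) ⟨x, rfl, rfl⟩

theorem continuous_inl : Continuous D.inl := continuous_quotient_mk'.comp _root_.continuous_inl
theorem continuous_inr : Continuous D.inr := continuous_quotient_mk'.comp _root_.continuous_inr

theorem total_induction {C : D.Total → Prop} (hl : ∀ p, C (D.inl p)) (hr : ∀ q, C (D.inr q)) (t) :
    C t := by
  obtain ⟨p | q⟩ := t
  · exact hl p
  · exact hr q

theorem isOpen_total_iff (S : Set D.Total) :
    IsOpen S ↔ IsOpen (D.inl ⁻¹' S) ∧ IsOpen (D.inr ⁻¹' S) := by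
  exact (isQuotientMap_quotient_mk' (s := D.setoid)).isOpen_preimage.symm.trans isOpen_sum_iff

theorem isOpenEmbedding_inl : IsOpenEmbedding D.inl := by
  refine .of_continuous_injective_isOpenMap D.continuous_inl ?_ ?_
  · intro p q h
    exact Quotient.exact (s := D.setoid) h
  · intro S hS
    rw [isOpen_total_iff]
    constructor
    · convert hS
      ext p
      constructor
      · rintro ⟨q, hq, h⟩
        obtain rfl : q = p := Quotient.exact (s := D.setoid) h
        exact hq
      · intro hp; exact ⟨p, hp, rfl⟩
    · convert D.isOpenMap_β _ (hS.preimage D.continuous_α)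
      ext q
      constructor
      · rintro ⟨p, hp, h⟩
        obtain ⟨x, rfl, rfl⟩ : ∃ x, D.α x = p ∧ D.β x = q := Quotient.exact (s := D.setoid) h
        exact ⟨x, hp, rfl⟩
      · rintro ⟨x, hx, rfl⟩
        exact ⟨D.α x, hx, D.inl_α x⟩

theorem isOpenEmbedding_inr : IsOpenEmbedding D.inr := by
  refine .of_continuous_injective_isOpenMap D.continuous_inr ?_ ?_
  · intro p q h
    exact Quotient.exact (s := D.setoid) h
  · intro S hS
    rw [isOpen_total_iff]
    constructor
    · convert D.isOpenMap_α _ (hS.preimage D.continuous_β)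
      ext p
      constructor
      · rintro ⟨q, hq, h⟩
        obtain ⟨x, rfl, rfl⟩ : ∃ x, D.α x = p ∧ D.β x = q := Quotient.exact (s := D.setoid) h.symm
        exact ⟨x, hq, rfl⟩
      · rintro ⟨x, hx, rfl⟩
        exact ⟨D.β x, hx, (D.inl_α x).symm⟩
    · convert hS
      ext p
      constructor
      · rintro ⟨q, hq, h⟩
        obtain rfl : q = p := Quotient.exact (s := D.setoid) h
        exact hq
      · intro hp; exact ⟨p, hp, rfl⟩

/-- A map out of the glued bundle. -/
def lift {Y : Type*} (f : φA.P → Y) (g : φB.P → Y) (h : ∀ x, f (D.α x) = g (D.β x)) : D.Total → Y :=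
  Quotient.lift (Sum.elim f g) (by
    rintro (p | p) (q | q) hpq
    · exact congrArg f hpq
    · obtain ⟨x, rfl, rfl⟩ := hpq
      exact h x
    · obtain ⟨x, rfl, rfl⟩ := hpq
      exact (h x).symm
    · exact congrArg g hpq)

theorem continuous_of_inl_inr {Y Z : Type*} [TopologicalSpace Y] [TopologicalSpace Z]
    {f : D.Total × Y → Z} (hl : Continuous fun z : φA.P × Y => f (D.inl z.1, z.2))
    (hr : Continuous fun z : φB.P × Y => f (D.inr z.1, z.2)) : Continuous f := by
  rw [continuous_iff_continuousAt]
  rintro ⟨t, y⟩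
  induction t using D.total_induction with
  | hl p =>
    exact continuousAt_of_comp_isOpenMap (f := Prod.map D.inl id)
      (D.isOpenEmbedding_inl.isOpenMap.prodMap IsOpenMap.id) hl (p, y)
  | hr p =>
    exact continuousAt_of_comp_isOpenMap (f := Prod.map D.inr id)
      (D.isOpenEmbedding_inr.isOpenMap.prodMap IsOpenMap.id) hr (p, y)

/-- The frames of the glued structure. -/
def frame : D.Total → TangentFrame I Q :=
  D.lift (D.cutFrame 1) (D.swap.cutFrame 1) fun x => by
    have h := D.swap.cutFrame_α 1 x
    rw [D.cutFrame_α, show D.β x = D.swap.α x from rfl, h]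
    change _ = D.G (unitInterval.symm (1 * unitInterval.symm (D.χ (b (φB.proj (D.β x)))))) x
    rw [one_mul, one_mul, unitInterval.symm_symm, D.base_eq]

/-- The glued Pin⁺ structure. -/
def glued : PinStructure.{u} I Q where
  P := D.Total
  act t g := D.lift (fun p => D.inl (φA.act p g)) (fun q => D.inr (φB.act q g))
    (fun x => by rw [← D.α_r, ← D.β_r, D.inl_α]) t
  act_one t := by
    induction t using D.total_induction with
    | hl p => exact congrArg D.inl (φA.act_one p)
    | hr p => exact congrArg D.inr (φB.act_one p)
  act_mul t g h := by
    induction t using D.total_induction with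
    | hl p => exact congrArg D.inl (φA.act_mul p g h)
    | hr p => exact congrArg D.inr (φB.act_mul p g h)
  continuous_act := D.continuous_of_inl_inr (D.continuous_inl.comp φA.continuous_act)
    (D.continuous_inr.comp φB.continuous_act)
  frame := D.frame
  continuous_frame := D.continuous_of_inl_inr
    (D.continuous_cutFrame.comp ((continuous_const.prodMk continuous_fst).prodMk continuous_snd))
    (D.swap.continuous_cutFrame.comp
      ((continuous_const.prodMk continuous_fst).prodMk continuous_snd))
  frame_act t g v := by
    induction t using D.total_induction with
    | hl p => exact D.cutFrame_act 1 p g v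
    | hr p => exact D.swap.cutFrame_act 1 p g v
  locally_trivial q := by
    rcases D.cover q with ⟨x, rfl⟩ | ⟨x, rfl⟩
    · obtain ⟨e, hx, he⟩ := φA.exists_triv x
      obtain ⟨e', hx', hs, he'⟩ := PinStructure.exists_trivialization_push
        (π' := fun t : D.Total => (D.frame t).base)
        (.of_continuous_injective_isOpenMap D.isLocalDiffeomorph_left.contMDiff.continuous
          D.injective_left D.isLocalDiffeomorph_left.isOpenMap) D.isOpenEmbedding_inl
        (fun p => D.base_cutFrame 1 p) (by
          intro t ht
          induction t using D.total_induction with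
          | hl p => exact ⟨p, rfl⟩
          | hr p =>
            have h2 : (D.frame (D.inr p)).base = b (φB.proj p) := D.swap.base_cutFrame 1 p
            rw [h2] at ht
            obtain ⟨y, rfl⟩ := D.mem_range_β p ht
            exact ⟨D.α y, D.inl_α y⟩) e x hx
      refine ⟨e', hx', ?_⟩
      intro p hp g
      rw [hs] at hp
      obtain ⟨p, hp, rfl⟩ := hp
      rw [he', ← he p hp g]
      exact he' _
    · obtain ⟨e, hx, he⟩ := φB.exists_triv x
      obtain ⟨e', hx', hs, he'⟩ := PinStructure.exists_trivialization_push
        (π' := fun t : D.Total => (D.frame t).base)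
        (.of_continuous_injective_isOpenMap D.isLocalDiffeomorph_right.contMDiff.continuous
          D.injective_right D.isLocalDiffeomorph_right.isOpenMap) D.isOpenEmbedding_inr
        (fun p => D.swap.base_cutFrame 1 p) (by
          intro t ht
          induction t using D.total_induction with
          | hr p => exact ⟨p, rfl⟩
          | hl p =>
            have h2 : (D.frame (D.inl p)).base = a (φA.proj p) := D.base_cutFrame 1 p
            rw [h2] at ht
            obtain ⟨y, rfl⟩ := D.mem_range_α p ht
            exact ⟨D.β y, (D.inl_α y).symm⟩) e x hx
      refine ⟨e', hx', ?_⟩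
      intro p hp g
      rw [hs] at hp
      obtain ⟨p, hp, rfl⟩ := hp
      rw [he', ← he p hp g]
      exact he' _

/-- The homotopy run backwards shows that the glued structure restricts to the given one. -/
theorem preserves_left : φA.Preserves D.glued a := by
  refine ⟨D.inl, fun t p => D.cutFrame (unitInterval.symm t) p, D.continuous_inl, fun p g => rfl,
    ?_,
    ?_, ?_, ?_, ?_⟩
  · exact D.continuous_cutFrame.comp (((unitInterval.continuous_symm.comp continuous_fst).prodMk
      (continuous_fst.comp continuous_snd)).prodMk (continuous_snd.comp continuous_snd))
  · intro t p
    exact (D.base_cutFrame _ p).trans (D.base_cutFrame 1 p).symm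
  · intro t p g v
    exact D.cutFrame_act _ p g v
  · intro p v
    change (D.cutFrame (unitInterval.symm 0) p).vec v = _
    rw [unitInterval.symm_zero]; rfl
  · intro p v
    change (D.cutFrame (unitInterval.symm 1) p).vec v = _
    rw [unitInterval.symm_one, D.cutFrame_of_χ_eq_zero 0 (by rw [zero_mul])]
    rfl

theorem preserves_right : φB.Preserves D.glued b := by
  refine ⟨D.inr, fun t p => D.swap.cutFrame (unitInterval.symm t) p, D.continuous_inr,
    fun p g => rfl, ?_, ?_, ?_, ?_, ?_⟩
  · exact D.swap.continuous_cutFrame.comp (((unitInterval.continuous_symm.comp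
      continuous_fst).prodMk
      (continuous_fst.comp continuous_snd)).prodMk (continuous_snd.comp continuous_snd))
  · intro t p
    exact (D.swap.base_cutFrame _ p).trans (D.swap.base_cutFrame 1 p).symm
  · intro t p g v
    exact D.swap.cutFrame_act _ p g v
  · intro p v
    change (D.swap.cutFrame (unitInterval.symm 0) p).vec v = _
    rw [unitInterval.symm_zero]; rfl
  · intro p v
    change (D.swap.cutFrame (unitInterval.symm 1) p).vec v = _
    rw [unitInterval.symm_one, D.swap.cutFrame_of_χ_eq_zero 0 (by rw [zero_mul])]
    rfl

end PinGluing

end gluing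

/-! ### Pulling back and gluing along sections -/

section pullback

variable {n : ℕ} {H H' : Type*} [TopologicalSpace H] [TopologicalSpace H']
  {I : ModelWithCorners ℝ (EuclideanSpace ℝ (Fin n)) H}
  {J : ModelWithCorners ℝ (EuclideanSpace ℝ (Fin n)) H'}

/-- The frame `b` composed with an automorphism of `ℝⁿ`. -/
def TangentFrame.precomp {M : Type*} [TopologicalSpace M] [ChartedSpace H M] (b : TangentFrame I M)
    (A : EuclideanSpace ℝ (Fin n) ≃L[ℝ] EuclideanSpace ℝ (Fin n)) : TangentFrame I M :=
  ⟨b.base, A.trans b.iso⟩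

@[simp] theorem TangentFrame.vec_precomp {M : Type*} [TopologicalSpace M] [ChartedSpace H M]
    (b : TangentFrame I M) (A : EuclideanSpace ℝ (Fin n) ≃L[ℝ] EuclideanSpace ℝ (Fin n)) (v) :
    (b.precomp A).vec v = b.vec (A v) := rfl

/-- `ρ(g)` as a continuous linear equivalence. -/
def pinRhoEquiv (g : PinPlus n) : EuclideanSpace ℝ (Fin n) ≃L[ℝ] EuclideanSpace ℝ (Fin n) :=
  equivOfInjective (pinRho g).toContinuousLinearMap (pinRho_injective g)

@[simp] theorem pinRhoEquiv_apply (g : PinPlus n) (v : EuclideanSpace ℝ (Fin n)) :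
    pinRhoEquiv g v = pinRho g v := rfl

namespace PinStructure

variable {M N : Type u} [TopologicalSpace M] [ChartedSpace H M] [IsManifold I ∞ M]
  [TopologicalSpace N] [ChartedSpace H' N] [IsManifold J ∞ N]

/-- The pullback of a Pin⁺ structure along a local diffeomorphism. -/
def pullback (φ : PinStructure.{u} J N) {f : M → N} (hf : IsLocalDiffeomorph I J ∞ f) :
    PinStructure.{u} I M where
  P := {z : M × φ.P // f z.1 = φ.proj z.2}
  act z g := ⟨(z.1.1, φ.act z.1.2 g), z.2.trans (φ.proj_act _ _).symm⟩
  act_one z := Subtype.ext (Prod.ext rfl (φ.act_one _))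
  act_mul z g h := Subtype.ext (Prod.ext rfl (φ.act_mul _ g h))
  continuous_act := by
    refine Continuous.subtype_mk ?_ _
    have h : Continuous fun z : {z : M × φ.P // f z.1 = φ.proj z.2} × PinPlus n => z.1.1 :=
      continuous_subtype_val.comp continuous_fst
    exact (continuous_fst.comp h).prodMk (φ.continuous_act' (continuous_snd.comp h) continuous_snd)
  frame z := (φ.frame z.1.2).comap hf z.1.1
  continuous_frame := by
    have h : Continuous fun z : {z : M × φ.P // f z.1 = φ.proj z.2} × EuclideanSpace ℝ (Fin n) =>
      z.1.1 :=
      continuous_subtype_val.comp continuous_fst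
    refine continuous_of_tangentMap hf (continuous_fst.comp h) ?_
    have h2 := φ.continuous_frame.comp ((continuous_snd.comp h).prodMk continuous_snd)
    refine h2.congr fun z => ?_
    exact (TangentFrame.tangentMap_vec_comap hf _ z.1.1.1 z.1.2.symm z.2).symm
  frame_act z g v := by
    refine tangentMap_injOn_fiber hf rfl ?_
    rw [TangentFrame.tangentMap_vec_comap hf _ _ z.2.symm, TangentFrame.tangentMap_vec_comap hf _ _
      ((φ.proj_act _ _).trans z.2.symm), φ.frame_act]
  locally_trivial x := by
    obtain ⟨e, hx, he⟩ := φ.exists_triv (f x)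
    have hfc : Continuous f := hf.contMDiff.continuous
    have hsymm : ∀ y, f y ∈ e.baseSet → φ.proj (e.toOpenPartialHomeomorph.symm (f y, 1)) = f y :=
      fun y hy => e.proj_symm_apply' hy
    classical
    obtain ⟨p₀, hp₀⟩ : ∃ p, φ.proj p = f x := ⟨_, hsymm x hx⟩
    let s : M → {z : M × φ.P // f z.1 = φ.proj z.2} := fun y =>
      if h : f y ∈ e.baseSet then ⟨(y, e.toOpenPartialHomeomorph.symm (f y, 1)), (hsymm y h).symm⟩
      else ⟨(x, p₀), hp₀.symm⟩
    have hs : ∀ y, ∀ h : f y ∈ e.baseSet,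
        s y = ⟨(y, e.toOpenPartialHomeomorph.symm (f y, 1)), (hsymm y h).symm⟩ := fun y h =>
          dif_pos h
    have hsc : ContinuousOn s (f ⁻¹' e.baseSet) := by
      refine (Topology.IsInducing.subtypeVal
        (t := {z : M × φ.P | f z.1 = φ.proj z.2})).continuousOn_iff.2 ?_
      have h1 : ContinuousOn (fun y => (y, e.toOpenPartialHomeomorph.symm (f y, 1)))
        (f ⁻¹' e.baseSet) := by
        refine continuousOn_id.prodMk ?_
        refine e.toOpenPartialHomeomorph.continuousOn_symm.comp
          (f := fun y => (f y, (1 : PinPlus n))) (by fun_prop) ?_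
        intro y hy
        rw [e.target_eq]; exact ⟨hy, trivial⟩
      refine h1.congr fun y hy => ?_
      simp only [Function.comp, hs y hy]
    have h1 : Continuous fun z : {z : M × φ.P // f z.1 = φ.proj z.2} => z.1.1 :=
      continuous_fst.comp continuous_subtype_val
    have h2 : Continuous fun z : {z : M × φ.P // f z.1 = φ.proj z.2} => z.1.2 :=
      continuous_snd.comp continuous_subtype_val
    have hmem : ∀ z : {z : M × φ.P // f z.1 = φ.proj z.2}, f z.1.1 ∈ e.baseSet → z.1.2 ∈ e.source :=
      fun z hz => e.mem_source.2 (by rw [← z.2]; exact hz)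
    have hes : ∀ y, f y ∈ e.baseSet → e (e.toOpenPartialHomeomorph.symm (f y, 1)) = (f y, 1) :=
      fun y hy => e.apply_symm_apply' hy
    have hss : ∀ y, f y ∈ e.baseSet → e.toOpenPartialHomeomorph.symm (f y, 1) ∈ e.source :=
      fun y hy => e.mem_source.2 (by rw [hsymm y hy]; exact hy)
    refine ⟨trivializationOfSection (fun z => z.1.1)
      (fun z g => ⟨(z.1.1, φ.act z.1.2 g), z.2.trans (φ.proj_act _ _).symm⟩) ?_ h1 (fun _ _ => rfl)
      (f ⁻¹' e.baseSet) (e.open_baseSet.preimage hfc) s hsc ?_ (fun z => (e z.1.2).2) ?_ ?_ ?_, hx,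
        ?_⟩
    · refine Continuous.subtype_mk ?_ _
      exact (h1.comp continuous_fst).prodMk (φ.continuous_act' (h2.comp continuous_fst)
        continuous_snd)
    · intro y hy
      rw [hs y hy]
    · exact continuous_snd.comp_continuousOn (e.toOpenPartialHomeomorph.continuousOn.comp
        (t := e.source)
        h2.continuousOn fun z hz => hmem z hz)
    · intro z hz
      have hz' : f z.1.1 ∈ e.baseSet := hz
      rw [hs z.1.1 hz']
      apply Subtype.ext
      refine Prod.ext rfl ?_
      refine φ.eq_of_triv e (φ.mem_source_act e (hss _ hz') _) ?_ ?_
      · rw [proj_act, hsymm _ hz', z.2]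
      · rw [he _ (hss _ hz'), hes _ hz', one_mul]
    · intro y hy g
      rw [hs y hy]
      change (e (φ.act (e.toOpenPartialHomeomorph.symm (f y, 1)) g)).2 = g
      rw [he _ (hss y hy), hes y hy, one_mul]
    · intro z hz g
      exact he _ (hmem z hz) g

theorem pullback_preserves (φ : PinStructure.{u} J N) {f : M → N} (hf : IsLocalDiffeomorph I J ∞ f)
    :
    (φ.pullback hf).Preserves φ f := by
  refine ⟨fun z => z.1.2, fun _ z => φ.frame z.1.2, continuous_snd.comp continuous_subtype_val,
    fun z g => rfl, ?_, fun _ _ => rfl, fun _ z g v => φ.frame_act _ g v, fun _ _ => rfl, ?_⟩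
  · exact φ.continuous_frame.comp (((continuous_snd.comp continuous_subtype_val).comp
      (continuous_fst.comp continuous_snd)).prodMk (continuous_snd.comp continuous_snd))
  · intro z v
    exact (TangentFrame.tangentMap_vec_comap hf _ z.1.1 z.2.symm v).symm

end PinStructure

end pullback

section sections

variable {n : ℕ} {H : Type*} [TopologicalSpace H]
  {I : ModelWithCorners ℝ (EuclideanSpace ℝ (Fin n)) H}
  {A B Q : Type*} [TopologicalSpace A] [ChartedSpace H A] [IsManifold I ∞ A]
  [TopologicalSpace B] [ChartedSpace H B] [IsManifold I ∞ B]
  [TopologicalSpace Q] [ChartedSpace H Q] [IsManifold I ∞ Q]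

/-- The function equal to `1` for `s ≤ 1/2` and to `0` for `s ≥ 2`. -/
def cutoff (s : ℝ) : unitInterval := projIcc 0 1 zero_le_one ((2 - s) * (2 / 3))

theorem continuous_cutoff : Continuous cutoff := by unfold cutoff; fun_prop

theorem cutoff_of_ge {s : ℝ} (h : 2 ≤ s) : cutoff s = 0 :=
  projIcc_of_le_left _ (by nlinarith)

theorem cutoff_of_le {s : ℝ} (h : s ≤ 1 / 2) : cutoff s = 1 :=
  projIcc_of_right_le _ (by nlinarith)

/-- Two Pin⁺ structures with sections `h₁`, `h₂` over a space `Y` covering the overlap of the two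
pieces, and a homotopy `γ` between the frames of these sections that is compatible with the
identifications of points of `Y`. The function `s` measures the position in the overlap. -/
structure SectionGluing (φA : PinStructure.{u} I A) (φB : PinStructure.{u} I B) (a : A → Q)
    (b : B → Q) (Y : Type*) [TopologicalSpace Y] where
  isLocalDiffeomorph_left : IsLocalDiffeomorph I I ∞ a
  isLocalDiffeomorph_right : IsLocalDiffeomorph I I ∞ b
  injective_left : Function.Injective a
  injective_right : Function.Injective b
  cover : ∀ q, q ∈ range a ∨ q ∈ range b
  κ₁ : Y → A
  κ₂ : Y → B
  isOpenMap_κ₁ : IsOpenMap κ₁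
  isOpenMap_κ₂ : IsOpenMap κ₂
  a_κ₁ : ∀ y, a (κ₁ y) = b (κ₂ y)
  mem_range_κ₁ : ∀ p, a p ∈ range b → p ∈ range κ₁
  mem_range_κ₂ : ∀ p, b p ∈ range a → p ∈ range κ₂
  h₁ : Y → φA.P
  h₂ : Y → φB.P
  continuous_h₁ : Continuous h₁
  continuous_h₂ : Continuous h₂
  proj_h₁ : ∀ y, φA.proj (h₁ y) = κ₁ y
  proj_h₂ : ∀ y, φB.proj (h₂ y) = κ₂ y
  γ : unitInterval → Y → TangentFrame I Q
  continuous_γ : Continuous fun z : (unitInterval × Y) × EuclideanSpace ℝ (Fin n) =>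
    (γ z.1.1 z.1.2).vec z.2
  base_γ : ∀ t y, (γ t y).base = a (κ₁ y)
  γ_zero : ∀ y v, (γ 0 y).vec v = tangentMap I I a ((φA.frame (h₁ y)).vec v)
  γ_one : ∀ y v, (γ 1 y).vec v = tangentMap I I b ((φB.frame (h₂ y)).vec v)
  deck : ∀ y y', κ₁ y = κ₁ y' → ∃ c, φA.act (h₁ y') c = h₁ y ∧ φB.act (h₂ y') c = h₂ y ∧
    ∀ t v, (γ t y').vec (pinRho c v) = (γ t y).vec v
  s : Y → ℝ
  continuous_s : Continuous s
  s_eq : ∀ y y', κ₁ y = κ₁ y' → s y = s y'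
  s_ge : ∀ p ∉ range κ₁, ∀ᶠ p' in 𝓝 p, ∀ y, κ₁ y = p' → 2 ≤ s y
  s_le : ∀ p ∉ range κ₂, ∀ᶠ p' in 𝓝 p, ∀ y, κ₂ y = p' → s y ≤ 1 / 2

namespace SectionGluing

variable {φA : PinStructure.{u} I A} {φB : PinStructure.{u} I B} {a : A → Q} {b : B → Q}
  {Y : Type*} [TopologicalSpace Y] (S : SectionGluing φA φB a b Y)

open Classical in
/-- The stopping time on `Q`. -/
def χ (q : Q) : unitInterval :=
  if h : ∃ y, a (S.κ₁ y) = q then cutoff (S.s h.choose) else if q ∈ range a then 0 else 1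

theorem χ_κ₁ (y : Y) : S.χ (a (S.κ₁ y)) = cutoff (S.s y) := by
  have h : ∃ y', a (S.κ₁ y') = a (S.κ₁ y) := ⟨y, rfl⟩
  rw [χ, dif_pos h]
  congr 1
  exact S.s_eq _ _ (S.injective_left h.choose_spec)

theorem χ_eventually_zero {p : A} (hp : p ∉ range S.κ₁) : ∀ᶠ p' in 𝓝 p, S.χ (a p') = 0 := by
  filter_upwards [S.s_ge p hp] with p' hp'
  by_cases h : p' ∈ range S.κ₁
  · obtain ⟨y, rfl⟩ := h
    rw [S.χ_κ₁, cutoff_of_ge (hp' y rfl)]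
  · have h2 : ¬ ∃ y, a (S.κ₁ y) = a p' := fun ⟨y, hy⟩ => h ⟨y, S.injective_left hy⟩
    rw [χ, dif_neg h2, if_pos ⟨p', rfl⟩]

theorem χ_eventually_one {p : B} (hp : p ∉ range S.κ₂) : ∀ᶠ p' in 𝓝 p, S.χ (b p') = 1 := by
  filter_upwards [S.s_le p hp] with p' hp'
  by_cases h : p' ∈ range S.κ₂
  · obtain ⟨y, rfl⟩ := h
    rw [← S.a_κ₁, S.χ_κ₁, cutoff_of_le (hp' y rfl)]
  · have h2 : ¬ ∃ y, a (S.κ₁ y) = b p' := by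
      rintro ⟨y, hy⟩
      rw [S.a_κ₁] at hy
      exact h ⟨y, S.injective_right hy⟩
    rw [χ, dif_neg h2, if_neg fun h3 => h (S.mem_range_κ₂ p' h3)]

theorem continuous_χ : Continuous S.χ := by
  rw [continuous_iff_continuousAt]
  have hov : ∀ y, ContinuousAt S.χ (a (S.κ₁ y)) := fun y =>
    continuousAt_of_comp_isOpenMap (f := fun y => a (S.κ₁ y)) (g := S.χ)
      (S.isLocalDiffeomorph_left.isOpenMap.comp S.isOpenMap_κ₁)
      ((continuous_cutoff.comp S.continuous_s).congr fun y => (S.χ_κ₁ y).symm) y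
  have hev : ∀ q (c : unitInterval), (∀ᶠ q' in 𝓝 q, S.χ q' = c) → ContinuousAt S.χ q := by
    intro q c h
    exact (continuousAt_const (y := c)).congr (h.mono fun q' h => h.symm)
  intro q
  rcases S.cover q with ⟨p, rfl⟩ | ⟨p, rfl⟩
  · by_cases hp : p ∈ range S.κ₁
    · obtain ⟨y, rfl⟩ := hp; exact hov y
    · refine hev _ 0 ?_
      rw [← S.isLocalDiffeomorph_left.isLocalHomeomorph.map_nhds_eq]
      exact S.χ_eventually_zero hp
  · by_cases hp : p ∈ range S.κ₂
    · obtain ⟨y, rfl⟩ := hp; rw [← S.a_κ₁]; exact hov y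
    · refine hev _ 1 ?_
      rw [← S.isLocalDiffeomorph_right.isLocalHomeomorph.map_nhds_eq]
      exact S.χ_eventually_one hp

/-- The gluing data parametrized by `Y × Pin⁺(n)`. -/
def toPinGluing : PinGluing φA φB a b (Y × PinPlus n) where
  isLocalDiffeomorph_left := S.isLocalDiffeomorph_left
  isLocalDiffeomorph_right := S.isLocalDiffeomorph_right
  injective_left := S.injective_left
  injective_right := S.injective_right
  cover := S.cover
  r x g := (x.1, x.2 * g)
  α x := φA.act (S.h₁ x.1) x.2
  β x := φB.act (S.h₂ x.1) x.2
  continuous_α := φA.continuous_act' (S.continuous_h₁.comp continuous_fst) continuous_snd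
  continuous_β := φB.continuous_act' (S.continuous_h₂.comp continuous_fst) continuous_snd
  isOpenMap_α := by
    refine φA.isOpenMap_of_equivariant (fun x g => (x.1, x.2 * g)) (by fun_prop) (by simp) _
      (φA.continuous_act' (S.continuous_h₁.comp continuous_fst) continuous_snd)
      (fun x g => φA.act_mul _ _ _) ?_
    simp only [PinStructure.proj_act, S.proj_h₁]
    exact S.isOpenMap_κ₁.comp isOpenMap_fst
  isOpenMap_β := by
    refine φB.isOpenMap_of_equivariant (fun x g => (x.1, x.2 * g)) (by fun_prop) (by simp) _
      (φB.continuous_act' (S.continuous_h₂.comp continuous_fst) continuous_snd)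
      (fun x g => φB.act_mul _ _ _) ?_
    simp only [PinStructure.proj_act, S.proj_h₂]
    exact S.isOpenMap_κ₂.comp isOpenMap_fst
  α_r x g := φA.act_mul _ _ _
  β_r x g := φB.act_mul _ _ _
  base_eq x := by
    simp only [PinStructure.proj_act, S.proj_h₁, S.proj_h₂, S.a_κ₁]
  α_eq_iff := by
    rintro ⟨y, g⟩ ⟨y', g'⟩
    have key : ∀ h : S.κ₁ y = S.κ₁ y', φA.act (S.h₁ y) g = φA.act (S.h₁ y') g' ↔
        φB.act (S.h₂ y) g = φB.act (S.h₂ y') g' := by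
      intro h
      obtain ⟨c, hc1, hc2, -⟩ := S.deck y y' h
      rw [← hc1, ← hc2, ← φA.act_mul, ← φB.act_mul]
      exact ⟨fun h => by rw [φA.act_injective _ h], fun h => by rw [φB.act_injective _ h]⟩
    constructor
    · intro h
      have h2 : S.κ₁ y = S.κ₁ y' := by
        have := congrArg φA.proj h
        simpa only [PinStructure.proj_act, S.proj_h₁] using this
      exact (key h2).1 h
    · intro h
      have h2 : S.κ₂ y = S.κ₂ y' := by
        have := congrArg φB.proj h
        simpa only [PinStructure.proj_act, S.proj_h₂] using this
      exact (key (S.injective_left (by rw [S.a_κ₁, S.a_κ₁, h2]))).2 h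
  mem_range_α p hp := by
    obtain ⟨y, hy⟩ := S.mem_range_κ₁ _ hp
    exact ⟨(y, φA.div (S.h₁ y) p), φA.act_div ((S.proj_h₁ y).trans hy)⟩
  mem_range_β p hp := by
    obtain ⟨y, hy⟩ := S.mem_range_κ₂ _ hp
    exact ⟨(y, φB.div (S.h₂ y) p), φB.act_div ((S.proj_h₂ y).trans hy)⟩
  G t x := (S.γ t x.1).precomp (pinRhoEquiv x.2)
  continuous_G := by
    have h1 := continuous_pinRho.comp (((continuous_snd (X := Y) (Y := PinPlus n)).comp
      ((continuous_snd (X := unitInterval)).comp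
      (continuous_fst (Y := EuclideanSpace ℝ (Fin n))))).prodMk continuous_snd)
    have h2 := S.continuous_γ.comp (Continuous.prodMk (((continuous_fst (X := unitInterval)
      (Y := Y × PinPlus n)).comp (continuous_fst (Y := EuclideanSpace ℝ (Fin n)))).prodMk
      (continuous_fst.comp (continuous_snd.comp continuous_fst))) h1)
    exact h2
  base_G t x := by
    rw [PinStructure.proj_act, S.proj_h₁]; exact S.base_γ t x.1
  G_r t x g v := by
    simp only [TangentFrame.vec_precomp, pinRhoEquiv_apply, pinRho_mul]
  G_eq t := by
    rintro ⟨y, g⟩ ⟨y', g'⟩ h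
    have h2 : S.κ₁ y = S.κ₁ y' := by
      have := congrArg φA.proj h
      simpa only [PinStructure.proj_act, S.proj_h₁] using this
    obtain ⟨c, hc1, hc2, hγ⟩ := S.deck y y' h2
    simp only at h
    rw [← hc1, ← φA.act_mul] at h
    obtain rfl : c * g = g' := φA.act_injective _ h
    refine TangentFrame.ext_vec fun v => ?_
    simp only [TangentFrame.vec_precomp, pinRhoEquiv_apply, pinRho_mul]
    exact (hγ t _).symm
  G_zero x v := by
    simp only [TangentFrame.vec_precomp, pinRhoEquiv_apply, φA.frame_act]
    exact S.γ_zero _ _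
  G_one x v := by
    simp only [TangentFrame.vec_precomp, pinRhoEquiv_apply, φB.frame_act]
    exact S.γ_one _ _
  χ := S.χ
  continuous_χ := S.continuous_χ
  χ_zero q hq := by
    obtain ⟨p, rfl⟩ := (S.cover q).resolve_right hq
    rw [← S.isLocalDiffeomorph_left.isLocalHomeomorph.map_nhds_eq]
    refine S.χ_eventually_zero ?_
    rintro ⟨y, rfl⟩
    exact hq ⟨_, (S.a_κ₁ y).symm⟩
  χ_one q hq := by
    obtain ⟨p, rfl⟩ := (S.cover q).resolve_left hq
    rw [← S.isLocalDiffeomorph_right.isLocalHomeomorph.map_nhds_eq]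
    refine S.χ_eventually_one ?_
    rintro ⟨y, rfl⟩
    exact hq ⟨_, S.a_κ₁ y⟩

end SectionGluing

end sections

/-! ### Local diffeomorphisms and immersions -/

section localDiffeo

variable {E E' E'' : Type*} [NormedAddCommGroup E] [NormedSpace ℝ E] [NormedAddCommGroup E']
  [NormedSpace ℝ E'] [NormedAddCommGroup E''] [NormedSpace ℝ E'']
  {H H' H'' : Type*} [TopologicalSpace H] [TopologicalSpace H'] [TopologicalSpace H'']
  {I : ModelWithCorners ℝ E H} {J : ModelWithCorners ℝ E' H'} {K : ModelWithCorners ℝ E'' H''}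
  {M N P : Type*} [TopologicalSpace M] [ChartedSpace H M] [TopologicalSpace N] [ChartedSpace H' N]
  [TopologicalSpace P] [ChartedSpace H'' P]

theorem IsLocalDiffeomorphAt.congr {f g : M → N} {x : M} (hf : IsLocalDiffeomorphAt I J ∞ f x)
    (h : g =ᶠ[𝓝 x] f) : IsLocalDiffeomorphAt I J ∞ g x := by
  obtain ⟨Φ, hx, hΦ⟩ := hf
  obtain ⟨U, hU, hUo, hxU⟩ := mem_nhds_iff.1 h
  let Ψ := Φ.toOpenPartialHomeomorph.restrOpen U hUo
  refine ⟨{ Ψ with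
    contMDiffOn_toFun := Φ.contMDiffOn_toFun.mono fun y hy => hy.1
    contMDiffOn_invFun := Φ.contMDiffOn_invFun.mono fun y hy => hy.1 }, ⟨hx, hxU⟩, ?_⟩
  rintro y ⟨hy, hyU⟩
  exact (hU hyU).trans (hΦ hy)

theorem IsLocalDiffeomorph.comp {g : N → P} {f : M → N} (hg : IsLocalDiffeomorph J K ∞ g)
    (hf : IsLocalDiffeomorph I J ∞ f) : IsLocalDiffeomorph I K ∞ (g ∘ f) :=
  fun x => (hf x).comp K P (hg (f x))

theorem IsLocalDiffeomorphAt.of_comp {g : N → P} {f : M → N} {x : M}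
    (hg : IsLocalDiffeomorphAt J K ∞ g (f x))
    (hf : ContinuousAt f x) (h : IsLocalDiffeomorphAt I K ∞ (g ∘ f) x) :
    IsLocalDiffeomorphAt I J ∞ f x := by
  have h1 : IsLocalDiffeomorphAt K J ∞ hg.localInverse ((g ∘ f) x) :=
    hg.localInverse_isLocalDiffeomorphAt
  refine (h.comp J N h1).congr ?_
  filter_upwards [hf.eventually hg.localInverse_eventuallyEq_left] with y hy
  exact hy.symm

theorem IsLocalDiffeomorph.of_comp {g : N → P} {f : M → N} (hg : IsLocalDiffeomorph J K ∞ g)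
    (hf : Continuous f) (h : IsLocalDiffeomorph I K ∞ (g ∘ f)) : IsLocalDiffeomorph I J ∞ f :=
  fun x => .of_comp (hg (f x)) hf.continuousAt (h x)

theorem isLocalDiffeomorph_subtypeVal [IsManifold I ∞ M] (U : Opens M) :
    IsLocalDiffeomorph I I ∞ (Subtype.val : U → M) := fun x => by
  classical
  exact ⟨{
     toFun := Subtype.val
     invFun := fun y => if h : y ∈ U then ⟨y, h⟩ else x
     source := univ
     target := U
     map_source' := fun y _ => y.2
     map_target' := fun _ _ => trivial
     left_inv' := fun y _ => dif_pos y.2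
     right_inv' := fun y hy => by
       have : y ∈ U := hy
       simp only [dif_pos this]
     open_source := isOpen_univ
     open_target := U.2
     contMDiffOn_toFun := contMDiff_subtype_val.contMDiffOn
     contMDiffOn_invFun := fun y hy => by
       refine ContMDiffAt.contMDiffWithinAt ?_
       rw [← ContMDiffAt.subtypeVal_comp_iff]
       refine contMDiffAt_id.congr_of_eventuallyEq ?_
       filter_upwards [U.2.mem_nhds hy] with z hz
       have : z ∈ U := hz
       simp only [Function.comp, dif_pos this, id] }, trivial, fun _ _ => rfl⟩

theorem SmoothGluing.isLocalDiffeomorph_mk {s : Setoid M} (h : SmoothGluing I s) [IsManifold I ∞ M]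
    :
    letI := h.chartedSpace
    IsLocalDiffeomorph I I ∞ (Quotient.mk s) := by
  let := h.chartedSpace
  have := h.isManifold
  intro y
  set e := h.isLocalHomeomorph_mk.localInverseAt y with he
  have hes : ∀ x, e.symm x = Quotient.mk s x := fun x => by
    rw [he, IsLocalHomeomorph.localInverseAt_symm]
  have hy : Quotient.mk s y ∈ e.source := by simp [he]
  have hval : e (Quotient.mk s y) = y := by simp [he]
  refine ⟨{ e.symm with
    contMDiffOn_toFun := by
      refine h.contMDiff_mk.contMDiffOn.congr fun x _ => hes x
    contMDiffOn_invFun := fun q hq => by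
      refine ContMDiffAt.contMDiffWithinAt (h.contMDiffAt_of_comp_mk ?_)
      rintro z rfl
      exact h.contMDiffAt_localInverse_comp y z hq }, ?_, fun x _ => (hes x).symm⟩
  have := e.map_source hy
  rwa [hval] at this

/-- A map that is related to an immersion by local diffeomorphisms of the domain and the codomain is
an immersion. -/
theorem Manifold.IsImmersionAtOfComplement.of_square {F : Type*} [NormedAddCommGroup F]
    [NormedSpace ℝ F]
    {M' N' : Type*} [TopologicalSpace M'] [ChartedSpace H M'] [TopologicalSpace N']
    [ChartedSpace H' N'] [IsManifold I ∞ M] [IsManifold J ∞ N] [IsManifold I ∞ M']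
    [IsManifold J ∞ N'] {f : M → N} {f' : M' → N'} {c : M' → M} {g : N' → N} {x : M'}
    (hf : IsImmersionAtOfComplement F I J ∞ f (c x)) (hc : IsLocalDiffeomorphAt I I ∞ c x)
    (hg : IsLocalDiffeomorphAt J J ∞ g (f' x)) (hf' : ContinuousAt f' x)
    (h : ∀ᶠ y in 𝓝 x, g (f' y) = f (c y)) : IsImmersionAtOfComplement F I J ∞ f' x := by
  have hgf : g (f' x) = f (c x) := h.self_of_nhds
  obtain ⟨Φ, hxΦ, hΦ⟩ := hc
  obtain ⟨Ψ, hxΨ, hΨ⟩ := hg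
  obtain ⟨U, hU, hUo, hxU⟩ := mem_nhds_iff.1 (h.and (hf'.eventually (Ψ.open_source.mem_nhds hxΨ)))
  let φ := (Φ.toOpenPartialHomeomorph.restrOpen U hUo).trans hf.domChart
  let ψ := Ψ.toOpenPartialHomeomorph.trans hf.codChart
  have hφ : φ ∈ IsManifold.maximalAtlas I ∞ M' := by
    refine OpenPartialHomeomorph.mem_maximalAtlas_of_contMDiffOn (I := I) (n := ∞) φ ?_ ?_
    · exact (contMDiffOn_of_mem_maximalAtlas hf.domChart_mem_maximalAtlas).comp
        (Φ.contMDiffOn_toFun.mono fun y hy => hy.1.1) fun y hy => hy.2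
    · exact Φ.contMDiffOn_invFun.comp ((contMDiffOn_symm_of_mem_maximalAtlas
        hf.domChart_mem_maximalAtlas).mono fun y hy => hy.1) fun y hy => hy.2.1
  have hψ : ψ ∈ IsManifold.maximalAtlas J ∞ N' := by
    refine OpenPartialHomeomorph.mem_maximalAtlas_of_contMDiffOn (I := J) (n := ∞) ψ ?_ ?_
    · exact (contMDiffOn_of_mem_maximalAtlas hf.codChart_mem_maximalAtlas).comp
        (Ψ.contMDiffOn_toFun.mono fun y hy => hy.1) fun y hy => hy.2
    · exact Ψ.contMDiffOn_invFun.comp ((contMDiffOn_symm_of_mem_maximalAtlas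
        hf.codChart_mem_maximalAtlas).mono fun y hy => hy.1) fun y hy => hy.2
  refine IsImmersionAtOfComplement.mk_of_continuousAt hf' hf.equiv φ ψ ⟨⟨hxΦ, hxU⟩, ?_⟩ ⟨hxΨ, ?_⟩
    hφ hψ ?_
  · change Φ x ∈ hf.domChart.source
    rw [← hΦ hxΦ]; exact hf.mem_domChart_source
  · change Ψ (f' x) ∈ hf.codChart.source
    rw [← hΨ hxΨ, hgf]; exact hf.mem_codChart_source
  · intro z hz
    rw [OpenPartialHomeomorph.extend_target] at hz
    obtain ⟨⟨hz1, hz2, hz3⟩, hz4⟩ := hz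
    have hz5 : z ∈ (hf.domChart.extend I).target := by
      rw [OpenPartialHomeomorph.extend_target]; exact ⟨hz1, hz4⟩
    rw [← hf.writtenInCharts hz5]
    set w := Φ.toOpenPartialHomeomorph.symm (hf.domChart.symm (I.symm z)) with hw
    have hwU : w ∈ U := hz3
    have hws : w ∈ Φ.source := Φ.toOpenPartialHomeomorph.map_target hz2
    have h1 : c w = hf.domChart.symm (I.symm z) :=
      (hΦ hws).trans (Φ.toOpenPartialHomeomorph.right_inv hz2)
    change J (hf.codChart (Ψ (f' w))) = J (hf.codChart (f (hf.domChart.symm (I.symm z))))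
    rw [← hΨ (hU hwU).2, (hU hwU).1, h1]

end localDiffeo

/-! ### Differentials of frames -/

namespace TangentFrame

variable {n : ℕ} {H H' H'' : Type*} [TopologicalSpace H] [TopologicalSpace H']
  [TopologicalSpace H'']
  {I : ModelWithCorners ℝ (EuclideanSpace ℝ (Fin n)) H}
  {J : ModelWithCorners ℝ (EuclideanSpace ℝ (Fin n)) H'}
  {K : ModelWithCorners ℝ (EuclideanSpace ℝ (Fin n)) H''}
  {M N P : Type*} [TopologicalSpace M] [ChartedSpace H M] [TopologicalSpace N] [ChartedSpace H' N]
  [TopologicalSpace P] [ChartedSpace H'' P]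

theorem map_map {g : N → P} {f : M → N} (hg : IsLocalDiffeomorph J K ∞ g)
    (hf : IsLocalDiffeomorph I J ∞ f) (b : TangentFrame I M) :
    (b.map hf).map hg = b.map (hg.comp hf) := by
  refine ext_vec fun v => ?_
  rw [vec_map, vec_map, vec_map, tangentMap_comp_at _ (hg.mdifferentiable (by simp) _)
    (hf.mdifferentiable (by simp) _)]

theorem map_congr {f g : M → N} (hf : IsLocalDiffeomorph I J ∞ f) (hg : IsLocalDiffeomorph I J ∞ g)
    (h : ∀ x, f x = g x) (b : TangentFrame I M) : b.map hf = b.map hg := by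
  obtain rfl : f = g := funext h
  rfl

theorem precomp_map {f : M → N} (hf : IsLocalDiffeomorph I J ∞ f) (b : TangentFrame I M)
    (A : EuclideanSpace ℝ (Fin n) ≃L[ℝ] EuclideanSpace ℝ (Fin n)) :
    (b.precomp A).map hf = (b.map hf).precomp A := rfl

theorem map_comap {f : M → N} (hf : IsLocalDiffeomorph I J ∞ f) (b : TangentFrame J N) (x : M)
    (h : b.base = f x) : (b.comap hf x).map hf = b :=
  ext_vec fun v => tangentMap_vec_comap hf b x h v

theorem map_injective {f : M → N} (hf : IsLocalDiffeomorph I J ∞ f) {b b' : TangentFrame I M}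
    (h : b.base = b'.base) (hb : b.map hf = b'.map hf) : b = b' := by
  refine ext_vec fun v => tangentMap_injOn_fiber hf h ?_
  exact congrArg (fun c => TangentFrame.vec c v) hb

end TangentFrame

/-! ### Cylinders -/

instance fact_zero_lt_two_real : Fact ((0 : ℝ) < 2) := ⟨two_pos⟩

/-- The cylinder `M × [0, 2]`, as a manifold with boundary over the Euclidean half space. -/
def Cyl (M : Type u) : Type u := M × Icc (0 : ℝ) 2

namespace Cyl

section basic

variable {M : Type*}

/-- The projection to `M`. -/
def fst (z : Cyl M) : M := z.1

/-- The height in the cylinder. -/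
def ht (z : Cyl M) : ℝ := (z.2 : ℝ)

/-- The point of the cylinder over `m` at the height `t`, clamped to `[0, 2]`. -/
def pt (m : M) (t : ℝ) : Cyl M := (m, projIcc 0 2 two_pos.le t)

theorem pt_fst_ht (z : Cyl M) : pt (fst z) (ht z) = z :=
  Prod.ext rfl (projIcc_val two_pos.le z.2)

theorem ht_mem (z : Cyl M) : ht z ∈ Icc (0 : ℝ) 2 := z.2.2

theorem fst_pt (m : M) (t : ℝ) : fst (pt m t) = m := rfl

theorem ht_pt (m : M) {t : ℝ} (h : t ∈ Icc (0 : ℝ) 2) : ht (pt m t) = t :=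
  congrArg Subtype.val (projIcc_of_mem two_pos.le h)

theorem ext {z w : Cyl M} (h : fst z = fst w) (h' : ht z = ht w) : z = w :=
  Prod.ext h (Subtype.ext h')

end basic

section topology

variable {M : Type*} [TopologicalSpace M]

instance : TopologicalSpace (Cyl M) := inferInstanceAs (TopologicalSpace (M × Icc (0 : ℝ) 2))
instance [T2Space M] : T2Space (Cyl M) := inferInstanceAs (T2Space (M × Icc (0 : ℝ) 2))
instance [CompactSpace M] : CompactSpace (Cyl M) :=
  inferInstanceAs (CompactSpace (M × Icc (0 : ℝ) 2))

theorem continuous_fst : Continuous (fst : Cyl M → M) :=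
  (_root_.continuous_fst : Continuous fun z : M × Icc (0 : ℝ) 2 => z.1)

theorem continuous_ht : Continuous (ht : Cyl M → ℝ) :=
  (continuous_subtype_val.comp continuous_snd : Continuous fun z : M × Icc (0 : ℝ) 2 => (z.2 : ℝ))

theorem continuous_pt : Continuous fun z : M × ℝ => pt z.1 z.2 :=
  (Continuous.prodMk _root_.continuous_fst (continuous_projIcc.comp continuous_snd) :
    Continuous fun z : M × ℝ => (z.1, projIcc 0 2 two_pos.le z.2))

end topology

end Cyl

/-- The identification of `ℝⁿ × [0, ∞)` with the half space of `ℝⁿ⁺¹`. -/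
def cylHomeo (n : ℕ) : ModelProd (EuclideanSpace ℝ (Fin n)) (EuclideanHalfSpace 1) ≃ₜ
    EuclideanHalfSpace (n + 1) where
  toFun z := ⟨WithLp.toLp 2 (Fin.cons (z.2.1 0) z.1.ofLp), z.2.2⟩
  invFun w := (WithLp.toLp 2 (Fin.tail w.1.ofLp), ⟨WithLp.toLp 2 fun _ => w.1 0, w.2⟩)
  left_inv z := by
    refine Prod.ext rfl (Subtype.ext ?_)
    ext i; fin_cases i; rfl
  right_inv w := by
    refine Subtype.ext ?_
    ext i; refine Fin.cases ?_ (fun i => ?_) i <;> rfl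
  continuous_toFun := by
    refine Continuous.subtype_mk ((PiLp.continuous_toLp 2 _).comp (continuous_pi fun i => ?_)) _
    refine Fin.cases ?_ (fun i => ?_) i
    · exact ((EuclideanSpace.proj (𝕜 := ℝ) (0 : Fin 1)).continuous.comp
        continuous_subtype_val).comp continuous_snd
    · exact (EuclideanSpace.proj (𝕜 := ℝ) i).continuous.comp continuous_fst
  continuous_invFun := by
    have h : ∀ i : Fin (n + 1), Continuous fun w : EuclideanHalfSpace (n + 1) => w.1 i := fun i =>
      (EuclideanSpace.proj (𝕜 := ℝ) i).continuous.comp continuous_subtype_val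
    refine Continuous.prodMk ?_ ?_
    · exact (PiLp.continuous_toLp 2 _).comp (continuous_pi fun i => h i.succ)
    · exact Continuous.subtype_mk ((PiLp.continuous_toLp 2 _).comp (continuous_pi fun i => h 0)) _

/-- The linear map underlying `cylHomeo`. -/
def cylLin (n : ℕ) : (EuclideanSpace ℝ (Fin n) × EuclideanSpace ℝ (Fin 1)) ≃L[ℝ]
    EuclideanSpace ℝ (Fin (n + 1)) :=
  LinearEquiv.toContinuousLinearEquiv
    { toFun := fun z => WithLp.toLp 2 (Fin.cons (z.2 0) z.1.ofLp)
      invFun := fun w => (WithLp.toLp 2 (Fin.tail w.ofLp), WithLp.toLp 2 fun _ => w 0)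
      map_add' := fun z w => by
        ext i; refine Fin.cases ?_ (fun i => ?_) i <;> rfl
      map_smul' := fun c w => by
        ext i; refine Fin.cases ?_ (fun i => ?_) i <;> rfl
      left_inv := fun z => by
        refine Prod.ext rfl ?_
        ext i; fin_cases i; rfl
      right_inv := fun w => by
        ext i; refine Fin.cases ?_ (fun i => ?_) i <;> rfl }

theorem cylLin_model {n : ℕ} (z : ModelProd (EuclideanSpace ℝ (Fin n)) (EuclideanHalfSpace 1)) :
    (𝓡∂ (n + 1)) (cylHomeo n z) = cylLin n (((𝓡 n).prod (𝓡∂ 1)) z) := rfl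

namespace Cyl

variable {n : ℕ} {M N : Type*} [TopologicalSpace M] [ChartedSpace (EuclideanSpace ℝ (Fin n)) M]
  [TopologicalSpace N] [ChartedSpace (EuclideanSpace ℝ (Fin n)) N]

/-- The underlying pair of a point of the cylinder. -/
def toProd (z : Cyl M) : M × Icc (0 : ℝ) 2 := z

/-- A pair as a point of the cylinder. -/
def ofProd (z : M × Icc (0 : ℝ) 2) : Cyl M := z

instance : ChartedSpace (EuclideanHalfSpace (n + 1)) (Cyl M) where
  atlas := (fun c : OpenPartialHomeomorph (M × Icc (0 : ℝ) 2)
    (ModelProd (EuclideanSpace ℝ (Fin n)) (EuclideanHalfSpace 1)) =>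
      (c.transHomeomorph (cylHomeo n) : OpenPartialHomeomorph (Cyl M) _)) '' atlas _ _
  chartAt z := (chartAt (ModelProd (EuclideanSpace ℝ (Fin n)) (EuclideanHalfSpace 1))
    (toProd z)).transHomeomorph (cylHomeo n)
  mem_chart_source z := mem_chart_source
    (ModelProd (EuclideanSpace ℝ (Fin n)) (EuclideanHalfSpace 1)) (toProd z)
  chart_mem_atlas z := mem_image_of_mem _ (chart_mem_atlas _ (toProd z))

theorem model_symm {w : EuclideanSpace ℝ (Fin (n + 1))} (hw : w ∈ range (𝓡∂ (n + 1))) :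
    (cylHomeo n).symm ((𝓡∂ (n + 1)).symm w) = ((𝓡 n).prod (𝓡∂ 1)).symm ((cylLin n).symm w) ∧
      (cylLin n).symm w ∈ range ((𝓡 n).prod (𝓡∂ 1)) := by
  obtain ⟨u, rfl⟩ := hw
  obtain ⟨z, rfl⟩ := (cylHomeo n).surjective u
  rw [ModelWithCorners.left_inv, cylLin_model, ContinuousLinearEquiv.symm_apply_apply,
    ModelWithCorners.left_inv]
  exact ⟨(cylHomeo n).symm_apply_apply z, z, rfl⟩

instance [IsManifold (𝓡 n) ∞ M] : IsManifold (𝓡∂ (n + 1)) ∞ (Cyl M) := by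
  refine isManifold_of_contDiffOn _ _ _ ?_
  intro d d' hd hd'
  obtain ⟨c, hc, rfl⟩ := (mem_image _ _ _).1 hd
  obtain ⟨c', hc', rfl⟩ := (mem_image _ _ _).1 hd'
  have h : ContDiffOn ℝ ∞ (((𝓡 n).prod (𝓡∂ 1)) ∘ (c.symm.trans c') ∘ ((𝓡 n).prod (𝓡∂ 1)).symm)
      (((𝓡 n).prod (𝓡∂ 1)).symm ⁻¹' (c.symm.trans c').source ∩ range ((𝓡 n).prod (𝓡∂ 1))) :=
    (mem_groupoid_of_pregroupoid.1
      ((contDiffGroupoid ∞ ((𝓡 n).prod (𝓡∂ 1))).compatible hc hc')).1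
  have h2 := ((cylLin n).contDiff.comp_contDiffOn h).comp
    ((cylLin n).symm.contDiff.contDiffOn (s := (𝓡∂ (n + 1)).symm ⁻¹'
      ((cylHomeo n).symm ⁻¹' (c.symm.trans c').source) ∩ range (𝓡∂ (n + 1)))) ?_
  · refine (h2.congr ?_).mono ?_
    · rintro w ⟨-, hw⟩
      obtain ⟨h3, -⟩ := model_symm hw
      have h4 : (c'.transHomeomorph (cylHomeo n)) ((c.transHomeomorph (cylHomeo n)).symm
          ((𝓡∂ (n + 1)).symm w)) =
          cylHomeo n (c' (c.symm ((cylHomeo n).symm ((𝓡∂ (n + 1)).symm w)))) := rfl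
      rw [h3] at h4
      exact congrArg (𝓡∂ (n + 1)) h4
    · rintro w ⟨hw, hw2⟩
      exact ⟨hw, hw2⟩
  · rintro w ⟨hw, hw2⟩
    obtain ⟨h3, h4⟩ := model_symm hw2
    refine ⟨?_, h4⟩
    rw [mem_preimage, ← h3]
    exact hw

theorem extChartAt_symm_eq (z : Cyl M) {w : EuclideanSpace ℝ (Fin (n + 1))}
    (hw : w ∈ range (𝓡∂ (n + 1))) : (extChartAt (𝓡∂ (n + 1)) z).symm w =
      ofProd ((extChartAt ((𝓡 n).prod (𝓡∂ 1)) (toProd z)).symm ((cylLin n).symm w)) := by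
  change ofProd ((chartAt _ (toProd z)).symm ((cylHomeo n).symm ((𝓡∂ (n + 1)).symm w))) = _
  rw [(model_symm hw).1]
  rfl

theorem extChartAt_eq (z : Cyl M) (w : M × Icc (0 : ℝ) 2) : extChartAt (𝓡∂ (n + 1)) z (ofProd w) =
    cylLin n (extChartAt ((𝓡 n).prod (𝓡∂ 1)) (toProd z) w) := rfl

theorem mem_extChartAt_target {z : Cyl M} {w : EuclideanSpace ℝ (Fin (n + 1))}
    (hw : w ∈ (extChartAt (𝓡∂ (n + 1)) z).target) : (cylLin n).symm w ∈
      (extChartAt ((𝓡 n).prod (𝓡∂ 1)) (toProd z)).target := by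
  have hr : w ∈ range (𝓡∂ (n + 1)) := extChartAt_target_subset_range z hw
  have h := (extChartAt (𝓡∂ (n + 1)) z).map_target hw
  have h2 := (extChartAt (𝓡∂ (n + 1)) z).right_inv hw
  rw [extChartAt_symm_eq z hr] at h h2
  rw [extChartAt_eq, ← ContinuousLinearEquiv.eq_symm_apply] at h2
  rw [← h2]
  rw [extChartAt_source] at h
  refine (extChartAt ((𝓡 n).prod (𝓡∂ 1)) (toProd z)).map_source ?_
  rw [extChartAt_source]
  exact h

theorem contMDiff_toProd :
    ContMDiff (𝓡∂ (n + 1)) ((𝓡 n).prod (𝓡∂ 1)) ∞ (toProd : Cyl M → M × Icc (0 : ℝ) 2) := by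
  intro z
  rw [contMDiffAt_iff]
  refine ⟨continuous_id.continuousAt, ?_⟩
  refine (cylLin n).symm.contDiff.contDiffWithinAt.congr_of_eventuallyEq_of_mem ?_
    (mem_range_self _)
  filter_upwards [extChartAt_target_mem_nhdsWithin (I := 𝓡∂ (n + 1)) z] with w hw
  have hr : w ∈ range (𝓡∂ (n + 1)) := extChartAt_target_subset_range z hw
  have := (extChartAt ((𝓡 n).prod (𝓡∂ 1)) (toProd z)).right_inv
    (mem_extChartAt_target hw)
  simp only [Function.comp]
  rw [extChartAt_symm_eq z hr]
  exact this

theorem contMDiff_ofProd :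
    ContMDiff ((𝓡 n).prod (𝓡∂ 1)) (𝓡∂ (n + 1)) ∞ (ofProd : M × Icc (0 : ℝ) 2 → Cyl M) := by
  intro z
  rw [contMDiffAt_iff]
  refine ⟨continuous_id.continuousAt, ?_⟩
  refine (cylLin n).contDiff.contDiffWithinAt.congr_of_eventuallyEq_of_mem ?_ (mem_range_self _)
  filter_upwards [extChartAt_target_mem_nhdsWithin (I := (𝓡 n).prod (𝓡∂ 1)) z] with w hw
  exact congrArg (cylLin n) ((extChartAt ((𝓡 n).prod (𝓡∂ 1)) z).right_inv hw)

end Cyl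

namespace Cyl

variable {n : ℕ} {M N : Type*} [TopologicalSpace M] [ChartedSpace (EuclideanSpace ℝ (Fin n)) M]
  [TopologicalSpace N] [ChartedSpace (EuclideanSpace ℝ (Fin n)) N]

theorem contMDiff_fst : ContMDiff (𝓡∂ (n + 1)) (𝓡 n) ∞ (fst : Cyl M → M) :=
  _root_.contMDiff_fst.comp contMDiff_toProd

theorem contMDiff_ht : ContMDiff (𝓡∂ (n + 1)) 𝓘(ℝ) ∞ (ht : Cyl M → ℝ) :=
  contMDiff_subtypeVal_Icc.comp (contMDiff_snd.comp contMDiff_toProd)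

/-- The slab `M × [0, 2]` in `M × ℝ`. -/
def slab (M : Type*) : Set (M × ℝ) := univ ×ˢ Icc 0 2

theorem contMDiffOn_pt : ContMDiffOn ((𝓡 n).prod 𝓘(ℝ)) (𝓡∂ (n + 1)) ∞
    (fun z : M × ℝ => pt z.1 z.2) (slab M) := by
  have h : ContMDiffOn ((𝓡 n).prod 𝓘(ℝ)) ((𝓡 n).prod (𝓡∂ 1)) ∞
      (fun z : M × ℝ => (z.1, projIcc 0 2 two_pos.le z.2)) (slab M) :=
    _root_.contMDiff_fst.contMDiffOn.prodMk
      (contMDiffOn_projIcc.comp contMDiff_snd.contMDiffOn fun z hz => hz.2)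
  exact contMDiff_ofProd.comp_contMDiffOn h

theorem contMDiffOn_of {E' H' X : Type*} [NormedAddCommGroup E'] [NormedSpace ℝ E']
    [TopologicalSpace H'] {J : ModelWithCorners ℝ E' H'} [TopologicalSpace X] [ChartedSpace H' X]
    {f : X → Cyl M} {s : Set X} (h1 : ContMDiffOn J (𝓡 n) ∞ (fun x => fst (f x)) s)
    (h2 : ContMDiffOn J 𝓘(ℝ) ∞ (fun x => ht (f x)) s) : ContMDiffOn J (𝓡∂ (n + 1)) ∞ f s := by
  refine (contMDiffOn_pt.comp (h1.prodMk h2) fun x _ => ⟨trivial, ht_mem _⟩).congr fun x _ => ?_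
  exact (pt_fst_ht _).symm

theorem uniqueMDiffOn_slab : UniqueMDiffOn ((𝓡 n).prod 𝓘(ℝ)) (slab M) :=
  uniqueMDiffOn_univ.prod (uniqueDiffOn_Icc two_pos).uniqueMDiffOn

/-- The tangent vector of the cylinder with components `v` and `c`. -/
def tvec (v : TangentBundle (𝓡 n) M) (y c : ℝ) : TangentBundle (𝓡∂ (n + 1)) (Cyl M) :=
  tangentMapWithin ((𝓡 n).prod 𝓘(ℝ)) (𝓡∂ (n + 1)) (fun z : M × ℝ => pt z.1 z.2) (slab M)
    ⟨(v.1, y), (v.2, c)⟩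

theorem tangentMap_fst_tvec (v : TangentBundle (𝓡 n) M) {y : ℝ} (hy : y ∈ Icc (0 : ℝ) 2) (c : ℝ) :
    tangentMap (𝓡∂ (n + 1)) (𝓡 n) fst (tvec v y c) = v := by
  have hs : ((v.1, y) : M × ℝ) ∈ slab M := ⟨trivial, hy⟩
  have h := tangentMapWithin_comp_at (I := (𝓡 n).prod 𝓘(ℝ)) (I' := 𝓡∂ (n + 1)) (I'' := 𝓡 n)
    (s := slab M) (u := univ) (g := fst) (f := fun z : M × ℝ => pt z.1 z.2) ⟨(v.1, y), (v.2, c)⟩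
    (contMDiff_fst.mdifferentiable (by simp) _).mdifferentiableWithinAt
    (contMDiffOn_pt.mdifferentiableOn (by simp) _ hs) (fun _ _ => trivial) (uniqueMDiffOn_slab _ hs)
  rw [tangentMapWithin_univ] at h
  refine h.symm.trans ?_
  exact tangentMapWithin_prodFst (uniqueMDiffOn_slab _ hs)

theorem tangentMap_ht_tvec (v : TangentBundle (𝓡 n) M) {y : ℝ} (hy : y ∈ Icc (0 : ℝ) 2) (c : ℝ) :
    tangentMap (𝓡∂ (n + 1)) 𝓘(ℝ) ht (tvec v y c) = ⟨y, c⟩ := by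
  have hs : ((v.1, y) : M × ℝ) ∈ slab M := ⟨trivial, hy⟩
  have h := tangentMapWithin_comp_at (I := (𝓡 n).prod 𝓘(ℝ)) (I' := 𝓡∂ (n + 1)) (I'' := 𝓘(ℝ))
    (s := slab M) (u := univ) (g := ht) (f := fun z : M × ℝ => pt z.1 z.2) ⟨(v.1, y), (v.2, c)⟩
    (contMDiff_ht.mdifferentiable (by simp) _).mdifferentiableWithinAt
    (contMDiffOn_pt.mdifferentiableOn (by simp) _ hs) (fun _ _ => trivial) (uniqueMDiffOn_slab _ hs)
  rw [tangentMapWithin_univ] at h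
  refine h.symm.trans ?_
  refine (tangentMapWithin_congr (f₁ := Prod.snd) (fun x hx => ht_pt _ hx.2) _ hs).trans ?_
  exact tangentMapWithin_prodSnd (uniqueMDiffOn_slab _ hs)

theorem tvec_tangentMap (V : TangentBundle (𝓡∂ (n + 1)) (Cyl M)) :
    tvec (tangentMap (𝓡∂ (n + 1)) (𝓡 n) fst V) (ht V.proj)
      (tangentMap (𝓡∂ (n + 1)) 𝓘(ℝ) ht V).2 = V := by
  have hs : ((fst V.proj, ht V.proj) : M × ℝ) ∈ slab M := ⟨trivial, ht_mem _⟩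
  have hd1 : MDifferentiableAt (𝓡∂ (n + 1)) (𝓡 n) fst V.proj :=
    contMDiff_fst.mdifferentiable (by simp) _
  have hd2 : MDifferentiableAt (𝓡∂ (n + 1)) 𝓘(ℝ) ht V.proj :=
    contMDiff_ht.mdifferentiable (by simp) _
  have h := tangentMapWithin_comp_at (I := 𝓡∂ (n + 1)) (I' := (𝓡 n).prod 𝓘(ℝ)) (I'' := 𝓡∂ (n + 1))
    (s := univ) (u := slab M) (g := fun z : M × ℝ => pt z.1 z.2)
    (f := fun z : Cyl M => (fst z, ht z)) V
    (contMDiffOn_pt.mdifferentiableOn (by simp) _ hs)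
    (hd1.prodMk hd2).mdifferentiableWithinAt (fun _ _ => ⟨trivial, ht_mem _⟩)
    (uniqueMDiffOn_univ _ trivial)
  have h2 : ((fun z : M × ℝ => pt z.1 z.2) ∘ fun z : Cyl M => (fst z, ht z)) = id :=
    funext fun z => pt_fst_ht z
  rw [h2, tangentMapWithin_univ, tangentMapWithin_univ, tangentMap_id] at h
  refine Eq.trans ?_ h.symm
  unfold tvec
  congr 1
  simp only [tangentMap]
  rw [hd1.mfderiv_prod hd2]
  rfl

/-- A tangent vector of the cylinder is determined by its base point and its components. -/
theorem tangent_ext {V W : TangentBundle (𝓡∂ (n + 1)) (Cyl M)}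
    (h1 : tangentMap (𝓡∂ (n + 1)) (𝓡 n) fst V = tangentMap (𝓡∂ (n + 1)) (𝓡 n) fst W)
    (h2 : tangentMap (𝓡∂ (n + 1)) 𝓘(ℝ) ht V = tangentMap (𝓡∂ (n + 1)) 𝓘(ℝ) ht W) : V = W := by
  have h3 : ht V.proj = ht W.proj := congrArg Bundle.TotalSpace.proj h2
  rw [← tvec_tangentMap V, ← tvec_tangentMap W, h1, h2, h3]

theorem continuous_tvec [IsManifold (𝓡 n) ∞ M] {X : Type*} [TopologicalSpace X]
    {v : X → TangentBundle (𝓡 n) M}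
    {y c : X → ℝ} (hv : Continuous v) (hy : Continuous y) (hy' : ∀ x, y x ∈ Icc (0 : ℝ) 2)
    (hc : Continuous c) : Continuous fun x => tvec (v x) (y x) (c x) := by
  have h1 := contMDiffOn_pt.continuousOn_tangentMapWithin (n := ∞) (by simp)
    (uniqueMDiffOn_slab (n := n) (M := M))
  have : IsManifold (𝓡 n) 1 M := .of_le (n := ∞) (by simp)
  have h2 := (contMDiff_equivTangentBundleProd_symm (n := 0) (I := 𝓡 n) (M := M) (I' := 𝓘(ℝ))
    (M' := ℝ)).continuous
  have h3 : Continuous fun x => (⟨y x, c x⟩ : TangentBundle 𝓘(ℝ) ℝ) :=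
    (tangentBundleModelSpaceHomeomorph 𝓘(ℝ)).symm.continuous.comp (hy.prodMk hc)
  exact h1.comp_continuous (h2.comp (hv.prodMk h3)) fun x => ⟨trivial, hy' x⟩

end Cyl

namespace Cyl

section map

variable {M N : Type*}

/-- The map of cylinders induced by a map `j`. -/
def map (j : N → M) (z : Cyl N) : Cyl M := pt (j (fst z)) (ht z)

theorem ht_map (j : N → M) (z : Cyl N) : ht (map j z) = ht z := ht_pt _ (ht_mem z)

end map

variable {n : ℕ} {M N : Type*} [TopologicalSpace M] [ChartedSpace (EuclideanSpace ℝ (Fin n)) M]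
  [TopologicalSpace N] [ChartedSpace (EuclideanSpace ℝ (Fin n)) N]

theorem euclInit_add (v w : EuclideanSpace ℝ (Fin (n + 1))) :
    euclInit (v + w) = euclInit v + euclInit w := rfl

theorem euclInit_smul (c : ℝ) (v : EuclideanSpace ℝ (Fin (n + 1))) :
    euclInit (c • v) = c • euclInit v := rfl

theorem continuous_euclInit : Continuous (euclInit (n := n)) :=
  (PiLp.continuous_toLp 2 _).comp
    (continuous_pi fun i => (EuclideanSpace.proj (𝕜 := ℝ) i.castSucc).continuous)

theorem tvec_injective {b : M} {v v' : TangentSpace (𝓡 n) b} {y c c' : ℝ}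
    (hy : y ∈ Icc (0 : ℝ) 2) (h : tvec ⟨b, v⟩ y c = tvec ⟨b, v'⟩ y c') : v = v' ∧ c = c' := by
  have h1 := congrArg (tangentMap (𝓡∂ (n + 1)) (𝓡 n) fst) h
  have h2 := congrArg (tangentMap (𝓡∂ (n + 1)) 𝓘(ℝ) ht) h
  rw [tangentMap_fst_tvec _ hy, tangentMap_fst_tvec _ hy] at h1
  rw [tangentMap_ht_tvec _ hy, tangentMap_ht_tvec _ hy] at h2
  exact ⟨eq_of_heq (Bundle.TotalSpace.mk.inj h1).2, eq_of_heq (Bundle.TotalSpace.mk.inj h2).2⟩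

/-- The linear map underlying `cylFrame`. -/
def cylFrameLin (b : TangentFrame (𝓡 n) M) (y : Icc (0 : ℝ) 2) :
    EuclideanSpace ℝ (Fin (n + 1)) →ₗ[ℝ] EuclideanSpace ℝ (Fin (n + 1)) where
  toFun w := (tvec ⟨b.base, b.iso (euclInit w)⟩ y (-w (Fin.last n))).2
  map_add' v w := by
    have : ((b.iso (euclInit (v + w)), -(v + w) (Fin.last n)) :
        EuclideanSpace ℝ (Fin n) × ℝ) = (b.iso (euclInit v), -v (Fin.last n)) +
          (b.iso (euclInit w), -w (Fin.last n)) := by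
      refine Prod.ext ?_ ?_
      · rw [euclInit_add]; exact b.iso.map_add _ _
      · simp [add_comm]
    unfold tvec tangentMapWithin
    simp only
    erw [this, map_add]
    rfl
  map_smul' c v := by
    have : ((b.iso (euclInit (c • v)), -(c • v) (Fin.last n)) :
        EuclideanSpace ℝ (Fin n) × ℝ) = c • (b.iso (euclInit v), -v (Fin.last n)) := by
      refine Prod.ext ?_ ?_
      · rw [euclInit_smul]; exact b.iso.map_smul _ _
      · simp
    unfold tvec tangentMapWithin
    simp only
    erw [this, map_smul]
    rfl

theorem cylFrameLin_injective (b : TangentFrame (𝓡 n) M) (y : Icc (0 : ℝ) 2) :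
    Function.Injective (cylFrameLin b y) := by
  intro v w h
  have h1 : tvec ⟨b.base, b.iso (euclInit v)⟩ y (-v (Fin.last n)) =
      tvec ⟨b.base, b.iso (euclInit w)⟩ y (-w (Fin.last n)) :=
    congrArg (fun z => (⟨pt b.base y, z⟩ : TangentBundle (𝓡∂ (n + 1)) (Cyl M))) h
  obtain ⟨h2, h3⟩ := tvec_injective y.2 h1
  exact euclSnoc_ext (b.iso.injective h2) (neg_injective h3)

/-- The frame of the cylinder at the height `y` given by a frame of `M` and the last vector
`-∂_y`. -/
def cylFrame (b : TangentFrame (𝓡 n) M) (y : Icc (0 : ℝ) 2) :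
    TangentFrame (𝓡∂ (n + 1)) (Cyl M) where
  base := pt b.base y
  iso := equivOfInjective (cylFrameLin b y).toContinuousLinearMap (cylFrameLin_injective b y)

theorem cylFrame_vec (b : TangentFrame (𝓡 n) M) (y : Icc (0 : ℝ) 2)
    (w : EuclideanSpace ℝ (Fin (n + 1))) : (cylFrame b y).vec w =
      tvec (b.vec (euclInit w)) y (-w (Fin.last n)) := rfl

theorem contMDiffOn_map {j : N → M} {s : Set N} (hj : ContMDiffOn (𝓡 n) (𝓡 n) ∞ j s) :
    ContMDiffOn (𝓡∂ (n + 1)) (𝓡∂ (n + 1)) ∞ (map j) (fst ⁻¹' s) :=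
  contMDiffOn_of (hj.comp contMDiff_fst.contMDiffOn fun _ h => h)
    (contMDiff_ht.contMDiffOn.congr fun z _ => ht_map j z)

theorem isLocalDiffeomorph_map {j : N → M} (hj : IsLocalDiffeomorph (𝓡 n) (𝓡 n) ∞ j) :
    IsLocalDiffeomorph (𝓡∂ (n + 1)) (𝓡∂ (n + 1)) ∞ (map j) := by
  intro z
  obtain ⟨Φ, hz, hΦ⟩ := hj (fst z)
  refine ⟨{
    toFun := map Φ
    invFun := map Φ.invFun
    source := fst ⁻¹' Φ.source
    target := fst ⁻¹' Φ.target
    map_source' := fun w hw => Φ.map_source hw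
    map_target' := fun w hw => Φ.map_target hw
    left_inv' := fun w hw => ext (Φ.left_inv hw) (by rw [ht_map, ht_map])
    right_inv' := fun w hw => ext (Φ.right_inv hw) (by rw [ht_map, ht_map])
    open_source := Φ.open_source.preimage continuous_fst
    open_target := Φ.open_target.preimage continuous_fst
    contMDiffOn_toFun := contMDiffOn_map Φ.contMDiffOn_toFun
    contMDiffOn_invFun := contMDiffOn_map Φ.contMDiffOn_invFun }, hz, ?_⟩
  intro w hw
  exact ext (hΦ hw) ((ht_map _ _).trans (ht_map _ _).symm)

theorem cylFrame_map {j : N → M} (hj : IsLocalDiffeomorph (𝓡 n) (𝓡 n) ∞ j)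
    (b : TangentFrame (𝓡 n) N) (y : Icc (0 : ℝ) 2) :
    (cylFrame b y).map (isLocalDiffeomorph_map hj) = cylFrame (b.map hj) y := by
  refine TangentFrame.ext_vec fun w => ?_
  have hd : ∀ z, MDifferentiableAt (𝓡∂ (n + 1)) (𝓡∂ (n + 1)) (map j) z :=
    (isLocalDiffeomorph_map hj).mdifferentiable (by simp)
  rw [TangentFrame.vec_map, cylFrame_vec, cylFrame_vec]
  refine tangent_ext ?_ ?_
  · rw [tangentMap_fst_tvec _ y.2, ← tangentMap_comp_at _
      (contMDiff_fst.mdifferentiable (by simp) _)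
      (hd _)]
    have : fst ∘ map j = j ∘ (fst : Cyl N → N) := rfl
    rw [this, tangentMap_comp_at _ (hj.mdifferentiable (by simp) _)
      (contMDiff_fst.mdifferentiable (by simp) _), tangentMap_fst_tvec _ y.2]
    rfl
  · rw [tangentMap_ht_tvec _ y.2, ← tangentMap_comp_at _ (contMDiff_ht.mdifferentiable (by simp) _)
      (hd _)]
    have : ht ∘ map j = (ht : Cyl N → ℝ) := funext (ht_map j)
    rw [this, tangentMap_ht_tvec _ y.2]

theorem continuous_cylFrame [IsManifold (𝓡 n) ∞ M] {X : Type*} [TopologicalSpace X]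
    {b : X → TangentFrame (𝓡 n) M} {y : X → Icc (0 : ℝ) 2} (hy : Continuous y)
    (hb : Continuous fun z : X × EuclideanSpace ℝ (Fin n) => (b z.1).vec z.2) :
    Continuous fun z : X × EuclideanSpace ℝ (Fin (n + 1)) => (cylFrame (b z.1) (y z.1)).vec z.2 :=
  continuous_tvec (hb.comp (_root_.continuous_fst.prodMk (continuous_euclInit.comp continuous_snd)))
    (continuous_subtype_val.comp (hy.comp _root_.continuous_fst)) (fun z => (y z.1).2)
    (((EuclideanSpace.proj (𝕜 := ℝ) (Fin.last n)).continuous.comp continuous_snd).neg)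

theorem isLocalDiffeomorph_toProd :
    IsLocalDiffeomorph (𝓡∂ (n + 1)) ((𝓡 n).prod (𝓡∂ 1)) ∞
      (toProd : Cyl M → M × Icc (0 : ℝ) 2) :=
  Diffeomorph.isLocalDiffeomorph
    { toFun := toProd, invFun := ofProd, left_inv := fun _ => rfl, right_inv := fun _ => rfl
      contMDiff_toFun := contMDiff_toProd, contMDiff_invFun := contMDiff_ofProd }

theorem isBoundaryPoint_iff [IsManifold (𝓡 n) ∞ M] (z : Cyl M) :
    (𝓡∂ (n + 1)).IsBoundaryPoint z ↔ ht z = 0 ∨ ht z = 2 := by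
  have : IsManifold (𝓡∂ (n + 1)) 1 (Cyl M) := .of_le (n := ∞) (by simp)
  rw [(isLocalDiffeomorph_toProd z).isBoundaryPoint_iff (by simp)]
  have h := congrArg (fun S => toProd z ∈ S)
    (boundary_product (x := (0 : ℝ)) (y := 2) (I := 𝓡 n) (M := M))
  exact (iff_of_eq h).trans
    ((and_iff_right trivial).trans (or_congr Subtype.ext_iff Subtype.ext_iff))

/-- The linear map `(v, c) ↦ (c, v)`. -/
def consLin (n : ℕ) : (EuclideanSpace ℝ (Fin n) × ℝ) ≃L[ℝ] EuclideanSpace ℝ (Fin (n + 1)) :=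
  ((ContinuousLinearEquiv.refl ℝ (EuclideanSpace ℝ (Fin n))).prodCongr
    (PiLp.equivOfUnique 2 ℝ (fun _ : Fin 1 => ℝ)).symm).trans (cylLin n)

theorem extChartAt_Icc_end {y : ℝ} (hy : y = 0 ∨ y = 2) :
    extChartAt (𝓡∂ 1) (projIcc 0 2 two_pos.le y) (projIcc 0 2 two_pos.le y) = 0 := by
  ext i
  obtain rfl : i = 0 := Subsingleton.elim _ _
  rcases hy with rfl | rfl
  · rw [extChartAt, Icc_chartedSpaceChartAt_of_le_top (by simp)]
    simp [IccLeftChart, modelWithCornersEuclideanHalfSpace]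
  · rw [extChartAt, Icc_chartedSpaceChartAt_of_top_le (by simp)]
    simp [IccRightChart, modelWithCornersEuclideanHalfSpace]

/-- The inclusion of either end of the cylinder is an immersion. -/
theorem isImmersionAt_end [IsManifold (𝓡 n) ∞ M] {y : ℝ} (hy : y = 0 ∨ y = 2) (m : M) :
    IsImmersionAtOfComplement ℝ (𝓡 n) (𝓡∂ (n + 1)) ∞ (fun m : M => pt m y) m := by
  refine IsImmersionAtOfComplement.mk_of_continuousAt
    (continuous_pt.comp (continuous_id.prodMk continuous_const)).continuousAt (consLin n)
    (chartAt _ m) (chartAt _ (pt m y)) (mem_chart_source _ m) (mem_chart_source _ _)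
    (IsManifold.chart_mem_maximalAtlas m) (IsManifold.chart_mem_maximalAtlas _) ?_
  intro v hv
  have h1 : extChartAt (𝓡 n) m ((extChartAt (𝓡 n) m).symm v) = v :=
    (extChartAt (𝓡 n) m).right_inv hv
  have h2 := extChartAt_Icc_end hy
  change extChartAt (𝓡∂ (n + 1)) (pt m y) (ofProd ((extChartAt (𝓡 n) m).symm v,
    projIcc 0 2 two_pos.le y)) = _
  rw [extChartAt_eq]
  have h3 : extChartAt ((𝓡 n).prod (𝓡∂ 1)) (toProd (pt m y)) ((extChartAt (𝓡 n) m).symm v,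
      projIcc 0 2 two_pos.le y) = (extChartAt (𝓡 n) m ((extChartAt (𝓡 n) m).symm v),
      extChartAt (𝓡∂ 1) (projIcc 0 2 two_pos.le y) (projIcc 0 2 two_pos.le y)) := rfl
  rw [h3, h1, h2]
  rfl

end Cyl

/-- If a function has a local minimum at a point of a manifold with boundary, then a tangent vector
along which it decreases points outward. -/
theorem pointsOutward_of_mfderiv_neg {n : ℕ} {W : Type*} [TopologicalSpace W]
    [ChartedSpace (EuclideanHalfSpace (n + 1)) W] {y : W} {g : W → ℝ}
    [IsManifold (𝓡∂ (n + 1)) 1 W]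
    (hg : MDifferentiableAt (𝓡∂ (n + 1)) 𝓘(ℝ) g y) (hmin : ∀ᶠ z in 𝓝 y, g y ≤ g z)
    {v : TangentSpace (𝓡∂ (n + 1)) y} {t d : ℝ}
    (hv : tangentMap (𝓡∂ (n + 1)) 𝓘(ℝ) g ⟨y, v⟩ = ⟨t, d⟩) (hneg : d < 0) : PointsOutward v := by
  have hid : HasMFDerivAt (𝓡∂ (n + 1)) 𝓘(ℝ, EuclideanSpace ℝ (Fin (n + 1)))
      (extChartAt (𝓡∂ (n + 1)) y) y (ContinuousLinearMap.id ℝ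
        (EuclideanSpace ℝ (Fin (n + 1)))) := by
    refine ⟨continuousAt_extChartAt y, ?_⟩
    refine HasFDerivWithinAt.congr_of_eventuallyEq (hasFDerivWithinAt_id _ _) ?_
      (congrArg (extChartAt (𝓡∂ (n + 1)) y) (extChartAt_to_inv y))
    filter_upwards [extChartAt_target_mem_nhdsWithin (I := 𝓡∂ (n + 1)) y] with w hw
    exact (extChartAt (𝓡∂ (n + 1)) y).right_inv hw
  unfold PointsOutward
  rw [hid.mfderiv]
  let v' : EuclideanSpace ℝ (Fin (n + 1)) := v
  change v' 0 < 0
  by_contra hpos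
  rw [not_lt] at hpos
  have hv2 : (mfderiv (𝓡∂ (n + 1)) 𝓘(ℝ) g y v : TangentSpace 𝓘(ℝ) (g y)) = d :=
    congrArg (fun V : TangentBundle 𝓘(ℝ) ℝ => (tangentBundleModelSpaceHomeomorph 𝓘(ℝ) V).2) hv
  have hd := hg.hasMFDerivAt.2
  set φ := extChartAt (𝓡∂ (n + 1)) y
  have hloc : IsLocalMinOn (writtenInExtChartAt (𝓡∂ (n + 1)) 𝓘(ℝ) y g) (range (𝓡∂ (n + 1)))
      (φ y) := by
    have hc : Tendsto φ.symm (𝓝[range (𝓡∂ (n + 1))] (φ y)) (𝓝 y) := by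
      have := (continuousAt_extChartAt_symm (I := 𝓡∂ (n + 1)) y).tendsto
      rw [extChartAt_to_inv] at this
      exact this.mono_left nhdsWithin_le_nhds
    filter_upwards [hc.eventually hmin] with z hz
    have h1 : φ.symm (φ y) = y := extChartAt_to_inv y
    change g (φ.symm (φ y)) ≤ g (φ.symm z)
    rw [h1]; exact hz
  have hcone : v' ∈
      posTangentConeAt (range (𝓡∂ (n + 1))) (φ y) := by
    refine mem_posTangentConeAt_of_segment_subset ?_
    have h0 : 0 ≤ (φ y) 0 := by
      have : φ y ∈ range (𝓡∂ (n + 1)) := mem_range_self _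
      rwa [range_modelWithCornersEuclideanHalfSpace] at this
    rw [range_modelWithCornersEuclideanHalfSpace]
    rintro _ ⟨a, b, ha, hb, -, rfl⟩
    change 0 ≤ a * (φ y) 0 + b * ((φ y) 0 + v' 0)
    positivity
  have h0 := hloc.hasFDerivWithinAt_nonneg hd hcone
  exact absurd (h0.trans_eq hv2) (not_le.2 hneg)

namespace PinStructure

open Cyl hiding continuous_fst

section cyl

variable {n : ℕ} {M : Type v} [TopologicalSpace M] [ChartedSpace (EuclideanSpace ℝ (Fin n)) M]
  [IsManifold (𝓡 n) ∞ M] (φ : PinStructure.{u} (𝓡 n) M)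

/-- The relation defining the total space of the product structure: `(p, ι(k) g, y)` is identified
with `(p k, g, y)` for `k` in `Pin⁺(n)`. -/
def cylSetoid : Setoid (φ.P × PinPlus (n + 1) × Icc (0 : ℝ) 2) where
  r x x' := ∃ k, x'.1 = φ.act x.1 k ∧ x.2.1 = pinIncl n k * x'.2.1 ∧ x.2.2 = x'.2.2
  iseqv := by
    refine ⟨fun x => ⟨1, by simp [φ.act_one]⟩, ?_, ?_⟩
    · rintro x x' ⟨k, h1, h2, h3⟩
      exact ⟨k⁻¹, by rw [h1, ← φ.act_mul, mul_inv_cancel, φ.act_one], by rw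
        [h2, map_inv, inv_mul_cancel_left], h3.symm⟩
    · rintro x x' x'' ⟨k, h1, h2, h3⟩ ⟨l, h4, h5, h6⟩
      exact ⟨k * l, by rw [h4, h1, φ.act_mul], by rw [h2, h5, map_mul, mul_assoc], h3.trans h6⟩

/-- The total space of the product structure. -/
def CylTotal : Type u := Quotient φ.cylSetoid

instance : TopologicalSpace φ.CylTotal := inferInstanceAs (TopologicalSpace (Quotient φ.cylSetoid))

/-- The class of `(p, g, y)`. -/
def cylMk (p : φ.P) (g : PinPlus (n + 1)) (y : Icc (0 : ℝ) 2) : φ.CylTotal :=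
  Quotient.mk φ.cylSetoid (p, g, y)

theorem cylMk_act (p : φ.P) (k : PinPlus n) (g : PinPlus (n + 1)) (y : Icc (0 : ℝ) 2) :
    φ.cylMk (φ.act p k) g y = φ.cylMk p (pinIncl n k * g) y :=
  Quotient.sound (φ.cylSetoid.symm' ⟨k, rfl, rfl, rfl⟩)

theorem isOpenQuotientMap_cylMk : IsOpenQuotientMap
    fun x : φ.P × PinPlus (n + 1) × Icc (0 : ℝ) 2 => φ.cylMk x.1 x.2.1 x.2.2 where
  surjective := Quotient.mk_surjective
  continuous := continuous_quotient_mk' (s := φ.cylSetoid)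
  isOpenMap V hV := by
    change IsOpen ((fun x : φ.P × PinPlus (n + 1) × Icc (0 : ℝ) 2 => φ.cylMk x.1 x.2.1 x.2.2) ⁻¹' _)
    have h : (fun x : φ.P × PinPlus (n + 1) × Icc (0 : ℝ) 2 =>
        φ.cylMk x.1 x.2.1 x.2.2) ⁻¹' ((fun x => φ.cylMk x.1 x.2.1 x.2.2) '' V) =
        ⋃ k, (fun x : φ.P × PinPlus (n + 1) × Icc (0 : ℝ) 2 =>
          (φ.act x.1 k, pinIncl n k⁻¹ * x.2.1, x.2.2)) ⁻¹' V := by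
      ext x
      simp only [mem_preimage, mem_iUnion]
      constructor
      · rintro ⟨x', hx', h⟩
        obtain ⟨k, h1, h2, h3⟩ := Quotient.exact (s := φ.cylSetoid) h.symm
        refine ⟨k, ?_⟩
        rw [h2, map_inv, inv_mul_cancel_left, ← h1, h3]
        exact hx'
      · rintro ⟨k, hk⟩
        refine ⟨_, hk, Quotient.sound (s := φ.cylSetoid) (φ.cylSetoid.symm' ⟨k, rfl, ?_, rfl⟩)⟩
        rw [map_inv, mul_inv_cancel_left]
    rw [h]
    refine isOpen_iUnion fun k => hV.preimage ?_
    exact (φ.continuous_act' continuous_fst continuous_const).prodMk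
      ((continuous_const.mul (continuous_fst.comp continuous_snd)).prodMk
        (continuous_snd.comp continuous_snd))

theorem continuous_cylMk : Continuous
    fun x : φ.P × PinPlus (n + 1) × Icc (0 : ℝ) 2 => φ.cylMk x.1 x.2.1 x.2.2 :=
  φ.isOpenQuotientMap_cylMk.continuous

theorem cylTotal_induction {p : φ.CylTotal → Prop} (h : ∀ x g y, p (φ.cylMk x g y)) (q) : p q := by
  rcases q with ⟨x, g, y⟩
  exact h x g y

/-- The action of `Pin⁺(n + 1)` on the total space. -/
def cylAct (q : φ.CylTotal) (h : PinPlus (n + 1)) : φ.CylTotal :=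
  Quotient.map (sa := φ.cylSetoid) (sb := φ.cylSetoid) (fun x => (x.1, x.2.1 * h, x.2.2))
    (fun x x' ⟨k, h1, h2, h3⟩ => ⟨k, h1, by rw [h2, mul_assoc], h3⟩) q

theorem cylAct_mk (p : φ.P) (g h : PinPlus (n + 1)) (y : Icc (0 : ℝ) 2) :
    φ.cylAct (φ.cylMk p g y) h = φ.cylMk p (g * h) y := rfl

theorem cylFrame_act (p : φ.P) (k : PinPlus n) (y : Icc (0 : ℝ) 2) :
    cylFrame (φ.frame (φ.act p k)) y =
      (cylFrame (φ.frame p) y).precomp (pinRhoEquiv (pinIncl n k)) := by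
  refine TangentFrame.ext_vec fun w => ?_
  rw [TangentFrame.vec_precomp, cylFrame_vec, cylFrame_vec, pinRhoEquiv_apply, φ.frame_act,
    ← euclSnoc_euclInit w, pinRho_pinIncl]
  simp

/-- The frame at a point of the total space. -/
def cylTotalFrame (q : φ.CylTotal) : TangentFrame (𝓡∂ (n + 1)) (Cyl M) :=
  Quotient.lift (s := φ.cylSetoid)
    (fun x => (cylFrame (φ.frame x.1) x.2.2).precomp (pinRhoEquiv x.2.1)) (by
      rintro ⟨p, g, y⟩ ⟨p', g', y'⟩ ⟨k, h1, h2, h3⟩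
      obtain rfl : p' = φ.act p k := h1
      obtain rfl : g = pinIncl n k * g' := h2
      obtain rfl : y = y' := h3
      simp only [cylFrame_act]
      refine TangentFrame.ext_vec fun w => ?_
      simp [pinRho_mul]) q

theorem cylTotalFrame_mk (p : φ.P) (g : PinPlus (n + 1)) (y : Icc (0 : ℝ) 2) :
    φ.cylTotalFrame (φ.cylMk p g y) = (cylFrame (φ.frame p) y).precomp (pinRhoEquiv g) := rfl

theorem continuous_cylAct : Continuous fun x : φ.CylTotal × PinPlus (n + 1) => φ.cylAct x.1
    x.2 := by
  refine (φ.isOpenQuotientMap_cylMk.prodMap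
    (IsOpenQuotientMap.id (X := PinPlus (n + 1)))).isQuotientMap.continuous_iff.2 ?_
  have h : Continuous fun x : (φ.P × PinPlus (n + 1) × Icc (0 : ℝ) 2) × PinPlus (n + 1) =>
      (x.1.1, x.1.2.1 * x.2, x.1.2.2) := by fun_prop
  exact φ.continuous_cylMk.comp h

theorem continuous_cylTotalFrame : Continuous
    fun x : φ.CylTotal × EuclideanSpace ℝ (Fin (n + 1)) => (φ.cylTotalFrame x.1).vec x.2 := by
  refine (φ.isOpenQuotientMap_cylMk.prodMap
    (IsOpenQuotientMap.id (X := EuclideanSpace ℝ (Fin (n + 1))))).isQuotientMap.continuous_iff.2 ?_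
  have h := continuous_cylFrame
    (X := φ.P × PinPlus (n + 1) × Icc (0 : ℝ) 2) (b := fun x => φ.frame x.1) (y := fun x => x.2.2)
    (continuous_snd.comp continuous_snd)
    (φ.continuous_frame.comp ((continuous_fst.comp continuous_fst).prodMk continuous_snd))
  have h2 := continuous_pinRho.comp (((continuous_fst (X := PinPlus (n + 1))
    (Y := Icc (0 : ℝ) 2)).comp
    ((continuous_snd (X := φ.P)).comp (continuous_fst
      (Y := EuclideanSpace ℝ (Fin (n + 1)))))).prodMk
      continuous_snd)
  have h3 := h.comp ((continuous_fst (Y := EuclideanSpace ℝ (Fin (n + 1)))).prodMk h2)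
  exact h3

/-- The product Pin⁺ structure on the cylinder. -/
def cyl : PinStructure.{u} (𝓡∂ (n + 1)) (Cyl M) where
  P := φ.CylTotal
  act := φ.cylAct
  act_one := φ.cylTotal_induction fun p g y => by rw [cylAct_mk, mul_one]
  act_mul q g h := by
    revert q
    refine φ.cylTotal_induction fun p g' y => ?_
    simp only [cylAct_mk, mul_assoc]
  continuous_act := φ.continuous_cylAct
  frame := φ.cylTotalFrame
  continuous_frame := φ.continuous_cylTotalFrame
  frame_act q g v := by
    revert q
    refine φ.cylTotal_induction fun p g' y => ?_
    simp [cylAct_mk, cylTotalFrame_mk, pinRho_mul]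
  locally_trivial z := by
    obtain ⟨e, hx, he⟩ := φ.exists_triv (fst z)
    have hbm : ∀ p g y, (φ.cylTotalFrame (φ.cylMk p g y)).base = pt (φ.proj p) y := fun _ _ _ => rfl
    have hcont : Continuous fun q => (φ.cylTotalFrame q).base := by
      refine φ.isOpenQuotientMap_cylMk.isQuotientMap.continuous_iff.2 ?_
      exact continuous_pt.comp ((φ.continuous_proj.comp continuous_fst).prodMk
        (continuous_subtype_val.comp (continuous_snd.comp continuous_snd)))
    have hact : ∀ q h, (φ.cylTotalFrame (φ.cylAct q h)).base = (φ.cylTotalFrame q).base :=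
      fun q h => by revert q; exact φ.cylTotal_induction fun _ _ _ => rfl
    let U : Set (Cyl M) := fst ⁻¹' e.baseSet
    have hU : IsOpen U := e.open_baseSet.preimage Cyl.continuous_fst
    let s : Cyl M → φ.CylTotal := fun w =>
      φ.cylMk (e.toOpenPartialHomeomorph.symm (fst w, 1)) 1 (toProd w).2
    have hes : ∀ m ∈ e.baseSet, e (e.toOpenPartialHomeomorph.symm (m, 1)) = (m, 1) :=
      fun m hm => e.apply_symm_apply' hm
    have hsp : ∀ m ∈ e.baseSet, φ.proj (e.toOpenPartialHomeomorph.symm (m, 1)) = m :=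
      fun m hm => e.proj_symm_apply' hm
    have hss : ∀ m ∈ e.baseSet, e.toOpenPartialHomeomorph.symm (m, 1) ∈ e.source :=
      fun m hm => e.mem_source.2 (by rw [hsp m hm]; exact hm)
    have hs : ContinuousOn s U := by
      have h1 : ContinuousOn (fun w : Cyl M => e.toOpenPartialHomeomorph.symm (fst w, 1)) U := by
        refine e.toOpenPartialHomeomorph.continuousOn_symm.comp
          (f := fun w : Cyl M => (fst w, (1 : PinPlus n)))
          (Cyl.continuous_fst.prodMk continuous_const).continuousOn ?_
        intro w hw
        rw [e.target_eq]; exact ⟨hw, trivial⟩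
      have h2 : Continuous fun w : Cyl M => (toProd w).2 :=
        (continuous_snd : Continuous fun w : M × Icc (0 : ℝ) 2 => w.2)
      exact φ.continuous_cylMk.comp_continuousOn
        (h1.prodMk (continuousOn_const.prodMk h2.continuousOn))
    have hdc : ∀ p k, φ.proj p ∈ e.baseSet →
        pinIncl n (e (φ.act p k)).2 = pinIncl n (e p).2 * pinIncl n k := fun p k hp => by
      rw [he p (e.mem_source.2 hp) k, map_mul]
    classical
    let d : φ.CylTotal → PinPlus (n + 1) := fun q =>
      Quotient.lift (s := φ.cylSetoid)
        (fun x => if φ.proj x.1 ∈ e.baseSet then pinIncl n (e x.1).2 * x.2.1 else 1) (by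
        rintro ⟨p, g, y⟩ ⟨p', g', y'⟩ ⟨k, h1, h2, h3⟩
        obtain rfl : p' = φ.act p k := h1
        obtain rfl : g = pinIncl n k * g' := h2
        simp only [proj_act]
        by_cases hp : φ.proj p ∈ e.baseSet
        · rw [if_pos hp, if_pos hp, hdc p k hp, mul_assoc]
        · rw [if_neg hp, if_neg hp]) q
    have hdm : ∀ p g y, φ.proj p ∈ e.baseSet → d (φ.cylMk p g y) = pinIncl n (e p).2 * g :=
      fun p g y hp => if_pos hp
    have hd : ContinuousOn d ((fun q => (φ.cylTotalFrame q).base) ⁻¹' U) := by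
      rw [φ.isOpenQuotientMap_cylMk.isQuotientMap.continuousOn_isOpen_iff (hU.preimage hcont)]
      have h1 : ContinuousOn (fun x : φ.P × PinPlus (n + 1) × Icc (0 : ℝ) 2 =>
          pinIncl n (e x.1).2 * x.2.1) {x | φ.proj x.1 ∈ e.baseSet} := by
        have h2 : ContinuousOn (fun x : φ.P × PinPlus (n + 1) × Icc (0 : ℝ) 2 => e x.1)
            {x | φ.proj x.1 ∈ e.baseSet} :=
          e.toOpenPartialHomeomorph.continuousOn.comp (t := e.source) continuous_fst.continuousOn
            fun x hx => e.mem_source.2 hx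
        exact (continuous_pinIncl.comp_continuousOn (continuous_snd.comp_continuousOn h2)).mul
          (continuous_fst.comp continuous_snd).continuousOn
      exact h1.congr fun x hx => hdm _ _ _ hx
    refine ⟨trivializationOfSection (fun q => (φ.cylTotalFrame q).base) φ.cylAct φ.continuous_cylAct
      hcont hact U hU s hs ?_ d hd ?_ ?_, hx, ?_⟩
    · intro w hw
      refine Cyl.ext (hsp _ hw) ?_
      exact ht_pt _ (toProd w).2.2
    · refine φ.cylTotal_induction fun p g y hp => ?_
      have hp' : φ.proj p ∈ e.baseSet := hp
      rw [hdm p g y hp', hbm]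
      have hy : (toProd (pt (φ.proj p) y)).2 = y := projIcc_val two_pos.le y
      change φ.cylAct (φ.cylMk _ _ (toProd (pt (φ.proj p) y)).2) _ = _
      rw [hy, cylAct_mk, one_mul, ← cylMk_act]
      congr 1
      refine φ.eq_of_triv e (φ.mem_source_act e (hss _ hp') _) ?_ ?_
      · rw [proj_act]; exact hsp _ hp'
      · refine (he _ (hss _ hp') _).trans ?_
        rw [hes _ hp', one_mul]
    · intro w hw g
      rw [show φ.cylAct (s w) g = φ.cylMk (e.toOpenPartialHomeomorph.symm (fst w, 1)) (1 * g)
        (toProd w).2 from rfl, hdm _ _ _ (by rw [hsp _ hw]; exact hw), hes _ hw, map_one, one_mul,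
        one_mul]
    · refine φ.cylTotal_induction fun p g y hp h => ?_
      have hp' : φ.proj p ∈ e.baseSet := hp
      have key : d (φ.cylAct (φ.cylMk p g y) h) = d (φ.cylMk p g y) * h := by
        rw [cylAct_mk, hdm _ _ _ hp', hdm _ _ _ hp', mul_assoc]
      exact key

end cyl

end PinStructure

/-! ### Partial inversions of `ℝⁿ` -/

/-- An orthogonal projection of `ℝⁿ`, thought of as the projection to the radial coordinates. -/
structure RadProj (n : ℕ) where
  lin : EuclideanSpace ℝ (Fin n) →L[ℝ] EuclideanSpace ℝ (Fin n)
  idem : ∀ v, lin (lin v) = lin v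
  symm : ∀ v w, inner ℝ (lin v) w = inner ℝ v (lin w)

namespace RadProj

variable {n : ℕ} (ϖ : RadProj n)

/-- Multiplication by `l` in the radial coordinates. -/
def scale (l : ℝ) (v : EuclideanSpace ℝ (Fin n)) : EuclideanSpace ℝ (Fin n) := v + (l - 1) • ϖ.lin v

theorem lin_scale (l : ℝ) (v : EuclideanSpace ℝ (Fin n)) : ϖ.lin (ϖ.scale l v) = l • ϖ.lin v := by
  rw [scale, map_add, map_smul, ϖ.idem]
  module

theorem scale_scale (l m : ℝ) (v : EuclideanSpace ℝ (Fin n)) :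
    ϖ.scale l (ϖ.scale m v) = ϖ.scale (l * m) v := by
  rw [scale, lin_scale, scale, scale]
  module

theorem scale_one (v : EuclideanSpace ℝ (Fin n)) : ϖ.scale 1 v = v := by simp [scale]

theorem continuous_scale : Continuous fun z : ℝ × EuclideanSpace ℝ (Fin n) => ϖ.scale z.1 z.2 := by
  unfold scale
  fun_prop

/-- Multiplication by `exp s` in the radial coordinates. -/
def stretch (s : ℝ) : EuclideanSpace ℝ (Fin n) ≃L[ℝ] EuclideanSpace ℝ (Fin n) :=
  ContinuousLinearEquiv.equivOfInverse
    (ContinuousLinearMap.id ℝ _ + (Real.exp s - 1) • ϖ.lin)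
    (ContinuousLinearMap.id ℝ _ + (Real.exp (-s) - 1) • ϖ.lin)
    (fun v => by
      change ϖ.scale _ (ϖ.scale _ v) = v
      rw [scale_scale, ← Real.exp_add, neg_add_cancel, Real.exp_zero, scale_one])
    (fun v => by
      change ϖ.scale _ (ϖ.scale _ v) = v
      rw [scale_scale, ← Real.exp_add, add_neg_cancel, Real.exp_zero, scale_one])

theorem stretch_apply (s : ℝ) (v : EuclideanSpace ℝ (Fin n)) :
    ϖ.stretch s v = ϖ.scale (Real.exp s) v := rfl

theorem lin_stretch (s : ℝ) (v : EuclideanSpace ℝ (Fin n)) :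
    ϖ.lin (ϖ.stretch s v) = Real.exp s • ϖ.lin v := ϖ.lin_scale _ _

theorem stretch_stretch (s t : ℝ) (v : EuclideanSpace ℝ (Fin n)) :
    ϖ.stretch s (ϖ.stretch t v) = ϖ.stretch (s + t) v := by
  rw [stretch_apply, stretch_apply, scale_scale, ← Real.exp_add]; rfl

theorem stretch_zero (v : EuclideanSpace ℝ (Fin n)) : ϖ.stretch 0 v = v := by
  rw [stretch_apply, Real.exp_zero, scale_one]

theorem continuous_stretch :
    Continuous fun z : ℝ × EuclideanSpace ℝ (Fin n) => ϖ.stretch z.1 z.2 :=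
  ϖ.continuous_scale.comp ((Real.continuous_exp.comp continuous_fst).prodMk continuous_snd)

/-- The squared norm of the radial coordinates. -/
def sq (x : EuclideanSpace ℝ (Fin n)) : ℝ := ‖ϖ.lin x‖ ^ 2

theorem continuous_sq : Continuous ϖ.sq := by unfold sq; fun_prop

theorem sq_pos {x : EuclideanSpace ℝ (Fin n)} (h : ϖ.lin x ≠ 0) : 0 < ϖ.sq x := by
  have := norm_pos_iff.2 h
  unfold sq; positivity

/-- The inversion in the radial coordinates. -/
def inversion (x : EuclideanSpace ℝ (Fin n)) : EuclideanSpace ℝ (Fin n) :=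
  ϖ.stretch (-Real.log (ϖ.sq x)) x

theorem inversion_eq (x : EuclideanSpace ℝ (Fin n)) :
    ϖ.inversion x = x + ((ϖ.sq x)⁻¹ - 1) • ϖ.lin x := by
  by_cases h : ϖ.lin x = 0
  · simp [inversion, stretch_apply, scale, h]
  · rw [inversion, stretch_apply, Real.exp_neg, Real.exp_log (ϖ.sq_pos h), scale]

theorem lin_inversion {x : EuclideanSpace ℝ (Fin n)} (h : ϖ.lin x ≠ 0) :
    ϖ.lin (ϖ.inversion x) = (ϖ.sq x)⁻¹ • ϖ.lin x := by
  rw [inversion, lin_stretch, Real.exp_neg, Real.exp_log (ϖ.sq_pos h)]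

theorem lin_inversion_ne {x : EuclideanSpace ℝ (Fin n)} (h : ϖ.lin x ≠ 0) :
    ϖ.lin (ϖ.inversion x) ≠ 0 := by
  rw [ϖ.lin_inversion h]
  exact smul_ne_zero (inv_ne_zero (ϖ.sq_pos h).ne') h

theorem sq_inversion {x : EuclideanSpace ℝ (Fin n)} (h : ϖ.lin x ≠ 0) :
    ϖ.sq (ϖ.inversion x) = (ϖ.sq x)⁻¹ := by
  have h1 := ϖ.sq_pos h
  rw [sq, ϖ.lin_inversion h, norm_smul, mul_pow, Real.norm_eq_abs, sq_abs]
  change (ϖ.sq x)⁻¹ ^ 2 * ϖ.sq x = _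
  field_simp

theorem inversion_inversion {x : EuclideanSpace ℝ (Fin n)} (h : ϖ.lin x ≠ 0) :
    ϖ.inversion (ϖ.inversion x) = x := by
  rw [inversion, ϖ.sq_inversion h, Real.log_inv, neg_neg, inversion, stretch_stretch,
    add_neg_cancel, stretch_zero]

theorem contDiffAt_inversion {x : EuclideanSpace ℝ (Fin n)} (h : ϖ.lin x ≠ 0) :
    ContDiffAt ℝ ∞ ϖ.inversion x := by
  have h1 : ContDiffAt ℝ ∞ ϖ.sq x := by
    unfold sq
    exact (ϖ.lin.contDiff.contDiffAt).norm_sq ℝ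
  have h2 : ContDiffAt ℝ ∞ (fun x => x + ((ϖ.sq x)⁻¹ - 1) • ϖ.lin x) x :=
    contDiffAt_id.add (((h1.inv (ϖ.sq_pos h).ne').sub contDiffAt_const).smul
      ϖ.lin.contDiff.contDiffAt)
  exact h2.congr_of_eventuallyEq (.of_forall ϖ.inversion_eq)

/-- The differential of the inversion is the reflection in the radial direction followed by a
scaling. -/
theorem fderiv_inversion {x : EuclideanSpace ℝ (Fin n)} (h : ϖ.lin x ≠ 0)
    (v : EuclideanSpace ℝ (Fin n)) : fderiv ℝ ϖ.inversion x v =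
      ϖ.stretch (-Real.log (ϖ.sq x)) (pinRho (pinDir (ϖ.lin x)) v) := by
  have hpos := ϖ.sq_pos h
  have h0 : HasFDerivAt ϖ.lin ϖ.lin x := ϖ.lin.hasFDerivAt
  have h1 : HasFDerivAt ϖ.sq (2 • (innerSL ℝ (ϖ.lin x)).comp ϖ.lin) x := h0.norm_sq
  have h2 : HasFDerivAt (fun x => (ϖ.sq x)⁻¹)
      ((-(ϖ.sq x ^ 2)⁻¹) • (2 • (innerSL ℝ (ϖ.lin x)).comp ϖ.lin)) x :=
    (hasDerivAt_inv hpos.ne').comp_hasFDerivAt x h1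
  have h3 := (hasFDerivAt_id x).add ((h2.sub_const 1).smul h0)
  have h4 : HasFDerivAt ϖ.inversion _ x := h3.congr_of_eventuallyEq (.of_forall ϖ.inversion_eq)
  rw [h4.fderiv, stretch_apply, Real.exp_neg, Real.exp_log hpos, pinRho_pinDir]
  have h5 : Inner.inner ℝ (ϖ.lin x) (ϖ.lin v) = Inner.inner ℝ (ϖ.lin x) v := by
    rw [← ϖ.symm, ϖ.idem]
  simp only [scale, map_sub, map_smul, ϖ.idem]
  simp only [_root_.add_apply, _root_.smul_apply,
    ContinuousLinearMap.smulRight_apply, ContinuousLinearMap.comp_apply, innerSL_apply_apply, h5,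
    ContinuousLinearMap.id_apply]
  change _ = v - (2 * Inner.inner ℝ (ϖ.lin x) v / ϖ.sq x) • ϖ.lin x + ((ϖ.sq x)⁻¹ - 1) •
    (ϖ.lin v - (2 * Inner.inner ℝ (ϖ.lin x) v / ϖ.sq x) • ϖ.lin x)
  have e : ϖ.sq x ≠ 0 := hpos.ne'
  generalize ϖ.sq x = q at e ⊢
  generalize Inner.inner ℝ (ϖ.lin x) v = r
  match_scalars <;> simp only [nsmul_eq_mul, smul_eq_mul, Nat.cast_ofNat] <;> field_simp
  ring
  exact h

/-- The projection to the radial coordinates and the last coordinate. -/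
def snoc : RadProj (n + 1) where
  lin := LinearMap.toContinuousLinearMap
    { toFun := fun w => euclSnoc (ϖ.lin (euclInit w)) (w (Fin.last n))
      map_add' := fun v w => euclSnoc_ext (by simp [Cyl.euclInit_add]) (by simp)
      map_smul' := fun c w => euclSnoc_ext (by simp [Cyl.euclInit_smul]) (by simp) }
  idem v := euclSnoc_ext (by simp [ϖ.idem]) (by simp)
  symm v w := by
    have key : ∀ v c w d, Inner.inner ℝ (euclSnoc (ϖ.lin v) c) (euclSnoc w d) =
        Inner.inner ℝ (euclSnoc v c) (euclSnoc (ϖ.lin w) d) := fun v c w d => by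
      rw [inner_euclSnoc, inner_euclSnoc, ϖ.symm]
    have h := key (euclInit v) (v (Fin.last n)) (euclInit w) (w (Fin.last n))
    rw [euclSnoc_euclInit, euclSnoc_euclInit] at h
    exact h

theorem snoc_lin (v : EuclideanSpace ℝ (Fin n)) (c : ℝ) :
    ϖ.snoc.lin (euclSnoc v c) = euclSnoc (ϖ.lin v) c := by simp [snoc]

theorem snoc_sq (v : EuclideanSpace ℝ (Fin n)) (c : ℝ) :
    ϖ.snoc.sq (euclSnoc v c) = ϖ.sq v + c ^ 2 := by
  rw [sq, snoc_lin, ← real_inner_self_eq_norm_sq, inner_euclSnoc, real_inner_self_eq_norm_sq,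
    ← pow_two]
  rfl

theorem snoc_stretch (s : ℝ) (v : EuclideanSpace ℝ (Fin n)) (c : ℝ) :
    ϖ.snoc.stretch s (euclSnoc v c) = euclSnoc (ϖ.stretch s v) (Real.exp s * c) := by
  rw [stretch_apply, stretch_apply, scale, snoc_lin, scale]
  refine euclSnoc_ext ?_ ?_
  · simp [Cyl.euclInit_add, Cyl.euclInit_smul]
  · simp; ring

end RadProj

/-- The block sum of an automorphism of `ℝⁿ` with the identity of `ℝ`. -/
def snocEquiv {n : ℕ} (A : EuclideanSpace ℝ (Fin n) ≃L[ℝ] EuclideanSpace ℝ (Fin n)) :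
    EuclideanSpace ℝ (Fin (n + 1)) ≃L[ℝ] EuclideanSpace ℝ (Fin (n + 1)) :=
  LinearEquiv.toContinuousLinearEquiv
    { toFun := fun w => euclSnoc (A (euclInit w)) (w (Fin.last n))
      invFun := fun w => euclSnoc (A.symm (euclInit w)) (w (Fin.last n))
      map_add' := fun v w => euclSnoc_ext (by simp [Cyl.euclInit_add]) (by simp)
      map_smul' := fun c w => euclSnoc_ext (by simp [Cyl.euclInit_smul]) (by simp)
      left_inv := fun w => euclSnoc_ext (by simp) (by simp)
      right_inv := fun w => euclSnoc_ext (by simp) (by simp) }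

theorem snocEquiv_euclSnoc {n : ℕ} (A : EuclideanSpace ℝ (Fin n) ≃L[ℝ] EuclideanSpace ℝ (Fin n))
    (v : EuclideanSpace ℝ (Fin n)) (c : ℝ) :
    snocEquiv A (euclSnoc v c) = euclSnoc (A v) c := by
  change euclSnoc (A (euclInit (euclSnoc v c))) (euclSnoc v c (Fin.last n)) = _
  simp

theorem snocEquiv_apply {n : ℕ} (A : EuclideanSpace ℝ (Fin n) ≃L[ℝ] EuclideanSpace ℝ (Fin n))
    (w : EuclideanSpace ℝ (Fin (n + 1))) :
    snocEquiv A w = euclSnoc (A (euclInit w)) (w (Fin.last n)) := rfl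

section gluingMatrix

variable {n : ℕ} (ϖ : RadProj n)

/-- The matrix interpolating between the frames on the two sides of the gluing: `F₁`, `F₂` are the
matrices of the frames on the two sides, and the inversion has the differential
`stretch (-log ‖X‖²) ∘ R_X` where `R_X` is the reflection in `X`. -/
def gluingMatrix (F₁ F₂ : EuclideanSpace ℝ (Fin n) ≃L[ℝ] EuclideanSpace ℝ (Fin n))
    (X : EuclideanSpace ℝ (Fin n)) (s : ℝ) :
    EuclideanSpace ℝ (Fin n) ≃L[ℝ] EuclideanSpace ℝ (Fin n) :=
  (pinRhoEquiv (pinDir X)).trans (F₂.trans ((ϖ.stretch s).trans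
    ((pinRhoEquiv (pinDir X)).trans F₁)))

theorem gluingMatrix_apply (F₁ F₂ : EuclideanSpace ℝ (Fin n) ≃L[ℝ] EuclideanSpace ℝ (Fin n))
    (X : EuclideanSpace ℝ (Fin n)) (s : ℝ) (v) : gluingMatrix ϖ F₁ F₂ X s v =
      F₁ (pinRho (pinDir X) (ϖ.stretch s (F₂ (pinRho (pinDir X) v)))) := rfl

theorem pinRho_pinDir_pinRho_pinDir (X v : EuclideanSpace ℝ (Fin n)) :
    pinRho (pinDir X) (pinRho (pinDir X) v) = v := by
  rw [← pinRho_mul, pinDir_mul_self, pinRho_one]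

theorem continuous_gluingMatrix {Z : Type*} [TopologicalSpace Z]
    {F₁ F₂ : Z → EuclideanSpace ℝ (Fin n) ≃L[ℝ] EuclideanSpace ℝ (Fin n)}
    {X : Z → EuclideanSpace ℝ (Fin n)} {s : Z → ℝ}
    (h1 : Continuous fun z : Z × EuclideanSpace ℝ (Fin n) => F₁ z.1 z.2)
    (h2 : Continuous fun z : Z × EuclideanSpace ℝ (Fin n) => F₂ z.1 z.2)
    (hX : Continuous X) (hX0 : ∀ z, X z ≠ 0) (hs : Continuous s) :
    Continuous fun z : Z × EuclideanSpace ℝ (Fin n) =>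
      gluingMatrix ϖ (F₁ z.1) (F₂ z.1) (X z.1) (s z.1) z.2 := by
  have hu : Continuous fun z => pinDir (X z) := continuousOn_pinDir.comp_continuous hX hX0
  have hR : ∀ {f : Z × EuclideanSpace ℝ (Fin n) → EuclideanSpace ℝ (Fin n)}, Continuous f →
      Continuous fun z : Z × EuclideanSpace ℝ (Fin n) => pinRho (pinDir (X z.1)) (f z) := by
    intro f hf
    have h := continuous_pinRho.comp ((hu.comp (continuous_fst
      (Y := EuclideanSpace ℝ (Fin n)))).prodMk hf)
    exact h
  have e1 := hR continuous_snd
  have e2 := h2.comp (continuous_fst.prodMk e1)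
  have e3 := ϖ.continuous_stretch.comp
    ((hs.comp (continuous_fst (Y := EuclideanSpace ℝ (Fin n)))).prodMk e2)
  have e4 := h1.comp (continuous_fst.prodMk (hR e3))
  exact e4

end gluingMatrix

/-! ### Gluing Pin⁺ structures along a partial inversion -/

section stage

variable {n : ℕ} {H : Type*} [TopologicalSpace H]
  {I : ModelWithCorners ℝ (EuclideanSpace ℝ (Fin n)) H}
  {A B : Type*} [TopologicalSpace A] [ChartedSpace H A] [IsManifold I ∞ A]
  [TopologicalSpace B] [ChartedSpace H B] [IsManifold I ∞ B]

/-- The flat frame on a tube `T` is carried by the inversion of `T` to the flat frame, reflected in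
the radial direction and stretched. -/
theorem map_inversion_flat {T : Type*} [TopologicalSpace T] [ChartedSpace H T] (ϖ : RadProj n)
    {fl : T → EuclideanSpace ℝ (Fin n)}
    (hfl : MDifferentiable I 𝓘(ℝ, EuclideanSpace ℝ (Fin n)) fl) {flat : T → TangentFrame I T}
    (hb : ∀ z, (flat z).base = z)
    (hflat : ∀ z w, tangentMap I 𝓘(ℝ, EuclideanSpace ℝ (Fin n)) fl ((flat z).vec w) =
      flatVec (fl z) w)
    {inv : T → T} (hinv : IsLocalDiffeomorph I I ∞ inv)
    (h : ∀ z, fl (inv z) = ϖ.inversion (fl z)) (h0 : ∀ z, ϖ.lin (fl z) ≠ 0) (z : T) :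
    (flat z).map hinv = (flat (inv z)).precomp
      ((pinRhoEquiv (pinDir (ϖ.lin (fl z)))).trans (ϖ.stretch (-Real.log (ϖ.sq (fl z))))) := by
  refine TangentFrame.ext_vec fun v => ?_
  rw [TangentFrame.vec_map, TangentFrame.vec_precomp]
  have hmd : MDifferentiableAt 𝓘(ℝ, EuclideanSpace ℝ (Fin n)) 𝓘(ℝ, EuclideanSpace ℝ (Fin n))
      ϖ.inversion (fl z) :=
    ((ϖ.contDiffAt_inversion (h0 z)).differentiableAt (by simp)).mdifferentiableAt
  have e1 : tangentMap I 𝓘(ℝ, EuclideanSpace ℝ (Fin n)) (fl ∘ inv) ((flat z).vec v) =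
      flatVec (fl (inv z)) (ϖ.stretch (-Real.log (ϖ.sq (fl z)))
        (pinRho (pinDir (ϖ.lin (fl z))) v)) := by
    have e2 : fl ∘ inv = ϖ.inversion ∘ fl := funext h
    have hz : ((flat z).vec v).1 = z := hb z
    rw [e2, tangentMap_comp_at _ (by rw [hz]; exact hmd) (hfl _), hflat, h,
      ← ϖ.fderiv_inversion (h0 z), ← mfderiv_eq_fderiv]
    rfl
  rw [tangentMap_comp_at _ (hfl _) (hinv.mdifferentiable (by simp) _)] at e1
  -- the differential of `fl` is injective on the fibre over `inv z`, as it straightens `flat`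
  have key : ∀ V : TangentBundle I T, V.proj = inv z → ∀ w,
      tangentMap I 𝓘(ℝ, EuclideanSpace ℝ (Fin n)) fl V = flatVec (fl (inv z)) w →
      V = (flat (inv z)).vec w := by
    rintro ⟨x, V⟩ hx w hV
    obtain rfl : x = (flat (inv z)).base := Eq.trans hx (hb _).symm
    obtain ⟨w', rfl⟩ := (flat (inv z)).iso.surjective V
    have e3 : flatVec (fl (inv z)) w' = flatVec (fl (inv z)) w := (hflat _ _).symm.trans hV
    have : w' = w := congrArg (fun V => (tangentBundleModelSpaceHomeomorph (𝓡 n) V).2) e3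
    rw [this]; rfl
  refine key _ ?_ _ e1
  exact congrArg inv (hb z)

/-- Pin⁺ structures on two manifolds with an open set `T` mapping to both, flattened by `fl` so that
an involution `inv` of `T` becomes the inversion in the radial coordinates, together with sections
`η₁`, `η₂` over `T` and homotopies `F₁`, `F₂` from their matrices to the identity. -/
structure FlatStage (φA : PinStructure.{u} I A) (φB : PinStructure.{u} I B)
    (T : Type*) [TopologicalSpace T] [ChartedSpace H T] [IsManifold I ∞ T] where
  ϖ : RadProj n
  fl : T → EuclideanSpace ℝ (Fin n)
  mdifferentiable_fl : MDifferentiable I 𝓘(ℝ, EuclideanSpace ℝ (Fin n)) fl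
  flat : T → TangentFrame I T
  base_flat : ∀ z, (flat z).base = z
  continuous_flat : Continuous fun z : T × EuclideanSpace ℝ (Fin n) => (flat z.1).vec z.2
  tangentMap_flat : ∀ z w, tangentMap I 𝓘(ℝ, EuclideanSpace ℝ (Fin n)) fl ((flat z).vec w) =
    flatVec (fl z) w
  inv : T → T
  isLocalDiffeomorph_inv : IsLocalDiffeomorph I I ∞ inv
  fl_inv : ∀ z, fl (inv z) = ϖ.inversion (fl z)
  lin_ne : ∀ z, ϖ.lin (fl z) ≠ 0
  k₁ : T → A
  k₂ : T → B
  isLocalDiffeomorph_k₁ : IsLocalDiffeomorph I I ∞ k₁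
  isLocalDiffeomorph_k₂ : IsLocalDiffeomorph I I ∞ k₂
  η₁ : T → φA.P
  η₂ : T → φB.P
  continuous_η₁ : Continuous η₁
  continuous_η₂ : Continuous η₂
  F₁ : unitInterval → T → EuclideanSpace ℝ (Fin n) ≃L[ℝ] EuclideanSpace ℝ (Fin n)
  F₂ : unitInterval → T → EuclideanSpace ℝ (Fin n) ≃L[ℝ] EuclideanSpace ℝ (Fin n)
  continuous_F₁ : Continuous fun z : (unitInterval × T) × EuclideanSpace ℝ (Fin n) =>
    F₁ z.1.1 z.1.2 z.2
  continuous_F₂ : Continuous fun z : (unitInterval × T) × EuclideanSpace ℝ (Fin n) =>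
    F₂ z.1.1 z.1.2 z.2
  F₁_one : ∀ z v, F₁ 1 z v = v
  F₂_one : ∀ z v, F₂ 1 z v = v
  frame_η₁ : ∀ z, φA.frame (η₁ z) = ((flat z).precomp (F₁ 0 z)).map isLocalDiffeomorph_k₁
  frame_η₂ : ∀ z, φB.frame (η₂ z) = ((flat z).precomp (F₂ 0 z)).map isLocalDiffeomorph_k₂
  deck : ∀ z z', k₁ z = k₁ z' → ∃ c : PinPlus n, φA.act (η₁ z') c = η₁ z ∧
    φB.act (η₂ (inv z')) (pinGrading n c) = η₂ (inv z) ∧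
    ((flat z').precomp (pinRhoEquiv c)).map isLocalDiffeomorph_k₁ =
      (flat z).map isLocalDiffeomorph_k₁ ∧
    (∀ t v, F₁ t z' (pinRho c v) = pinRho c (F₁ t z v)) ∧
    (∀ t v, F₂ t (inv z') (pinRho c v) = pinRho c (F₂ t (inv z) v)) ∧
    (∀ v, ϖ.lin (pinRho c v) = pinRho c (ϖ.lin v)) ∧
    ϖ.lin (fl z') = pinRho c (ϖ.lin (fl z))

namespace FlatStage

variable {φA : PinStructure.{u} I A} {φB : PinStructure.{u} I B}
  {T : Type*} [TopologicalSpace T] [ChartedSpace H T] [IsManifold I ∞ T] (S : FlatStage φA φB T)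

/-- The radial direction. -/
def rad (z : T) : EuclideanSpace ℝ (Fin n) := S.ϖ.lin (S.fl z)

theorem continuous_fl : Continuous S.fl := S.mdifferentiable_fl.continuous

theorem continuous_rad : Continuous S.rad := S.ϖ.lin.continuous.comp S.continuous_fl

/-- The squared length of the radial coordinates. -/
def radSq (z : T) : ℝ := S.ϖ.sq (S.fl z)

theorem continuous_radSq : Continuous S.radSq := S.ϖ.continuous_sq.comp S.continuous_fl

theorem radSq_pos (z : T) : 0 < S.radSq z := S.ϖ.sq_pos (S.lin_ne z)

theorem proj_η₁ (z : T) : φA.proj (S.η₁ z) = S.k₁ z := by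
  rw [PinStructure.proj, S.frame_η₁]; exact congrArg S.k₁ (S.base_flat z)

theorem proj_η₂ (z : T) : φB.proj (S.η₂ z) = S.k₂ z := by
  rw [PinStructure.proj, S.frame_η₂]; exact congrArg S.k₂ (S.base_flat z)

/-- The matrices interpolating between the two families of frames over the overlap. -/
def Λ (t : unitInterval) (z : T) : EuclideanSpace ℝ (Fin n) ≃L[ℝ] EuclideanSpace ℝ (Fin n) :=
  gluingMatrix S.ϖ (S.F₁ t z) (S.F₂ (unitInterval.symm t) (S.inv z)) (S.rad z)
    (t * Real.log (S.radSq z))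

theorem continuous_Λ : Continuous fun z : (unitInterval × T) × EuclideanSpace ℝ (Fin n) =>
    S.Λ z.1.1 z.1.2 z.2 := by
  refine continuous_gluingMatrix S.ϖ (Z := unitInterval × T) (F₁ := fun z => S.F₁ z.1 z.2)
    (F₂ := fun z => S.F₂ (unitInterval.symm z.1) (S.inv z.2)) (X := fun z => S.rad z.2)
    (s := fun z => (z.1 : ℝ) * Real.log (S.radSq z.2)) S.continuous_F₁ ?_
    (S.continuous_rad.comp continuous_snd) (fun z => S.lin_ne z.2) ?_
  · exact S.continuous_F₂.comp (((unitInterval.continuous_symm.comp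
      (continuous_fst.comp continuous_fst)).prodMk
        (S.isLocalDiffeomorph_inv.contMDiff.continuous.comp
      (continuous_snd.comp continuous_fst))).prodMk continuous_snd)
  · exact (continuous_subtype_val.comp continuous_fst).mul
      ((S.continuous_radSq.comp continuous_snd).log fun z => (S.radSq_pos _).ne')

theorem radSq_eq {z z' : T} (h : S.k₁ z = S.k₁ z') : S.radSq z = S.radSq z' := by
  obtain ⟨c, -, -, -, -, -, -, hc⟩ := S.deck z z' h
  rw [radSq, radSq, RadProj.sq, RadProj.sq, hc, norm_pinRho]

theorem isLocalDiffeomorph_k₂_inv : IsLocalDiffeomorph I I ∞ fun z => S.k₂ (S.inv z) :=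
  S.isLocalDiffeomorph_k₂.comp S.isLocalDiffeomorph_inv

/-- On the second side the element `pinDir` undoes the reflection in the differential of the
inversion. -/
theorem frame_η₂_inv (z : T) : φB.frame (φB.act (S.η₂ (S.inv z)) (pinDir (S.rad z))) =
    ((flat S z).precomp (S.Λ 1 z)).map S.isLocalDiffeomorph_k₂_inv := by
  have e1 : (flat S (S.inv z)) = ((S.flat z).map S.isLocalDiffeomorph_inv).precomp
      ((S.ϖ.stretch (Real.log (S.radSq z))).trans (pinRhoEquiv (pinDir (S.rad z)))) := by
    rw [map_inversion_flat S.ϖ S.mdifferentiable_fl S.base_flat S.tangentMap_flat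
      S.isLocalDiffeomorph_inv S.fl_inv S.lin_ne]
    refine TangentFrame.ext_vec fun v => ?_
    simp only [TangentFrame.vec_precomp, ContinuousLinearEquiv.trans_apply, pinRhoEquiv_apply]
    rw [rad, pinRho_pinDir_pinRho_pinDir, radSq, S.ϖ.stretch_stretch, neg_add_cancel,
      S.ϖ.stretch_zero]
  refine TangentFrame.ext_vec fun v => ?_
  have e2 : (S.flat z).map S.isLocalDiffeomorph_k₂_inv =
      ((S.flat z).map S.isLocalDiffeomorph_inv).map S.isLocalDiffeomorph_k₂ :=
    (TangentFrame.map_map _ _ _).symm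
  rw [φB.frame_act, S.frame_η₂, e1, TangentFrame.precomp_map, TangentFrame.precomp_map,
    TangentFrame.precomp_map, e2]
  simp only [TangentFrame.vec_precomp, ContinuousLinearEquiv.trans_apply, pinRhoEquiv_apply,
    Λ, gluingMatrix_apply, S.F₁_one, unitInterval.symm_one, Icc.coe_one, one_mul]

variable {Q : Type*} [TopologicalSpace Q] [ChartedSpace H Q] [IsManifold I ∞ Q] {a : A → Q}
  {b : B → Q}

/-- The gluing of Pin⁺ structures along the inversion. -/
def toSectionGluing (ha : IsLocalDiffeomorph I I ∞ a) (hb : IsLocalDiffeomorph I I ∞ b)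
    (ha' : Function.Injective a) (hb' : Function.Injective b)
    (cover : ∀ q, q ∈ range a ∨ q ∈ range b) (hab : ∀ z, a (S.k₁ z) = b (S.k₂ (S.inv z)))
    (h₁ : ∀ p, a p ∈ range b → p ∈ range S.k₁)
    (h₂ : ∀ p, b p ∈ range a → p ∈ range fun z => S.k₂ (S.inv z))
    (s_ge : ∀ p ∉ range S.k₁, ∀ᶠ p' in 𝓝 p, ∀ z, S.k₁ z = p' → 2 ≤ S.radSq z)
    (s_le : ∀ p ∉ range fun z => S.k₂ (S.inv z), ∀ᶠ p' in 𝓝 p, ∀ z, S.k₂ (S.inv z) = p' →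
      S.radSq z ≤ 1 / 2) : SectionGluing φA φB a b T where
  isLocalDiffeomorph_left := ha
  isLocalDiffeomorph_right := hb
  injective_left := ha'
  injective_right := hb'
  cover := cover
  κ₁ := S.k₁
  κ₂ z := S.k₂ (S.inv z)
  isOpenMap_κ₁ := S.isLocalDiffeomorph_k₁.isOpenMap
  isOpenMap_κ₂ := S.isLocalDiffeomorph_k₂_inv.isOpenMap
  a_κ₁ := hab
  mem_range_κ₁ := h₁
  mem_range_κ₂ := h₂
  h₁ := S.η₁
  h₂ z := φB.act (S.η₂ (S.inv z)) (pinDir (S.rad z))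
  continuous_h₁ := S.continuous_η₁
  continuous_h₂ := φB.continuous_act'
    (S.continuous_η₂.comp S.isLocalDiffeomorph_inv.contMDiff.continuous)
    (continuousOn_pinDir.comp_continuous S.continuous_rad S.lin_ne)
  proj_h₁ := S.proj_η₁
  proj_h₂ z := by rw [PinStructure.proj_act, S.proj_η₂]
  γ t z := (((S.flat z).precomp (S.Λ t z)).map S.isLocalDiffeomorph_k₁).map ha
  continuous_γ := by
    have h := S.continuous_flat.comp (((continuous_snd (X := unitInterval) (Y := T)).comp
      (continuous_fst (Y := EuclideanSpace ℝ (Fin n)))).prodMk S.continuous_Λ)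
    exact (ha.contMDiff.continuous_tangentMap (by simp)).comp
      ((S.isLocalDiffeomorph_k₁.contMDiff.continuous_tangentMap (by simp)).comp h)
  base_γ t z := congrArg (fun x => a (S.k₁ x)) (S.base_flat z)
  γ_zero z v := by
    rw [S.frame_η₁, TangentFrame.vec_map, TangentFrame.precomp_map, TangentFrame.precomp_map]
    simp only [TangentFrame.vec_precomp, Λ, gluingMatrix_apply, unitInterval.symm_zero, S.F₂_one]
    simp only [Icc.coe_zero, zero_mul, S.ϖ.stretch_zero, pinRho_pinDir_pinRho_pinDir]
  γ_one z v := by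
    rw [S.frame_η₂_inv, ← TangentFrame.vec_map hb, TangentFrame.map_map, TangentFrame.map_map]
    exact congrArg (fun f => TangentFrame.vec f v) (TangentFrame.map_congr _ _ hab _)
  deck z z' h := by
    obtain ⟨c, h1, h2, h3, h4, h5, h6, h7⟩ := S.deck z z' h
    have hX : S.rad z' = pinRho c (S.rad z) := h7
    have hu : pinDir (S.rad z') * c = pinGrading n c * pinDir (S.rad z) := by
      rw [hX, pinDir_pinRho _ (show S.rad z ≠ 0 from S.lin_ne z), inv_mul_cancel_right]
    refine ⟨c, h1, ?_, fun t v => ?_⟩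
    · rw [← φB.act_mul, hu, φB.act_mul, h2]
    · have hR : ∀ w, pinRho (pinDir (S.rad z')) (pinRho c w) =
          pinRho c (pinRho (pinDir (S.rad z)) w) := fun w => by
        rw [← pinRho_mul, hu, pinRho_mul, pinRho_pinGrading]
      have hst : ∀ s w, S.ϖ.stretch s (pinRho c w) = pinRho c (S.ϖ.stretch s w) := fun s w => by
        simp only [RadProj.stretch_apply, RadProj.scale, h6, map_add, map_smul]
      have hΛ : S.Λ t z' (pinRho c v) = pinRho c (S.Λ t z v) := by
        simp only [Λ, gluingMatrix_apply, hR, h5, hst, h4, S.radSq_eq h]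
      rw [TangentFrame.precomp_map, TangentFrame.precomp_map, TangentFrame.precomp_map,
        TangentFrame.precomp_map, TangentFrame.vec_precomp, TangentFrame.vec_precomp, hΛ, ← h3]
      rfl
  s := S.radSq
  continuous_s := S.continuous_radSq
  s_eq _ _ h := S.radSq_eq h
  s_ge := s_ge
  s_le := s_le

end FlatStage

end stage

section region

variable {n : ℕ} {H : Type*} [TopologicalSpace H]
  {I : ModelWithCorners ℝ (EuclideanSpace ℝ (Fin n)) H}

/-- A smooth involution of an open set is a diffeomorphism of it. -/
theorem isLocalDiffeomorph_involution {T : Type*} [TopologicalSpace T] [ChartedSpace H T]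
    (O : Opens T) {f : T → T} (hO : ∀ z ∈ O, f z ∈ O) (hf : ∀ z ∈ O, f (f z) = z)
    (hs : ∀ z ∈ O, ContMDiffAt I I ∞ f z) :
    IsLocalDiffeomorph I I ∞ fun z : O => (⟨f z, hO z z.2⟩ : O) := by
  have h : ContMDiff I I ∞ fun z : O => (⟨f z, hO z z.2⟩ : O) := fun z =>
    (ContMDiffAt.subtypeVal_comp_iff _ _ _).1 (contMDiffAt_subtype_iff.2 (hs z z.2))
  let D : Diffeomorph I I O O ∞ :=
    { toFun := fun z => ⟨f z, hO z z.2⟩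
      invFun := fun z => ⟨f z, hO z z.2⟩
      left_inv := fun z => Subtype.ext (hf z z.2)
      right_inv := fun z => Subtype.ext (hf z z.2)
      contMDiff_toFun := h
      contMDiff_invFun := h }
  exact D.isLocalDiffeomorph

/-- A local diffeomorphism into an open submanifold, obtained by restriction. -/
theorem isLocalDiffeomorph_restrict {T X : Type*} [TopologicalSpace T] [ChartedSpace H T]
    [IsManifold I ∞ T] [TopologicalSpace X] [ChartedSpace H X] [IsManifold I ∞ X] (O : Opens T)
    (A : Opens X) {k : T → X} (hk : IsLocalDiffeomorph I I ∞ k) (h : ∀ z ∈ O, k z ∈ A) :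
    IsLocalDiffeomorph I I ∞ fun z : O => (⟨k z, h z z.2⟩ : A) :=
  .of_comp (isLocalDiffeomorph_subtypeVal A)
    ((hk.contMDiff.continuous.comp continuous_subtype_val).subtype_mk _)
    (hk.comp (isLocalDiffeomorph_subtypeVal O))

variable {X₁ X₂ : Type u} [TopologicalSpace X₁] [ChartedSpace H X₁] [IsManifold I ∞ X₁]
  [TopologicalSpace X₂] [ChartedSpace H X₂] [IsManifold I ∞ X₂]

/-- The data of a `FlatStage` given on a larger manifold `T`, with the inversion restricted to an
open set `O`, which is mapped to open submanifolds `A₁`, `A₂`. -/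
structure FlatRegion (φ₁ : PinStructure.{u} I X₁) (φ₂ : PinStructure.{u} I X₂)
    (T : Type*) [TopologicalSpace T] [ChartedSpace H T] [IsManifold I ∞ T] where
  ϖ : RadProj n
  fl : T → EuclideanSpace ℝ (Fin n)
  mdifferentiable_fl : MDifferentiable I 𝓘(ℝ, EuclideanSpace ℝ (Fin n)) fl
  flat : T → TangentFrame I T
  base_flat : ∀ z, (flat z).base = z
  continuous_flat : Continuous fun z : T × EuclideanSpace ℝ (Fin n) => (flat z.1).vec z.2
  tangentMap_flat : ∀ z w, tangentMap I 𝓘(ℝ, EuclideanSpace ℝ (Fin n)) fl ((flat z).vec w) =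
    flatVec (fl z) w
  O : Opens T
  inv : T → T
  inv_mem : ∀ z ∈ O, inv z ∈ O
  inv_inv : ∀ z ∈ O, inv (inv z) = z
  contMDiffAt_inv : ∀ z ∈ O, ContMDiffAt I I ∞ inv z
  fl_inv : ∀ z ∈ O, fl (inv z) = ϖ.inversion (fl z)
  lin_ne : ∀ z ∈ O, ϖ.lin (fl z) ≠ 0
  A₁ : Opens X₁
  A₂ : Opens X₂
  k₁ : T → X₁
  k₂ : T → X₂
  k₁_mem : ∀ z ∈ O, k₁ z ∈ A₁
  k₂_mem : ∀ z ∈ O, k₂ z ∈ A₂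
  isLocalDiffeomorph_k₁ : IsLocalDiffeomorph I I ∞ k₁
  isLocalDiffeomorph_k₂ : IsLocalDiffeomorph I I ∞ k₂
  η₁ : T → φ₁.P
  η₂ : T → φ₂.P
  continuous_η₁ : Continuous η₁
  continuous_η₂ : Continuous η₂
  F₁ : unitInterval → T → EuclideanSpace ℝ (Fin n) ≃L[ℝ] EuclideanSpace ℝ (Fin n)
  F₂ : unitInterval → T → EuclideanSpace ℝ (Fin n) ≃L[ℝ] EuclideanSpace ℝ (Fin n)
  continuous_F₁ : Continuous fun z : (unitInterval × T) × EuclideanSpace ℝ (Fin n) =>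
    F₁ z.1.1 z.1.2 z.2
  continuous_F₂ : Continuous fun z : (unitInterval × T) × EuclideanSpace ℝ (Fin n) =>
    F₂ z.1.1 z.1.2 z.2
  F₁_one : ∀ z v, F₁ 1 z v = v
  F₂_one : ∀ z v, F₂ 1 z v = v
  frame_η₁ : ∀ z, φ₁.frame (η₁ z) = ((flat z).precomp (F₁ 0 z)).map isLocalDiffeomorph_k₁
  frame_η₂ : ∀ z, φ₂.frame (η₂ z) = ((flat z).precomp (F₂ 0 z)).map isLocalDiffeomorph_k₂
  deck : ∀ z ∈ O, ∀ z' ∈ O, k₁ z = k₁ z' → ∃ c : PinPlus n, φ₁.act (η₁ z') c = η₁ z ∧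
    φ₂.act (η₂ (inv z')) (pinGrading n c) = η₂ (inv z) ∧
    ((flat z').precomp (pinRhoEquiv c)).map isLocalDiffeomorph_k₁ =
      (flat z).map isLocalDiffeomorph_k₁ ∧
    (∀ t v, F₁ t z' (pinRho c v) = pinRho c (F₁ t z v)) ∧
    (∀ t v, F₂ t (inv z') (pinRho c v) = pinRho c (F₂ t (inv z) v)) ∧
    (∀ v, ϖ.lin (pinRho c v) = pinRho c (ϖ.lin v)) ∧
    ϖ.lin (fl z') = pinRho c (ϖ.lin (fl z))

namespace FlatRegion

variable {φ₁ : PinStructure.{u} I X₁} {φ₂ : PinStructure.{u} I X₂}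
  {T : Type*} [TopologicalSpace T] [ChartedSpace H T] [IsManifold I ∞ T] (R : FlatRegion φ₁ φ₂ T)

theorem proj_η₁ (z : T) : φ₁.proj (R.η₁ z) = R.k₁ z := by
  rw [PinStructure.proj, R.frame_η₁]; exact congrArg R.k₁ (R.base_flat z)

theorem proj_η₂ (z : T) : φ₂.proj (R.η₂ z) = R.k₂ z := by
  rw [PinStructure.proj, R.frame_η₂]; exact congrArg R.k₂ (R.base_flat z)

/-- The restriction of a Pin⁺ structure to an open submanifold. -/
abbrev _root_.PinStructure.restrict {X : Type u} [TopologicalSpace X] [ChartedSpace H X]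
    [IsManifold I ∞ X] (φ : PinStructure.{u} I X) (U : Opens X) : PinStructure.{u} I U :=
  φ.pullback (isLocalDiffeomorph_subtypeVal U)

/-- The flat frame on the open set `O`. -/
def flatO (z : R.O) : TangentFrame I R.O :=
  (R.flat z).comap (isLocalDiffeomorph_subtypeVal R.O) z

theorem flatO_map (z : R.O) : (R.flatO z).map (isLocalDiffeomorph_subtypeVal R.O) = R.flat z :=
  TangentFrame.map_comap _ _ _ (R.base_flat z)

theorem flatO_map_restrict {X : Type*} [TopologicalSpace X] [ChartedSpace H X] [IsManifold I ∞ X]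
    {A : Opens X} {k : T → X} (hk : IsLocalDiffeomorph I I ∞ k) (h : ∀ z ∈ R.O, k z ∈ A) (z : R.O) :
    ((R.flatO z).map (isLocalDiffeomorph_restrict R.O A hk h)).map (isLocalDiffeomorph_subtypeVal A)
      = (R.flat z).map hk := by
  rw [← R.flatO_map, TangentFrame.map_map, TangentFrame.map_map]

theorem _root_.PinStructure.restrict_frame {X : Type u} [TopologicalSpace X] [ChartedSpace H X]
    [IsManifold I ∞ X] (φ : PinStructure.{u} I X) (A : Opens X) (x : A) (p : φ.P)
    (h : (x : X) = φ.proj p) :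
    TangentFrame.map (isLocalDiffeomorph_subtypeVal A) ((φ.restrict A).frame ⟨(x, p), h⟩) =
      φ.frame p :=
  TangentFrame.map_comap (isLocalDiffeomorph_subtypeVal A) (φ.frame p) x h.symm

theorem frame_restrict {X : Type u} [TopologicalSpace X] [ChartedSpace H X] [IsManifold I ∞ X]
    (φ : PinStructure.{u} I X) {A : Opens X} {k : T → X} (hk : IsLocalDiffeomorph I I ∞ k)
    (h : ∀ z ∈ R.O, k z ∈ A) (z : R.O) {p : φ.P}
    {F : EuclideanSpace ℝ (Fin n) ≃L[ℝ] EuclideanSpace ℝ (Fin n)}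
    (hp : φ.frame p = ((R.flat z).precomp F).map hk) (h' : k z = φ.proj p) :
    (φ.restrict A).frame ⟨(⟨k z, h z z.2⟩, p), h'⟩ =
      ((R.flatO z).precomp F).map (isLocalDiffeomorph_restrict R.O A hk h) := by
  refine TangentFrame.map_injective (isLocalDiffeomorph_subtypeVal A) rfl ?_
  rw [TangentFrame.precomp_map, TangentFrame.precomp_map, R.flatO_map_restrict hk h]
  exact (φ.restrict_frame A _ p h').trans hp

/-- The gluing data on the open submanifolds. -/
def toStage : FlatStage (φ₁.restrict R.A₁) (φ₂.restrict R.A₂) R.O where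
  ϖ := R.ϖ
  fl z := R.fl z
  mdifferentiable_fl := R.mdifferentiable_fl.comp
    ((isLocalDiffeomorph_subtypeVal R.O).mdifferentiable (by simp))
  flat := R.flatO
  base_flat _ := rfl
  continuous_flat := by
    refine continuous_of_tangentMap (isLocalDiffeomorph_subtypeVal R.O) continuous_fst ?_
    have h := R.continuous_flat.comp ((continuous_subtype_val.comp continuous_fst).prodMk
      (continuous_snd (X := R.O) (Y := EuclideanSpace ℝ (Fin n))))
    refine h.congr fun z => ?_
    rw [← TangentFrame.vec_map (isLocalDiffeomorph_subtypeVal R.O), R.flatO_map]; rfl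
  tangentMap_flat z w := by
    have h := tangentMap_comp_at (g := R.fl) (f := (Subtype.val : R.O → T)) ((R.flatO z).vec w)
      (R.mdifferentiable_fl _) ((isLocalDiffeomorph_subtypeVal (I := I) R.O).mdifferentiable
        (by simp) _)
    refine h.trans ?_
    rw [← TangentFrame.vec_map (isLocalDiffeomorph_subtypeVal R.O), R.flatO_map, R.tangentMap_flat]
  inv z := ⟨R.inv z, R.inv_mem z z.2⟩
  isLocalDiffeomorph_inv :=
    isLocalDiffeomorph_involution R.O R.inv_mem R.inv_inv R.contMDiffAt_inv
  fl_inv z := R.fl_inv z z.2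
  lin_ne z := R.lin_ne z z.2
  k₁ z := ⟨R.k₁ z, R.k₁_mem z z.2⟩
  k₂ z := ⟨R.k₂ z, R.k₂_mem z z.2⟩
  isLocalDiffeomorph_k₁ := isLocalDiffeomorph_restrict R.O R.A₁ R.isLocalDiffeomorph_k₁ R.k₁_mem
  isLocalDiffeomorph_k₂ := isLocalDiffeomorph_restrict R.O R.A₂ R.isLocalDiffeomorph_k₂ R.k₂_mem
  η₁ z := ⟨(⟨R.k₁ z, R.k₁_mem z z.2⟩, R.η₁ z), (R.proj_η₁ z).symm⟩
  η₂ z := ⟨(⟨R.k₂ z, R.k₂_mem z z.2⟩, R.η₂ z), (R.proj_η₂ z).symm⟩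
  continuous_η₁ := Continuous.subtype_mk (Continuous.prodMk (Continuous.subtype_mk
    (R.isLocalDiffeomorph_k₁.contMDiff.continuous.comp continuous_subtype_val) _)
    (R.continuous_η₁.comp continuous_subtype_val)) _
  continuous_η₂ := Continuous.subtype_mk (Continuous.prodMk (Continuous.subtype_mk
    (R.isLocalDiffeomorph_k₂.contMDiff.continuous.comp continuous_subtype_val) _)
    (R.continuous_η₂.comp continuous_subtype_val)) _
  F₁ t z := R.F₁ t z
  F₂ t z := R.F₂ t z
  continuous_F₁ := R.continuous_F₁.comp (((continuous_fst.comp continuous_fst).prodMk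
    (continuous_subtype_val.comp (continuous_snd.comp continuous_fst))).prodMk continuous_snd)
  continuous_F₂ := R.continuous_F₂.comp (((continuous_fst.comp continuous_fst).prodMk
    (continuous_subtype_val.comp (continuous_snd.comp continuous_fst))).prodMk continuous_snd)
  F₁_one z := R.F₁_one z
  F₂_one z := R.F₂_one z
  frame_η₁ z := R.frame_restrict φ₁ R.isLocalDiffeomorph_k₁ R.k₁_mem z (R.frame_η₁ z) _
  frame_η₂ z := R.frame_restrict φ₂ R.isLocalDiffeomorph_k₂ R.k₂_mem z (R.frame_η₂ z) _
  deck z z' h := by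
    have hk : R.k₁ z = R.k₁ z' := congrArg Subtype.val h
    obtain ⟨c, h1, h2, h3, h4⟩ := R.deck z z.2 z' z'.2 hk
    have hk2 : R.k₂ (R.inv z) = R.k₂ (R.inv z') := by
      rw [← R.proj_η₂, ← h2, PinStructure.proj_act, R.proj_η₂]
    refine ⟨c, Subtype.ext (Prod.ext h.symm h1), Subtype.ext (Prod.ext (Subtype.ext hk2.symm) h2),
      ?_, h4⟩
    refine TangentFrame.map_injective (isLocalDiffeomorph_subtypeVal R.A₁) h.symm ?_
    rw [TangentFrame.precomp_map, TangentFrame.precomp_map, R.flatO_map_restrict,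
      R.flatO_map_restrict]
    exact h3

end FlatRegion

end region

/-! ### Flat coordinates on a tube -/

section tube

variable {n : ℕ}

/-- The standard frame of `ℝⁿ` at `x`. -/
def stdFrame (x : EuclideanSpace ℝ (Fin n)) : TangentFrame (𝓡 n) (EuclideanSpace ℝ (Fin n)) :=
  ⟨x, ContinuousLinearEquiv.refl ℝ _⟩

theorem continuous_stdFrame : Continuous fun z : EuclideanSpace ℝ (Fin n) × EuclideanSpace ℝ (Fin n)
    => (stdFrame z.1).vec z.2 := continuous_flatVec

variable {E : Type*} [TopologicalSpace E] [ChartedSpace (EuclideanSpace ℝ (Fin n)) E]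
  (K : CollarModel n E) {M₁ M₂ : Type u}
  [TopologicalSpace M₁] [ChartedSpace (EuclideanSpace ℝ (Fin n)) M₁] [T2Space M₁]
  [IsManifold (𝓡 n) ∞ M₁]
  [TopologicalSpace M₂] [ChartedSpace (EuclideanSpace ℝ (Fin n)) M₂] [T2Space M₂]
  [IsManifold (𝓡 n) ∞ M₂]

/-- Coordinates `cov : ℝⁿ → E` on the model tube in which the involution is the inversion in the
radial coordinates, and sections `σ₁`, `σ₂` of the two Pin⁺ structures over `ℝⁿ` with homotopies
`F₁`, `F₂` from their matrices to the identity. Where `cov` identifies two points, the sections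
differ by an element `c` of the Pin group and its image under the grading involution respectively.
    -/
structure FlatTube (i₁ : OpenTube n E M₁) (i₂ : OpenTube n E M₂) (φ₁ : PinStructure.{u} (𝓡 n) M₁)
    (φ₂ : PinStructure.{u} (𝓡 n) M₂) where
  ϖ : RadProj n
  cov : EuclideanSpace ℝ (Fin n) → E
  cov_surjective : Function.Surjective cov
  isLocalDiffeomorph_cov : IsLocalDiffeomorph (𝓡 n) (𝓡 n) ∞ cov
  mem_core_iff : ∀ x, cov x ∈ K.core ↔ ϖ.lin x = 0
  inv_cov : ∀ x, ϖ.lin x ≠ 0 → K.inv (cov x) = cov (ϖ.inversion x)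
  σ₁ : EuclideanSpace ℝ (Fin n) → φ₁.P
  σ₂ : EuclideanSpace ℝ (Fin n) → φ₂.P
  continuous_σ₁ : Continuous σ₁
  continuous_σ₂ : Continuous σ₂
  F₁ : unitInterval → EuclideanSpace ℝ (Fin n) →
    EuclideanSpace ℝ (Fin n) ≃L[ℝ] EuclideanSpace ℝ (Fin n)
  F₂ : unitInterval → EuclideanSpace ℝ (Fin n) →
    EuclideanSpace ℝ (Fin n) ≃L[ℝ] EuclideanSpace ℝ (Fin n)
  continuous_F₁ : Continuous fun z : (unitInterval × EuclideanSpace ℝ (Fin n)) ×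
    EuclideanSpace ℝ (Fin n) => F₁ z.1.1 z.1.2 z.2
  continuous_F₂ : Continuous fun z : (unitInterval × EuclideanSpace ℝ (Fin n)) ×
    EuclideanSpace ℝ (Fin n) => F₂ z.1.1 z.1.2 z.2
  F₁_one : ∀ x v, F₁ 1 x v = v
  F₂_one : ∀ x v, F₂ 1 x v = v
  frame_σ₁ : ∀ x, φ₁.frame (σ₁ x) = ((stdFrame x).precomp (F₁ 0 x)).map
    (i₁.isLocalDiffeomorph.comp isLocalDiffeomorph_cov)
  frame_σ₂ : ∀ x, φ₂.frame (σ₂ x) = ((stdFrame x).precomp (F₂ 0 x)).map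
    (i₂.isLocalDiffeomorph.comp isLocalDiffeomorph_cov)
  deck : ∀ x x', cov x = cov x' → ∃ c : PinPlus n,
    ((stdFrame x').precomp (pinRhoEquiv c)).map isLocalDiffeomorph_cov =
      (stdFrame x).map isLocalDiffeomorph_cov ∧
    (∀ l, φ₁.act (σ₁ (ϖ.scale l x')) c = σ₁ (ϖ.scale l x)) ∧
    (∀ l, φ₂.act (σ₂ (ϖ.scale l x')) (pinGrading n c) = σ₂ (ϖ.scale l x)) ∧
    (∀ t l v, F₁ t (ϖ.scale l x') (pinRho c v) = pinRho c (F₁ t (ϖ.scale l x) v)) ∧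
    (∀ t l v, F₂ t (ϖ.scale l x') (pinRho c v) = pinRho c (F₂ t (ϖ.scale l x) v)) ∧
    (∀ v, ϖ.lin (pinRho c v) = pinRho c (ϖ.lin v)) ∧
    ϖ.lin x' = pinRho c (ϖ.lin x)
  exists_compact : ∀ R : ℝ, ∃ B : Set (EuclideanSpace ℝ (Fin n)), IsCompact B ∧
    ∀ x, ϖ.sq x ≤ R → ∃ x' ∈ B, cov x' = cov x

namespace FlatTube

variable {K} {i₁ : OpenTube n E M₁} {i₂ : OpenTube n E M₂} {φ₁ : PinStructure.{u} (𝓡 n) M₁}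
  {φ₂ : PinStructure.{u} (𝓡 n) M₂} (D : FlatTube K i₁ i₂ φ₁ φ₂)

/-- The coordinates of the tube in `M₁`. -/
def j₁ (x : EuclideanSpace ℝ (Fin n)) : M₁ := i₁.toFun (D.cov x)
/-- The coordinates of the tube in `M₂`. -/
def j₂ (x : EuclideanSpace ℝ (Fin n)) : M₂ := i₂.toFun (D.cov x)

theorem isLocalDiffeomorph_j₁ : IsLocalDiffeomorph (𝓡 n) (𝓡 n) ∞ D.j₁ :=
  i₁.isLocalDiffeomorph.comp D.isLocalDiffeomorph_cov

theorem isLocalDiffeomorph_j₂ : IsLocalDiffeomorph (𝓡 n) (𝓡 n) ∞ D.j₂ :=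
  i₂.isLocalDiffeomorph.comp D.isLocalDiffeomorph_cov

theorem proj_σ₁ (x : EuclideanSpace ℝ (Fin n)) : φ₁.proj (D.σ₁ x) = D.j₁ x := by
  rw [PinStructure.proj, D.frame_σ₁]; rfl

theorem cov_scale {x x' : EuclideanSpace ℝ (Fin n)} (h : D.cov x = D.cov x') (l : ℝ) :
    D.cov (D.ϖ.scale l x) = D.cov (D.ϖ.scale l x') := by
  obtain ⟨c, -, h1, -⟩ := D.deck x x' h
  have h2 := congrArg φ₁.proj (h1 l)
  rw [PinStructure.proj_act, D.proj_σ₁, D.proj_σ₁] at h2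
  exact (i₁.injective h2).symm

theorem sq_eq {x x' : EuclideanSpace ℝ (Fin n)} (h : D.cov x = D.cov x') : D.ϖ.sq x = D.ϖ.sq
    x' := by
  obtain ⟨c, -, -, -, -, -, -, hc⟩ := D.deck x x' h
  rw [RadProj.sq, RadProj.sq, hc, norm_pinRho]

theorem deck_frame_j₁ {x x' : EuclideanSpace ℝ (Fin n)} {c : PinPlus n}
    (h : ((stdFrame x').precomp (pinRhoEquiv c)).map D.isLocalDiffeomorph_cov =
      (stdFrame x).map D.isLocalDiffeomorph_cov) :
    ((stdFrame x').precomp (pinRhoEquiv c)).map D.isLocalDiffeomorph_j₁ =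
      (stdFrame x).map D.isLocalDiffeomorph_j₁ := by
  have h' := congrArg (fun b => TangentFrame.map i₁.isLocalDiffeomorph b) h
  simp only [TangentFrame.map_map] at h'
  exact h'

/-- The gluing data for the sum of `M₁` and `M₂` along the tubes. -/
def region : FlatRegion φ₁ φ₂ (EuclideanSpace ℝ (Fin n)) where
  ϖ := D.ϖ
  fl x := x
  mdifferentiable_fl := mdifferentiable_id
  flat := stdFrame
  base_flat _ := rfl
  continuous_flat := continuous_stdFrame
  tangentMap_flat z w := congrFun tangentMap_id _
  O := ⟨{x | D.ϖ.lin x ≠ 0}, isOpen_ne.preimage D.ϖ.lin.continuous⟩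
  inv := D.ϖ.inversion
  inv_mem z hz := D.ϖ.lin_inversion_ne hz
  inv_inv z hz := D.ϖ.inversion_inversion hz
  contMDiffAt_inv z hz := (D.ϖ.contDiffAt_inversion hz).contMDiffAt
  fl_inv _ _ := rfl
  lin_ne _ h := h
  A₁ := K.compl i₁
  A₂ := K.compl i₂
  k₁ := D.j₁
  k₂ := D.j₂
  k₁_mem z hz := (K.mem_compl_iff i₁ _).2 fun h => hz ((D.mem_core_iff z).1 h)
  k₂_mem z hz := (K.mem_compl_iff i₂ _).2 fun h => hz ((D.mem_core_iff z).1 h)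
  isLocalDiffeomorph_k₁ := D.isLocalDiffeomorph_j₁
  isLocalDiffeomorph_k₂ := D.isLocalDiffeomorph_j₂
  η₁ := D.σ₁
  η₂ := D.σ₂
  continuous_η₁ := D.continuous_σ₁
  continuous_η₂ := D.continuous_σ₂
  F₁ := D.F₁
  F₂ := D.F₂
  continuous_F₁ := D.continuous_F₁
  continuous_F₂ := D.continuous_F₂
  F₁_one := D.F₁_one
  F₂_one := D.F₂_one
  frame_η₁ := D.frame_σ₁
  frame_η₂ := D.frame_σ₂
  deck z hz z' hz' h := by
    have hcov : D.cov z = D.cov z' := i₁.injective h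
    obtain ⟨c, h1, h2, h3, h4, h5, h6, h7⟩ := D.deck z z' hcov
    have hi : D.ϖ.inversion z' = D.ϖ.scale (Real.exp (-Real.log (D.ϖ.sq z))) z' := by
      rw [D.sq_eq hcov]; rfl
    refine ⟨c, ?_, ?_, D.deck_frame_j₁ h1, fun t v => ?_, fun t v => ?_, h6, h7⟩
    · have := h2 1
      rwa [D.ϖ.scale_one, D.ϖ.scale_one] at this
    · rw [hi]; exact h3 _
    · have := h4 t 1 v
      rwa [D.ϖ.scale_one, D.ϖ.scale_one] at this
    · rw [hi]; exact h5 t _ v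

end FlatTube

end tube

section tubeSum

variable {n : ℕ} {E : Type*} [TopologicalSpace E] [ChartedSpace (EuclideanSpace ℝ (Fin n)) E]
  {K : CollarModel n E} {M₁ M₂ : Type u}
  [TopologicalSpace M₁] [ChartedSpace (EuclideanSpace ℝ (Fin n)) M₁] [T2Space M₁]
  [IsManifold (𝓡 n) ∞ M₁]
  [TopologicalSpace M₂] [ChartedSpace (EuclideanSpace ℝ (Fin n)) M₂] [T2Space M₂]
  [IsManifold (𝓡 n) ∞ M₂]
  {i₁ : OpenTube n E M₁} {i₂ : OpenTube n E M₂}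

namespace TubeSum

theorem isLocalDiffeomorph_inl :
    IsLocalDiffeomorph (𝓡 n) (𝓡 n) ∞ (inl : K.compl i₁ → TubeSum K i₁ i₂) := by
  let := (K.smoothGluing_glueSetoid i₁ i₂).chartedSpace
  exact (K.smoothGluing_glueSetoid i₁ i₂).isLocalDiffeomorph_mk.comp
    PinStructure.isLocalDiffeomorph_inl

theorem isLocalDiffeomorph_inr :
    IsLocalDiffeomorph (𝓡 n) (𝓡 n) ∞ (inr : K.compl i₂ → TubeSum K i₁ i₂) := by
  let := (K.smoothGluing_glueSetoid i₁ i₂).chartedSpace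
  exact (K.smoothGluing_glueSetoid i₁ i₂).isLocalDiffeomorph_mk.comp
    PinStructure.isLocalDiffeomorph_inr

theorem injective_inl : Function.Injective (inl : K.compl i₁ → TubeSum K i₁ i₂) :=
  fun _ _ h => Quotient.exact (s := K.glueSetoid i₁ i₂) h

theorem injective_inr : Function.Injective (inr : K.compl i₂ → TubeSum K i₁ i₂) :=
  fun _ _ h => Quotient.exact (s := K.glueSetoid i₁ i₂) h

theorem mem_range (q : TubeSum K i₁ i₂) : q ∈ range inl ∨ q ∈ range inr := by
  obtain ⟨p | p, rfl⟩ := Quotient.exists_rep q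
  · exact .inl ⟨p, rfl⟩
  · exact .inr ⟨p, rfl⟩

theorem inl_eq_inr_iff (p : K.compl i₁) (q : K.compl i₂) :
    (inl p : TubeSum K i₁ i₂) = inr q ↔
      ∃ z ∉ K.core, (p : M₁) = i₁.toFun z ∧ (q : M₂) = i₂.toFun (K.inv z) :=
  ⟨fun h => Quotient.exact (s := K.glueSetoid i₁ i₂) h,
    fun h => Quotient.sound (s := K.glueSetoid i₁ i₂) h⟩

end TubeSum

namespace FlatTube

variable {φ₁ : PinStructure.{u} (𝓡 n) M₁}
  {φ₂ : PinStructure.{u} (𝓡 n) M₂} (D : FlatTube K i₁ i₂ φ₁ φ₂)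

theorem image_eq_of_cov {X : Type*} (f : E → X) (R : ℝ) : ∃ B, IsCompact B ∧
    (fun x => f (D.cov x)) '' {x | D.ϖ.sq x ≤ R} = (fun x => f (D.cov x)) '' B := by
  obtain ⟨B, hB, hB'⟩ := D.exists_compact R
  refine ⟨B ∩ {x | D.ϖ.sq x ≤ R}, hB.inter_right (isClosed_le D.ϖ.continuous_sq continuous_const),
    subset_antisymm ?_ (image_mono inter_subset_right)⟩
  rintro _ ⟨x, hx, rfl⟩
  obtain ⟨x', hx', h⟩ := hB' x hx
  exact ⟨x', ⟨hx', (D.sq_eq h).trans_le hx⟩, congrArg f h⟩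

/-- A closed tube around the core is compact in `M₁`, although its preimage in `ℝⁿ` need not be. -/
theorem isClosed_image_j₁ (R : ℝ) : IsClosed (D.j₁ '' {x | D.ϖ.sq x ≤ R}) := by
  obtain ⟨B, hB, h⟩ := D.image_eq_of_cov i₁.toFun R
  change IsClosed ((fun x => i₁.toFun (D.cov x)) '' _)
  rw [h]
  exact (hB.image D.isLocalDiffeomorph_j₁.contMDiff.continuous).isClosed

theorem isClosed_image_j₂ (R : ℝ) : IsClosed (D.j₂ '' {x | D.ϖ.sq x ≤ R}) := by
  obtain ⟨B, hB, h⟩ := D.image_eq_of_cov i₂.toFun R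
  change IsClosed ((fun x => i₂.toFun (D.cov x)) '' _)
  rw [h]
  exact (hB.image D.isLocalDiffeomorph_j₂.contMDiff.continuous).isClosed

theorem lin_ne_of_mem₁ {x} (h : D.j₁ x ∈ K.compl i₁) : D.ϖ.lin x ≠ 0 := fun h0 =>
  (K.mem_compl_iff i₁ _).1 h ((D.mem_core_iff x).2 h0)

theorem lin_ne_of_mem₂ {x} (h : D.j₂ x ∈ K.compl i₂) : D.ϖ.lin x ≠ 0 := fun h0 =>
  (K.mem_compl_iff i₂ _).1 h ((D.mem_core_iff x).2 h0)

/-- The gluing of the Pin⁺ structures over the sum of `M₁` and `M₂`. -/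
def sectionGluing : SectionGluing (φ₁.restrict (K.compl i₁)) (φ₂.restrict (K.compl i₂))
    (TubeSum.inl : K.compl i₁ → TubeSum K i₁ i₂) TubeSum.inr D.region.O :=
  D.region.toStage.toSectionGluing TubeSum.isLocalDiffeomorph_inl TubeSum.isLocalDiffeomorph_inr
    TubeSum.injective_inl TubeSum.injective_inr TubeSum.mem_range
    (fun z => (TubeSum.inl_eq_inr_iff _ _).2 ⟨D.cov z, fun h => z.2 ((D.mem_core_iff _).1 h), rfl,
      congrArg i₂.toFun (D.inv_cov z z.2).symm⟩)
    (by
      rintro p ⟨q, hq⟩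
      obtain ⟨z, hz, h1, -⟩ := (TubeSum.inl_eq_inr_iff _ _).1 hq.symm
      obtain ⟨x, rfl⟩ := D.cov_surjective z
      exact ⟨⟨x, fun h => hz ((D.mem_core_iff x).2 h)⟩, Subtype.ext h1.symm⟩)
    (by
      rintro q ⟨p, hp⟩
      obtain ⟨z, hz, -, h1⟩ := (TubeSum.inl_eq_inr_iff _ _).1 hp
      obtain ⟨x, rfl⟩ := D.cov_surjective z
      have hx : D.ϖ.lin x ≠ 0 := fun h => hz ((D.mem_core_iff x).2 h)
      rw [D.inv_cov x hx] at h1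
      exact ⟨⟨x, hx⟩, Subtype.ext h1.symm⟩)
    (by
      intro p hp
      have hp' : (p : M₁) ∉ D.j₁ '' {x | D.ϖ.sq x ≤ 2} := by
        rintro ⟨x, -, hx⟩
        exact hp ⟨⟨x, D.lin_ne_of_mem₁ (hx ▸ p.2)⟩, Subtype.ext hx⟩
      filter_upwards [continuous_subtype_val.continuousAt.preimage_mem_nhds
        ((D.isClosed_image_j₁ 2).isOpen_compl.mem_nhds hp')] with p' h z hz
      by_contra hlt
      exact h ⟨z, (not_le.1 hlt).le, congrArg Subtype.val hz⟩)
    (by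
      intro p hp
      have hp' : (p : M₂) ∉ D.j₂ '' {x | D.ϖ.sq x ≤ 2} := by
        rintro ⟨x, -, hx⟩
        have h0 := D.lin_ne_of_mem₂ (hx ▸ p.2)
        exact hp ⟨⟨D.ϖ.inversion x, D.ϖ.lin_inversion_ne h0⟩,
          Subtype.ext ((congrArg D.j₂ (D.ϖ.inversion_inversion h0)).trans hx)⟩
      filter_upwards [continuous_subtype_val.continuousAt.preimage_mem_nhds
        ((D.isClosed_image_j₂ 2).isOpen_compl.mem_nhds hp')] with p' h z hz
      by_contra hlt
      refine h ⟨D.ϖ.inversion z, ?_, congrArg Subtype.val hz⟩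
      have hz0 : D.ϖ.lin z ≠ 0 := z.2
      have hpos := D.ϖ.sq_pos hz0
      -- `1/2 ≤ ‖X‖²` means that the inverted point lies in the closed tube of squared radius `2`
      change D.ϖ.sq (D.ϖ.inversion z) ≤ 2
      rw [D.ϖ.sq_inversion hz0, inv_le_comm₀ hpos two_pos, ← one_div]
      exact (not_le.1 hlt).le)

/-- The Pin⁺ structure on the sum of `M₁` and `M₂`. -/
def glued : PinStructure.{u} (𝓡 n) (TubeSum K i₁ i₂) := D.sectionGluing.toPinGluing.glued

theorem isGluedFrom : D.glued.IsGluedFrom φ₁ φ₂ :=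
  ⟨⟨φ₁.restrict _, φ₁.pullback_preserves _, D.sectionGluing.toPinGluing.preserves_left⟩,
    ⟨φ₂.restrict _, φ₂.pullback_preserves _, D.sectionGluing.toPinGluing.preserves_right⟩⟩

end FlatTube

end tubeSum

/-! ### Gluing two manifolds along two local diffeomorphisms -/

section overlap

variable {E H : Type*} [NormedAddCommGroup E] [NormedSpace ℝ E] [TopologicalSpace H]
    (I : ModelWithCorners ℝ E H)
    (A B : Type u) [TopologicalSpace A] [ChartedSpace H A] [TopologicalSpace B] [ChartedSpace H B]
    (Y : Type*) [TopologicalSpace Y] [ChartedSpace H Y]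

/-- Local diffeomorphisms from `Y` to `A` and to `B` that identify the same pairs of points. They
induce a diffeomorphism between open subsets of `A` and of `B`. -/
structure Overlap where
  κ₁ : Y → A
  κ₂ : Y → B
  isLocalDiffeomorph_κ₁ : IsLocalDiffeomorph I I ∞ κ₁
  isLocalDiffeomorph_κ₂ : IsLocalDiffeomorph I I ∞ κ₂
  eq_iff : ∀ y y', κ₁ y = κ₁ y' ↔ κ₂ y = κ₂ y'

namespace Overlap

variable {I A B Y} (G : Overlap I A B Y)

/-- The relation identifying `κ₁ y` with `κ₂ y`. -/
def rel : A ⊕ B → A ⊕ B → Prop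
  | .inl a, .inl a' => a = a'
  | .inl a, .inr b => ∃ y, G.κ₁ y = a ∧ G.κ₂ y = b
  | .inr b, .inl a => ∃ y, G.κ₁ y = a ∧ G.κ₂ y = b
  | .inr b, .inr b' => b = b'

/-- The relation `rel` as an equivalence relation. -/
def setoid : Setoid (A ⊕ B) where
  r := G.rel
  iseqv := by
    refine ⟨?_, ?_, ?_⟩
    · rintro (a | b) <;> rfl
    · rintro (a | b) (a' | b') h
      · exact Eq.symm h
      · exact h
      · exact h
      · exact Eq.symm h
    · rintro (a | b) (a' | b') (a'' | b'') h h'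
      · exact Eq.trans h h'
      · obtain rfl : a = a' := h
        exact h'
      · obtain ⟨y, rfl, rfl⟩ := h
        obtain ⟨y', rfl, h4⟩ := h'
        exact (G.eq_iff _ _).2 h4.symm
      · obtain rfl : b' = b'' := h'
        exact h
      · obtain rfl : a' = a'' := h'
        exact h
      · obtain ⟨y, rfl, rfl⟩ := h
        obtain ⟨y', h3, rfl⟩ := h'
        exact (G.eq_iff _ _).1 h3.symm
      · obtain rfl : b = b' := h
        exact h'
      · exact Eq.trans h h'

/-- The identification is local over `Y`: the local transport maps are `κ₂` after a local inverse of
`κ₁`, and conversely. -/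
theorem smoothGluing : SmoothGluing I G.setoid where
  transport := by
    rintro (a | b) (a' | b') h
    · obtain rfl : a = a' := h
      exact ⟨id, rfl, contMDiffAt_id, .of_forall G.setoid.refl'⟩
    · obtain ⟨y, rfl, rfl⟩ := h
      have hl := G.isLocalDiffeomorph_κ₁ y
      let p : A ⊕ B → A := Sum.elim id (fun _ => G.κ₁ y)
      have hp : ContMDiff I I ∞ p := contMDiff_id.sumElim contMDiff_const
      have hL : hl.localInverse (G.κ₁ y) = y := hl.localInverse_left_inv hl.localInverse_mem_target
      have hs : ContMDiffAt I I ∞ (fun a => G.κ₂ (hl.localInverse a)) (p (.inl (G.κ₁ y))) := by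
        refine ContMDiffAt.comp (G.κ₁ y) (g := G.κ₂) ?_ hl.localInverse_contMDiffAt
        exact G.isLocalDiffeomorph_κ₂.contMDiff _
      refine ⟨fun x => .inr (G.κ₂ (hl.localInverse (p x))), ?_, ?_, ?_⟩
      · exact congrArg (fun y => Sum.inr (G.κ₂ y)) hL
      · exact ContMDiffAt.comp (Sum.inl (G.κ₁ y) : A ⊕ B) (g := Sum.inr) (ContMDiff.inr _)
          (ContMDiffAt.comp (Sum.inl (G.κ₁ y) : A ⊕ B)
            (g := fun a => G.κ₂ (hl.localInverse a)) (f := p) hs (hp _))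
      · rw [nhds_inl, eventually_map]
        filter_upwards [hl.localInverse_eventuallyEq_right] with a ha
        exact ⟨hl.localInverse a, ha, rfl⟩
    · obtain ⟨y, rfl, rfl⟩ := h
      have hl := G.isLocalDiffeomorph_κ₂ y
      let p : A ⊕ B → B := Sum.elim (fun _ => G.κ₂ y) id
      have hp : ContMDiff I I ∞ p := contMDiff_const.sumElim contMDiff_id
      have hL : hl.localInverse (G.κ₂ y) = y := hl.localInverse_left_inv hl.localInverse_mem_target
      have hs : ContMDiffAt I I ∞ (fun a => G.κ₁ (hl.localInverse a)) (p (.inr (G.κ₂ y))) := by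
        refine ContMDiffAt.comp (G.κ₂ y) (g := G.κ₁) ?_ hl.localInverse_contMDiffAt
        exact G.isLocalDiffeomorph_κ₁.contMDiff _
      refine ⟨fun x => .inl (G.κ₁ (hl.localInverse (p x))), ?_, ?_, ?_⟩
      · exact congrArg (fun y => Sum.inl (G.κ₁ y)) hL
      · exact ContMDiffAt.comp (Sum.inr (G.κ₂ y) : A ⊕ B) (g := Sum.inl) (ContMDiff.inl _)
          (ContMDiffAt.comp (Sum.inr (G.κ₂ y) : A ⊕ B)
            (g := fun a => G.κ₁ (hl.localInverse a)) (f := p) hs (hp _))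
      · rw [nhds_inr, eventually_map]
        filter_upwards [hl.localInverse_eventuallyEq_right] with a ha
        exact ⟨hl.localInverse a, rfl, ha⟩
    · obtain rfl : b = b' := h
      exact ⟨id, rfl, contMDiffAt_id, .of_forall G.setoid.refl'⟩
  locally_injective := by
    rintro (a | b)
    · refine ⟨range .inl, isOpen_range_inl.mem_nhds ⟨a, rfl⟩, ?_⟩
      rintro _ ⟨x, rfl⟩ _ ⟨x', rfl⟩ h
      exact congrArg _ h
    · refine ⟨range .inr, isOpen_range_inr.mem_nhds ⟨b, rfl⟩, ?_⟩
      rintro _ ⟨x, rfl⟩ _ ⟨x', rfl⟩ h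
      exact congrArg _ h

/-- The manifold glued from `A` and `B`. -/
def Space : Type u := Quotient G.setoid

instance : TopologicalSpace G.Space := inferInstanceAs (TopologicalSpace (Quotient G.setoid))

instance : ChartedSpace H G.Space := G.smoothGluing.chartedSpace

/-- The inclusion of `A`. -/
def inl (a : A) : G.Space := Quotient.mk G.setoid (.inl a)
/-- The inclusion of `B`. -/
def inr (b : B) : G.Space := Quotient.mk G.setoid (.inr b)

theorem inl_κ₁ (y : Y) : G.inl (G.κ₁ y) = G.inr (G.κ₂ y) :=
  Quotient.sound (s := G.setoid) ⟨y, rfl, rfl⟩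

theorem inl_eq_inr_iff (a : A) (b : B) : G.inl a = G.inr b ↔ ∃ y, G.κ₁ y = a ∧ G.κ₂ y = b :=
  ⟨fun h => Quotient.exact (s := G.setoid) h, fun h => Quotient.sound (s := G.setoid) h⟩

theorem injective_inl : Function.Injective G.inl :=
  fun _ _ h => Quotient.exact (s := G.setoid) h

theorem injective_inr : Function.Injective G.inr :=
  fun _ _ h => Quotient.exact (s := G.setoid) h

theorem mem_range (q : G.Space) : q ∈ range G.inl ∨ q ∈ range G.inr := by
  obtain ⟨p | p, rfl⟩ := Quotient.exists_rep q
  · exact .inl ⟨p, rfl⟩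
  · exact .inr ⟨p, rfl⟩

variable [IsManifold I ∞ A] [IsManifold I ∞ B]

instance : IsManifold I ∞ G.Space := G.smoothGluing.isManifold

theorem isLocalDiffeomorph_inl : IsLocalDiffeomorph I I ∞ G.inl := by
  let := G.smoothGluing.chartedSpace
  refine IsLocalDiffeomorph.comp G.smoothGluing.isLocalDiffeomorph_mk (f := Sum.inl) fun x => ?_
  exact ⟨{ toFun := Sum.inl
           invFun := Sum.elim id fun _ => x
           source := univ
           target := range Sum.inl
           map_source' := fun y _ => ⟨y, rfl⟩
           map_target' := fun _ _ => trivial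
           left_inv' := fun _ _ => rfl
           right_inv' := by rintro _ ⟨y, rfl⟩; rfl
           open_source := isOpen_univ
           open_target := isOpen_range_inl
           contMDiffOn_toFun := ContMDiff.inl.contMDiffOn
           contMDiffOn_invFun := (contMDiff_id.sumElim contMDiff_const).contMDiffOn },
         trivial, fun _ _ => rfl⟩

theorem isLocalDiffeomorph_inr : IsLocalDiffeomorph I I ∞ G.inr := by
  let := G.smoothGluing.chartedSpace
  refine IsLocalDiffeomorph.comp G.smoothGluing.isLocalDiffeomorph_mk (f := Sum.inr) fun x => ?_
  exact ⟨{ toFun := Sum.inr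
           invFun := Sum.elim (fun _ => x) id
           source := univ
           target := range Sum.inr
           map_source' := fun y _ => ⟨y, rfl⟩
           map_target' := fun _ _ => trivial
           left_inv' := fun _ _ => rfl
           right_inv' := by rintro _ ⟨y, rfl⟩; rfl
           open_source := isOpen_univ
           open_target := isOpen_range_inr
           contMDiffOn_toFun := ContMDiff.inr.contMDiffOn
           contMDiffOn_invFun := (contMDiff_const.sumElim contMDiff_id).contMDiffOn },
         trivial, fun _ _ => rfl⟩

theorem isOpenEmbedding_inl : IsOpenEmbedding G.inl :=
  .of_continuous_injective_isOpenMap G.isLocalDiffeomorph_inl.contMDiff.continuous G.injective_inl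
    G.isLocalDiffeomorph_inl.isOpenMap

theorem isOpenEmbedding_inr : IsOpenEmbedding G.inr :=
  .of_continuous_injective_isOpenMap G.isLocalDiffeomorph_inr.contMDiff.continuous G.injective_inr
    G.isLocalDiffeomorph_inr.isOpenMap

theorem _root_.Ultrafilter.exists_tendsto_of_range_mem {X Z : Type*} (f : Ultrafilter X) {m : Z → X}
    (hm : range m ∈ f) : ∃ g : Ultrafilter Z, Tendsto m g f := by
  have : (comap m (f : Filter X)).NeBot := f.neBot.comap_of_range_mem hm
  exact ⟨Ultrafilter.of _, tendsto_iff_comap.2 (Ultrafilter.of_le _)⟩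

/-- The glued manifold is Hausdorff if the identification is closed. -/
theorem t2Space [T2Space A] [T2Space B] (h : ∀ (F : Ultrafilter Y) a b, Tendsto G.κ₁ F (𝓝 a) →
    Tendsto G.κ₂ F (𝓝 b) → ∃ y, G.κ₁ y = a ∧ G.κ₂ y = b) : T2Space G.Space := by
  have mixed : ∀ (f : Ultrafilter G.Space) a b, (f : Filter G.Space) ≤ 𝓝 (G.inl a) →
      (f : Filter G.Space) ≤ 𝓝 (G.inr b) → G.inl a = G.inr b := by
    intro f a b ha hb
    have h1 := ha (G.isOpenEmbedding_inl.isOpen_range.mem_nhds ⟨a, rfl⟩)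
    have h2 := hb (G.isOpenEmbedding_inr.isOpen_range.mem_nhds ⟨b, rfl⟩)
    have h3 : range (fun y => G.inl (G.κ₁ y)) ∈ f := by
      filter_upwards [h1, h2]
      rintro _ ⟨a', rfl⟩ ⟨b', hb'⟩
      obtain ⟨y, hy, -⟩ := (G.inl_eq_inr_iff _ _).1 hb'.symm
      exact ⟨y, congrArg G.inl hy⟩
    obtain ⟨g, hg⟩ := f.exists_tendsto_of_range_mem h3
    have e1 : Tendsto G.κ₁ g (𝓝 a) :=
      G.isOpenEmbedding_inl.isInducing.tendsto_nhds_iff.2 (hg.mono_right ha)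
    have e2 : Tendsto G.κ₂ g (𝓝 b) := by
      refine G.isOpenEmbedding_inr.isInducing.tendsto_nhds_iff.2 ?_
      exact (hg.mono_right hb).congr G.inl_κ₁
    exact (G.inl_eq_inr_iff _ _).2 (h g a b e1 e2)
  refine t2_iff_ultrafilter.2 fun {x y} f hx hy => ?_
  rcases G.mem_range x with ⟨a, rfl⟩ | ⟨a, rfl⟩ <;> rcases G.mem_range y with ⟨b, rfl⟩ | ⟨b, rfl⟩
  · obtain ⟨g, hg⟩ := f.exists_tendsto_of_range_mem
      (hx (G.isOpenEmbedding_inl.isOpen_range.mem_nhds ⟨a, rfl⟩))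
    have e1 : Tendsto id (g : Filter A) (𝓝 a) :=
      G.isOpenEmbedding_inl.isInducing.tendsto_nhds_iff.2 (hg.mono_right hx)
    have e2 : Tendsto id (g : Filter A) (𝓝 b) :=
      G.isOpenEmbedding_inl.isInducing.tendsto_nhds_iff.2 (hg.mono_right hy)
    rw [tendsto_nhds_unique e1 e2]
  · exact mixed f a b hx hy
  · exact (mixed f b a hy hx).symm
  · obtain ⟨g, hg⟩ := f.exists_tendsto_of_range_mem
      (hx (G.isOpenEmbedding_inr.isOpen_range.mem_nhds ⟨a, rfl⟩))
    have e1 : Tendsto id (g : Filter B) (𝓝 a) :=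
      G.isOpenEmbedding_inr.isInducing.tendsto_nhds_iff.2 (hg.mono_right hx)
    have e2 : Tendsto id (g : Filter B) (𝓝 b) :=
      G.isOpenEmbedding_inr.isInducing.tendsto_nhds_iff.2 (hg.mono_right hy)
    rw [tendsto_nhds_unique e1 e2]

end Overlap

end overlap

/-! ### The gluing of the cylinders -/

theorem pinRhoEquiv_pinIncl {n : ℕ} (g : PinPlus n) : ∀ w : EuclideanSpace ℝ (Fin (n + 1)),
    pinRho (pinIncl n g) w = snocEquiv (pinRhoEquiv g) w := by
  intro w
  rw [snocEquiv_apply, pinRhoEquiv_apply, ← pinRho_pinIncl, euclSnoc_euclInit]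

/-- The pair `(v, c)` as a linear function. -/
def snocLin (n : ℕ) : (EuclideanSpace ℝ (Fin n) × ℝ) →L[ℝ] EuclideanSpace ℝ (Fin (n + 1)) :=
  LinearMap.toContinuousLinearMap
    { toFun := fun z => euclSnoc z.1 z.2
      map_add' := fun v w => euclSnoc_ext (by simp [Cyl.euclInit_add]) (by simp)
      map_smul' := fun c w => euclSnoc_ext (by simp [Cyl.euclInit_smul]) (by simp) }

namespace Cyl

section frames

variable {n : ℕ} {M : Type*} [TopologicalSpace M] [ChartedSpace (EuclideanSpace ℝ (Fin n)) M]

/-- The height as a point of the interval. -/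
def height (z : Cyl M) : Icc (0 : ℝ) 2 := ⟨ht z, ht_mem z⟩

theorem continuous_height : Continuous (height : Cyl M → _) := continuous_ht.subtype_mk _

theorem cylFrame_precomp (b : TangentFrame (𝓡 n) M)
    (A : EuclideanSpace ℝ (Fin n) ≃L[ℝ] EuclideanSpace ℝ (Fin n)) (y : Icc (0 : ℝ) 2) :
    cylFrame (b.precomp A) y = (cylFrame b y).precomp (snocEquiv A) := by
  refine TangentFrame.ext_vec fun w => ?_
  rw [TangentFrame.vec_precomp, cylFrame_vec, cylFrame_vec, TangentFrame.vec_precomp,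
    snocEquiv_apply, euclInit_euclSnoc, euclSnoc_last]

/-- The coordinates `(x, -y)` of the cylinder over `ℝⁿ`. With this sign the last vector of the
frames points out of the cylinder at height `0`. -/
def flat (z : Cyl (EuclideanSpace ℝ (Fin n))) : EuclideanSpace ℝ (Fin (n + 1)) :=
  euclSnoc (fst z) (-ht z)

theorem hasMFDerivAt_flat (z : Cyl (EuclideanSpace ℝ (Fin n))) :
    HasMFDerivAt (𝓡∂ (n + 1)) 𝓘(ℝ, EuclideanSpace ℝ (Fin (n + 1))) flat z
      ((snocLin n).comp ((mfderiv (𝓡∂ (n + 1)) (𝓡 n) fst z).prod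
        (-mfderiv (𝓡∂ (n + 1)) 𝓘(ℝ) ht z))) := by
  have h1 : MDifferentiableAt (𝓡∂ (n + 1)) (𝓡 n) fst z := contMDiff_fst.mdifferentiable (by simp) _
  have h2 : MDifferentiableAt (𝓡∂ (n + 1)) 𝓘(ℝ) ht z := contMDiff_ht.mdifferentiable (by simp) _
  have h4 : HasMFDerivAt (𝓡∂ (n + 1)) 𝓘(ℝ) (fun z => -ht z) z
      (-mfderiv (𝓡∂ (n + 1)) 𝓘(ℝ) ht z) := h2.hasMFDerivAt.neg
  have h3 : HasMFDerivAt (𝓡∂ (n + 1)) 𝓘(ℝ, EuclideanSpace ℝ (Fin n) × ℝ) (fun z => (fst z, -ht z)) z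
      ((mfderiv (𝓡∂ (n + 1)) (𝓡 n) fst z).prod (-mfderiv (𝓡∂ (n + 1)) 𝓘(ℝ) ht z)) :=
    ⟨h1.continuousAt.prodMk h4.1, h1.hasMFDerivAt.2.prodMk h4.2⟩
  exact (snocLin n).hasMFDerivAt.comp z h3

/-- In the coordinates `flat`, the frame `cylFrame` of the cylinder over `ℝⁿ` is the standard one.
-/
theorem tangentMap_flat (z : Cyl (EuclideanSpace ℝ (Fin n))) (w : EuclideanSpace ℝ (Fin (n + 1))) :
    tangentMap (𝓡∂ (n + 1)) 𝓘(ℝ, EuclideanSpace ℝ (Fin (n + 1))) flat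
      ((cylFrame (stdFrame (fst z)) (height z)).vec w) = flatVec (flat z) w := by
  have h1 := tangentMap_fst_tvec ((stdFrame (fst z)).vec (euclInit w)) (ht_mem z) (-w (Fin.last n))
  have h2 := tangentMap_ht_tvec ((stdFrame (fst z)).vec (euclInit w)) (ht_mem z) (-w (Fin.last n))
  have e1 := congrArg (fun V => (tangentBundleModelSpaceHomeomorph (𝓡 n) V).2) h1
  have e2 := congrArg (fun V => (tangentBundleModelSpaceHomeomorph 𝓘(ℝ) V).2) h2
  have h3 : ((cylFrame (stdFrame (fst z)) (height z)).vec w).1 = z := pt_fst_ht z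
  have h4 := hasMFDerivAt_flat ((cylFrame (stdFrame (fst z)) (height z)).vec w).1
  rw [tangentMap, h4.mfderiv]
  refine Bundle.TotalSpace.ext (congrArg flat h3) (heq_of_eq ?_)
  refine euclSnoc_ext ((euclInit_euclSnoc _ _).trans e1) ?_
  refine (euclSnoc_last _ _).trans ?_
  exact (congrArg Neg.neg e2).trans (neg_neg _)

end frames

end Cyl

section bordism

open Cyl hiding continuous_fst

variable {n : ℕ} {E : Type*} [TopologicalSpace E] [ChartedSpace (EuclideanSpace ℝ (Fin n)) E]
  {K : CollarModel n E} {M₁ M₂ : Type u}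
  [TopologicalSpace M₁] [ChartedSpace (EuclideanSpace ℝ (Fin n)) M₁] [T2Space M₁]
  [IsManifold (𝓡 n) ∞ M₁]
  [TopologicalSpace M₂] [ChartedSpace (EuclideanSpace ℝ (Fin n)) M₂] [T2Space M₂]
  [IsManifold (𝓡 n) ∞ M₂]
  {i₁ : OpenTube n E M₁} {i₂ : OpenTube n E M₂}
  {φ₁ : PinStructure.{u} (𝓡 n) M₁} {φ₂ : PinStructure.{u} (𝓡 n) M₂}

theorem RadProj.contDiff_sq (ϖ : RadProj n) : ContDiff ℝ ∞ ϖ.sq := by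
  unfold RadProj.sq
  exact ϖ.lin.contDiff.norm_sq ℝ

namespace FlatTube

variable (D : FlatTube K i₁ i₂ φ₁ φ₂)

/-- The squared distance to the core of the tube at height `0`. -/
def rsq (z : Cyl (EuclideanSpace ℝ (Fin n))) : ℝ := D.ϖ.sq (fst z) + ht z ^ 2

theorem continuous_rsq : Continuous D.rsq :=
  (D.ϖ.continuous_sq.comp Cyl.continuous_fst).add (continuous_ht.pow 2)

theorem snoc_sq_flat (z : Cyl (EuclideanSpace ℝ (Fin n))) : D.ϖ.snoc.sq (flat z) = D.rsq z := by
  rw [flat, RadProj.snoc_sq, neg_sq]; rfl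

theorem sq_ht_le_rsq (z : Cyl (EuclideanSpace ℝ (Fin n))) : ht z ^ 2 ≤ D.rsq z :=
  le_add_of_nonneg_left (sq_nonneg _)

theorem sq_fst_le_rsq (z : Cyl (EuclideanSpace ℝ (Fin n))) : D.ϖ.sq (fst z) ≤ D.rsq z :=
  le_add_of_nonneg_right (sq_nonneg _)

/-- The overlap region of the two cylinders. The inversion exchanges its two conditions. -/
def overlapRegion : Opens (Cyl (EuclideanSpace ℝ (Fin n))) :=
  ⟨{z | ht z < 2 ∧ ht z < 2 * D.rsq z}, (isOpen_lt continuous_ht continuous_const).inter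
    (isOpen_lt continuous_ht (D.continuous_rsq.const_mul 2))⟩

theorem rsq_pos {z : Cyl (EuclideanSpace ℝ (Fin n))} (h : z ∈ D.overlapRegion) : 0 < D.rsq z := by
  have h1 : ht z < 2 * D.rsq z := h.2
  have h2 := (ht_mem z).1
  linarith

/-- The inversion `(x, y) ↦ (x, y) / r²` of the cylinder, where `x` is divided in its radial
coordinates only. -/
def cylInv (z : Cyl (EuclideanSpace ℝ (Fin n))) : Cyl (EuclideanSpace ℝ (Fin n)) :=
  pt (D.ϖ.scale (D.rsq z)⁻¹ (fst z)) ((D.rsq z)⁻¹ * ht z)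

theorem fst_cylInv (z : Cyl (EuclideanSpace ℝ (Fin n))) :
    fst (D.cylInv z) = D.ϖ.scale (D.rsq z)⁻¹ (fst z) := rfl

theorem ht_cylInv {z : Cyl (EuclideanSpace ℝ (Fin n))} (h : z ∈ D.overlapRegion) :
    ht (D.cylInv z) = (D.rsq z)⁻¹ * ht z := by
  have h0 := D.rsq_pos h
  have h2 : ht z < 2 * D.rsq z := h.2
  refine ht_pt _ ⟨mul_nonneg (inv_nonneg.2 h0.le) (ht_mem z).1, ?_⟩
  rw [inv_mul_le_iff₀ h0]
  linarith

theorem rsq_cylInv {z : Cyl (EuclideanSpace ℝ (Fin n))} (h : z ∈ D.overlapRegion) :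
    D.rsq (D.cylInv z) = (D.rsq z)⁻¹ := by
  have h0 := D.rsq_pos h
  rw [rsq, D.ht_cylInv h, D.fst_cylInv, RadProj.sq, D.ϖ.lin_scale, norm_smul, mul_pow,
    Real.norm_eq_abs, sq_abs, mul_pow, ← mul_add]
  change (D.rsq z)⁻¹ ^ 2 * D.rsq z = _
  field_simp

theorem cylInv_mem {z : Cyl (EuclideanSpace ℝ (Fin n))} (h : z ∈ D.overlapRegion) :
    D.cylInv z ∈ D.overlapRegion := by
  have h0 := D.rsq_pos h
  have h1 : ht z < 2 := h.1
  have h2 : ht z < 2 * D.rsq z := h.2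
  constructor
  · rw [D.ht_cylInv h, inv_mul_lt_iff₀ h0]
    linarith
  · rw [D.ht_cylInv h, D.rsq_cylInv h, mul_comm]
    exact mul_lt_mul_of_pos_right h1 (inv_pos.2 h0)

theorem cylInv_cylInv {z : Cyl (EuclideanSpace ℝ (Fin n))} (h : z ∈ D.overlapRegion) :
    D.cylInv (D.cylInv z) = z := by
  have h0 := D.rsq_pos h
  refine Cyl.ext ?_ ?_
  · rw [D.fst_cylInv, D.rsq_cylInv h, D.fst_cylInv, D.ϖ.scale_scale, _root_.inv_inv,
      mul_inv_cancel₀ h0.ne', D.ϖ.scale_one]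
  · rw [D.ht_cylInv (D.cylInv_mem h), D.rsq_cylInv h, D.ht_cylInv h, _root_.inv_inv,
      mul_inv_cancel_left₀ h0.ne']

theorem continuousAt_cylInv {z : Cyl (EuclideanSpace ℝ (Fin n))} (h : D.rsq z ≠ 0) :
    ContinuousAt D.cylInv z := by
  have h1 : ContinuousAt (fun z => (D.rsq z)⁻¹) z := D.continuous_rsq.continuousAt.inv₀ h
  exact continuous_pt.continuousAt.comp
    ((D.ϖ.continuous_scale.continuousAt.comp (h1.prodMk Cyl.continuous_fst.continuousAt)).prodMk
      (h1.mul continuous_ht.continuousAt))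

theorem contMDiffAt_cylInv {z : Cyl (EuclideanSpace ℝ (Fin n))} (h : z ∈ D.overlapRegion) :
    ContMDiffAt (𝓡∂ (n + 1)) (𝓡∂ (n + 1)) ∞ D.cylInv z := by
  have hs : ContMDiff (𝓡∂ (n + 1)) 𝓘(ℝ) ∞ D.rsq := by
    have h1 : ContMDiff (𝓡∂ (n + 1)) 𝓘(ℝ) ∞ fun z => D.ϖ.sq (fst z) :=
      D.ϖ.contDiff_sq.contMDiff.comp contMDiff_fst
    exact h1.add (contMDiff_ht.pow 2)
  have hi : ContMDiffOn (𝓡∂ (n + 1)) 𝓘(ℝ) ∞ (fun z => (D.rsq z)⁻¹) D.overlapRegion :=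
    fun w hw => ((contDiffAt_inv ℝ (D.rsq_pos hw).ne').contMDiffAt.comp w (hs w)).contMDiffWithinAt
  refine (contMDiffOn_of ?_ ?_).contMDiffAt (D.overlapRegion.2.mem_nhds h)
  · have h1 : ContMDiff (𝓡∂ (n + 1)) 𝓘(ℝ, EuclideanSpace ℝ (Fin n)) ∞ fun z => D.ϖ.lin (fst z) :=
      D.ϖ.lin.contDiff.contMDiff.comp contMDiff_fst
    have h2 : ContMDiff (𝓡∂ (n + 1)) 𝓘(ℝ, EuclideanSpace ℝ (Fin n)) ∞
      (fst : Cyl (EuclideanSpace ℝ (Fin n)) → _) := contMDiff_fst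
    exact h2.contMDiffOn.add ((hi.sub contMDiffOn_const).smul h1.contMDiffOn)
  · exact (hi.mul contMDiff_ht.contMDiffOn).congr fun w hw => D.ht_cylInv hw

theorem flat_cylInv {z : Cyl (EuclideanSpace ℝ (Fin n))} (h : z ∈ D.overlapRegion) :
    flat (D.cylInv z) = D.ϖ.snoc.inversion (flat z) := by
  rw [RadProj.inversion_eq, D.snoc_sq_flat, flat, D.ht_cylInv h, flat, RadProj.snoc_lin]
  refine euclSnoc_ext ?_ ?_
  · rw [euclInit_add, euclInit_smul]
    simp only [euclInit_euclSnoc]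
    rfl
  · simp
    ring

/-- Two points of the cylinder over `ℝⁿ` with the same image in the cylinder over the tube. -/
def Same (z z' : Cyl (EuclideanSpace ℝ (Fin n))) : Prop :=
  D.cov (fst z) = D.cov (fst z') ∧ ht z = ht z'

variable {D} in
theorem Same.symm {z z' : Cyl (EuclideanSpace ℝ (Fin n))} (h : D.Same z z') : D.Same z' z :=
  ⟨h.1.symm, h.2.symm⟩

variable {D} in
theorem Same.rsq_eq {z z' : Cyl (EuclideanSpace ℝ (Fin n))} (h : D.Same z z') :
    D.rsq z = D.rsq z' := by
  rw [rsq, rsq, h.2, D.sq_eq h.1]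

variable {D} in
theorem Same.cylInv {z z' : Cyl (EuclideanSpace ℝ (Fin n))} (h : D.Same z z') :
    D.Same (D.cylInv z) (D.cylInv z') := by
  constructor
  · rw [D.fst_cylInv, D.fst_cylInv, h.rsq_eq, D.cov_scale h.1]
  · rw [FlatTube.cylInv, FlatTube.cylInv, h.rsq_eq, h.2]
    rfl

/-- The coordinates of the cylinder over the tube in the cylinder over `M₁`. -/
def k₁ : Cyl (EuclideanSpace ℝ (Fin n)) → Cyl M₁ := Cyl.map D.j₁
/-- The coordinates of the cylinder over the tube in the cylinder over `M₂`. -/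
def k₂ : Cyl (EuclideanSpace ℝ (Fin n)) → Cyl M₂ := Cyl.map D.j₂

theorem k₁_eq_iff (z z' : Cyl (EuclideanSpace ℝ (Fin n))) : D.k₁ z = D.k₁ z' ↔ D.Same z z' := by
  constructor
  · intro h
    refine ⟨i₁.injective (congrArg fst h), ?_⟩
    have := congrArg ht h
    rwa [k₁, ht_map, ht_map] at this
  · intro h
    refine Cyl.ext (congrArg i₁.toFun h.1) ?_
    rw [k₁, ht_map, ht_map, h.2]

theorem k₂_eq_iff (z z' : Cyl (EuclideanSpace ℝ (Fin n))) : D.k₂ z = D.k₂ z' ↔ D.Same z z' := by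
  constructor
  · intro h
    refine ⟨i₂.injective (congrArg fst h), ?_⟩
    have := congrArg ht h
    rwa [k₂, ht_map, ht_map] at this
  · intro h
    refine Cyl.ext (congrArg i₂.toFun h.1) ?_
    rw [k₂, ht_map, ht_map, h.2]

theorem isLocalDiffeomorph_k₁ : IsLocalDiffeomorph (𝓡∂ (n + 1)) (𝓡∂ (n + 1)) ∞ D.k₁ :=
  isLocalDiffeomorph_map D.isLocalDiffeomorph_j₁

theorem isLocalDiffeomorph_k₂ : IsLocalDiffeomorph (𝓡∂ (n + 1)) (𝓡∂ (n + 1)) ∞ D.k₂ :=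
  isLocalDiffeomorph_map D.isLocalDiffeomorph_j₂

/-- Points of the cylinder close to the core have representatives in a compact set. -/
theorem exists_compact_rep (R : ℝ) : ∃ B : Set (Cyl (EuclideanSpace ℝ (Fin n))), IsCompact B ∧
    ∀ z, D.rsq z ≤ R → ∃ z' ∈ B, D.Same z' z := by
  obtain ⟨B, hB, h⟩ := D.exists_compact R
  refine ⟨B ×ˢ (univ : Set (Icc (0 : ℝ) 2)), hB.prod isCompact_univ, fun z hz => ?_⟩
  obtain ⟨x, hx, hxz⟩ := h (fst z) ((D.sq_fst_le_rsq z).trans hz)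
  exact ⟨pt x (ht z), ⟨hx, trivial⟩, hxz, ht_pt _ (ht_mem z)⟩

/-- A closed set of points close to the core, saturated for `Same`, has a closed image. -/
theorem isClosed_image {X : Type*} [TopologicalSpace X] [T2Space X]
    {f : Cyl (EuclideanSpace ℝ (Fin n)) → X} (hf : Continuous f)
    (hs : ∀ z z', D.Same z z' → f z = f z') {S : Set (Cyl (EuclideanSpace ℝ (Fin n)))}
    (hS : IsClosed S) (hSs : ∀ z z', D.Same z z' → z ∈ S → z' ∈ S) {R : ℝ}
    (hR : ∀ z ∈ S, D.rsq z ≤ R) : IsClosed (f '' S) := by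
  obtain ⟨B, hB, h⟩ := D.exists_compact_rep R
  have : f '' S = f '' (B ∩ S) := by
    refine subset_antisymm ?_ (image_mono inter_subset_right)
    rintro _ ⟨z, hz, rfl⟩
    obtain ⟨z', hz', hzz⟩ := h z (hR z hz)
    exact ⟨z', ⟨hz', hSs _ _ hzz.symm hz⟩, hs _ _ hzz⟩
  rw [this]
  exact ((hB.inter_right hS).image hf).isClosed

/-- The part of the cylinder over the tube that is removed: in the radial coordinates and the
height, the closed ball of diameter `1/2` that touches height `0` at the core. -/
def removed : Set (Cyl (EuclideanSpace ℝ (Fin n))) := {z | 2 * D.rsq z ≤ ht z}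

theorem rsq_lt_of_mem_removed {z} (h : z ∈ D.removed) : D.rsq z < 1 := by
  have h1 : 2 * D.rsq z ≤ ht z := h
  have h2 := D.sq_ht_le_rsq z
  nlinarith

theorem Same.removed {z z' : Cyl (EuclideanSpace ℝ (Fin n))} (h : D.Same z z')
    (hz : z ∈ D.removed) : z' ∈ D.removed := by
  have h1 : 2 * D.rsq z ≤ ht z := hz
  rw [h.rsq_eq, h.2] at h1
  exact h1

theorem isClosed_removed : IsClosed D.removed :=
  isClosed_le (D.continuous_rsq.const_mul 2) continuous_ht

/-- The piece of the cylinder over `M₁`. -/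
def piece₁ : Opens (Cyl M₁) := ⟨(D.k₁ '' D.removed)ᶜ, (D.isClosed_image
  D.isLocalDiffeomorph_k₁.contMDiff.continuous (fun _ _ => (D.k₁_eq_iff _ _).2) D.isClosed_removed
  (fun _ _ => Same.removed D) fun _ h => (D.rsq_lt_of_mem_removed h).le).isOpen_compl⟩

/-- The piece of the cylinder over `M₂`. -/
def piece₂ : Opens (Cyl M₂) := ⟨(D.k₂ '' D.removed)ᶜ, (D.isClosed_image
  D.isLocalDiffeomorph_k₂.contMDiff.continuous (fun _ _ => (D.k₂_eq_iff _ _).2) D.isClosed_removed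
  (fun _ _ => Same.removed D) fun _ h => (D.rsq_lt_of_mem_removed h).le).isOpen_compl⟩

theorem k₁_mem_iff (z) : D.k₁ z ∈ D.piece₁ ↔ ht z < 2 * D.rsq z := by
  rw [← not_le]
  refine not_congr ⟨?_, fun h => ⟨z, h, rfl⟩⟩
  rintro ⟨z', hz', h⟩
  exact Same.removed D ((D.k₁_eq_iff _ _).1 h) hz'

theorem k₂_mem_iff (z) : D.k₂ z ∈ D.piece₂ ↔ ht z < 2 * D.rsq z := by
  rw [← not_le]
  refine not_congr ⟨?_, fun h => ⟨z, h, rfl⟩⟩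
  rintro ⟨z', hz', h⟩
  exact Same.removed D ((D.k₂_eq_iff _ _).1 h) hz'

theorem frame_cylMk {M : Type u} [TopologicalSpace M] [ChartedSpace (EuclideanSpace ℝ (Fin n)) M]
    [IsManifold (𝓡 n) ∞ M] (φ : PinStructure.{u} (𝓡 n) M) {j : EuclideanSpace ℝ (Fin n) → M}
    (hj : IsLocalDiffeomorph (𝓡 n) (𝓡 n) ∞ j) {p : φ.P} {b : TangentFrame (𝓡 n) _}
    {F : EuclideanSpace ℝ (Fin n) ≃L[ℝ] EuclideanSpace ℝ (Fin n)}
    (h : φ.frame p = (b.precomp F).map hj) (y : Icc (0 : ℝ) 2) : φ.cyl.frame (φ.cylMk p 1 y) =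
      ((cylFrame b y).precomp (snocEquiv F)).map (isLocalDiffeomorph_map hj) := by
  rw [← cylFrame_precomp, cylFrame_map hj, ← h]
  refine TangentFrame.ext_vec fun v => ?_
  change ((cylFrame (φ.frame p) y).precomp (pinRhoEquiv 1)).vec v = _
  rw [TangentFrame.vec_precomp, pinRhoEquiv_apply, pinRho_one]

theorem cylMk_deck {M : Type u} [TopologicalSpace M] [ChartedSpace (EuclideanSpace ℝ (Fin n)) M]
    [IsManifold (𝓡 n) ∞ M] (φ : PinStructure.{u} (𝓡 n) M) {p p' : φ.P} {c : PinPlus n}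
    (h : φ.act p' c = p) (y : Icc (0 : ℝ) 2) :
    φ.cyl.act (φ.cylMk p' 1 y) (pinIncl n c) = φ.cylMk p 1 y := by
  change φ.cylMk p' (1 * pinIncl n c) y = _
  rw [← h, φ.cylMk_act, one_mul, mul_one]

/-- The gluing data for the cylinders over `M₁` and `M₂`. -/
def cylRegion : FlatRegion φ₁.cyl φ₂.cyl (Cyl (EuclideanSpace ℝ (Fin n))) where
  ϖ := D.ϖ.snoc
  fl := flat
  mdifferentiable_fl z := (hasMFDerivAt_flat z).mdifferentiableAt
  flat z := cylFrame (stdFrame (fst z)) (height z)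
  base_flat z := pt_fst_ht z
  continuous_flat := continuous_cylFrame (b := fun z => stdFrame (fst z)) continuous_height
    (continuous_stdFrame.comp
    ((Cyl.continuous_fst.comp continuous_fst).prodMk continuous_snd))
  tangentMap_flat := Cyl.tangentMap_flat
  O := D.overlapRegion
  inv := D.cylInv
  inv_mem _ h := D.cylInv_mem h
  inv_inv _ h := D.cylInv_cylInv h
  contMDiffAt_inv _ h := D.contMDiffAt_cylInv h
  fl_inv _ h := D.flat_cylInv h
  lin_ne z h h0 := by
    have h1 := D.rsq_pos h
    rw [← D.snoc_sq_flat, RadProj.sq, h0] at h1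
    simp at h1
  A₁ := D.piece₁
  A₂ := D.piece₂
  k₁ := D.k₁
  k₂ := D.k₂
  k₁_mem z hz := (D.k₁_mem_iff z).2 hz.2
  k₂_mem z hz := (D.k₂_mem_iff z).2 hz.2
  isLocalDiffeomorph_k₁ := D.isLocalDiffeomorph_k₁
  isLocalDiffeomorph_k₂ := D.isLocalDiffeomorph_k₂
  η₁ z := φ₁.cylMk (D.σ₁ (fst z)) 1 (height z)
  η₂ z := φ₂.cylMk (D.σ₂ (fst z)) 1 (height z)
  continuous_η₁ := φ₁.continuous_cylMk.comp ((D.continuous_σ₁.comp Cyl.continuous_fst).prodMk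
    (continuous_const.prodMk continuous_height))
  continuous_η₂ := φ₂.continuous_cylMk.comp ((D.continuous_σ₂.comp Cyl.continuous_fst).prodMk
    (continuous_const.prodMk continuous_height))
  F₁ t z := snocEquiv (D.F₁ t (fst z))
  F₂ t z := snocEquiv (D.F₂ t (fst z))
  continuous_F₁ := by
    have h := D.continuous_F₁.comp (((continuous_fst.comp continuous_fst).prodMk
      (Cyl.continuous_fst.comp (continuous_snd.comp continuous_fst))).prodMk
      (continuous_euclInit.comp (continuous_snd (X := unitInterval ×
        Cyl (EuclideanSpace ℝ (Fin n))))))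
    exact (snocLin n).continuous.comp (h.prodMk
      ((EuclideanSpace.proj (𝕜 := ℝ) (Fin.last n)).continuous.comp continuous_snd))
  continuous_F₂ := by
    have h := D.continuous_F₂.comp (((continuous_fst.comp continuous_fst).prodMk
      (Cyl.continuous_fst.comp (continuous_snd.comp continuous_fst))).prodMk
      (continuous_euclInit.comp (continuous_snd (X := unitInterval ×
        Cyl (EuclideanSpace ℝ (Fin n))))))
    exact (snocLin n).continuous.comp (h.prodMk
      ((EuclideanSpace.proj (𝕜 := ℝ) (Fin.last n)).continuous.comp continuous_snd))
  F₁_one z v := by rw [snocEquiv_apply, D.F₁_one, euclSnoc_euclInit]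
  F₂_one z v := by rw [snocEquiv_apply, D.F₂_one, euclSnoc_euclInit]
  frame_η₁ z := frame_cylMk φ₁ D.isLocalDiffeomorph_j₁ (D.frame_σ₁ (fst z)) (height z)
  frame_η₂ z := frame_cylMk φ₂ D.isLocalDiffeomorph_j₂ (D.frame_σ₂ (fst z)) (height z)
  deck z hz z' hz' h := by
    have hs := (D.k₁_eq_iff z z').1 h
    obtain ⟨c, h1, h2, h3, h4, h5, h6, h7⟩ := D.deck _ _ hs.1
    have hh : height z' = height z := Subtype.ext hs.2.symm
    have hi : height (D.cylInv z') = height (D.cylInv z) := Subtype.ext hs.cylInv.2.symm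
    refine ⟨pinIncl n c, ?_, ?_, ?_, fun t v => ?_, fun t v => ?_, fun v => ?_, ?_⟩
    · have h8 := h2 1
      rw [D.ϖ.scale_one, D.ϖ.scale_one] at h8
      rw [hh]
      exact cylMk_deck φ₁ h8 _
    · rw [← pinIncl_pinGrading, hi, D.fst_cylInv, D.fst_cylInv, hs.rsq_eq]
      exact cylMk_deck φ₂ (h3 _) _
    · have h8 : (cylFrame (stdFrame (fst z')) (height z')).precomp (pinRhoEquiv (pinIncl n c)) =
          cylFrame ((stdFrame (fst z')).precomp (pinRhoEquiv c)) (height z') := by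
        rw [cylFrame_precomp]
        refine TangentFrame.ext_vec fun v => ?_
        rw [TangentFrame.vec_precomp, TangentFrame.vec_precomp, pinRhoEquiv_apply,
          pinRhoEquiv_pinIncl]
      rw [h8]
      refine (cylFrame_map D.isLocalDiffeomorph_j₁ _ _).trans ?_
      rw [D.deck_frame_j₁ h1, hh]
      exact (cylFrame_map D.isLocalDiffeomorph_j₁ _ _).symm
    · have h8 := h4 t 1
      rw [D.ϖ.scale_one, D.ϖ.scale_one] at h8
      simp only [pinRhoEquiv_pinIncl, snocEquiv_apply, euclInit_euclSnoc, euclSnoc_last,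
        pinRhoEquiv_apply, h8]
    · have h8 := h5 t (D.rsq z)⁻¹
      simp only [pinRhoEquiv_pinIncl, snocEquiv_apply, euclInit_euclSnoc, euclSnoc_last,
        pinRhoEquiv_apply, D.fst_cylInv, ← hs.rsq_eq, h8]
    · rw [← euclSnoc_euclInit v, pinRho_pinIncl, RadProj.snoc_lin, RadProj.snoc_lin,
        pinRho_pinIncl, h6]
    · rw [flat, flat, RadProj.snoc_lin, RadProj.snoc_lin, pinRho_pinIncl, h7, hs.2]

end FlatTube

end bordism

section bordism

open Cyl hiding continuous_fst

variable {n : ℕ} {E : Type*} [TopologicalSpace E] [ChartedSpace (EuclideanSpace ℝ (Fin n)) E]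
  {K : CollarModel n E} {M₁ M₂ : Type u}
  [TopologicalSpace M₁] [ChartedSpace (EuclideanSpace ℝ (Fin n)) M₁] [T2Space M₁]
  [IsManifold (𝓡 n) ∞ M₁]
  [TopologicalSpace M₂] [ChartedSpace (EuclideanSpace ℝ (Fin n)) M₂] [T2Space M₂]
  [IsManifold (𝓡 n) ∞ M₂]
  {i₁ : OpenTube n E M₁} {i₂ : OpenTube n E M₂}
  {φ₁ : PinStructure.{u} (𝓡 n) M₁} {φ₂ : PinStructure.{u} (𝓡 n) M₂}

namespace FlatTube

variable (D : FlatTube K i₁ i₂ φ₁ φ₂)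

/-- The identification of the pieces of the two cylinders. -/
def overlap : Overlap (𝓡∂ (n + 1)) D.piece₁ D.piece₂ D.overlapRegion where
  κ₁ := D.cylRegion.toStage.k₁
  κ₂ z := D.cylRegion.toStage.k₂ (D.cylRegion.toStage.inv z)
  isLocalDiffeomorph_κ₁ := D.cylRegion.toStage.isLocalDiffeomorph_k₁
  isLocalDiffeomorph_κ₂ := D.cylRegion.toStage.isLocalDiffeomorph_k₂_inv
  eq_iff z z' := by
    have h1 : D.k₁ z = D.k₁ z' ↔ D.k₂ (D.cylInv z) = D.k₂ (D.cylInv z') := by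
      rw [D.k₁_eq_iff, D.k₂_eq_iff]
      refine ⟨Same.cylInv, fun h => ?_⟩
      have := h.cylInv
      rwa [D.cylInv_cylInv z.2, D.cylInv_cylInv z'.2] at this
    exact ⟨fun h => Subtype.ext (h1.1 (congrArg Subtype.val h)),
      fun h => Subtype.ext (h1.2 (congrArg Subtype.val h))⟩

theorem coe_κ₁ (z : D.overlapRegion) : (D.overlap.κ₁ z : Cyl M₁) = D.k₁ z := rfl
theorem coe_κ₂ (z : D.overlapRegion) : (D.overlap.κ₂ z : Cyl M₂) = D.k₂ (D.cylInv z) := rfl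

/-- Limits of points of the overlap in the part where the distance to the core is at most one. -/
theorem exists_limit {X₁ X₂ ι : Type*} [TopologicalSpace X₁] [T2Space X₁] [TopologicalSpace X₂]
    [T2Space X₂] {f : Cyl (EuclideanSpace ℝ (Fin n)) → X₁} {g : Cyl (EuclideanSpace ℝ (Fin n)) → X₂}
    (hf : Continuous f) (hg : Continuous g) (hfs : ∀ z z', D.Same z z' → f z = f z')
    (hgs : ∀ z z', D.Same z z' → g z = g z') (F : Ultrafilter ι)
    {u : ι → Cyl (EuclideanSpace ℝ (Fin n))} (hu : ∀ᶠ i in (F : Filter ι), D.rsq (u i) ≤ 1)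
    {a : X₁} {b : X₂} (ha : Tendsto (fun i => f (u i)) F (𝓝 a))
    (hb : Tendsto (fun i => g (D.cylInv (u i))) F (𝓝 b)) (ha' : a ∉ f '' D.removed) :
    ∃ z ∈ D.overlapRegion, f z = a ∧ g (D.cylInv z) = b := by
  obtain ⟨B, hB, h⟩ := D.exists_compact_rep 1
  have hr : ∀ i, ∃ z, D.Same z (u i) ∧ (D.rsq (u i) ≤ 1 → z ∈ B) := by
    intro i
    by_cases hi : D.rsq (u i) ≤ 1
    · obtain ⟨z, hz, hs⟩ := h _ hi
      exact ⟨z, hs, fun _ => hz⟩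
    · exact ⟨u i, ⟨rfl, rfl⟩, fun h => absurd h hi⟩
  choose r hr hrB using hr
  have hBF : ((F.map r : Ultrafilter _) : Filter (Cyl (EuclideanSpace ℝ (Fin n)))) ≤ 𝓟 B := by
    rw [le_principal_iff, Ultrafilter.coe_map, mem_map]
    filter_upwards [hu] with i hi
    exact hrB i hi
  obtain ⟨w, -, hw⟩ := hB.ultrafilter_le_nhds _ hBF
  have hw' : Tendsto r F (𝓝 w) := hw
  have h1 : f w = a := tendsto_nhds_unique ((hf.tendsto w).comp hw')
    (ha.congr fun i => (hfs _ _ (hr i)).symm)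
  have h2 : ht w < 2 * D.rsq w := by
    by_contra hlt
    exact ha' ⟨w, not_lt.1 hlt, h1⟩
  have h3 : D.rsq w ≤ 1 := by
    refine le_of_tendsto ((D.continuous_rsq.tendsto w).comp hw') ?_
    filter_upwards [hu] with i hi
    exact (hr i).rsq_eq.trans_le hi
  have h4 : D.rsq w ≠ 0 := by
    have := (ht_mem w).1
    intro h0
    linarith
  refine ⟨w, ⟨by linarith, h2⟩, h1, ?_⟩
  refine tendsto_nhds_unique ((hg.continuousAt.comp (D.continuousAt_cylInv h4)).tendsto.comp hw') ?_
  exact hb.congr fun i => (hgs _ _ (hr i).cylInv).symm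

/-- The bordism between the sum and the disjoint union. -/
abbrev W : Type u := D.overlap.Space

/-- The identification is closed. Along an ultrafilter either `r² ≤ 1`, or `r² ≤ 1` for the inverted
points, and in both cases representatives can be chosen in a compact set. The limit is again in the
overlap, because the pieces omit the removed sets. -/
theorem t2Space_W : T2Space D.W := by
  refine D.overlap.t2Space fun F a b ha hb => ?_
  have ha1 : Tendsto (fun z : D.overlapRegion => D.k₁ z) F (𝓝 (a : Cyl M₁)) :=
    (continuous_subtype_val.tendsto a).comp ha
  have hb1 : Tendsto (fun z : D.overlapRegion => D.k₂ (D.cylInv z)) F (𝓝 (b : Cyl M₂)) :=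
    (continuous_subtype_val.tendsto b).comp hb
  have c1 := D.isLocalDiffeomorph_k₁.contMDiff.continuous
  have c2 := D.isLocalDiffeomorph_k₂.contMDiff.continuous
  rcases F.em fun z : D.overlapRegion => D.rsq z ≤ 1 with hF | hF
  · obtain ⟨z, hz, h1, h2⟩ := D.exists_limit c1 c2 (fun _ _ => (D.k₁_eq_iff _ _).2)
      (fun _ _ => (D.k₂_eq_iff _ _).2) F hF ha1 hb1 a.2
    exact ⟨⟨z, hz⟩, Subtype.ext h1, Subtype.ext h2⟩
  · obtain ⟨z, hz, h1, h2⟩ := D.exists_limit c2 c1 (fun _ _ => (D.k₂_eq_iff _ _).2)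
      (fun _ _ => (D.k₁_eq_iff _ _).2) F (u := fun z => D.cylInv z) (by
        filter_upwards [hF] with z hz
        rw [D.rsq_cylInv z.2]
        exact inv_le_one_of_one_le₀ (not_le.1 hz).le) hb1
      (ha1.congr fun z => by rw [D.cylInv_cylInv z.2]) b.2
    exact ⟨⟨D.cylInv z, D.cylInv_mem hz⟩, Subtype.ext h2,
      Subtype.ext ((congrArg D.k₂ (D.cylInv_cylInv hz)).trans h1)⟩

theorem notMem_image_of_rsq_lt {X : Type*} {f : Cyl (EuclideanSpace ℝ (Fin n)) → X} {m : X}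
    (hm : m ∉ f '' {z | D.rsq z < 1}) : m ∉ f '' D.removed :=
  fun h => hm (image_mono (fun _ => D.rsq_lt_of_mem_removed) h)

/-- The parts `r² ≥ 1` of the two pieces are compact, and they cover the bordism, since the
inversion exchanges `r² < 1` and `r² > 1`. -/
theorem compactSpace_W [CompactSpace M₁] [CompactSpace M₂] : CompactSpace D.W := by
  have ho : IsOpen {z | D.rsq z < 1} := isOpen_lt D.continuous_rsq continuous_const
  have e1 : IsCompact (Subtype.val ⁻¹' (D.k₁ '' {z | D.rsq z < 1})ᶜ : Set D.piece₁) := by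
    refine Topology.IsInducing.subtypeVal.isCompact_preimage' ?_ ?_
    · exact (D.isLocalDiffeomorph_k₁.isOpenMap _ ho).isClosed_compl.isCompact
    · intro m hm
      exact ⟨⟨m, D.notMem_image_of_rsq_lt hm⟩, rfl⟩
  have e2 : IsCompact (Subtype.val ⁻¹' (D.k₂ '' {z | D.rsq z < 1})ᶜ : Set D.piece₂) := by
    refine Topology.IsInducing.subtypeVal.isCompact_preimage' ?_ ?_
    · exact (D.isLocalDiffeomorph_k₂.isOpenMap _ ho).isClosed_compl.isCompact
    · intro m hm
      exact ⟨⟨m, D.notMem_image_of_rsq_lt hm⟩, rfl⟩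
  have key := (e1.image D.overlap.isLocalDiffeomorph_inl.contMDiff.continuous).union
    (e2.image D.overlap.isLocalDiffeomorph_inr.contMDiff.continuous)
  refine ⟨?_⟩
  convert key
  refine (eq_univ_of_forall fun w => ?_).symm
  rcases D.overlap.mem_range w with ⟨m, rfl⟩ | ⟨m, rfl⟩
  -- a point with `r² < 1` in one piece has `r² > 1` in the other
  · by_cases hm : (m : Cyl M₁) ∈ D.k₁ '' {z | D.rsq z < 1}
    · obtain ⟨z, hz, hzm⟩ := hm
      have hz1 : D.rsq z < 1 := hz
      have hz2 : ht z < 2 * D.rsq z := (D.k₁_mem_iff z).1 (hzm ▸ m.2)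
      have hz3 : z ∈ D.overlapRegion := ⟨by linarith, hz2⟩
      have hm' : D.overlap.κ₁ ⟨z, hz3⟩ = m := Subtype.ext hzm
      refine .inr ⟨D.overlap.κ₂ ⟨z, hz3⟩, ?_, by rw [← hm', D.overlap.inl_κ₁]⟩
      rintro ⟨z', hz', h⟩
      have h1 : D.rsq z' = D.rsq (D.cylInv z) := ((D.k₂_eq_iff _ _).1 h).rsq_eq
      rw [D.rsq_cylInv hz3] at h1
      have h2 : D.rsq z' < 1 := hz'
      have h3 := one_lt_inv_iff₀.2 ⟨D.rsq_pos hz3, hz1⟩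
      linarith
    · exact .inl ⟨m, hm, rfl⟩
  · by_cases hm : (m : Cyl M₂) ∈ D.k₂ '' {z | D.rsq z < 1}
    · obtain ⟨z, hz, hzm⟩ := hm
      have hz1 : D.rsq z < 1 := hz
      have hz2 : ht z < 2 * D.rsq z := (D.k₂_mem_iff z).1 (hzm ▸ m.2)
      have hz3 : z ∈ D.overlapRegion := ⟨by linarith, hz2⟩
      have hm' : D.overlap.κ₂ ⟨D.cylInv z, D.cylInv_mem hz3⟩ = m :=
        Subtype.ext ((congrArg D.k₂ (D.cylInv_cylInv hz3)).trans hzm)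
      refine .inl ⟨D.overlap.κ₁ ⟨D.cylInv z, D.cylInv_mem hz3⟩, ?_, by
        rw [← hm', D.overlap.inl_κ₁]⟩
      rintro ⟨z', hz', h⟩
      have h1 : D.rsq z' = D.rsq (D.cylInv z) := ((D.k₁_eq_iff _ _).1 h).rsq_eq
      rw [D.rsq_cylInv hz3] at h1
      have h2 : D.rsq z' < 1 := hz'
      have h3 := one_lt_inv_iff₀.2 ⟨D.rsq_pos hz3, hz1⟩
      linarith
    · exact .inr ⟨m, hm, rfl⟩

theorem notMem_image₁ {p : D.piece₁} (hp : p ∉ range D.overlap.κ₁) :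
    (p : Cyl M₁) ∉ D.k₁ '' {z | D.rsq z ≤ 2} := by
  rintro ⟨z, hz, h⟩
  have hz1 : D.rsq z ≤ 2 := hz
  refine hp ⟨⟨z, ?_, (D.k₁_mem_iff z).1 (h ▸ p.2)⟩, Subtype.ext h⟩
  change ht z < 2
  nlinarith [D.sq_ht_le_rsq z]

theorem notMem_image₂ {p : D.piece₂} (hp : p ∉ range D.overlap.κ₂) :
    (p : Cyl M₂) ∉ D.k₂ '' {z | D.rsq z ≤ 2} := by
  rintro ⟨z, hz, h⟩
  have hz1 : D.rsq z ≤ 2 := hz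
  have hzO : z ∈ D.overlapRegion := by
    refine ⟨?_, (D.k₂_mem_iff z).1 (h ▸ p.2)⟩
    change ht z < 2
    nlinarith [D.sq_ht_le_rsq z]
  exact hp ⟨⟨D.cylInv z, D.cylInv_mem hzO⟩,
    Subtype.ext ((congrArg D.k₂ (D.cylInv_cylInv hzO)).trans h)⟩

/-- The gluing of the Pin⁺ structures over the bordism. -/
def cylGluing : SectionGluing (φ₁.cyl.restrict D.piece₁) (φ₂.cyl.restrict D.piece₂)
    D.overlap.inl D.overlap.inr D.overlapRegion :=
  D.cylRegion.toStage.toSectionGluing D.overlap.isLocalDiffeomorph_inl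
    D.overlap.isLocalDiffeomorph_inr D.overlap.injective_inl D.overlap.injective_inr
    D.overlap.mem_range D.overlap.inl_κ₁
    (by
      rintro p ⟨q, hq⟩
      obtain ⟨z, hz, -⟩ := (D.overlap.inl_eq_inr_iff _ _).1 hq.symm
      exact ⟨z, hz⟩)
    (by
      rintro p ⟨q, hq⟩
      obtain ⟨z, -, hz⟩ := (D.overlap.inl_eq_inr_iff _ _).1 hq
      exact ⟨z, hz⟩)
    (by
      intro p hp
      have hc := D.isClosed_image D.isLocalDiffeomorph_k₁.contMDiff.continuous
        (fun _ _ => (D.k₁_eq_iff _ _).2)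
        (isClosed_le D.continuous_rsq (continuous_const (y := (2 : ℝ))))
        (fun z z' h hz => h.rsq_eq.symm.trans_le hz) fun _ h => h
      filter_upwards [continuous_subtype_val.continuousAt.preimage_mem_nhds
        (hc.isOpen_compl.mem_nhds (D.notMem_image₁ hp))] with p' h z hz
      by_contra hlt
      refine h ⟨z, ?_, congrArg Subtype.val hz⟩
      have h2 : D.cylRegion.toStage.radSq z = D.rsq z := D.snoc_sq_flat z
      rw [h2] at hlt
      exact (not_le.1 hlt).le)
    (by
      intro p hp
      have hc := D.isClosed_image D.isLocalDiffeomorph_k₂.contMDiff.continuous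
        (fun _ _ => (D.k₂_eq_iff _ _).2)
        (isClosed_le D.continuous_rsq (continuous_const (y := (2 : ℝ))))
        (fun z z' h hz => h.rsq_eq.symm.trans_le hz) fun _ h => h
      filter_upwards [continuous_subtype_val.continuousAt.preimage_mem_nhds
        (hc.isOpen_compl.mem_nhds (D.notMem_image₂ hp))] with p' h z hz
      by_contra hlt
      refine h ⟨D.cylInv z, ?_, congrArg Subtype.val hz⟩
      have h2 : D.cylRegion.toStage.radSq z = D.rsq z := D.snoc_sq_flat z
      rw [h2] at hlt
      have hpos := D.rsq_pos z.2
      change D.rsq (D.cylInv z) ≤ 2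
      rw [D.rsq_cylInv z.2, inv_le_comm₀ hpos two_pos, ← one_div]
      exact (not_le.1 hlt).le)

/-- The Pin⁺ structure on the bordism. -/
def pinW : PinStructure.{u} (𝓡∂ (n + 1)) D.W := D.cylGluing.toPinGluing.glued

end FlatTube

end bordism

/-! ### The ends of a manifold glued from cylinders -/

section ends

open Cyl hiding continuous_fst

variable {n : ℕ} {N M A W : Type*}
  [TopologicalSpace N] [ChartedSpace (EuclideanSpace ℝ (Fin n)) N] [IsManifold (𝓡 n) ∞ N]
  [TopologicalSpace M] [ChartedSpace (EuclideanSpace ℝ (Fin n)) M] [IsManifold (𝓡 n) ∞ M]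
  [TopologicalSpace A] [ChartedSpace (EuclideanSpace ℝ (Fin n)) A] [IsManifold (𝓡 n) ∞ A]
  [TopologicalSpace W] [ChartedSpace (EuclideanHalfSpace (n + 1)) W]
  [IsManifold (𝓡∂ (n + 1)) ∞ W]

theorem Cyl.tangentMap_pt {y : ℝ} (hy : y ∈ Icc (0 : ℝ) 2) (hs : MDifferentiable (𝓡 n) (𝓡∂ (n + 1))
    fun m : M => pt m y) (V : TangentBundle (𝓡 n) M) :
    tangentMap (𝓡 n) (𝓡∂ (n + 1)) (fun m : M => pt m y) V = tvec V y 0 := by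
  refine tangent_ext ?_ ?_
  · rw [tangentMap_fst_tvec V hy]
    refine (tangentMap_comp_at (g := (fst : Cyl M → M)) (f := fun m : M => pt m y) V
      (contMDiff_fst.mdifferentiable (by simp) _) (hs _)).symm.trans ?_
    exact congrFun tangentMap_id V
  · rw [tangentMap_ht_tvec V hy]
    refine (tangentMap_comp_at (g := (ht : Cyl M → ℝ)) (f := fun m : M => pt m y) V
      (contMDiff_ht.mdifferentiable (by simp) _) (hs _)).symm.trans ?_
    have h : (ht : Cyl M → ℝ) ∘ (fun m : M => pt m y) = fun _ => y := funext fun m => ht_pt m hy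
    rw [h, tangentMap, mfderiv_const]
    rfl

theorem TangentBundle.snd_eq_of_eq {E H M : Type*} [NormedAddCommGroup E] [NormedSpace ℝ E]
    [TopologicalSpace H] {I : ModelWithCorners ℝ E H} [TopologicalSpace M] [ChartedSpace H M]
    {V V' : TangentBundle I M} (h : V = V') : (V.2 : E) = V'.2 := by
  rw [h]

/-- Over the open piece `a : A → N`, the map `j : N → W` is the inclusion of the end of height `y`
of the cylinder over `M`, where `c : A → M` and `g` embeds an open part `P` of that cylinder in `W`.
-/
structure EndPiece (n : ℕ) {N M A W : Type*}
  [TopologicalSpace N] [ChartedSpace (EuclideanSpace ℝ (Fin n)) N]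
  [TopologicalSpace M] [ChartedSpace (EuclideanSpace ℝ (Fin n)) M]
  [TopologicalSpace A] [ChartedSpace (EuclideanSpace ℝ (Fin n)) A]
  [TopologicalSpace W] [ChartedSpace (EuclideanHalfSpace (n + 1)) W] (j : N → W) (a : A → N)
    (c : A → M) (y : ℝ) (P : Opens (Cyl M)) (g : P → W) :
    Prop where
  isLocalDiffeomorph_left : IsLocalDiffeomorph (𝓡 n) (𝓡 n) ∞ a
  isLocalDiffeomorph_coord : IsLocalDiffeomorph (𝓡 n) (𝓡 n) ∞ c
  isLocalDiffeomorph_right : IsLocalDiffeomorph (𝓡∂ (n + 1)) (𝓡∂ (n + 1)) ∞ g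
  injective_coord : Function.Injective c
  injective_right : Function.Injective g
  height_eq : y = 0 ∨ y = 2
  mem : ∀ m, pt (c m) y ∈ P
  square : ∀ m, j (a m) = g ⟨pt (c m) y, mem m⟩
  mem_range : ∀ q v, j q = g v → q ∈ range a

namespace EndPiece

variable {j : N → W} {a : A → N} {c : A → M} {y : ℝ} {P : Opens (Cyl M)} {g : P → W}

theorem height_mem (h : EndPiece n j a c y P g) : y ∈ Icc (0 : ℝ) 2 := by
  rcases h.height_eq with rfl | rfl <;> constructor <;> norm_num

theorem isInducing (h : EndPiece n j a c y P g) :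
    IsInducing fun m : A => (⟨pt (c m) y, h.mem m⟩ : P) := by
  refine IsInducing.of_comp (g := fun v : P => fst (v : Cyl M)) ?_
    (Cyl.continuous_fst.comp continuous_subtype_val) ?_
  · exact Continuous.subtype_mk (continuous_pt.comp
      (h.isLocalDiffeomorph_coord.contMDiff.continuous.prodMk continuous_const)) _
  · exact (IsOpenEmbedding.of_continuous_injective_isOpenMap
      h.isLocalDiffeomorph_coord.contMDiff.continuous h.injective_coord
      h.isLocalDiffeomorph_coord.isOpenMap).isInducing

theorem isImmersionAt_coord (h : EndPiece n j a c y P g) (m : A) :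
    IsImmersionAtOfComplement ℝ (𝓡 n) (𝓡∂ (n + 1)) ∞ (fun m : A => (⟨pt (c m) y, h.mem m⟩ : P)) m :=
  (isImmersionAt_end h.height_eq (c m)).of_square (h.isLocalDiffeomorph_coord m)
    (isLocalDiffeomorph_subtypeVal P _) h.isInducing.continuous.continuousAt
    (.of_forall fun _ => rfl)

theorem continuousAt (h : EndPiece n j a c y P g) (m : A) : ContinuousAt j (a m) :=
  continuousAt_of_comp_isOpenMap h.isLocalDiffeomorph_left.isOpenMap
    ((h.isLocalDiffeomorph_right.contMDiff.continuous.comp h.isInducing.continuous).congr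
      fun m => (h.square m).symm) m

theorem isImmersionAt (h : EndPiece n j a c y P g) (m : A) :
    IsImmersionAtOfComplement ℝ (𝓡 n) (𝓡∂ (n + 1)) ∞ j (a m) := by
  have hl := h.isLocalDiffeomorph_left m
  have hr := h.isLocalDiffeomorph_right ⟨pt (c m) y, h.mem m⟩
  have hL : hl.localInverse (a m) = m := hl.localInverse_left_inv hl.localInverse_mem_target
  have h1 := h.isImmersionAt_coord m
  rw [← hL] at h1
  refine h1.of_square hl.localInverse_isLocalDiffeomorphAt (g := hr.localInverse) ?_
    (h.continuousAt m) ?_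
  · rw [h.square]
    exact hr.localInverse_isLocalDiffeomorphAt
  · have h2 : Tendsto (fun q => (⟨pt (c (hl.localInverse q)) y, h.mem _⟩ : P)) (𝓝 (a m))
        (𝓝 ⟨pt (c m) y, h.mem m⟩) := by
      have h3 := h.isInducing.continuous.continuousAt.tendsto.comp
        hl.localInverse_contMDiffAt.continuousAt.tendsto
      rw [hL] at h3
      exact h3
    filter_upwards [hl.localInverse_eventuallyEq_right,
      h2.eventually hr.localInverse_eventuallyEq_left] with q hq hq2
    have hq' : a (hl.localInverse q) = q := hq
    have e := h.square (hl.localInverse q)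
    rw [hq'] at e
    rw [e]
    exact hq2

theorem eq_of_eq (h : EndPiece n j a c y P g) {q : N} {m : A} (hq : j q = j (a m)) : q = a m := by
  obtain ⟨m', rfl⟩ := h.mem_range q _ (hq.trans (h.square m))
  rw [h.square, h.square] at hq
  have h1 := congrArg Subtype.val (h.injective_right hq)
  exact congrArg a (h.injective_coord (congrArg fst h1))

theorem nhds_eq (h : EndPiece n j a c y P g) (m : A) : 𝓝 (a m) = comap j (𝓝 (j (a m))) := by
  refine le_antisymm (h.continuousAt m).tendsto.le_comap fun S hS => ?_
  have h1 : a ⁻¹' S ∈ 𝓝 m := h.isLocalDiffeomorph_left.contMDiff.continuous.continuousAt hS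
  rw [h.isInducing.nhds_eq_comap] at h1
  obtain ⟨V, hV, hVS⟩ := h1
  refine ⟨g '' V, ?_, ?_⟩
  · rw [h.square]
    exact h.isLocalDiffeomorph_right.isOpenMap.image_mem_nhds hV
  · rintro q ⟨v, hv, hvq⟩
    obtain ⟨m', rfl⟩ := h.mem_range q v hvq.symm
    rw [h.square] at hvq
    exact hVS (show (⟨pt (c m') y, h.mem m'⟩ : P) ∈ V from h.injective_right hvq ▸ hv)

theorem isSmoothEmbedding {A' M' : Type*}
    [TopologicalSpace M'] [ChartedSpace (EuclideanSpace ℝ (Fin n)) M'] [IsManifold (𝓡 n) ∞ M']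
    [TopologicalSpace A'] [ChartedSpace (EuclideanSpace ℝ (Fin n)) A'] [IsManifold (𝓡 n) ∞ A']
    {a' : A' → N} {c' : A' → M'} {P' : Opens (Cyl M')} {g' : P' → W}
    (h : EndPiece n j a c y P g) (h' : EndPiece n j a' c' y P' g')
    (cover : ∀ q, q ∈ range a ∨ q ∈ range a') : IsSmoothEmbedding (𝓡 n) (𝓡∂ (n + 1)) ∞ j where
  isImmersion := ⟨ℝ, inferInstance, inferInstance, fun q => by
    rcases cover q with ⟨m, rfl⟩ | ⟨m, rfl⟩
    · exact h.isImmersionAt m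
    · exact h'.isImmersionAt m⟩
  isEmbedding := by
    refine ⟨isInducing_iff_nhds.2 fun q => ?_, fun q q' hq => ?_⟩
    · rcases cover q with ⟨m, rfl⟩ | ⟨m, rfl⟩
      · exact h.nhds_eq m
      · exact h'.nhds_eq m
    · rcases cover q' with ⟨m, rfl⟩ | ⟨m, rfl⟩
      · exact h.eq_of_eq hq
      · exact h'.eq_of_eq hq

theorem isBoundaryPoint_iff (h : EndPiece n j a c y P g) (v : P) :
    (𝓡∂ (n + 1)).IsBoundaryPoint (g v) ↔ ht (v : Cyl M) = 0 ∨ ht (v : Cyl M) = 2 := by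
  rw [← Cyl.isBoundaryPoint_iff (n := n), ← (h.isLocalDiffeomorph_right v).isBoundaryPoint_iff
    (by simp),
    (isLocalDiffeomorph_subtypeVal P v).isBoundaryPoint_iff (by simp)]

section frames

variable {b : TangentFrame (𝓡 n) A} {B : TangentFrame (𝓡∂ (n + 1)) P}
  {e : ℝ}
  (h : EndPiece n j a c y P g)

theorem base_eq (hB : ∀ w, (B.map (isLocalDiffeomorph_subtypeVal P)).vec w =
    tvec ((b.map h.isLocalDiffeomorph_coord).vec (euclInit w)) y (-(e * w (Fin.last n)))) :
    B.base = ⟨pt (c b.base) y, h.mem _⟩ :=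
  Subtype.ext (congrArg Bundle.TotalSpace.proj (hB 0))

/-- If a frame at the end of the cylinder is the product of a frame of `N` with a multiple of the
height direction, its horizontal vectors are the images of the vectors of the frame of `N`. -/
theorem vec_map_euclSnoc (hB : ∀ w, (B.map (isLocalDiffeomorph_subtypeVal P)).vec w =
    tvec ((b.map h.isLocalDiffeomorph_coord).vec (euclInit w)) y (-(e * w (Fin.last n))))
    (v : EuclideanSpace ℝ (Fin n)) :
    (B.map h.isLocalDiffeomorph_right).vec (euclSnoc v 0) =
      tangentMap (𝓡 n) (𝓡∂ (n + 1)) j ((b.map h.isLocalDiffeomorph_left).vec v) := by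
  have hι : MDifferentiable (𝓡 n) (𝓡∂ (n + 1)) (fun m : A => (⟨pt (c m) y, h.mem m⟩ : P)) :=
    fun m => (h.isImmersionAt_coord m).contMDiffAt.mdifferentiableAt (by simp)
  have hpt : MDifferentiable (𝓡 n) (𝓡∂ (n + 1)) (fun m : M => pt m y) :=
    fun m => (isImmersionAt_end h.height_eq m).contMDiffAt.mdifferentiableAt (by simp)
  have e1 : B.vec (euclSnoc v 0) = tangentMap (𝓡 n) (𝓡∂ (n + 1))
      (fun m : A => (⟨pt (c m) y, h.mem m⟩ : P)) (b.vec v) := by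
    refine tangentMap_injOn_fiber (isLocalDiffeomorph_subtypeVal P) (h.base_eq hB) ?_
    rw [← TangentFrame.vec_map (isLocalDiffeomorph_subtypeVal P), hB, euclInit_euclSnoc,
      euclSnoc_last, mul_zero, neg_zero, ← tangentMap_pt h.height_mem hpt,
      TangentFrame.vec_map]
    refine (tangentMap_comp_at (g := fun m : M => pt m y) (f := c) (b.vec v) (hpt _)
      (h.isLocalDiffeomorph_coord.mdifferentiable (by simp) _)).symm.trans ?_
    exact tangentMap_comp_at (g := (Subtype.val : P → Cyl M)) (b.vec v)
      ((isLocalDiffeomorph_subtypeVal (I := 𝓡∂ (n + 1)) P).mdifferentiable (by simp) _) (hι _)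
  rw [TangentFrame.vec_map, e1, TangentFrame.vec_map]
  refine (tangentMap_comp_at (g := g) (b.vec v)
    (h.isLocalDiffeomorph_right.mdifferentiable (by simp) _) (hι _)).symm.trans ?_
  have e2 : (g ∘ fun m : A => (⟨pt (c m) y, h.mem m⟩ : P)) = j ∘ a := funext fun m =>
    (h.square m).symm
  rw [e2]
  refine tangentMap_comp_at (g := j) (f := a) (b.vec v) ?_
    (h.isLocalDiffeomorph_left.mdifferentiable (by simp) _)
  exact (h.isImmersionAt _).contMDiffAt.mdifferentiableAt (by simp)

/-- The height of the cylinder is a function on `W` near the end, and its derivative is read off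
from the last coordinate of a frame. -/
theorem tangentMap_height (hB : ∀ w, (B.map (isLocalDiffeomorph_subtypeVal P)).vec w =
    tvec ((b.map h.isLocalDiffeomorph_coord).vec (euclInit w)) y (-(e * w (Fin.last n))))
    (w : EuclideanSpace ℝ (Fin (n + 1))) :
    ∃ f : W → ℝ, MDifferentiableAt (𝓡∂ (n + 1)) 𝓘(ℝ) f (g B.base) ∧ f (g B.base) = y ∧
      (∀ z, f z ∈ Icc (0 : ℝ) 2) ∧
      tangentMap (𝓡∂ (n + 1)) 𝓘(ℝ) f ((B.map h.isLocalDiffeomorph_right).vec w) =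
        ⟨y, -(e * w (Fin.last n))⟩ := by
  have hr := h.isLocalDiffeomorph_right B.base
  have hL : hr.localInverse (g B.base) = B.base := hr.localInverse_left_inv
    hr.localInverse_mem_target
  have h1 : MDifferentiable (𝓡∂ (n + 1)) 𝓘(ℝ) fun v : P => ht (v : Cyl M) :=
    (contMDiff_ht.comp (isLocalDiffeomorph_subtypeVal (I := 𝓡∂ (n + 1))
      P).contMDiff).mdifferentiable
      (by simp)
  have h2 : MDifferentiableAt (𝓡∂ (n + 1)) (𝓡∂ (n + 1)) hr.localInverse (g B.base) :=
    hr.localInverse_contMDiffAt.mdifferentiableAt (by simp)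
  have h3 : MDifferentiableAt (𝓡∂ (n + 1)) 𝓘(ℝ) (fun z => ht (hr.localInverse z : Cyl M))
    (g B.base) :=
    (h1 _).comp (g B.base) h2
  have hb : ht (B.base : Cyl M) = y := by rw [h.base_eq hB]; exact ht_pt _ h.height_mem
  refine ⟨fun z => ht (hr.localInverse z : Cyl M), h3, ?_, fun z => ht_mem _, ?_⟩
  · exact (congrArg (fun v : P => ht (v : Cyl M)) hL).trans hb
  · rw [TangentFrame.vec_map]
    refine (tangentMap_comp_at (B.vec w) h3
      (h.isLocalDiffeomorph_right.mdifferentiable (by simp) _)).symm.trans ?_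
    have e1 : (fun z => ht (hr.localInverse z : Cyl M)) ∘ g =ᶠ[𝓝 B.base]
        fun v : P => ht (v : Cyl M) := by
      filter_upwards [hr.localInverse_eventuallyEq_left] with v hv
      exact congrArg (fun v : P => ht (v : Cyl M)) hv
    have e2 : tangentMap (𝓡∂ (n + 1)) 𝓘(ℝ) ((fun z => ht (hr.localInverse z : Cyl M)) ∘ g)
      (B.vec w) =
        tangentMap (𝓡∂ (n + 1)) 𝓘(ℝ) (fun v : P => ht (v : Cyl M)) (B.vec w) := by
      refine Bundle.TotalSpace.ext e1.self_of_nhds (heq_of_eq ?_)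
      exact DFunLike.congr_fun e1.mfderiv_eq (B.vec w).2
    rw [e2]
    refine (tangentMap_comp_at (g := (ht : Cyl M → ℝ)) (f := (Subtype.val : P → Cyl M)) (B.vec w)
      (contMDiff_ht.mdifferentiable (by simp) _)
      ((isLocalDiffeomorph_subtypeVal (I := 𝓡∂ (n + 1)) P).mdifferentiable (by simp) _)).trans ?_
    rw [← TangentFrame.vec_map (isLocalDiffeomorph_subtypeVal P), hB,
      tangentMap_ht_tvec _ h.height_mem]

/-- At height `0` the height has a minimum and at height `2` a maximum, so the outward vectors are
those along which it decreases, or increases, respectively. -/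
theorem pointsOutward (hB : ∀ w, (B.map (isLocalDiffeomorph_subtypeVal P)).vec w =
    tvec ((b.map h.isLocalDiffeomorph_coord).vec (euclInit w)) y (-(e * w (Fin.last n))))
    {w : EuclideanSpace ℝ (Fin (n + 1))}
    (he : 0 < e)
    (hw : y = 0 ∧ 0 < w (Fin.last n) ∨ y = 2 ∧ w (Fin.last n) < 0) :
    PointsOutward ((B.map h.isLocalDiffeomorph_right).vec w).2 := by
  obtain ⟨f, hf, hfy, hf2, hfw⟩ := h.tangentMap_height hB w
  rcases hw with ⟨rfl, hw⟩ | ⟨rfl, hw⟩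
  · exact pointsOutward_of_mfderiv_neg hf (.of_forall fun z => hfy.trans_le (hf2 z).1) hfw
      (neg_neg_of_pos (mul_pos he hw))
  · refine pointsOutward_of_mfderiv_neg (g := fun z => -f z) (t := -2) (d := e * w (Fin.last n))
      hf.neg
      (.of_forall fun z => neg_le_neg ((hf2 z).2.trans_eq hfy.symm)) ?_
      (mul_neg_of_pos_of_neg he hw)
    have h1 : HasMFDerivAt (𝓡∂ (n + 1)) 𝓘(ℝ) (fun z => -f z) (g B.base)
      (-mfderiv (𝓡∂ (n + 1)) 𝓘(ℝ) f (g B.base)) := hf.hasMFDerivAt.neg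
    refine Bundle.TotalSpace.ext (congrArg Neg.neg hfy) (heq_of_eq ?_)
    refine (DFunLike.congr_fun h1.mfderiv _).trans ?_
    have h2 := TangentBundle.snd_eq_of_eq hfw
    exact (congrArg Neg.neg h2).trans (neg_neg _)

end frames

end EndPiece

namespace PinStructure

theorem proj_surjective (φ : PinStructure (𝓡 n) N) : Function.Surjective φ.proj := by
  intro x
  obtain ⟨e, hx, -⟩ := φ.exists_triv x
  exact ⟨_, e.proj_symm_apply' (b := x) (x := (1 : PinPlus n)) hx⟩

/-- A bundle map over `j` compatible with the inclusion of the Pin groups, whose frames extend the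
frames of `N`, determines a normal field along `j` by their last vectors, and with respect to that
field `φ` is the structure induced by `Ψ`. -/
theorem exists_normal (φ : PinStructure (𝓡 n) N) (Ψ : PinStructure (𝓡∂ (n + 1)) W) {j : N → W}
    (κ : φ.P → Ψ.P) (hκ : Continuous κ)
    (hact : ∀ p g, κ (φ.act p g) = Ψ.act (κ p) (pinIncl n g))
    (hv : ∀ p v, (Ψ.frame (κ p)).vec (euclSnoc v 0) =
      tangentMap (𝓡 n) (𝓡∂ (n + 1)) j ((φ.frame p).vec v)) :
    ∃ ν : ∀ x, TangentSpace (𝓡∂ (n + 1)) (j x),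
      (Continuous fun x => (⟨j x, ν x⟩ : TangentBundle (𝓡∂ (n + 1)) W)) ∧
      (∀ p, (⟨j (φ.proj p), ν (φ.proj p)⟩ : TangentBundle (𝓡∂ (n + 1)) W) =
        (Ψ.frame (κ p)).vec (euclSnoc 0 1)) ∧ φ.IsBoundaryOf Ψ j ν := by
  have hbase : ∀ p, (Ψ.frame (κ p)).base = j (φ.proj p) := fun p =>
    congrArg Bundle.TotalSpace.proj (hv p 0)
  choose s hs using φ.proj_surjective
  let ν : ∀ x, TangentSpace (𝓡∂ (n + 1)) (j x) := fun x =>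
    ((Ψ.frame (κ (s x))).vec (euclSnoc 0 1)).2
  have hν : ∀ p, (⟨j (φ.proj p), ν (φ.proj p)⟩ : TangentBundle (𝓡∂ (n + 1)) W) =
      (Ψ.frame (κ p)).vec (euclSnoc 0 1) := by
    intro p
    obtain ⟨g, hg⟩ := φ.exists_act_eq (hs (φ.proj p))
    have e1 : (Ψ.frame (κ p)).vec (euclSnoc 0 1) =
        (Ψ.frame (κ (s (φ.proj p)))).vec (euclSnoc 0 1) := by
      conv_lhs => rw [← hg, hact, Ψ.frame_act, pinRho_pinIncl, map_zero]
    rw [e1]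
    exact Bundle.TotalSpace.ext ((hbase _).trans (congrArg j (hs _))).symm HEq.rfl
  refine ⟨ν, ?_, hν, κ, fun _ p => Ψ.frame (κ p), hκ, hact, ?_, fun _ _ => rfl, ?_, fun _ _ => rfl,
    ?_⟩
  · rw [continuous_iff_continuousAt]
    intro x
    obtain ⟨U, σ, hU, hxU, hσ, hσp, -⟩ := φ.exists_localSection (s x)
    rw [hs] at hxU
    have h1 : ContinuousOn (fun x => (Ψ.frame (κ (σ x))).vec (euclSnoc 0 1)) U :=
      Ψ.continuous_frame.comp_continuousOn ((hκ.comp_continuousOn hσ).prodMk continuousOn_const)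
    refine (h1.continuousAt (hU.mem_nhds hxU)).congr ?_
    filter_upwards [hU.mem_nhds hxU] with x' hx'
    rw [← hν, hσp x' hx']
  · exact Ψ.continuous_frame.comp ((hκ.comp (continuous_fst.comp continuous_snd)).prodMk
      (continuous_snd.comp continuous_snd))
  · intro t p g v
    change (Ψ.frame (κ (φ.act p g))).vec v = _
    rw [hact, Ψ.frame_act]
  · intro p w
    have hw : w = euclSnoc (euclInit w) 0 + w (Fin.last n) • euclSnoc 0 1 :=
      euclSnoc_ext (by simp [euclInit_add, euclInit_smul]) (by simp)
    refine Bundle.TotalSpace.ext (hbase p) (heq_of_eq ?_)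
    change (Ψ.frame (κ p)).iso w = _
    conv_lhs => rw [hw, map_add, map_smul]
    refine congrArg₂ (· + ·) (TangentBundle.snd_eq_of_eq (hv p _)) ?_
    exact congrArg (w (Fin.last n) • ·) (TangentBundle.snd_eq_of_eq (hν p)).symm

end PinStructure

end ends

/-! ### The boundary of the bordism -/

section bordism

open Cyl hiding continuous_fst

variable {n : ℕ} {E : Type*} [TopologicalSpace E] [ChartedSpace (EuclideanSpace ℝ (Fin n)) E]
  {K : CollarModel n E} {M₁ M₂ : Type u}
  [TopologicalSpace M₁] [ChartedSpace (EuclideanSpace ℝ (Fin n)) M₁] [T2Space M₁]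
  [IsManifold (𝓡 n) ∞ M₁]
  [TopologicalSpace M₂] [ChartedSpace (EuclideanSpace ℝ (Fin n)) M₂] [T2Space M₂]
  [IsManifold (𝓡 n) ∞ M₂]
  {i₁ : OpenTube n E M₁} {i₂ : OpenTube n E M₂}
  {φ₁ : PinStructure.{u} (𝓡 n) M₁} {φ₂ : PinStructure.{u} (𝓡 n) M₂}

theorem Cyl.zero_mem_Icc : (0 : ℝ) ∈ Icc (0 : ℝ) 2 := ⟨le_rfl, two_pos.le⟩
theorem Cyl.two_mem_Icc : (2 : ℝ) ∈ Icc (0 : ℝ) 2 := ⟨two_pos.le, le_rfl⟩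

namespace FlatTube

variable (D : FlatTube K i₁ i₂ φ₁ φ₂)

theorem lin_eq_zero_of_removed {z : Cyl (EuclideanSpace ℝ (Fin n))} (hz : z ∈ D.removed)
    (h0 : ht z = 0) : D.ϖ.lin (fst z) = 0 := by
  have h1 : 2 * D.rsq z ≤ ht z := hz
  have h2 := D.sq_fst_le_rsq z
  have h3 : D.ϖ.sq (fst z) ≤ 0 := by linarith
  exact norm_eq_zero.1 (pow_eq_zero_iff two_ne_zero |>.1 (le_antisymm h3 (sq_nonneg _)))

theorem pt_zero_mem₁ (m : K.compl i₁) : pt (m : M₁) 0 ∈ D.piece₁ := by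
  rintro ⟨z, hz, h⟩
  have h1 : ht z = 0 := by
    have := congrArg ht h
    rwa [k₁, ht_map, ht_pt _ zero_mem_Icc] at this
  have h2 : D.j₁ (fst z) = m := congrArg fst h
  exact D.lin_ne_of_mem₁ (h2 ▸ m.2) (D.lin_eq_zero_of_removed hz h1)

theorem pt_zero_mem₂ (m : K.compl i₂) : pt (m : M₂) 0 ∈ D.piece₂ := by
  rintro ⟨z, hz, h⟩
  have h1 : ht z = 0 := by
    have := congrArg ht h
    rwa [k₂, ht_map, ht_pt _ zero_mem_Icc] at this
  have h2 : D.j₂ (fst z) = m := congrArg fst h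
  exact D.lin_ne_of_mem₂ (h2 ▸ m.2) (D.lin_eq_zero_of_removed hz h1)

theorem ht_ne_two {z : Cyl (EuclideanSpace ℝ (Fin n))} (hz : z ∈ D.removed) : ht z ≠ 2 := by
  intro h
  have h1 := D.rsq_lt_of_mem_removed hz
  have h2 := D.sq_ht_le_rsq z
  rw [h] at h2
  linarith

theorem pt_two_mem₁ (m : M₁) : pt m 2 ∈ D.piece₁ := by
  rintro ⟨z, hz, h⟩
  have := congrArg ht h
  rw [k₁, ht_map, ht_pt _ two_mem_Icc] at this
  exact D.ht_ne_two hz this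

theorem pt_two_mem₂ (m : M₂) : pt m 2 ∈ D.piece₂ := by
  rintro ⟨z, hz, h⟩
  have := congrArg ht h
  rw [k₂, ht_map, ht_pt _ two_mem_Icc] at this
  exact D.ht_ne_two hz this

theorem fst_mem_compl₁ {v : Cyl M₁} (hv : v ∈ D.piece₁) (h0 : ht v = 0) : fst v ∈ K.compl i₁ := by
  rintro ⟨e, he, hev⟩
  obtain ⟨x, rfl⟩ := D.cov_surjective e
  have hx := (D.mem_core_iff x).1 he
  refine hv ⟨pt x 0, ?_, Cyl.ext hev ?_⟩
  · change 2 * (‖D.ϖ.lin x‖ ^ 2 + ht (pt x 0) ^ 2) ≤ ht (pt x 0)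
    rw [hx, ht_pt _ zero_mem_Icc]
    simp
  · rw [k₁, ht_map, ht_pt _ zero_mem_Icc, h0]

theorem fst_mem_compl₂ {v : Cyl M₂} (hv : v ∈ D.piece₂) (h0 : ht v = 0) : fst v ∈ K.compl i₂ := by
  rintro ⟨e, he, hev⟩
  obtain ⟨x, rfl⟩ := D.cov_surjective e
  have hx := (D.mem_core_iff x).1 he
  refine hv ⟨pt x 0, ?_, Cyl.ext hev ?_⟩
  · change 2 * (‖D.ϖ.lin x‖ ^ 2 + ht (pt x 0) ^ 2) ≤ ht (pt x 0)
    rw [hx, ht_pt _ zero_mem_Icc]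
    simp
  · rw [k₂, ht_map, ht_pt _ zero_mem_Icc, h0]

theorem rsq_pt_zero (x : EuclideanSpace ℝ (Fin n)) : D.rsq (pt x 0) = D.ϖ.sq x := by
  rw [rsq, ht_pt _ zero_mem_Icc, fst_pt]
  ring

theorem pt_zero_mem {x : EuclideanSpace ℝ (Fin n)} (h : D.ϖ.lin x ≠ 0) :
    pt x 0 ∈ D.overlapRegion := by
  change ht (pt x 0) < 2 ∧ ht (pt x 0) < 2 * D.rsq (pt x 0)
  rw [D.rsq_pt_zero, ht_pt _ zero_mem_Icc]
  exact ⟨two_pos, mul_pos two_pos (D.ϖ.sq_pos h)⟩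

theorem cylInv_pt_zero (x : EuclideanSpace ℝ (Fin n)) :
    D.cylInv (pt x 0) = pt (D.ϖ.inversion x) 0 := by
  rw [cylInv, D.rsq_pt_zero, ht_pt _ zero_mem_Icc, mul_zero, fst_pt, D.ϖ.inversion_eq]
  rfl

theorem k₁_pt (x : EuclideanSpace ℝ (Fin n)) {y : ℝ} (hy : y ∈ Icc (0 : ℝ) 2) :
    D.k₁ (pt x y) = pt (D.j₁ x) y := by
  rw [k₁, Cyl.map, ht_pt _ hy]; rfl

theorem k₂_pt (x : EuclideanSpace ℝ (Fin n)) {y : ℝ} (hy : y ∈ Icc (0 : ℝ) 2) :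
    D.k₂ (pt x y) = pt (D.j₂ x) y := by
  rw [k₂, Cyl.map, ht_pt _ hy]; rfl

theorem inl_eq_inr_of_eq {a : K.compl i₁} {b : K.compl i₂}
    (h : (TubeSum.inl a : TubeSum K i₁ i₂) = TubeSum.inr b) :
    D.overlap.inl ⟨pt (a : M₁) 0, D.pt_zero_mem₁ a⟩ = D.overlap.inr
      ⟨pt (b : M₂) 0, D.pt_zero_mem₂ b⟩ := by
  obtain ⟨e, he, h1, h2⟩ := (TubeSum.inl_eq_inr_iff _ _).1 h
  obtain ⟨x, rfl⟩ := D.cov_surjective e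
  have hx : D.ϖ.lin x ≠ 0 := fun h0 => he ((D.mem_core_iff x).2 h0)
  rw [D.inv_cov x hx] at h2
  refine (D.overlap.inl_eq_inr_iff _ _).2 ⟨⟨pt x 0, D.pt_zero_mem hx⟩, Subtype.ext ?_, Subtype.ext
    ?_⟩
  · exact (D.k₁_pt x zero_mem_Icc).trans (congrArg (fun m => pt m 0) h1.symm)
  · refine (congrArg D.k₂ (D.cylInv_pt_zero x)).trans ?_
    exact (D.k₂_pt _ zero_mem_Icc).trans (congrArg (fun m => pt m 0) h2.symm)

/-- The inclusion of the sum of `M₁` and `M₂` as the bottom of the bordism. -/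
def incl : TubeSum K i₁ i₂ → D.W :=
  Quotient.lift (Sum.elim (fun a => D.overlap.inl ⟨pt (a : M₁) 0, D.pt_zero_mem₁ a⟩)
    (fun b => D.overlap.inr ⟨pt (b : M₂) 0, D.pt_zero_mem₂ b⟩)) (by
      rintro (a | b) (a' | b') h
      · obtain rfl : a = a' := h
        rfl
      · exact D.inl_eq_inr_of_eq (Quotient.sound (s := K.glueSetoid i₁ i₂) h)
      · exact (D.inl_eq_inr_of_eq (Quotient.sound (s := K.glueSetoid i₁ i₂) h).symm).symm
      · obtain rfl : b = b' := h
        rfl)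

/-- The inclusion of the disjoint union of `M₁` and `M₂` as the top of the bordism. -/
def inclTop : M₁ ⊕ M₂ → D.W :=
  Sum.elim (fun m => D.overlap.inl ⟨pt m 2, D.pt_two_mem₁ m⟩)
    (fun m => D.overlap.inr ⟨pt m 2, D.pt_two_mem₂ m⟩)

theorem incl_inl (a : K.compl i₁) :
    D.incl (TubeSum.inl a) = D.overlap.inl ⟨pt (a : M₁) 0, D.pt_zero_mem₁ a⟩ := rfl

theorem incl_inr (b : K.compl i₂) :
    D.incl (TubeSum.inr b) = D.overlap.inr ⟨pt (b : M₂) 0, D.pt_zero_mem₂ b⟩ := rfl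

theorem endPiece₁ : EndPiece n D.incl TubeSum.inl (Subtype.val : K.compl i₁ → M₁) 0 D.piece₁
    D.overlap.inl where
  isLocalDiffeomorph_left := TubeSum.isLocalDiffeomorph_inl
  isLocalDiffeomorph_coord := isLocalDiffeomorph_subtypeVal _
  isLocalDiffeomorph_right := D.overlap.isLocalDiffeomorph_inl
  injective_coord := Subtype.val_injective
  injective_right := D.overlap.injective_inl
  height_eq := .inl rfl
  mem := D.pt_zero_mem₁
  square := D.incl_inl
  mem_range q v h := by
    rcases TubeSum.mem_range q with hq | ⟨m, rfl⟩
    · exact hq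
    rw [incl_inr] at h
    obtain ⟨z, -, hz⟩ := (D.overlap.inl_eq_inr_iff _ _).1 h.symm
    have h2 : D.j₂ (fst (D.cylInv z)) = m := congrArg fst (congrArg Subtype.val hz)
    set x := fst (D.cylInv z)
    have hx : D.ϖ.lin x ≠ 0 := D.lin_ne_of_mem₂ (h2 ▸ m.2)
    have hx' := D.ϖ.lin_inversion_ne hx
    refine ⟨⟨D.j₁ (D.ϖ.inversion x), ?_⟩, ?_⟩
    · exact (K.mem_compl_iff i₁ _).2 fun h => hx' ((D.mem_core_iff _).1 h)
    · refine (TubeSum.inl_eq_inr_iff _ _).2 ⟨D.cov (D.ϖ.inversion x), fun h =>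
        hx' ((D.mem_core_iff _).1 h), rfl, ?_⟩
      rw [D.inv_cov _ hx', D.ϖ.inversion_inversion hx]
      exact h2.symm

theorem endPiece₂ : EndPiece n D.incl TubeSum.inr (Subtype.val : K.compl i₂ → M₂) 0 D.piece₂
    D.overlap.inr where
  isLocalDiffeomorph_left := TubeSum.isLocalDiffeomorph_inr
  isLocalDiffeomorph_coord := isLocalDiffeomorph_subtypeVal _
  isLocalDiffeomorph_right := D.overlap.isLocalDiffeomorph_inr
  injective_coord := Subtype.val_injective
  injective_right := D.overlap.injective_inr
  height_eq := .inl rfl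
  mem := D.pt_zero_mem₂
  square := D.incl_inr
  mem_range q v h := by
    rcases TubeSum.mem_range q with ⟨m, rfl⟩ | hq
    swap
    · exact hq
    rw [incl_inl] at h
    obtain ⟨z, hz, -⟩ := (D.overlap.inl_eq_inr_iff _ _).1 h
    have h2 : D.j₁ (fst (z : Cyl (EuclideanSpace ℝ (Fin n)))) = m :=
      congrArg fst (congrArg Subtype.val hz)
    set x := fst (z : Cyl (EuclideanSpace ℝ (Fin n)))
    have hx : D.ϖ.lin x ≠ 0 := D.lin_ne_of_mem₁ (h2 ▸ m.2)
    have hx' := D.ϖ.lin_inversion_ne hx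
    refine ⟨⟨D.j₂ (D.ϖ.inversion x), ?_⟩, ?_⟩
    · exact (K.mem_compl_iff i₂ _).2 fun h => hx' ((D.mem_core_iff _).1 h)
    · refine ((TubeSum.inl_eq_inr_iff _ _).2 ⟨D.cov x, fun h =>
        hx ((D.mem_core_iff _).1 h), h2.symm, ?_⟩).symm
      rw [D.inv_cov _ hx]
      rfl

theorem inl_ne_inr_two {v : D.piece₁} {m : M₂} :
    D.overlap.inl v ≠ D.overlap.inr ⟨pt m 2, D.pt_two_mem₂ m⟩ := by
  intro h
  obtain ⟨z, -, hz⟩ := (D.overlap.inl_eq_inr_iff _ _).1 h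
  have h1 := congrArg ht (congrArg Subtype.val hz)
  rw [D.coe_κ₂, k₂, ht_map, ht_pt _ two_mem_Icc] at h1
  exact (D.cylInv_mem z.2).1.ne h1

theorem inl_two_ne_inr {m : M₁} {v : D.piece₂} :
    D.overlap.inl ⟨pt m 2, D.pt_two_mem₁ m⟩ ≠ D.overlap.inr v := by
  intro h
  obtain ⟨z, hz, -⟩ := (D.overlap.inl_eq_inr_iff _ _).1 h
  have h1 := congrArg ht (congrArg Subtype.val hz)
  rw [D.coe_κ₁, k₁, ht_map, ht_pt _ two_mem_Icc] at h1
  exact z.2.1.ne h1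

theorem endPieceTop₁ : EndPiece n D.inclTop Sum.inl (id : M₁ → M₁) 2 D.piece₁ D.overlap.inl where
  isLocalDiffeomorph_left := PinStructure.isLocalDiffeomorph_inl
  isLocalDiffeomorph_coord := (Diffeomorph.refl (𝓡 n) M₁ ∞).isLocalDiffeomorph
  isLocalDiffeomorph_right := D.overlap.isLocalDiffeomorph_inl
  injective_coord := Function.injective_id
  injective_right := D.overlap.injective_inl
  height_eq := .inr rfl
  mem := D.pt_two_mem₁
  square _ := rfl
  mem_range := by
    rintro (m | m) v h
    · exact ⟨m, rfl⟩
    · exact absurd h.symm D.inl_ne_inr_two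

theorem endPieceTop₂ : EndPiece n D.inclTop Sum.inr (id : M₂ → M₂) 2 D.piece₂ D.overlap.inr where
  isLocalDiffeomorph_left := PinStructure.isLocalDiffeomorph_inr
  isLocalDiffeomorph_coord := (Diffeomorph.refl (𝓡 n) M₂ ∞).isLocalDiffeomorph
  isLocalDiffeomorph_right := D.overlap.isLocalDiffeomorph_inr
  injective_coord := Function.injective_id
  injective_right := D.overlap.injective_inr
  height_eq := .inr rfl
  mem := D.pt_two_mem₂
  square _ := rfl
  mem_range := by
    rintro (m | m) v h
    · exact absurd h D.inl_two_ne_inr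
    · exact ⟨m, rfl⟩

theorem disjoint_range : Disjoint (range D.incl) (range D.inclTop) := by
  rw [Set.disjoint_right]
  rintro _ ⟨m | m, rfl⟩ ⟨q, hq⟩
  · obtain ⟨a, rfl⟩ := D.endPiece₁.mem_range q _ hq
    have h1 := congrArg ht (congrArg Subtype.val (D.overlap.injective_inl hq))
    rw [ht_pt _ zero_mem_Icc, ht_pt _ two_mem_Icc] at h1
    exact two_ne_zero h1.symm
  · obtain ⟨a, rfl⟩ := D.endPiece₂.mem_range q _ hq
    have h1 := congrArg ht (congrArg Subtype.val (D.overlap.injective_inr hq))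
    rw [ht_pt _ zero_mem_Icc, ht_pt _ two_mem_Icc] at h1
    exact two_ne_zero h1.symm

/-- The boundary of the cylinders consists of the levels `0` and `2`, and the bottom of either piece
is the complement of the core. -/
theorem boundary_eq : range D.incl ∪ range D.inclTop = (𝓡∂ (n + 1)).boundary D.W := by
  ext w
  change _ ↔ (𝓡∂ (n + 1)).IsBoundaryPoint w
  constructor
  · rintro (⟨q, rfl⟩ | ⟨m | m, rfl⟩)
    · rcases TubeSum.mem_range q with ⟨a, rfl⟩ | ⟨a, rfl⟩
      · exact (D.endPiece₁.isBoundaryPoint_iff _).2 (.inl (ht_pt _ zero_mem_Icc))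
      · exact (D.endPiece₂.isBoundaryPoint_iff _).2 (.inl (ht_pt _ zero_mem_Icc))
    · exact (D.endPieceTop₁.isBoundaryPoint_iff _).2 (.inr (ht_pt _ two_mem_Icc))
    · exact (D.endPieceTop₂.isBoundaryPoint_iff _).2 (.inr (ht_pt _ two_mem_Icc))
  · intro hw
    rcases D.overlap.mem_range w with ⟨v, rfl⟩ | ⟨v, rfl⟩
    · rcases (D.endPiece₁.isBoundaryPoint_iff v).1 hw with h0 | h0
      · refine .inl ⟨TubeSum.inl ⟨fst (v : Cyl M₁), D.fst_mem_compl₁ v.2 h0⟩, ?_⟩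
        exact congrArg D.overlap.inl (Subtype.ext (Cyl.ext rfl
          ((ht_pt _ zero_mem_Icc).trans h0.symm)))
      · refine .inr ⟨Sum.inl (fst (v : Cyl M₁)), ?_⟩
        exact congrArg D.overlap.inl (Subtype.ext (Cyl.ext rfl
          ((ht_pt _ two_mem_Icc).trans h0.symm)))
    · rcases (D.endPiece₂.isBoundaryPoint_iff v).1 hw with h0 | h0
      · refine .inl ⟨TubeSum.inr ⟨fst (v : Cyl M₂), D.fst_mem_compl₂ v.2 h0⟩, ?_⟩
        exact congrArg D.overlap.inr (Subtype.ext (Cyl.ext rfl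
          ((ht_pt _ zero_mem_Icc).trans h0.symm)))
      · refine .inr ⟨Sum.inr (fst (v : Cyl M₂)), ?_⟩
        exact congrArg D.overlap.inr (Subtype.ext (Cyl.ext rfl
          ((ht_pt _ two_mem_Icc).trans h0.symm)))

end FlatTube

end bordism

/-! ### The Pin⁺ structures induced on the boundary of the bordism -/

/-- Along the level `0` the radial direction is horizontal, so the gluing matrix of the cylinders is
a block sum. The last coordinate is radial, hence the factor `exp s`. -/
theorem gluingMatrix_snoc {n : ℕ} (ϖ : RadProj n)
    (F₁ F₂ : EuclideanSpace ℝ (Fin n) ≃L[ℝ] EuclideanSpace ℝ (Fin n))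
    (X v : EuclideanSpace ℝ (Fin n)) (s d : ℝ) :
    gluingMatrix ϖ.snoc (snocEquiv F₁) (snocEquiv F₂) (euclSnoc X 0) s (euclSnoc v d) =
      euclSnoc (gluingMatrix ϖ F₁ F₂ X s v) (Real.exp s * d) := by
  rw [gluingMatrix_apply, gluingMatrix_apply, ← euclIncl_eq, ← pinIncl_pinDir, pinRho_pinIncl,
    snocEquiv_euclSnoc, ϖ.snoc_stretch, pinRho_pinIncl, snocEquiv_euclSnoc]

section ends

open Cyl hiding continuous_fst

variable {n : ℕ} {N M A W : Type*}
  [TopologicalSpace N] [ChartedSpace (EuclideanSpace ℝ (Fin n)) N] [IsManifold (𝓡 n) ∞ N]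
  [TopologicalSpace M] [ChartedSpace (EuclideanSpace ℝ (Fin n)) M] [IsManifold (𝓡 n) ∞ M]
  [TopologicalSpace A] [ChartedSpace (EuclideanSpace ℝ (Fin n)) A] [IsManifold (𝓡 n) ∞ A]
  [TopologicalSpace W] [ChartedSpace (EuclideanHalfSpace (n + 1)) W]
  [IsManifold (𝓡∂ (n + 1)) ∞ W]

/-- The frame `B` of `W` extends the frame `b` of `N` along `j`, and the vector with last coordinate
`s` points outward. -/
def IsEndFrame (j : N → W) (s : ℝ) (b : TangentFrame (𝓡 n) N) (B : TangentFrame (𝓡∂ (n + 1)) W) :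
    Prop :=
  (∀ v, B.vec (euclSnoc v 0) = tangentMap (𝓡 n) (𝓡∂ (n + 1)) j (b.vec v)) ∧
    PointsOutward (B.vec (euclSnoc 0 s)).2

theorem EndPiece.isEndFrame {j : N → W} {a : A → N} {c : A → M} {y : ℝ} {P : Opens (Cyl M)}
    {g : P → W} (h : EndPiece n j a c y P g) {b : TangentFrame (𝓡 n) A}
    {B : TangentFrame (𝓡∂ (n + 1)) P} {e s : ℝ}
    (hB : ∀ w, (B.map (isLocalDiffeomorph_subtypeVal P)).vec w =
      tvec ((b.map h.isLocalDiffeomorph_coord).vec (euclInit w)) y (-(e * w (Fin.last n))))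
    (he : 0 < e) (hs : y = 0 ∧ s = 1 ∨ y = 2 ∧ s = -1) :
    IsEndFrame j s (b.map h.isLocalDiffeomorph_left) (B.map h.isLocalDiffeomorph_right) := by
  refine ⟨h.vec_map_euclSnoc hB, h.pointsOutward hB he ?_⟩
  rw [euclSnoc_last]
  rcases hs with ⟨hy, rfl⟩ | ⟨hy, rfl⟩
  · exact .inl ⟨hy, one_pos⟩
  · exact .inr ⟨hy, neg_one_lt_zero⟩

theorem TangentFrame.vec_smul_snd (B : TangentFrame (𝓡∂ (n + 1)) W) (s : ℝ)
    (w : EuclideanSpace ℝ (Fin (n + 1))) : (B.vec (s • w)).2 = s • (B.vec w).2 :=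
  B.iso.map_smul s w

theorem PointsOutward.congr_smul {V V' : TangentBundle (𝓡∂ (n + 1)) W} {s : ℝ} (h : V = V')
    (hV : PointsOutward (s • V'.2)) : PointsOutward (s • V.2) := by
  subst h; exact hV

/-- Frames that extend those of `N` and end in an outward (`s = 1`) or inward (`s = -1`) vector
provide a normal field that induces `φ`. -/
theorem PinStructure.exists_outward_normal (φ : PinStructure (𝓡 n) N)
    (Ψ : PinStructure (𝓡∂ (n + 1)) W) {j : N → W} {s : ℝ} (κ : φ.P → Ψ.P) (hκ : Continuous κ)
    (hact : ∀ p g, κ (φ.act p g) = Ψ.act (κ p) (pinIncl n g))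
    (h : ∀ p, IsEndFrame j s (φ.frame p) (Ψ.frame (κ p))) :
    ∃ ν : ∀ x, TangentSpace (𝓡∂ (n + 1)) (j x),
      (Continuous fun x => (⟨j x, ν x⟩ : TangentBundle (𝓡∂ (n + 1)) W)) ∧
      (∀ x, PointsOutward (s • ν x)) ∧ φ.IsBoundaryOf Ψ j ν := by
  obtain ⟨ν, h1, h2, h3⟩ := φ.exists_normal Ψ κ hκ hact fun p => (h p).1
  refine ⟨ν, h1, fun x => ?_, h3⟩
  obtain ⟨p, rfl⟩ := φ.proj_surjective x
  have key : PointsOutward (s • ((Ψ.frame (κ p)).vec (euclSnoc 0 1)).2) := by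
    rw [← TangentFrame.vec_smul_snd]
    have e : s • euclSnoc (0 : EuclideanSpace ℝ (Fin n)) 1 = euclSnoc 0 s :=
      euclSnoc_ext (by simp [euclInit_smul]) (by simp)
    rw [e]
    exact (h p).2
  exact PointsOutward.congr_smul (V := ⟨j (φ.proj p), ν (φ.proj p)⟩) (h2 p) key

end ends

section endLift

open Cyl hiding continuous_fst

variable {n : ℕ} {M : Type u} [TopologicalSpace M] [ChartedSpace (EuclideanSpace ℝ (Fin n)) M]
  [IsManifold (𝓡 n) ∞ M] (φ : PinStructure.{u} (𝓡 n) M) (P : Opens (Cyl M))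

namespace PinStructure

/-- The point of the product structure over the point `(x, y)` of the cylinder given by a point of
the principal bundle over `x`. -/
def endLift (x : M) (p : φ.P) (hx : x = φ.proj p) (y : Icc (0 : ℝ) 2) (h : pt x y ∈ P) :
    (φ.cyl.restrict P).P :=
  ⟨(⟨pt x y, h⟩, φ.cylMk p 1 y), congrArg (fun x => pt x (y : ℝ)) hx⟩

theorem endLift_act (x : M) (p : φ.P) (hx : x = φ.proj p) (y : Icc (0 : ℝ) 2) (h : pt x y ∈ P)
    (g : PinPlus n) (hx' : x = φ.proj (φ.act p g)) : φ.endLift P x (φ.act p g) hx' y h =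
      (φ.cyl.restrict P).act (φ.endLift P x p hx y h) (pinIncl n g) := by
  refine Subtype.ext (Prod.ext rfl ((φ.cylMk_act p g 1 y).trans ?_))
  change _ = φ.cylMk p (1 * pinIncl n g) y
  rw [mul_one, one_mul]

theorem continuous_endLift {Z : Type*} [TopologicalSpace Z] {x : Z → M} {p : Z → φ.P}
    (hx : ∀ z, x z = φ.proj (p z)) (y : Icc (0 : ℝ) 2) (h : ∀ z, pt (x z) y ∈ P)
    (hxc : Continuous x) (hp : Continuous p) :
    Continuous fun z => φ.endLift P (x z) (p z) (hx z) y (h z) :=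
  Continuous.subtype_mk (Continuous.prodMk (Continuous.subtype_mk (continuous_pt.comp
    (hxc.prodMk (continuous_const (y := (y : ℝ))))) h) (φ.continuous_cylMk.comp
    (hp.prodMk (continuous_const (y := ((1 : PinPlus (n + 1)), y)))))) _

theorem frame_endLift (x : M) (p : φ.P) (hx : x = φ.proj p) (y : Icc (0 : ℝ) 2) (h : pt x y ∈ P)
    (w : EuclideanSpace ℝ (Fin (n + 1))) :
    (((φ.cyl.restrict P).frame (φ.endLift P x p hx y h)).map (isLocalDiffeomorph_subtypeVal P)).vec
      w
      = tvec ((φ.frame p).vec (euclInit w)) y (-(1 * w (Fin.last n))) := by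
  refine (congrArg (fun b => TangentFrame.vec b w)
    (φ.cyl.restrict_frame P ⟨pt x y, h⟩ (φ.cylMk p 1 y)
      (congrArg (fun x => pt x (y : ℝ)) hx))).trans ?_
  change ((cylFrame (φ.frame p) y).precomp (pinRhoEquiv 1)).vec w = _
  rw [TangentFrame.vec_precomp, pinRhoEquiv_apply, pinRho_one, cylFrame_vec, one_mul]

end PinStructure

end endLift

/-- The frames of a gluing on the points of the section `h₁`: the homotopy stopped at the cutoff
time. -/
theorem SectionGluing.cutFrame_act_h₁ {n : ℕ} {H : Type*} [TopologicalSpace H]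
    {I : ModelWithCorners ℝ (EuclideanSpace ℝ (Fin n)) H}
    {A B Q : Type*} [TopologicalSpace A] [ChartedSpace H A] [IsManifold I ∞ A]
    [TopologicalSpace B] [ChartedSpace H B] [IsManifold I ∞ B]
    [TopologicalSpace Q] [ChartedSpace H Q] [IsManifold I ∞ Q]
    {φA : PinStructure.{u} I A} {φB : PinStructure.{u} I B} {a : A → Q} {b : B → Q}
    {Y : Type*} [TopologicalSpace Y] (S : SectionGluing φA φB a b Y) (y : Y) (g : PinPlus n) :
    S.toPinGluing.cutFrame 1 (φA.act (S.h₁ y) g) =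
      (S.γ (cutoff (S.s y)) y).precomp (pinRhoEquiv g) := by
  have h := S.toPinGluing.cutFrame_α 1 (y, g)
  refine h.trans ?_
  have e : a (φA.proj (S.toPinGluing.α (y, g))) = a (S.κ₁ y) :=
    congrArg a ((φA.proj_act _ _).trans (S.proj_h₁ y))
  rw [e, one_mul]
  change (S.γ (S.χ (a (S.κ₁ y))) y).precomp (pinRhoEquiv g) = _
  rw [S.χ_κ₁]

section bordism

open Cyl hiding continuous_fst

variable {n : ℕ} {E : Type*} [TopologicalSpace E] [ChartedSpace (EuclideanSpace ℝ (Fin n)) E]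
  {K : CollarModel n E} {M₁ M₂ : Type u}
  [TopologicalSpace M₁] [ChartedSpace (EuclideanSpace ℝ (Fin n)) M₁] [T2Space M₁]
  [IsManifold (𝓡 n) ∞ M₁]
  [TopologicalSpace M₂] [ChartedSpace (EuclideanSpace ℝ (Fin n)) M₂] [T2Space M₂]
  [IsManifold (𝓡 n) ∞ M₂]
  {i₁ : OpenTube n E M₁} {i₂ : OpenTube n E M₂}
  {φ₁ : PinStructure.{u} (𝓡 n) M₁} {φ₂ : PinStructure.{u} (𝓡 n) M₂}

/-- The bottom of the cylinder as a point of the interval of heights. -/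
def Cyl.bot : Icc (0 : ℝ) 2 := ⟨0, zero_mem_Icc⟩
/-- The top of the cylinder as a point of the interval of heights. -/
def Cyl.top : Icc (0 : ℝ) 2 := ⟨2, two_mem_Icc⟩

namespace FlatTube

variable (D : FlatTube K i₁ i₂ φ₁ φ₂)

/-- The bundle map over the bottom of the first cylinder. -/
def lift₁ (p : (φ₁.restrict (K.compl i₁)).P) : (φ₁.cyl.restrict D.piece₁).P :=
  φ₁.endLift D.piece₁ p.1.1 p.1.2 p.2 bot (D.pt_zero_mem₁ _)

/-- The bundle map over the bottom of the second cylinder. -/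
def lift₂ (p : (φ₂.restrict (K.compl i₂)).P) : (φ₂.cyl.restrict D.piece₂).P :=
  φ₂.endLift D.piece₂ p.1.1 p.1.2 p.2 bot (D.pt_zero_mem₂ _)

theorem lift₁_act (p : (φ₁.restrict (K.compl i₁)).P) (g : PinPlus n) :
    D.lift₁ ((φ₁.restrict (K.compl i₁)).act p g) =
      (φ₁.cyl.restrict D.piece₁).act (D.lift₁ p) (pinIncl n g) :=
  φ₁.endLift_act D.piece₁ _ _ p.2 bot _ g _

theorem lift₂_act (p : (φ₂.restrict (K.compl i₂)).P) (g : PinPlus n) :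
    D.lift₂ ((φ₂.restrict (K.compl i₂)).act p g) =
      (φ₂.cyl.restrict D.piece₂).act (D.lift₂ p) (pinIncl n g) :=
  φ₂.endLift_act D.piece₂ _ _ p.2 bot _ g _

theorem continuous_lift₁ : Continuous D.lift₁ :=
  φ₁.continuous_endLift D.piece₁ _ bot _
    (continuous_subtype_val.comp (continuous_fst.comp continuous_subtype_val))
    (continuous_snd.comp continuous_subtype_val)

theorem continuous_lift₂ : Continuous D.lift₂ :=
  φ₂.continuous_endLift D.piece₂ _ bot _
    (continuous_subtype_val.comp (continuous_fst.comp continuous_subtype_val))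
    (continuous_snd.comp continuous_subtype_val)

/-- A point of the overlap at the bottom of the cylinder. -/
def bottom (z : D.region.O) : D.overlapRegion := ⟨pt z 0, D.pt_zero_mem z.2⟩

theorem height_bottom (z : D.region.O) :
    height (D.bottom z : Cyl (EuclideanSpace ℝ (Fin n))) = bot :=
  Subtype.ext (ht_pt (z : EuclideanSpace ℝ (Fin n)) zero_mem_Icc)

theorem lift₁_h₁ (z : D.region.O) : D.lift₁ (D.sectionGluing.h₁ z) = D.cylGluing.h₁
    (D.bottom z) := by
  refine Subtype.ext (Prod.ext (Subtype.ext (D.k₁_pt _ zero_mem_Icc).symm) ?_)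
  change φ₁.cylMk (D.σ₁ z) 1 bot = φ₁.cylMk (D.σ₁ z) 1
    (height (D.bottom z : Cyl (EuclideanSpace ℝ (Fin n))))
  rw [D.height_bottom]

theorem rad_bottom (z : D.region.O) : D.cylRegion.toStage.rad (D.bottom z) =
    euclSnoc (D.region.toStage.rad z) 0 := by
  change D.ϖ.snoc.lin (euclSnoc (z : EuclideanSpace ℝ (Fin n))
    (-ht (pt (z : EuclideanSpace ℝ (Fin n)) 0))) = _
  rw [ht_pt _ zero_mem_Icc, neg_zero, RadProj.snoc_lin]
  rfl

theorem lift₂_h₂ (z : D.region.O) : D.lift₂ (D.sectionGluing.h₂ z) = D.cylGluing.h₂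
    (D.bottom z) := by
  have e1 : D.cylGluing.h₂ (D.bottom z) = (φ₂.cyl.restrict D.piece₂).act
      (D.cylRegion.toStage.η₂ (D.cylRegion.toStage.inv (D.bottom z)))
      (pinDir (D.cylRegion.toStage.rad (D.bottom z))) := rfl
  have e2 : D.sectionGluing.h₂ z = (φ₂.restrict (K.compl i₂)).act
      (D.region.toStage.η₂ (D.region.toStage.inv z)) (pinDir (D.region.toStage.rad z)) := rfl
  have hinv : D.cylInv (pt (z : EuclideanSpace ℝ (Fin n)) 0) =
      pt (D.ϖ.inversion (z : EuclideanSpace ℝ (Fin n))) 0 := D.cylInv_pt_zero z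
  rw [e1, e2]
  refine (D.lift₂_act _ _).trans ?_
  rw [D.rad_bottom, ← euclIncl_eq, ← pinIncl_pinDir]
  refine congrArg (fun p => (φ₂.cyl.restrict D.piece₂).act p _) ?_
  refine Subtype.ext (Prod.ext (Subtype.ext ?_) ?_)
  · exact ((congrArg D.k₂ hinv).trans (D.k₂_pt _ zero_mem_Icc)).symm
  · change φ₂.cylMk (D.σ₂ (D.ϖ.inversion z)) 1 bot =
      φ₂.cylMk (D.σ₂ (fst (D.cylInv (pt (z : EuclideanSpace ℝ (Fin n)) 0)))) 1
        (height (D.cylInv (pt (z : EuclideanSpace ℝ (Fin n)) 0)))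
    rw [hinv]
    exact congrArg (φ₂.cylMk _ 1) (Subtype.ext (ht_pt (D.ϖ.inversion z) zero_mem_Icc).symm)

/-- The bundle map over the bottom of the bordism. -/
def liftBottom : D.glued.P → D.pinW.P :=
  D.sectionGluing.toPinGluing.lift (fun p => D.cylGluing.toPinGluing.inl (D.lift₁ p))
    (fun p => D.cylGluing.toPinGluing.inr (D.lift₂ p)) (by
      rintro ⟨z, g⟩
      have h1 : D.lift₁ (D.sectionGluing.toPinGluing.α (z, g)) =
          D.cylGluing.toPinGluing.α (D.bottom z, pinIncl n g) :=
        (D.lift₁_act _ _).trans (congrArg (fun p => (φ₁.cyl.restrict D.piece₁).act p (pinIncl n g))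
          (D.lift₁_h₁ z))
      have h2 : D.lift₂ (D.sectionGluing.toPinGluing.β (z, g)) =
          D.cylGluing.toPinGluing.β (D.bottom z, pinIncl n g) :=
        (D.lift₂_act _ _).trans (congrArg (fun p => (φ₂.cyl.restrict D.piece₂).act p (pinIncl n g))
          (D.lift₂_h₂ z))
      rw [h1, h2, PinGluing.inl_α])

theorem continuous_liftBottom : Continuous D.liftBottom := by
  have h := D.sectionGluing.toPinGluing.continuous_of_inl_inr (Y := Unit)
    (f := fun z => D.liftBottom z.1)
    (D.cylGluing.toPinGluing.continuous_inl.comp (D.continuous_lift₁.comp continuous_fst))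
    (D.cylGluing.toPinGluing.continuous_inr.comp (D.continuous_lift₂.comp continuous_fst))
  exact h.comp (g := fun z => D.liftBottom z.1) (f := fun t => (t, ()))
    (continuous_id.prodMk continuous_const)

theorem liftBottom_act (t : D.glued.P) (g : PinPlus n) :
    D.liftBottom (D.glued.act t g) = D.pinW.act (D.liftBottom t) (pinIncl n g) := by
  revert t
  refine D.sectionGluing.toPinGluing.total_induction (fun p => ?_) fun p => ?_
  · exact congrArg D.cylGluing.toPinGluing.inl (D.lift₁_act p g)
  · exact congrArg D.cylGluing.toPinGluing.inr (D.lift₂_act p g)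

/-- The matrices of the two gluings agree at the bottom, up to a positive factor in the last
coordinate. -/
theorem Λ_bottom (t : unitInterval) (z : D.region.O) (v : EuclideanSpace ℝ (Fin n)) (d : ℝ) :
    D.cylRegion.toStage.Λ t (D.bottom z) (euclSnoc v d) =
      euclSnoc (D.region.toStage.Λ t z v)
        (Real.exp (t * Real.log (D.region.toStage.radSq z)) * d) := by
  have h1 : D.cylRegion.toStage.Λ t (D.bottom z) = gluingMatrix D.ϖ.snoc (snocEquiv (D.F₁ t z))
      (snocEquiv (D.F₂ (unitInterval.symm t) (fst (D.cylInv
        (pt (z : EuclideanSpace ℝ (Fin n)) 0)))))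
      (D.cylRegion.toStage.rad (D.bottom z))
      (t * Real.log (D.ϖ.snoc.sq (flat (pt (z : EuclideanSpace ℝ (Fin n)) 0)))) := rfl
  rw [h1, D.rad_bottom, D.cylInv_pt_zero, D.snoc_sq_flat, D.rsq_pt_zero, gluingMatrix_snoc]
  rfl

/-- The frame of the sum over the overlap, as a frame of the first piece. -/
def frameO (c : unitInterval) (z : D.region.O) : TangentFrame (𝓡 n) (K.compl i₁) :=
  ((D.region.flatO z).precomp (D.region.toStage.Λ c z)).map D.region.toStage.isLocalDiffeomorph_k₁

/-- The frame of the bordism over the overlap, as a frame of the first piece. -/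
def cylFrameO (c : unitInterval) (z : D.overlapRegion) : TangentFrame (𝓡∂ (n + 1)) D.piece₁ :=
  ((D.cylRegion.flatO z).precomp (D.cylRegion.toStage.Λ c z)).map
    D.cylRegion.toStage.isLocalDiffeomorph_k₁

theorem sectionGluing_γ (c : unitInterval) (z : D.region.O) :
    D.sectionGluing.γ c z = (D.frameO c z).map TubeSum.isLocalDiffeomorph_inl := rfl

theorem cylGluing_γ (c : unitInterval) (z : D.overlapRegion) :
    D.cylGluing.γ c z = (D.cylFrameO c z).map D.overlap.isLocalDiffeomorph_inl := rfl

theorem frameO_map (c : unitInterval) (z : D.region.O) :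
    (D.frameO c z).map (isLocalDiffeomorph_subtypeVal (K.compl i₁)) =
      ((stdFrame (z : EuclideanSpace ℝ (Fin n))).map D.isLocalDiffeomorph_j₁).precomp
        (D.region.toStage.Λ c z) := by
  have h := D.region.flatO_map_restrict D.isLocalDiffeomorph_j₁ D.region.k₁_mem z
  exact congrArg (fun b => TangentFrame.precomp b (D.region.toStage.Λ c z)) h

set_option maxRecDepth 4000 in
theorem cylFrameO_map (c : unitInterval) (z : D.overlapRegion) :
    (D.cylFrameO c z).map (isLocalDiffeomorph_subtypeVal D.piece₁) =
      (cylFrame ((stdFrame (fst (z : Cyl (EuclideanSpace ℝ (Fin n))))).map D.isLocalDiffeomorph_j₁)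
        (height (z : Cyl (EuclideanSpace ℝ (Fin n))))).precomp (D.cylRegion.toStage.Λ c z) := by
  have h := D.cylRegion.flatO_map_restrict D.isLocalDiffeomorph_k₁ D.cylRegion.k₁_mem z
  have h' : (cylFrame (stdFrame (fst (z : Cyl (EuclideanSpace ℝ (Fin n)))))
      (height (z : Cyl (EuclideanSpace ℝ (Fin n))))).map D.isLocalDiffeomorph_k₁ =
      cylFrame ((stdFrame (fst (z : Cyl (EuclideanSpace ℝ (Fin n))))).map D.isLocalDiffeomorph_j₁)
        (height (z : Cyl (EuclideanSpace ℝ (Fin n)))) :=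
    cylFrame_map D.isLocalDiffeomorph_j₁ _ _
  exact congrArg (fun b => TangentFrame.precomp b (D.cylRegion.toStage.Λ c z)) (h.trans h')

/-- Over the overlap both gluings are stopped at the same time, as `r²` restricts to `‖X‖²` at
height `0`. The frames at that time correspond to each other by `Λ_bottom`. -/
theorem isEndFrame_overlap (z : D.region.O) (g : PinPlus n) :
    IsEndFrame D.incl 1
      (D.sectionGluing.toPinGluing.cutFrame 1
        ((φ₁.restrict (K.compl i₁)).act (D.sectionGluing.h₁ z) g))
      (D.cylGluing.toPinGluing.cutFrame 1
        ((φ₁.cyl.restrict D.piece₁).act (D.cylGluing.h₁ (D.bottom z)) (pinIncl n g))) := by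
  rw [SectionGluing.cutFrame_act_h₁, SectionGluing.cutFrame_act_h₁]
  have hs : D.cylGluing.s (D.bottom z) = D.sectionGluing.s z :=
    (D.snoc_sq_flat _).trans (D.rsq_pt_zero z)
  rw [hs]
  generalize cutoff (D.sectionGluing.s z) = c
  rw [D.sectionGluing_γ, D.cylGluing_γ, ← TangentFrame.precomp_map, ← TangentFrame.precomp_map]
  refine EndPiece.isEndFrame D.endPiece₁
    (e := Real.exp (c * Real.log (D.region.toStage.radSq z))) (fun w => ?_) (Real.exp_pos _)
    (.inl ⟨rfl, rfl⟩)
  rw [TangentFrame.precomp_map, D.cylFrameO_map, TangentFrame.precomp_map,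
    show TangentFrame.map _ (D.frameO c z) = _ from D.frameO_map c z]
  simp only [TangentFrame.vec_precomp, cylFrame_vec, D.height_bottom, pinRhoEquiv_apply]
  rw [← euclSnoc_euclInit w, pinRho_pinIncl, D.Λ_bottom, euclSnoc_last,
    euclInit_euclSnoc, euclInit_euclSnoc, euclSnoc_last]
  rfl

/-- The frames of the sum extend to those of the bordism, with an outward vector at the end: over
the overlap by `isEndFrame_overlap`, elsewhere because the frames are those of the cylinders. -/
theorem isEndFrame_bottom (t : D.glued.P) :
    IsEndFrame D.incl 1 (D.glued.frame t) (D.pinW.frame (D.liftBottom t)) := by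
  have key : ∀ x, IsEndFrame D.incl 1
      (D.glued.frame (D.sectionGluing.toPinGluing.inl (D.sectionGluing.toPinGluing.α x)))
      (D.pinW.frame (D.liftBottom
        (D.sectionGluing.toPinGluing.inl (D.sectionGluing.toPinGluing.α x)))) := by
    rintro ⟨z, g⟩
    have h := D.isEndFrame_overlap z g
    rw [← D.lift₁_h₁, ← D.lift₁_act] at h
    exact h
  revert t
  refine D.sectionGluing.toPinGluing.total_induction (fun p => ?_) fun p => ?_
  · by_cases hp : p ∈ range D.sectionGluing.toPinGluing.α
    · obtain ⟨x, rfl⟩ := hp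
      exact key x
    have hp' : D.lift₁ p ∉ range D.cylGluing.toPinGluing.α := by
      rintro ⟨⟨z, g⟩, hz⟩
      have h1 : D.overlap.κ₁ z = ⟨pt (p.1.1 : M₁) 0, D.pt_zero_mem₁ _⟩ :=
        ((((φ₁.cyl.restrict D.piece₁).proj_act _ _).trans (D.cylGluing.proj_h₁ z)).symm).trans
          (congrArg (φ₁.cyl.restrict D.piece₁).proj hz)
      refine hp (D.sectionGluing.toPinGluing.mem_range_α p ?_)
      refine D.endPiece₂.mem_range _ (D.overlap.κ₂ z) ?_
      rw [← D.overlap.inl_κ₁, h1]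
      rfl
    change IsEndFrame D.incl 1 (D.sectionGluing.toPinGluing.cutFrame 1 p)
      (D.cylGluing.toPinGluing.cutFrame 1 (D.lift₁ p))
    rw [PinGluing.cutFrame_of_notMem _ _ hp, PinGluing.cutFrame_of_notMem _ _ hp']
    refine D.endPiece₁.isEndFrame (fun w => ?_) one_pos (.inl ⟨rfl, rfl⟩)
    have h1 := congrArg (fun b => TangentFrame.vec b (euclInit w)) (φ₁.restrict_frame _ _ p.1.2 p.2)
    exact (φ₁.frame_endLift D.piece₁ _ _ p.2 bot _ w).trans
      (congrArg (fun V => tvec V 0 (-(1 * w (Fin.last n)))) h1.symm)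
  · by_cases hp : p ∈ range D.sectionGluing.toPinGluing.β
    · obtain ⟨x, rfl⟩ := hp
      rw [← PinGluing.inl_α]
      exact key x
    have hp' : D.lift₂ p ∉ range D.cylGluing.toPinGluing.β := by
      rintro ⟨⟨z, g⟩, hz⟩
      have h1 : D.overlap.κ₂ z = ⟨pt (p.1.1 : M₂) 0, D.pt_zero_mem₂ _⟩ :=
        ((((φ₂.cyl.restrict D.piece₂).proj_act _ _).trans (D.cylGluing.proj_h₂ z)).symm).trans
          (congrArg (φ₂.cyl.restrict D.piece₂).proj hz)
      refine hp (D.sectionGluing.toPinGluing.mem_range_β p ?_)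
      refine D.endPiece₁.mem_range _ (D.overlap.κ₁ z) ?_
      rw [D.overlap.inl_κ₁, h1]
      rfl
    change IsEndFrame D.incl 1 (D.sectionGluing.toPinGluing.swap.cutFrame 1 p)
      (D.cylGluing.toPinGluing.swap.cutFrame 1 (D.lift₂ p))
    rw [PinGluing.cutFrame_of_notMem _ _ hp, PinGluing.cutFrame_of_notMem _ _ hp']
    refine D.endPiece₂.isEndFrame (fun w => ?_) one_pos (.inl ⟨rfl, rfl⟩)
    have h1 := congrArg (fun b => TangentFrame.vec b (euclInit w)) (φ₂.restrict_frame _ _ p.1.2 p.2)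
    exact (φ₂.frame_endLift D.piece₂ _ _ p.2 bot _ w).trans
      (congrArg (fun V => tvec V 0 (-(1 * w (Fin.last n)))) h1.symm)

/-- The bundle map over the top of the bordism. -/
def liftTop : (φ₁.sum φ₂).P → D.pinW.P :=
  Sum.elim (fun p => D.cylGluing.toPinGluing.inl
      (φ₁.endLift D.piece₁ (φ₁.proj p) p rfl top (D.pt_two_mem₁ _)))
    (fun p => D.cylGluing.toPinGluing.inr
      (φ₂.endLift D.piece₂ (φ₂.proj p) p rfl top (D.pt_two_mem₂ _)))

theorem continuous_liftTop : Continuous D.liftTop :=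
  Continuous.sumElim
    (D.cylGluing.toPinGluing.continuous_inl.comp
      (φ₁.continuous_endLift D.piece₁ _ top _ φ₁.continuous_proj continuous_id))
    (D.cylGluing.toPinGluing.continuous_inr.comp
      (φ₂.continuous_endLift D.piece₂ _ top _ φ₂.continuous_proj continuous_id))

theorem _root_.PinStructure.endLift_congr {M : Type u} [TopologicalSpace M]
    [ChartedSpace (EuclideanSpace ℝ (Fin n)) M] [IsManifold (𝓡 n) ∞ M]
    (φ : PinStructure.{u} (𝓡 n) M) (P : Opens (Cyl M)) {x x' : M} (h : x = x') (p : φ.P)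
    (hx : x = φ.proj p) (hx' : x' = φ.proj p) (y : Icc (0 : ℝ) 2) (hy : pt x y ∈ P)
    (hy' : pt x' y ∈ P) : φ.endLift P x p hx y hy = φ.endLift P x' p hx' y hy' := by
  subst h; rfl

theorem liftTop_act (t : (φ₁.sum φ₂).P) (g : PinPlus n) :
    D.liftTop ((φ₁.sum φ₂).act t g) = D.pinW.act (D.liftTop t) (pinIncl n g) := by
  rcases t with p | p
  · refine congrArg D.cylGluing.toPinGluing.inl (Eq.trans ?_
      (φ₁.endLift_act D.piece₁ (φ₁.proj p) p rfl top (D.pt_two_mem₁ _) g (φ₁.proj_act p g).symm))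
    exact φ₁.endLift_congr D.piece₁ (φ₁.proj_act p g) _ _ _ _ _ _
  · refine congrArg D.cylGluing.toPinGluing.inr (Eq.trans ?_
      (φ₂.endLift_act D.piece₂ (φ₂.proj p) p rfl top (D.pt_two_mem₂ _) g (φ₂.proj_act p g).symm))
    exact φ₂.endLift_congr D.piece₂ (φ₂.proj_act p g) _ _ _ _ _ _

theorem _root_.TangentFrame.map_id {M : Type*} [TopologicalSpace M]
    [ChartedSpace (EuclideanSpace ℝ (Fin n)) M] (b : TangentFrame (𝓡 n) M)
    (h : IsLocalDiffeomorph (𝓡 n) (𝓡 n) ∞ (id : M → M)) : b.map h = b :=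
  TangentFrame.ext_vec fun v => (TangentFrame.vec_map h b v).trans (congrFun tangentMap_id _)

/-- The top is disjoint from the overlap, so the frames there are those of the cylinders. Their last
vector points downward, that is, into the bordism. -/
theorem isEndFrame_top (t : (φ₁.sum φ₂).P) :
    IsEndFrame D.inclTop (-1) ((φ₁.sum φ₂).frame t) (D.pinW.frame (D.liftTop t)) := by
  rcases t with p | p
  · have hp : φ₁.endLift D.piece₁ (φ₁.proj p) p rfl top (D.pt_two_mem₁ _) ∉
        range D.cylGluing.toPinGluing.α := by
      rintro ⟨⟨z, g⟩, hz⟩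
      have h1 : D.overlap.κ₁ z = ⟨pt (φ₁.proj p) 2, D.pt_two_mem₁ _⟩ :=
        ((((φ₁.cyl.restrict D.piece₁).proj_act _ _).trans (D.cylGluing.proj_h₁ z)).symm).trans
          (congrArg (φ₁.cyl.restrict D.piece₁).proj hz)
      have h2 := D.overlap.inl_κ₁ z
      rw [h1] at h2
      exact D.inl_two_ne_inr h2
    change IsEndFrame D.inclTop (-1) ((φ₁.frame p).map PinStructure.isLocalDiffeomorph_inl)
      (D.cylGluing.toPinGluing.cutFrame 1 _)
    rw [PinGluing.cutFrame_of_notMem _ _ hp]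
    refine D.endPieceTop₁.isEndFrame (fun w => ?_) one_pos (.inr ⟨rfl, rfl⟩)
    rw [TangentFrame.map_id]
    exact φ₁.frame_endLift D.piece₁ _ _ rfl top _ w
  · have hp : φ₂.endLift D.piece₂ (φ₂.proj p) p rfl top (D.pt_two_mem₂ _) ∉
        range D.cylGluing.toPinGluing.β := by
      rintro ⟨⟨z, g⟩, hz⟩
      have h1 : D.overlap.κ₂ z = ⟨pt (φ₂.proj p) 2, D.pt_two_mem₂ _⟩ :=
        ((((φ₂.cyl.restrict D.piece₂).proj_act _ _).trans (D.cylGluing.proj_h₂ z)).symm).trans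
          (congrArg (φ₂.cyl.restrict D.piece₂).proj hz)
      have h2 := D.overlap.inl_κ₁ z
      rw [h1] at h2
      exact D.inl_ne_inr_two h2
    change IsEndFrame D.inclTop (-1) ((φ₂.frame p).map PinStructure.isLocalDiffeomorph_inr)
      (D.cylGluing.toPinGluing.swap.cutFrame 1 _)
    rw [PinGluing.cutFrame_of_notMem _ _ hp]
    refine D.endPieceTop₂.isEndFrame (fun w => ?_) one_pos (.inr ⟨rfl, rfl⟩)
    rw [TangentFrame.map_id]
    exact φ₂.frame_endLift D.piece₂ _ _ rfl top _ w

/-- The glued structure is bordant to the disjoint union. -/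
theorem pinBordant [CompactSpace M₁] [CompactSpace M₂] : PinBordant D.glued (φ₁.sum φ₂) := by
  have := D.t2Space_W
  have := D.compactSpace_W
  obtain ⟨ν, h1, h2, h3⟩ := D.glued.exists_outward_normal D.pinW D.liftBottom
    D.continuous_liftBottom D.liftBottom_act D.isEndFrame_bottom
  obtain ⟨ν', h1', h2', h3'⟩ := (φ₁.sum φ₂).exists_outward_normal D.pinW D.liftTop
    D.continuous_liftTop D.liftTop_act D.isEndFrame_top
  exact ⟨{
    W := D.W
    pin := D.pinW
    incl := D.incl
    incl' := D.inclTop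
    isSmoothEmbedding := D.endPiece₁.isSmoothEmbedding D.endPiece₂ TubeSum.mem_range
    isSmoothEmbedding' := D.endPieceTop₁.isSmoothEmbedding D.endPieceTop₂ fun q => by
      rcases q with m | m
      exacts [.inl ⟨m, rfl⟩, .inr ⟨m, rfl⟩]
    disjoint := D.disjoint_range
    boundary_eq := D.boundary_eq
    normal := ν
    normal' := ν'
    continuous_normal := h1
    continuous_normal' := h1'
    outward := fun x => by simpa only [one_smul] using h2 x
    inward := fun x => by simpa only [neg_one_smul] using h2' x
    isBoundary := h3
    isBoundary' := h3' }⟩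

end FlatTube

end bordism

/-! ### Flat coordinates from triangular sections -/

section triangular

variable {n : ℕ} {E M : Type*}
  [TopologicalSpace E] [ChartedSpace (EuclideanSpace ℝ (Fin n)) E] [IsManifold (𝓡 n) ∞ E]
  [TopologicalSpace M] [ChartedSpace (EuclideanSpace ℝ (Fin n)) M] [IsManifold (𝓡 n) ∞ M]

theorem eq_map_flatFrame {j : EuclideanSpace ℝ (Fin n) → M}
    (hj : IsLocalDiffeomorph (𝓡 n) (𝓡 n) ∞ j) (b : TangentFrame (𝓡 n) M)
    (x : EuclideanSpace ℝ (Fin n)) (h : b.base = j x) :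
    b = ((stdFrame x).precomp (flatFrame hj b x)).map hj :=
  TangentFrame.ext_vec fun v => (tangentMap_flatFrame hj b x h v).symm

/-- If the differentials of `j` at `x` and `x'` differ by `ρ(c)`, then so do the matrices of a frame
with respect to them. -/
theorem flatFrame_deck {j : EuclideanSpace ℝ (Fin n) → M}
    (hj : IsLocalDiffeomorph (𝓡 n) (𝓡 n) ∞ j) {x x' : EuclideanSpace ℝ (Fin n)} {c : PinPlus n}
    (h : ((stdFrame x').precomp (pinRhoEquiv c)).map hj = (stdFrame x).map hj)
    (b : TangentFrame (𝓡 n) M) (hb : b.base = j x) (v : EuclideanSpace ℝ (Fin n)) :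
    flatFrame hj b x' v = pinRho c (flatFrame hj b x v) := by
  have hx : j x' = j x := congrArg TangentFrame.base h
  refine flatFrame_eq hj b x' (hb.trans hx.symm) ?_
  exact (congrArg (fun b' => TangentFrame.vec b' (flatFrame hj b x v)) h).trans
    (tangentMap_flatFrame hj b x hb v)

/-- The linear path from a triangular automorphism to the identity. -/
def triPath (A : EuclideanSpace ℝ (Fin n) ≃L[ℝ] EuclideanSpace ℝ (Fin n))
    (hA : IsTri (A : EuclideanSpace ℝ (Fin n) →L[ℝ] EuclideanSpace ℝ (Fin n)))
    (t : unitInterval) : EuclideanSpace ℝ (Fin n) ≃L[ℝ] EuclideanSpace ℝ (Fin n) :=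
  equivOfInjective _ (hA.lineMap t).injective

/-- Let `σ` be a section of `ψ` with triangular frames over the coordinates `cov` of `E`, and let
the local diffeomorphism `i` match `ψ` with `φ` up to homotopy. The image of `σ` is a section of `φ`
whose matrices are homotopic to the identity: first along the homotopy of Pin⁺ structures to the
matrices of `σ`, while these are straightened linearly. The homotopy is compatible with the deck
transformations of `cov`. -/
theorem PinStructure.LiftsAlong.exists_flatSection {ψ : PinStructure (𝓡 n) E}
    {φ : PinStructure (𝓡 n) M} {θ : PinPlus n →* PinPlus n}
    (hθ : ∀ g v, pinRho (θ g) v = pinRho g v) {i : E → M}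
    (hi : IsLocalDiffeomorph (𝓡 n) (𝓡 n) ∞ i)
    (H : ψ.LiftsAlong φ θ fun p v => tangentMap (𝓡 n) (𝓡 n) i ((ψ.frame p).vec v))
    {cov : EuclideanSpace ℝ (Fin n) → E} (hcov : IsLocalDiffeomorph (𝓡 n) (𝓡 n) ∞ cov)
    {σ : EuclideanSpace ℝ (Fin n) → ψ.P} (hσ : Continuous σ) (hproj : ∀ x, ψ.proj (σ x) = cov x)
    (htri : ∀ x, IsTri (flatFrame hcov (ψ.frame (σ x)) x :
      EuclideanSpace ℝ (Fin n) →L[ℝ] EuclideanSpace ℝ (Fin n))) :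
    ∃ (s : EuclideanSpace ℝ (Fin n) → φ.P) (F : unitInterval → EuclideanSpace ℝ (Fin n) →
        EuclideanSpace ℝ (Fin n) ≃L[ℝ] EuclideanSpace ℝ (Fin n)),
      Continuous s ∧
      (Continuous fun z : (unitInterval × EuclideanSpace ℝ (Fin n)) × EuclideanSpace ℝ (Fin n) =>
        F z.1.1 z.1.2 z.2) ∧
      (∀ x v, F 1 x v = v) ∧
      (∀ x, φ.frame (s x) = ((stdFrame x).precomp (F 0 x)).map (hi.comp hcov)) ∧
      ∀ x x' c, ((stdFrame x').precomp (pinRhoEquiv c)).map hcov = (stdFrame x).map hcov →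
        ψ.act (σ x') c = σ x → φ.act (s x') (θ c) = s x ∧
        ∀ t v, F t x' (pinRho c v) = pinRho c (F t x v) := by
  obtain ⟨h, G, hh, hact, hG, hbase, hGact, hG0, hG1⟩ := H
  have hj : IsLocalDiffeomorph (𝓡 n) (𝓡 n) ∞ (i ∘ cov) := hi.comp hcov
  have hGb : ∀ t x, (G t (σ x)).base = i (cov x) := fun t x => by
    rw [hbase, ← hbase 1]
    exact (congrArg Bundle.TotalSpace.proj (hG1 (σ x) 0)).trans (congrArg i (hproj x))
  let T := fun x => flatFrame hcov (ψ.frame (σ x)) x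
  let A := fun t x => flatFrame hj (G t (σ x)) x
  have hT : Continuous fun z : EuclideanSpace ℝ (Fin n) × EuclideanSpace ℝ (Fin n) => T z.1 z.2 :=
    continuous_flatFrame hcov (b := fun x => ψ.frame (σ x)) (x := fun x => x) continuous_id hproj
      (ψ.continuous_frame.comp ((hσ.comp continuous_fst).prodMk continuous_snd))
  have hA : Continuous fun z : (unitInterval × EuclideanSpace ℝ (Fin n)) ×
      EuclideanSpace ℝ (Fin n) => A z.1.1 z.1.2 z.2 :=
    continuous_flatFrame hj (b := fun z : unitInterval × EuclideanSpace ℝ (Fin n) => G z.1 (σ z.2))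
      (x := fun z => z.2) continuous_snd (fun z => hGb z.1 z.2)
      (hG.comp ((continuous_fst.comp continuous_fst).prodMk
        ((hσ.comp (continuous_snd.comp continuous_fst)).prodMk continuous_snd)))
  have hA0 : ∀ x, G 0 (σ x) = φ.frame (h (σ x)) := fun x => TangentFrame.ext_vec (hG0 _)
  have hA1 : ∀ x v, A 1 x v = T x v := fun x v => by
    refine flatFrame_eq hj _ x (hGb 1 x) ?_
    refine Eq.trans ?_ (hG1 (σ x) v).symm
    refine Eq.trans ?_ (congrArg (tangentMap (𝓡 n) (𝓡 n) i)
      (tangentMap_flatFrame hcov _ x (hproj x) v))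
    exact tangentMap_comp_at (I := 𝓡 n) (I' := 𝓡 n) (I'' := 𝓡 n) (g := i) (f := cov)
      (flatVec x (T x v)) ((hi (cov x)).contMDiffAt.mdifferentiableAt (by simp))
      ((hcov x).contMDiffAt.mdifferentiableAt (by simp))
  -- At time `t` this is `A t x ∘ (T x)⁻¹ ∘ ((1 - t) T x + t)`. As `A 1 x = T x`, it runs from
  -- `A 0 x`, the matrix of the section, to the identity.
  let F : unitInterval → EuclideanSpace ℝ (Fin n) →
        EuclideanSpace ℝ (Fin n) ≃L[ℝ] EuclideanSpace ℝ (Fin n) :=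
    fun t x => (triPath (T x) (htri x) t).trans ((T x).symm.trans (A t x))
  have hFv : ∀ t x v, F t x v = A t x ((T x).symm ((1 - (t : ℝ)) • T x v + (t : ℝ) • v)) :=
    fun t x v => rfl
  refine ⟨fun x => h (σ x), F, hh.comp hσ, ?_, ?_, ?_, ?_⟩
  · have hs := continuous_symm_apply hT
    have h1 : Continuous fun z : (unitInterval × EuclideanSpace ℝ (Fin n)) ×
        EuclideanSpace ℝ (Fin n) => (1 - (z.1.1 : ℝ)) • T z.1.2 z.2 + (z.1.1 : ℝ) • z.2 := by
      have h2 := hT.comp ((continuous_snd.comp continuous_fst).prodMk continuous_snd :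
        Continuous fun z : (unitInterval × EuclideanSpace ℝ (Fin n)) ×
          EuclideanSpace ℝ (Fin n) => (z.1.2, z.2))
      have h3 : Continuous fun z : (unitInterval × EuclideanSpace ℝ (Fin n)) ×
          EuclideanSpace ℝ (Fin n) => (z.1.1 : ℝ) :=
        continuous_subtype_val.comp (continuous_fst.comp continuous_fst)
      exact ((continuous_const.sub h3).smul h2).add (h3.smul continuous_snd)
    exact hA.comp (continuous_fst.prodMk
      (hs.comp ((continuous_snd.comp continuous_fst).prodMk h1)))
  · intro x v
    rw [hFv, hA1, ContinuousLinearEquiv.apply_symm_apply]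
    simp
  · intro x
    have hF0 : F 0 x = A 0 x := by
      ext v : 2
      rw [hFv]
      simp
    rw [hF0, ← hA0]
    exact eq_map_flatFrame hj _ x (hGb 0 x)
  · intro x x' c hd hc
    have hdj : ((stdFrame x').precomp (pinRhoEquiv c)).map hj = (stdFrame x).map hj := by
      have := congrArg (fun b => TangentFrame.map hi b) hd
      simpa only [TangentFrame.map_map] using this
    have hTc : ∀ v, T x' (pinRho c v) = pinRho c (T x v) := fun v => by
      have hx : cov x' = cov x := congrArg TangentFrame.base hd
      have h1 := ψ.flatFrame_act hcov (σ x') x' (hproj x') c v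
      rw [hc] at h1
      exact h1.symm.trans (flatFrame_deck hcov hd _ (hproj x) v)
    have hAc : ∀ t v, A t x' (pinRho c v) = pinRho c (A t x v) := fun t v => by
      have hx : i (cov x') = i (cov x) := congrArg (fun b => i (TangentFrame.base b)) hd
      have h1 : flatFrame hj (G t (σ x)) x' v = A t x' (pinRho c v) := by
        refine flatFrame_eq hj _ x' ((hGb t x).trans hx.symm) ?_
        rw [tangentMap_flatFrame hj _ x' (hGb t x'), ← hc, hGact, hθ]
      exact h1.symm.trans (flatFrame_deck hj hdj _ (hGb t x) v)
    have hTs : ∀ v, (T x').symm (pinRho c v) = pinRho c ((T x).symm v) := fun v => by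
      rw [ContinuousLinearEquiv.symm_apply_eq, hTc, ContinuousLinearEquiv.apply_symm_apply]
    refine ⟨by rw [← hact, hc], fun t v => ?_⟩
    rw [hFv, hFv, hTc, ← map_smul (pinRho c), ← map_smul (pinRho c), ← map_add, hTs, hAc]

theorem PinStructure.liftsAlong_id (φ : PinStructure (𝓡 n) M) :
    φ.LiftsAlong φ (MonoidHom.id _) fun p v => tangentMap (𝓡 n) (𝓡 n) id ((φ.frame p).vec v) :=
  ⟨id, fun _ p => φ.frame p, continuous_id, fun _ _ => rfl,
    φ.continuous_frame.comp continuous_snd, fun _ _ => rfl, fun _ => φ.frame_act,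
    fun _ _ => rfl, fun p v => by rw [tangentMap_id]; rfl⟩

end triangular

/-! ### The tube around a point -/

section disc

variable {n : ℕ} {M₁ M₂ : Type u}
  [TopologicalSpace M₁] [ChartedSpace (EuclideanSpace ℝ (Fin n)) M₁] [T2Space M₁]
  [IsManifold (𝓡 n) ∞ M₁]
  [TopologicalSpace M₂] [ChartedSpace (EuclideanSpace ℝ (Fin n)) M₂] [T2Space M₂]
  [IsManifold (𝓡 n) ∞ M₂]

theorem isLocalDiffeomorph_id' : IsLocalDiffeomorph (𝓡 n) (𝓡 n) ∞ (id : M₁ → M₁) :=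
  (Diffeomorph.refl (𝓡 n) M₁ ∞).isLocalDiffeomorph

/-- On `ℝⁿ` all coordinates are radial. -/
def discProj (n : ℕ) : RadProj n where
  lin := ContinuousLinearMap.id ℝ _
  idem _ := rfl
  symm _ _ := rfl

/-- A disc is simply connected, so any two Pin⁺ structures admit flat coordinates. -/
theorem exists_flatTube_disc (i₁ : OpenTube n (EuclideanSpace ℝ (Fin n)) M₁)
    (i₂ : OpenTube n (EuclideanSpace ℝ (Fin n)) M₂) (φ₁ : PinStructure.{u} (𝓡 n) M₁)
    (φ₂ : PinStructure.{u} (𝓡 n) M₂) : Nonempty (FlatTube (discCollarModel n) i₁ i₂ φ₁ φ₂) := by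
  obtain ⟨σ₁, hσ₁, hp₁, ht₁⟩ := φ₁.exists_triSection i₁.isLocalDiffeomorph
  obtain ⟨σ₂, hσ₂, hp₂, ht₂⟩ := φ₂.exists_triSection i₂.isLocalDiffeomorph
  obtain ⟨s₁, F₁, hs₁, hF₁, h1₁, h0₁, -⟩ := PinStructure.LiftsAlong.exists_flatSection
    (θ := MonoidHom.id (PinPlus n)) (i := id) (cov := i₁.toFun) (fun _ _ => rfl)
    isLocalDiffeomorph_id' φ₁.liftsAlong_id i₁.isLocalDiffeomorph hσ₁ hp₁ ht₁
  obtain ⟨s₂, F₂, hs₂, hF₂, h1₂, h0₂, -⟩ := PinStructure.LiftsAlong.exists_flatSection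
    (θ := MonoidHom.id (PinPlus n)) (i := id) (cov := i₂.toFun) (fun _ _ => rfl)
    isLocalDiffeomorph_id' φ₂.liftsAlong_id i₂.isLocalDiffeomorph hσ₂ hp₂ ht₂
  exact ⟨{
    ϖ := discProj n
    cov := id
    cov_surjective := Function.surjective_id
    isLocalDiffeomorph_cov := isLocalDiffeomorph_id'
    mem_core_iff := fun x => Iff.rfl
    inv_cov := fun x hx => by
      rw [RadProj.inversion_eq]
      change (‖x‖ ^ 2)⁻¹ • x = x + ((‖x‖ ^ 2)⁻¹ - 1) • x
      module
    σ₁ := s₁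
    σ₂ := s₂
    continuous_σ₁ := hs₁
    continuous_σ₂ := hs₂
    F₁ := F₁
    F₂ := F₂
    continuous_F₁ := hF₁
    continuous_F₂ := hF₂
    F₁_one := h1₁
    F₂_one := h1₂
    frame_σ₁ := h0₁
    frame_σ₂ := h0₂
    deck := by
      rintro x x' (rfl : x = x')
      refine ⟨1, ?_, fun l => φ₁.act_one _, fun l => ?_, fun t l v => ?_, fun t l v => ?_, fun v =>
        ?_,
        ?_⟩
      · refine congrArg (fun b => TangentFrame.map isLocalDiffeomorph_id' b) ?_
        exact TangentFrame.ext_vec fun v => congrArg (stdFrame x).vec (pinRho_one v)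
      · rw [map_one, φ₂.act_one]
      · rw [pinRho_one, pinRho_one]
      · rw [pinRho_one, pinRho_one]
      · rw [pinRho_one, pinRho_one]
      · rw [pinRho_one]
    exists_compact := fun R => by
      refine ⟨Metric.closedBall 0 (√R), isCompact_closedBall _ _, fun x hx => ⟨x, ?_, rfl⟩⟩
      rw [mem_closedBall_zero_iff]
      exact Real.le_sqrt_of_sq_le hx }⟩

end disc

/-! ### The tube around an orientation reversing circle -/

section circle

/-- The radial coordinates of `ℝ³ × ℝ` are the first three. -/
def circleProj : RadProj 4 where
  lin := LinearMap.toContinuousLinearMap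
    { toFun := fun x => !₂[x 0, x 1, x 2, 0]
      map_add' := fun x y => by ext i; fin_cases i <;> simp
      map_smul' := fun c x => by ext i; fin_cases i <;> simp }
  idem x := by ext i; fin_cases i <;> simp
  symm x y := by simp [PiLp.inner_apply, Fin.sum_univ_four]

theorem circleProj_lin (x : EuclideanSpace ℝ (Fin 4)) :
    circleProj.lin x = !₂[x 0, x 1, x 2, 0] := rfl

theorem circleProj_sq (x : EuclideanSpace ℝ (Fin 4)) :
    circleProj.sq x = TwistedTube.radSq x := by
  rw [RadProj.sq, circleProj_lin, EuclideanSpace.real_norm_sq_eq]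
  simp [Fin.sum_univ_four, TwistedTube.radSq]

theorem circleProj_inversion (x : EuclideanSpace ℝ (Fin 4)) :
    circleProj.inversion x = TwistedTube.radInv x := by
  rw [RadProj.inversion_eq, circleProj_sq, circleProj_lin]
  ext i; fin_cases i <;> simp [TwistedTube.radInv] <;> ring

/-- The deck transformations are affine, with linear part in the image of the Pin group. -/
theorem exists_twistShift_eq (k : ℤ) :
    ∃ c : PinPlus 4, ∀ v, pinRho c v = !₂[(-1 : ℝ) ^ k * v 0, v 1, v 2, v 3] := by
  rcases Int.even_or_odd k with hk | hk
  · refine ⟨1, fun v => ?_⟩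
    rw [pinRho_one, hk.neg_one_zpow]
    ext i; fin_cases i <;> simp
  · refine ⟨pinDir (EuclideanSpace.single 0 1), fun v => ?_⟩
    rw [pinRho_pinDir, hk.neg_one_zpow]
    · ext i; fin_cases i <;> simp [EuclideanSpace.inner_single_left]
      ring
    · simp

theorem twistShift_eq_pinRho_add {k : ℤ} {c : PinPlus 4}
    (hc : ∀ v, pinRho c v = !₂[(-1 : ℝ) ^ k * v 0, v 1, v 2, v 3])
    (x : EuclideanSpace ℝ (Fin 4)) : twistShift k x = pinRho c x + !₂[0, 0, 0, (k : ℝ)] := by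
  rw [hc]
  ext i; fin_cases i <;> simp [twistShift]

theorem tangentMap_twistShift {k : ℤ} {c : PinPlus 4}
    (hc : ∀ v, pinRho c v = !₂[(-1 : ℝ) ^ k * v 0, v 1, v 2, v 3])
    (x v : EuclideanSpace ℝ (Fin 4)) :
    tangentMap (𝓡 4) (𝓡 4) (twistShift k) (flatVec x v) =
      flatVec (twistShift k x) (pinRho c v) := by
  have h : HasFDerivAt (twistShift k) (pinRho c).toContinuousLinearMap x := by
    have h1 : HasFDerivAt (fun y => pinRho c y + !₂[0, 0, 0, (k : ℝ)])
        (pinRho c).toContinuousLinearMap x :=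
      ((pinRho c).toContinuousLinearMap.hasFDerivAt).add_const _
    exact h1.congr_of_eventuallyEq (.of_forall (twistShift_eq_pinRho_add hc))
  have h2 : mfderiv (𝓡 4) (𝓡 4) (twistShift k) x = (pinRho c).toContinuousLinearMap := by
    rw [mfderiv_eq_fderiv, h.fderiv]
  exact congrArg (fun A : EuclideanSpace ℝ (Fin 4) →L[ℝ] EuclideanSpace ℝ (Fin 4) =>
    flatVec (twistShift k x) (A v)) h2

theorem TwistedTube.isLocalDiffeomorph_mk : IsLocalDiffeomorph (𝓡 4) (𝓡 4) ∞ TwistedTube.mk :=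
  smoothGluing_twistSetoid.isLocalDiffeomorph_mk

theorem TwistedTube.mk_twistShift (k : ℤ) (x : EuclideanSpace ℝ (Fin 4)) :
    mk (twistShift k x) = mk x :=
  (Quotient.sound (s := twistSetoid) ⟨k, rfl⟩ : mk x = mk (twistShift k x)).symm

theorem stdFrame_twistShift {k : ℤ} {c : PinPlus 4}
    (hc : ∀ v, pinRho c v = !₂[(-1 : ℝ) ^ k * v 0, v 1, v 2, v 3])
    (x : EuclideanSpace ℝ (Fin 4)) :
    ((stdFrame (twistShift k x)).precomp (pinRhoEquiv c)).map TwistedTube.isLocalDiffeomorph_mk =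
      (stdFrame x).map TwistedTube.isLocalDiffeomorph_mk := by
  refine TangentFrame.ext_vec fun v => ?_
  change tangentMap (𝓡 4) (𝓡 4) TwistedTube.mk (flatVec (twistShift k x) (pinRho c v)) =
    tangentMap (𝓡 4) (𝓡 4) TwistedTube.mk (flatVec x v)
  rw [← tangentMap_twistShift hc]
  have h := tangentMap_comp_at (I := 𝓡 4) (I' := 𝓡 4) (I'' := 𝓡 4) (g := TwistedTube.mk)
    (f := twistShift k) (flatVec x v)
    ((TwistedTube.contMDiff_mk _).mdifferentiableAt (by simp))
    ((contDiff_twistShift k).contMDiff.contMDiffAt.mdifferentiableAt (by simp))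
  have h2 : TwistedTube.mk ∘ twistShift k = TwistedTube.mk :=
    funext (TwistedTube.mk_twistShift k)
  rw [h2] at h
  exact h.symm

theorem circleProj_scale_twistShift (k : ℤ) (l : ℝ) (x : EuclideanSpace ℝ (Fin 4)) :
    circleProj.scale l (twistShift k x) = twistShift k (circleProj.scale l x) := by
  rw [RadProj.scale, RadProj.scale, circleProj_lin, circleProj_lin]
  ext i; fin_cases i <;> simp [twistShift]
  ring

/-- Conjugation by a diagonal matrix of signs preserves triangular matrices. -/
theorem isTri_of_twist {k : ℤ} {c : PinPlus 4}
    (hc : ∀ v, pinRho c v = !₂[(-1 : ℝ) ^ k * v 0, v 1, v 2, v 3])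
    {A B : EuclideanSpace ℝ (Fin 4) →L[ℝ] EuclideanSpace ℝ (Fin 4)} (hA : IsTri A)
    (hAB : ∀ v, A (pinRho c v) = pinRho c (B v)) : IsTri B := by
  have hk : (-1 : ℝ) ^ k * (-1 : ℝ) ^ k = 1 := by
    rcases Int.even_or_odd k with h | h <;> simp [h.neg_one_zpow]
  let s : Fin 4 → ℝ := ![(-1 : ℝ) ^ k, 1, 1, 1]
  have hs : ∀ i, s i * s i = 1 := fun i => by fin_cases i <;> simp [s, hk]
  have hρ : ∀ v i, pinRho c v i = s i * v i := fun v i => by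
    rw [hc]; fin_cases i <;> simp [s]
  have he : ∀ j, pinRho c (euclBasis 4 j) = s j • euclBasis 4 j := fun j => by
    ext i
    rw [hρ]
    by_cases h : i = j
    · rw [h]; rfl
    · simp [h]
  have hB : ∀ i j, B (euclBasis 4 j) i = s i * s j * A (euclBasis 4 j) i := fun i j => by
    have h := congrArg (fun w : EuclideanSpace ℝ (Fin 4) => s i * w i) (hAB (euclBasis 4 j))
    simp only [he, map_smul, hρ, PiLp.smul_apply, smul_eq_mul, ← mul_assoc, hs, one_mul] at h
    exact h.symm
  intro i
  refine ⟨?_, fun j hij => ?_⟩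
  · rw [hB, hs, one_mul]; exact (hA i).1
  · rw [hB, (hA i).2 j hij, mul_zero]

/-- A section with triangular frames over the universal cover of the tube is carried to itself by
the deck transformations, up to the action of a fixed element of the Pin group. -/
theorem exists_act_twistShift (ψ : PinStructure (𝓡 4) TwistedTube)
    {σ : EuclideanSpace ℝ (Fin 4) → ψ.P} (hσ : Continuous σ)
    (hproj : ∀ x, ψ.proj (σ x) = TwistedTube.mk x)
    (htri : ∀ x, IsTri (flatFrame TwistedTube.isLocalDiffeomorph_mk (ψ.frame (σ x)) x :
      EuclideanSpace ℝ (Fin 4) →L[ℝ] EuclideanSpace ℝ (Fin 4))) (k : ℤ) :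
    ∃ c : PinPlus 4, (∀ v, pinRho c v = !₂[(-1 : ℝ) ^ k * v 0, v 1, v 2, v 3]) ∧
      ∀ x, ψ.act (σ (twistShift k x)) c = σ x := by
  -- Any lift of the linear part of the deck transformation carries `σ` to a triangular section.
  have key : ∀ c : PinPlus 4, (∀ v, pinRho c v = !₂[(-1 : ℝ) ^ k * v 0, v 1, v 2, v 3]) → ∀ x,
      ψ.proj (ψ.act (σ (twistShift k x)) c) = TwistedTube.mk x ∧
      IsTri (flatFrame TwistedTube.isLocalDiffeomorph_mk
        (ψ.frame (ψ.act (σ (twistShift k x)) c)) x :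
        EuclideanSpace ℝ (Fin 4) →L[ℝ] EuclideanSpace ℝ (Fin 4)) := by
    intro c hc x
    have hp : ψ.proj (ψ.act (σ (twistShift k x)) c) = TwistedTube.mk x := by
      rw [ψ.proj_act, hproj, TwistedTube.mk_twistShift]
    refine ⟨hp, isTri_of_twist hc (htri (twistShift k x)) fun v => ?_⟩
    have h1 := ψ.flatFrame_act TwistedTube.isLocalDiffeomorph_mk (σ (twistShift k x))
      (twistShift k x) (hproj _) c v
    exact h1.symm.trans (flatFrame_deck _ (stdFrame_twistShift hc x) _ hp v)
  -- The shifted section has triangular frames again. At `0` it differs from `σ` by an element `g`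
  -- of the kernel of `ρ`; after multiplication by `g` both agree at `0`, hence everywhere.
  obtain ⟨c₀, hc₀⟩ := exists_twistShift_eq k
  obtain ⟨g, hg⟩ := ψ.exists_act_eq ((key c₀ hc₀ 0).1.trans (hproj 0).symm)
  have hg1 : ∀ v, pinRho g v = v := by
    refine pinRho_eq_of_isTri _ (key c₀ hc₀ 0).2 g ?_
    rw [← ψ.isTri_act_iff _ _ _ (key c₀ hc₀ 0).1, hg]
    exact htri 0
  have hc : ∀ v, pinRho (c₀ * g) v = !₂[(-1 : ℝ) ^ k * v 0, v 1, v 2, v 3] := fun v => by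
    rw [pinRho_mul, hg1, hc₀]
  refine ⟨c₀ * g, hc, congrFun ?_⟩
  refine ψ.triSection_unique TwistedTube.isLocalDiffeomorph_mk ?_ hσ (fun x => (key _ hc x).1) hproj
    (fun x => (key _ hc x).2) htri 0 ?_
  · exact ψ.continuous_act' (hσ.comp (contDiff_twistShift k).continuous) continuous_const
  · rw [ψ.act_mul, hg]

variable {M₁ M₂ : Type u}
  [TopologicalSpace M₁] [ChartedSpace (EuclideanSpace ℝ (Fin 4)) M₁] [T2Space M₁]
  [IsManifold (𝓡 4) ∞ M₁]
  [TopologicalSpace M₂] [ChartedSpace (EuclideanSpace ℝ (Fin 4)) M₂] [T2Space M₂]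
  [IsManifold (𝓡 4) ∞ M₂]

/-- The sections over both tubes come from one section of `ψ` over the universal cover, hence their
behaviour under deck transformations differs by the grading involution only. -/
theorem exists_flatTube_circle (ψ : PinStructure.{u} (𝓡 4) TwistedTube)
    (i₁ : OpenTube 4 TwistedTube M₁) (i₂ : OpenTube 4 TwistedTube M₂)
    {φ₁ : PinStructure.{u} (𝓡 4) M₁} {φ₂ : PinStructure.{u} (𝓡 4) M₂}
    (H₁ : ψ.Preserves φ₁ i₁.toFun) (H₂ : ψ.Reverses φ₂ i₂.toFun) :
    Nonempty (FlatTube circleCollarModel i₁ i₂ φ₁ φ₂) := by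
  obtain ⟨σ, hσ, hp, ht⟩ := ψ.exists_triSection TwistedTube.isLocalDiffeomorph_mk
  obtain ⟨s₁, F₁, hs₁, hF₁, h1₁, h0₁, hd₁⟩ := PinStructure.LiftsAlong.exists_flatSection
    (θ := MonoidHom.id (PinPlus 4)) (i := i₁.toFun) (cov := TwistedTube.mk) (fun _ _ => rfl)
      i₁.isLocalDiffeomorph H₁ TwistedTube.isLocalDiffeomorph_mk hσ hp ht
  obtain ⟨s₂, F₂, hs₂, hF₂, h1₂, h0₂, hd₂⟩ := PinStructure.LiftsAlong.exists_flatSection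
    (θ := pinGrading 4) (i := i₂.toFun) (cov := TwistedTube.mk) pinRho_pinGrading
      i₂.isLocalDiffeomorph H₂ TwistedTube.isLocalDiffeomorph_mk hσ hp ht
  exact ⟨{
    ϖ := circleProj
    cov := TwistedTube.mk
    cov_surjective := Quotient.mk_surjective
    isLocalDiffeomorph_cov := TwistedTube.isLocalDiffeomorph_mk
    mem_core_iff := fun x => by
      refine (TwistedTube.mk_mem_core x).trans ?_
      rw [← circleProj_sq, RadProj.sq]
      simp
    inv_cov := fun x _ => congrArg TwistedTube.mk (circleProj_inversion x).symm
    σ₁ := s₁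
    σ₂ := s₂
    continuous_σ₁ := hs₁
    continuous_σ₂ := hs₂
    F₁ := F₁
    F₂ := F₂
    continuous_F₁ := hF₁
    continuous_F₂ := hF₂
    F₁_one := h1₁
    F₂_one := h1₂
    frame_σ₁ := h0₁
    frame_σ₂ := h0₂
    deck := by
      intro x x' h
      obtain ⟨k, rfl⟩ : ∃ k : ℤ, x' = twistShift k x := Quotient.exact h
      obtain ⟨c, hc, hcσ⟩ := exists_act_twistShift ψ hσ hp ht k
      have hl : ∀ v, circleProj.lin (pinRho c v) = pinRho c (circleProj.lin v) := fun v => by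
        rw [hc, hc, circleProj_lin, circleProj_lin]
        ext i; fin_cases i <;> simp
      have hsc := fun l => circleProj_scale_twistShift k l x
      have e₁ := fun l => hd₁ (circleProj.scale l x) _ c (stdFrame_twistShift hc _) (hcσ _)
      have e₂ := fun l => hd₂ (circleProj.scale l x) _ c (stdFrame_twistShift hc _) (hcσ _)
      refine ⟨c, stdFrame_twistShift hc x, fun l => ?_, fun l => ?_, fun t l v => ?_,
        fun t l v => ?_, hl, ?_⟩
      · rw [hsc]; exact (e₁ l).1
      · rw [hsc]; exact (e₂ l).1
      · rw [hsc]; exact (e₁ l).2 t v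
      · rw [hsc]; exact (e₂ l).2 t v
      · rw [hc, circleProj_lin, circleProj_lin]
        ext i; fin_cases i <;> simp [twistShift]
    exists_compact := fun R => by
      -- an integral shift moves the circle coordinate into `[0, 1)`
      refine ⟨Metric.closedBall 0 (√(R + 1)), isCompact_closedBall _ _,
        fun x hx => ⟨twistShift (-⌊x 3⌋) x, ?_, TwistedTube.mk_twistShift _ _⟩⟩
      rw [circleProj_sq, ← TwistedTube.radSq_twistShift (-⌊x 3⌋)] at hx
      rw [mem_closedBall_zero_iff]
      refine Real.le_sqrt_of_sq_le ?_
      have h3 : twistShift (-⌊x 3⌋) x 3 = Int.fract (x 3) := by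
        simp [twistShift, Int.fract, sub_eq_add_neg]
      have h4 : Int.fract (x 3) ^ 2 ≤ 1 :=
        pow_le_one₀ (Int.fract_nonneg _) (Int.fract_lt_one _).le
      rw [EuclideanSpace.real_norm_sq_eq, Fin.sum_univ_four, h3]
      unfold TwistedTube.radSq at hx
      linarith }⟩

end circle

theorem mainTheorem9
    {M₁ M₂ : Type u}
    [TopologicalSpace M₁] [ChartedSpace (EuclideanSpace ℝ (Fin 4)) M₁] [IsManifold (𝓡 4) ∞ M₁]
    [CompactSpace M₁] [T2Space M₁]
    [TopologicalSpace M₂] [ChartedSpace (EuclideanSpace ℝ (Fin 4)) M₂] [IsManifold (𝓡 4) ∞ M₂]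
    [CompactSpace M₂] [T2Space M₂]
    (φ₁ : PinStructure.{u} (𝓡 4) M₁) (φ₂ : PinStructure.{u} (𝓡 4) M₂) :
    (∀ (ψ : PinStructure.{u} (𝓡 4) TwistedTube)
        (i₁ : OpenTube 4 TwistedTube M₁) (i₂ : OpenTube 4 TwistedTube M₂),
      ψ.Preserves φ₁ i₁.toFun → ψ.Reverses φ₂ i₂.toFun →
      ∃ Φ : PinStructure.{u} (𝓡 4) (CircleSum i₁ i₂),
        Φ.IsGluedFrom φ₁ φ₂ ∧ PinBordant Φ (φ₁.sum φ₂)) ∧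
    (∀ (i₁ : OpenTube 4 (EuclideanSpace ℝ (Fin 4)) M₁)
        (i₂ : OpenTube 4 (EuclideanSpace ℝ (Fin 4)) M₂),
      ∃ Φ : PinStructure.{u} (𝓡 4) (ConnectedSum i₁ i₂),
        Φ.IsGluedFrom φ₁ φ₂ ∧ PinBordant Φ (φ₁.sum φ₂)) := by
  refine ⟨fun ψ i₁ i₂ H₁ H₂ => ?_, fun i₁ i₂ => ?_⟩
  · obtain ⟨D⟩ := exists_flatTube_circle ψ i₁ i₂ H₁ H₂
    exact ⟨D.glued, D.isGluedFrom, D.pinBordant⟩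
  · obtain ⟨D⟩ := exists_flatTube_disc i₁ i₂ φ₁ φ₂
    exact ⟨D.glued, D.isGluedFrom, D.pinBordant⟩
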